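/- **Setting.** Let $(X_i,T_i,Y_i(0),Y_i(1))$, $i\ge 1$, be i.i.d. with $X_i\in\mathbb R^p$, $T_i\in\{0,1\}$, and let $Y_i=T_iY_i(1)+(1-T_i)Y_i(0)$; only $(X_i,T_i,Y_i)$ is observed. Assume $\mathbb E|Y(0)|<\infty$, $T\perp\{Y(0),Y(1)\}\mid X$, and $0<e(X)<1$ a.s., where $e(x)=\mathbb P(T=1\mid X=x)$. Put $p_1=\mathbb P(T=1)$, $m_0(x)=\mathbb E[Y(0)\mid X=x]$, $w^*(x)=\frac{(1-p_1)e(x)}{p_1(1-e(x))}$ and $\theta_0=\mathbb E[Y(0)\mid T=1]$. **Procedure.** Given the first $n$ units, with control and treated index sets $\mathcal I_c,\mathcal I_t$, split each at random, using only the treatment indicators and randomness independent of the data, into two folds $\mathcal I_{c,1},\mathcal I_{c,2}$ and $\mathcal I_{t,1},\mathcal I_{t,2}$ of equal size (up to one unit). For $k=1,2$, an arbitrary (possibly randomized) measurable algorithm learns $\hat\phi^{(k)}:\mathbb R^p\to\mathbb R^d$ ($d$ fixed) from the observed data of the units outside fold $k$. Write $\hat\phi(X_i)=\hat\phi^{(k)}(X_i)$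 for $i$ in fold $k$. With tolerances $\delta_{n,j}\ge 0$, the weights $(\hat w_i)_{i\in\mathcal I_{c,k}}$ minimize $\sum_{i\in\mathcal I_{c,k}}w_i^2$ subject to $$\Big|\frac1{|\mathcal I_{c,k}|}\sum_{i\in\mathcal I_{c,k}}w_i\hat\phi_j(X_i)-\hat\tau_{k,j}\Big|\le\delta_{n,j}\ (j=1,\dots,d),\qquad \frac1{|\mathcal I_{c,k}|}\sum_{i\in\mathcal I_{c,k}}w_i=1,$$ where $\hat\tau_{k,j}$ is the mean of $\hat\phi_j(X_i)$ over $\mathcal I_t$ (the result also holds with $\mathcal I_{t,k}$ in place of $\mathcal I_t$). If the program is infeasible, $\hat w$ is arbitrary (measurable). The estimator is $\hat\theta_0=|\mathcal I_c|^{-1}\sum_{i\in\mathcal I_c}\hat w_iY_i$. **Theorem.** Suppose that (i) $\mathbb E[\{Y(0)-m_0(X)\}^2\mid X,T=0]\le M_1$ a.s. for some constant $M_1$; (ii) $\delta_{n,j}=o(n^{-1/2})$ for each $j$; (iii) for $k=1,2$, $\|\hat\phi^{(k)}-\phi^*\|_{L_2(P_X)}=o_P(n^{-1/4})$ for a fixed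 $\phi^*:\mathbb R^p\to\mathbb R^d$ with $\mathbb E\|\phi^*(X)\|^2<\infty$ and $\mathbb E[\phi^*(X)\phi^*(X)^\top\mid T=0]$ of full rank; moreover, if $a^\top\phi^*(X)=1$ a.s. for some $a\in\mathbb R^d$, then the learned features satisfy $a^\top\hat\phi^{(k)}\equiv 1$ (as when the first feature is the intercept); (iv) there are $\lambda^*,\beta^*\in\mathbb R^d$ with $w^*(X)=(\lambda^*)^\top\phi^*(X)$ and $m_0(X)=(\beta^*)^\top\phi^*(X)$ a.s. Then $\sqrt n(\hat\theta_0-\theta_0)\rightsquigarrow N(0,\sigma_0^2)$, where $$\sigma_0^2=\operatorname{Var}\Big\{\frac{(1-T)w^*(X)[Y(0)-m_0(X)]}{1-p_1}+\frac{T\{m_0(X)-\theta_0\}}{p_1}\Big\}<\infty .$$ Moreover, $\sigma_0^2$ is consistently estimated: with $n_c=|\mathcal I_c|$, $n_t=|\mathcal I_t|$, $\hat p=n_t/n$, $\hat\beta^{(k)}$ the OLS coefficient of $Y_i$ on $\hat\phi^{(k)}(X_i)$ over $i\in\mathcal I_{c,k}$, and, for $i$ in fold $k$, $\hat m_i=(\hat\beta^{(k)})^\top\hat\phi^{(k)}(X_i)$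 and $\bar m_i=|\mathcal I_{t,k}|^{-1}\sum_{l\in\mathcal I_{t,k}}\hat m_l$, $$\hat\sigma^2=\frac1{n_c(1-\hat p)}\sum_{i\in\mathcal I_c}\{\hat w_i(Y_i-\hat m_i)\}^2+\frac1{n_t\hat p}\sum_{i\in\mathcal I_t}(\hat m_i-\bar m_i)^2\ \xrightarrow{P}\ \sigma_0^2 .$$ Finally, $\sigma_0^2$ is the semiparametric efficiency bound for $\theta_0=\mathbb E\big[\mathbb E[Y\mid X,T=0]\mid T=1\big]$, as a functional of the otherwise unrestricted law $R$ of $(X,T,Y)$: along every regular one-dimensional submodel $R_t$ ($R_0=R$, density ratios $dR_t/dR$ bounded away from $0$ and $\infty$ near $t=0$ and differentiable in quadratic mean at $0$ with score $s$) this functional is differentiable at $t=0$, and $\sigma_0^2$ is the supremum of the Cramér–Rao bounds $\{\frac{d}{dt}\theta_0(R_t)|_{t=0}\}^2/\mathbb E_R[s^2]$ over the submodels with $\mathbb E_R[s^2]>0$. -/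

import Mathlib

open MeasureTheory ProbabilityTheory Filter Topology Asymptotics
open scoped ENNReal NNReal

namespace CrossBalancing

noncomputable section

/-! ### Population: records, causal assumptions, estimand -/

/-- The full record `(X, T, Y(0), Y(1))` of one subject, with `X ∈ ℝᵖ` and `T = true` for a
treated subject. -/
abbrev FullRecord (p : ℕ) : Type := (Fin p → ℝ) × Bool × ℝ × ℝ

/-- The observed record `(X, T, Y)` of one subject. -/
abbrev ObsRecord (p : ℕ) : Type := (Fin p → ℝ) × Bool × ℝ

/-- The covariates `X`. -/
def cov {p : ℕ} (z : FullRecord p) : Fin p → ℝ := z.1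

/-- The treatment indicator `T`. -/
def trt {p : ℕ} (z : FullRecord p) : Bool := z.2.1

/-- The potential outcome `Y(0)`. -/
def y0 {p : ℕ} (z : FullRecord p) : ℝ := z.2.2.1

/-- The potential outcome `Y(1)`. -/
def y1 {p : ℕ} (z : FullRecord p) : ℝ := z.2.2.2

/-- What is observed: `(X, T, Y)` with `Y = T Y(1) + (1 - T) Y(0)`. -/
def observe {p : ℕ} (z : FullRecord p) : ObsRecord p :=
  (cov z, trt z, bif trt z then y1 z else y0 z)

theorem measurable_cov {p : ℕ} : Measurable (cov (p := p)) := measurable_fst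

theorem measurable_trt {p : ℕ} : Measurable (trt (p := p)) := measurable_fst.comp measurable_snd

theorem measurable_y0 {p : ℕ} : Measurable (y0 (p := p)) :=
  measurable_fst.comp (measurable_snd.comp measurable_snd)

theorem measurable_y1 {p : ℕ} : Measurable (y1 (p := p)) :=
  measurable_snd.comp (measurable_snd.comp measurable_snd)

theorem measurable_observe {p : ℕ} : Measurable (observe (p := p)) := by
  refine measurable_cov.prodMk (measurable_trt.prodMk ?_)
  have h : (fun z : FullRecord p => bif trt z then y1 z else y0 z)
      = fun z => if trt z = true then y1 z else y0 z := by
    funext z; cases trt z <;> rfl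
  rw [h]
  exact Measurable.ite (measurable_trt (measurableSet_singleton true)) measurable_y1 measurable_y0

section Population

variable {p : ℕ} (Q : Measure (FullRecord p))

/-- The marginal law of the covariates. -/
def covLaw : Measure (Fin p → ℝ) := Q.map cov

/-- The conditional law of a record given `T = 0`. -/
def controlLaw : Measure (FullRecord p) := ProbabilityTheory.cond Q {z | trt z = false}

/-- The conditional law of a record given `T = 1`. -/
def treatedLaw : Measure (FullRecord p) := ProbabilityTheory.cond Q {z | trt z = true}

/-- `p = ℙ(T = 1)`. -/
def pTreat : ℝ := Q.real {z | trt z = true}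

/-- The estimand `θ₀ = 𝔼[Y(0) ∣ T = 1]`. -/
def theta0 : ℝ := ∫ z, y0 z ∂(treatedLaw Q)

variable [IsProbabilityMeasure Q]

/-- The propensity score `e(x) = ℙ(T = 1 ∣ X = x)`. -/
def propensity (x : Fin p → ℝ) : ℝ := (condDistrib trt cov Q x).real {true}

/-- The prognostic score `m₀(x) = 𝔼[Y(0) ∣ X = x]`. -/
def prognostic (x : Fin p → ℝ) : ℝ := ∫ y, y ∂(condDistrib y0 cov Q x)

/-- The weight function `w*(x) = (1 - p) e(x) / (p (1 - e(x)))`. -/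
def wStar (x : Fin p → ℝ) : ℝ :=
  (1 - pTreat Q) * propensity Q x / (pTreat Q * (1 - propensity Q x))

/-- Unconfoundedness, `T ⫫ (Y(0), Y(1)) ∣ X`. -/
def Unconfounded : Prop :=
  CondIndepFun (MeasurableSpace.comap (cov (p := p)) inferInstance) measurable_cov.comap_le
    trt (fun z => (y0 z, y1 z)) Q

/-- Overlap, `0 < e(X) < 1` almost surely. -/
def Overlap : Prop :=
  ∀ᵐ x ∂(covLaw Q), 0 < propensity Q x ∧ propensity Q x < 1

/-- `𝔼[(Y(0) - m₀(X))² ∣ X, T = 0] ≤ M` almost surely given `T = 0`. -/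
def CondVarianceBounded (M : ℝ) : Prop :=
  ∀ᵐ z ∂(controlLaw Q),
    ∫⁻ y, ENNReal.ofReal ((y - prognostic Q (cov z)) ^ 2)
      ∂(condDistrib y0 (fun z => (cov z, trt z)) Q (cov z, false)) ≤ ENNReal.ofReal M

/-- The control second-moment matrix `𝔼[φ(X) φ(X)ᵀ ∣ T = 0]`. -/
def controlSecondMoment {d : ℕ} (φ : (Fin p → ℝ) → EuclideanSpace ℝ (Fin d)) :
    Matrix (Fin d) (Fin d) ℝ :=
  Matrix.of fun i j => ∫ z, φ (cov z) i * φ (cov z) j ∂(controlLaw Q)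

/-- The efficient influence function of the AIPW estimator of `θ₀`,
`(1 - T) w*(X) (Y(0) - m₀(X)) / (1 - p) + T (m₀(X) - θ₀) / p`. -/
def influence (z : FullRecord p) : ℝ :=
  (bif trt z then 0 else 1) * wStar Q (cov z) * (y0 z - prognostic Q (cov z)) / (1 - pTreat Q)
    + (bif trt z then 1 else 0) * (prognostic Q (cov z) - theta0 Q) / pTreat Q

/-- `σ₀²`, the variance of the efficient influence function. -/
def sigmaSq : ℝ := ProbabilityTheory.variance (influence Q) Q

/-- The law of the observed record. -/
def obsLaw : ProbabilityMeasure (ObsRecord p) :=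
  ⟨Q.map observe, Measure.isProbabilityMeasure_map measurable_observe.aemeasurable⟩

end Population

/-! ### The cross-balancing procedure -/

/-- The average of `f` over the units in `I`. -/
def avg {ι : Type*} (I : Finset ι) (f : ι → ℝ) : ℝ := (∑ i ∈ I, f i) / (I.card : ℝ)

section Sample

variable {p d n : ℕ}

/-- Units in treatment arm `a`. -/
def arm (t : Fin n → Bool) (a : Bool) : Finset (Fin n) := {i | t i = a}

/-- Units in treatment arm `a` and fold `k`. -/
def armFold (t : Fin n → Bool) (s : Fin n → Fin 2) (a : Bool) (k : Fin 2) : Finset (Fin n) :=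
  {i | t i = a ∧ s i = k}

/-- The split `s` divides each treatment arm into two folds of equal size (up to one unit if the
size of the arm is odd). -/
def BalancedSplit (t : Fin n → Bool) (s : Fin n → Fin 2) : Prop :=
  ∀ a : Bool, (armFold t s a 0).card ≤ (armFold t s a 1).card + 1 ∧
    (armFold t s a 1).card ≤ (armFold t s a 0).card + 1

/-- The treated sample on which the balancing target is computed: all treated units, each with
the features of its own fold, or only the treated units of the fold that is being weighted. -/
inductive TargetSample : Type
  | allTreated
  | ownFold

/-- The treated mean of the `j`-th feature, the balancing target of fold `k`. -/
def treatedTarget (v : TargetSample) (z : Fin n → ObsRecord p) (s : Fin n → Fin 2)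
    (φ : Fin 2 → (Fin p → ℝ) → EuclideanSpace ℝ (Fin d)) (k : Fin 2) (j : Fin d) : ℝ :=
  match v with
  | .allTreated => avg (arm (fun i => (z i).2.1) true) fun i => φ (s i) (z i).1 j
  | .ownFold => avg (armFold (fun i => (z i).2.1) s true k) fun i => φ k (z i).1 j

/-- `w` satisfies the balancing and normalization constraints of fold `k`
(only the weights of the control units in fold `k` matter). -/
def Feasible (v : TargetSample) (z : Fin n → ObsRecord p) (s : Fin n → Fin 2)
    (φ : Fin 2 → (Fin p → ℝ) → EuclideanSpace ℝ (Fin d)) (δ : Fin d → ℝ) (k : Fin 2)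
    (w : Fin n → ℝ) : Prop :=
  (∀ j, |avg (armFold (fun i => (z i).2.1) s false k) (fun i => w i * φ k (z i).1 j)
      - treatedTarget v z s φ k j| ≤ δ j) ∧
    avg (armFold (fun i => (z i).2.1) s false k) w = 1

/-- `w` solves the balancing program of fold `k`: it is feasible and has the smallest sum of
squared weights over the control units in fold `k`. -/
def IsSolution (v : TargetSample) (z : Fin n → ObsRecord p) (s : Fin n → Fin 2)
    (φ : Fin 2 → (Fin p → ℝ) → EuclideanSpace ℝ (Fin d)) (δ : Fin d → ℝ) (k : Fin 2)
    (w : Fin n → ℝ) : Prop :=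
  Feasible v z s φ δ k w ∧ ∀ w', Feasible v z s φ δ k w' →
    ∑ i ∈ armFold (fun i => (z i).2.1) s false k, w i ^ 2 ≤
      ∑ i ∈ armFold (fun i => (z i).2.1) s false k, w' i ^ 2

/-- The estimator `θ̂₀`, the weighted mean outcome of the control units. -/
def thetaHat (z : Fin n → ObsRecord p) (w : Fin n → ℝ) : ℝ :=
  avg (arm (fun i => (z i).2.1) false) fun i => w i * (z i).2.2

/-- The OLS coefficient of `Y` on the features of fold `k`, over the control units of fold `k`. -/
def olsCoef (z : Fin n → ObsRecord p) (s : Fin n → Fin 2)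
    (φ : Fin 2 → (Fin p → ℝ) → EuclideanSpace ℝ (Fin d)) (k : Fin 2) : Fin d → ℝ :=
  Matrix.mulVec
    (Matrix.of fun a b => ∑ i ∈ armFold (fun i => (z i).2.1) s false k,
      φ k (z i).1 a * φ k (z i).1 b)⁻¹
    (fun a => ∑ i ∈ armFold (fun i => (z i).2.1) s false k, φ k (z i).1 a * (z i).2.2)

/-- The fitted outcome `β̂⁽ᵏ⁾ᵀ φ̂⁽ᵏ⁾(X_i)` of unit `i`, where `k` is the fold of `i`. -/
def fitted (z : Fin n → ObsRecord p) (s : Fin n → Fin 2)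
    (φ : Fin 2 → (Fin p → ℝ) → EuclideanSpace ℝ (Fin d)) (i : Fin n) : ℝ :=
  ∑ j, olsCoef z s φ (s i) j * φ (s i) (z i).1 j

/-- The variance estimator `σ̂²`, with `p̂ = n_t / n`:
`1/(n_c (1 - p̂)) ∑_{T_i = 0} (ŵ_i (Y_i - β̂ᵀφ̂(X_i)))²
  + 1/(n_t p̂) ∑_{T_i = 1} (β̂ᵀφ̂(X_i) - β̂ᵀφ̄)²`,
where `β̂ᵀφ̄` is the mean of `β̂ᵀφ̂` over the treated units in the fold of `i`. -/
def varianceEstimator (z : Fin n → ObsRecord p) (s : Fin n → Fin 2)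
    (φ : Fin 2 → (Fin p → ℝ) → EuclideanSpace ℝ (Fin d)) (w : Fin n → ℝ) : ℝ :=
  let t : Fin n → Bool := fun i => (z i).2.1
  let pHat : ℝ := ((arm t true).card : ℝ) / n
  avg (arm t false) (fun i => (w i * ((z i).2.2 - fitted z s φ i)) ^ 2) / (1 - pHat)
    + avg (arm t true) (fun i =>
        (fitted z s φ i - avg (armFold t s true (s i)) (fitted z s φ)) ^ 2) / pHat

end Sample

/-- An algorithm that learns a feature map `ℝᵖ → ℝᵈ` from the observed records of the units in a
set `I`, possibly with auxiliary randomness `u`. Nothing but measurability is asked of it. -/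
structure FeatureLearner (p d : ℕ) (𝒰 : Type*) [MeasurableSpace 𝒰] where
  /-- the feature map learned from the records `z i`, `i ∈ I` -/
  fit : ∀ n : ℕ, Finset (Fin n) → (Fin n → ObsRecord p) → 𝒰 →
    (Fin p → ℝ) → EuclideanSpace ℝ (Fin d)
  /-- records of units outside `I` are not used -/
  fit_congr : ∀ n I z z' u, (∀ i ∈ I, z i = z' i) → fit n I z u = fit n I z' u
  measurable_fit : ∀ n I,
    Measurable fun q : (Fin n → ObsRecord p) × 𝒰 × (Fin p → ℝ) => fit n I q.1 q.2.1 q.2.2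

/-- The choices that specify a cross-balancing procedure, for every sample size `n`. -/
structure Procedure (p d : ℕ) (𝒰 : Type*) [MeasurableSpace 𝒰] where
  /-- the fold of each unit, drawn from the treatment indicators and auxiliary randomness only -/
  split : ∀ n : ℕ, (Fin n → Bool) → 𝒰 → Fin n → Fin 2
  measurable_split : ∀ n t, Measurable (split n t)
  balanced_split : ∀ n t u, BalancedSplit t (split n t u)
  /-- the algorithm that learns the features to be applied to fold `k` -/
  learner : Fin 2 → FeatureLearner p d 𝒰
  /-- the tolerances of the balancing constraints -/
  tol : ℕ → Fin d → ℝ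
  tol_nonneg : ∀ n j, 0 ≤ tol n j
  /-- the treated sample on which the balancing target is computed -/
  target : TargetSample

namespace Procedure

variable {p d : ℕ} {𝒰 : Type*} [MeasurableSpace 𝒰] (C : Procedure p d 𝒰) {n : ℕ}

/-- The folds of a sample `z`, with auxiliary randomness `u`. -/
def folds (z : Fin n → ObsRecord p) (u : 𝒰) : Fin n → Fin 2 :=
  C.split n (fun i => (z i).2.1) u

/-- The features `φ̂⁽ᵏ⁾`, learned on the records outside fold `k`. -/
def features (z : Fin n → ObsRecord p) (u : 𝒰) (k : Fin 2) :
    (Fin p → ℝ) → EuclideanSpace ℝ (Fin d) :=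
  (C.learner k).fit n {i | C.folds z u i ≠ k} z u

/-- `w` is a vector of cross-balancing weights: in each fold whose balancing program is feasible
it is the solution of that program (no convention is made about infeasible programs). -/
def IsWeights (z : Fin n → ObsRecord p) (u : 𝒰) (w : Fin n → ℝ) : Prop :=
  ∀ k, (∃ w', Feasible C.target z (C.folds z u) (C.features z u) (C.tol n) k w') →
    IsSolution C.target z (C.folds z u) (C.features z u) (C.tol n) k w

end Procedure

/-- The first `n` observed records. -/
def sample {p : ℕ} {Ω : Type*} (D : ℕ → Ω → FullRecord p) (n : ℕ) (ω : Ω) :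
    Fin n → ObsRecord p :=
  fun i => observe (D i ω)

/-- `A_n = o_P(r_n)` for `A_n ≥ 0`. -/
def IsLittleOInProb {Ω : Type*} [MeasurableSpace Ω] (P : Measure Ω) (A : ℕ → Ω → ℝ≥0∞)
    (r : ℕ → ℝ) : Prop :=
  ∀ ε : ℝ, 0 < ε →
    Tendsto (fun n => P {ω | ENNReal.ofReal (ε * r n) < A n ω}) atTop (𝓝 0)

/-! ### The semiparametric efficiency bound

The law of the observed record is unrestricted apart from overlap (unconfoundedness puts no
restriction on it), and `θ₀ = 𝔼[𝔼[Y ∣ X, T = 0] ∣ T = 1]` is a functional of it. -/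

/-- `𝔼_R[𝔼_R[Y ∣ X, T = 0] ∣ T = 1]` as a functional of a law `R` of observed records. -/
def identifiedMean {p : ℕ} (R : ProbabilityMeasure (ObsRecord p)) : ℝ :=
  ∫ o, (∫ y, y ∂(condDistrib (fun o : ObsRecord p => o.2.2)
      (fun o : ObsRecord p => (o.1, o.2.1)) (R : Measure (ObsRecord p)) (o.1, false)))
    ∂(ProbabilityTheory.cond (R : Measure (ObsRecord p)) {o | o.2.1 = true})

/-- A regular one-dimensional parametric submodel through `R`: near `t = 0` the law `R_t` has a
density ratio `f_t = dR_t/dR` bounded away from `0` and `∞`, differentiable in quadratic mean at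
`t = 0` with score `s ∈ L²(R)`. (For such bounded ratios, `(f_t - 1)/t → s` in `L²(R)` is the same
as `(√f_t - 1)/t → s/2` in `L²(R)`. The two-sided bound keeps `R_t` in the model with overlap. The
scores of these submodels make up all mean-zero functions in `L²(R)`.) -/
structure RegularSubmodel {p : ℕ} (R : ProbabilityMeasure (ObsRecord p)) where
  law : ℝ → ProbabilityMeasure (ObsRecord p)
  density : ℝ → ObsRecord p → ℝ
  score : ObsRecord p → ℝ
  measurable_density : ∀ t, Measurable (density t)
  law_zero : law 0 = R
  law_eq : ∀ᶠ t in 𝓝 (0 : ℝ), (law t : Measure (ObsRecord p))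
    = (R : Measure (ObsRecord p)).withDensity fun o => ENNReal.ofReal (density t o)
  density_bounds : ∃ c K : ℝ, 0 < c ∧ ∀ᶠ t in 𝓝 (0 : ℝ), ∀ o, c ≤ density t o ∧ density t o ≤ K
  memLp_score : MemLp score 2 (R : Measure (ObsRecord p))
  tendsto_score : Tendsto
    (fun t => eLpNorm (fun o => (density t o - 1) / t - score o) 2 (R : Measure (ObsRecord p)))
    (𝓝[≠] (0 : ℝ)) (𝓝 0)

/-- `V` is the semiparametric efficiency bound at `R` for the parameter `Ψ`: `Ψ` is differentiable
along every regular parametric submodel, and `V` is the supremum of the Cramér–Rao bounds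
`(dΨ(R_t)/dt)² / 𝔼[s²]` at `t = 0` over the submodels with positive information. -/
def IsEfficiencyBound {p : ℕ} (Ψ : ProbabilityMeasure (ObsRecord p) → ℝ)
    (R : ProbabilityMeasure (ObsRecord p)) (V : ℝ) : Prop :=
  (∀ S : RegularSubmodel R, DifferentiableAt ℝ (fun t => Ψ (S.law t)) 0) ∧
    IsLUB {b : ℝ | ∃ S : RegularSubmodel R,
      0 < ∫ o, S.score o ^ 2 ∂(R : Measure (ObsRecord p)) ∧
      b = deriv (fun t => Ψ (S.law t)) 0 ^ 2
        / ∫ o, S.score o ^ 2 ∂(R : Measure (ObsRecord p))} V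

end

end CrossBalancing

/-! Write r = Y(0) − m₀(X). The core is asymptotic linearity: up to o_P(n^{-1/2}), the estimator
equals the control mean of w* r plus the treated mean of m₀
(`BalancingModel.isLittleO_thetaHat_sub`). Replacing the random arm proportions by their
probabilities turns this into an i.i.d. mean of `influence`, and the central limit theorem and
Slutsky's lemma finish.

Two population facts drive everything. Under unconfoundedness and overlap, w* is the density of the
treated covariate law with respect to the control one (`lintegral_wStar`), and in each arm r is
orthogonal to functions of X (`setIntegral_mul_residual`).

The weights are understood through duality without multipliers. If the sample Gram matrix is
invertible and the features span the constant, the solution is linear in the learned features: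
projecting it on their span keeps all moments, hence feasibility, and lowers the norm
(`weights_eq_linear`). The moments of the solution and those of w* both estimate the treated means
of φ*, so its coefficients approach λ* at rate o_P(n^{-1/4}).

For the expansion, write Y(0) = β*ᵀφ̂ − β*ᵀ(φ̂ − φ*) + r on the controls. Balancing moves the first
term to the treated target. Replacing ŵ by w* in front of r costs coefficient errors times averages
of r φ̂, a product of two o_P(n^{-1/4}) factors, and averages of r(φ̂ − φ*), which are
o_P(n^{-1/2}). The weighted mean of φ̂ − φ* is, up to o_P(n^{-1/2}), its mean over the treated
population. That bias is only o_P(n^{-1/4}) and is not negligible fold by fold, but it also enters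
through the targets with the opposite sign. As the folds have nearly equal shares in both arms, the
biases cancel up to a product of two o_P(n^{-1/4}) terms.

Cross-fitting enters through a resampling identity: given its arm, a record of fold k can be redrawn
independently of features that were learned outside the fold (`lintegral_resample`). It yields
conditional Markov and Chebyshev inequalities for fold averages. Since w* need not be bounded, it is
truncated at n^{3/8}. This is harmless because its third moment under the control law is its second
moment under the treated law, hence finite.

If φ* does not span the constant, an exactly balanced intercept is added to the features. The
normalization constraint already imposes it, so the weights do not change
(`BalancingModel.withIntercept`).

Consistency of the variance estimator follows from empirical L² convergence of the weights and of
the fitted outcomes, with separate envelope arguments for products with r and with w*.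

For the efficiency bound, the treated mean of the regression of a tilted law f R is rewritten
through m₀ and the odds of f R only (`RegressionModel.exists_odds_withDensity`). Differentiating
this gives the covariance of the score with the influence function. Cauchy–Schwarz bounds the
Cramér–Rao ratios, and truncated, centred influence functions used as scores show that the bound is
sharp (`isEfficiencyBound_of_influence`). -/

namespace CrossBalancing

attribute [fun_prop] measurable_cov measurable_trt measurable_y0

/-! ### Population identities: arms, odds weighting and orthogonality of the residual. -/

section PopulationFacts

set_option linter.unusedSectionVars false

variable {p : ℕ} {Q : Measure (FullRecord p)} [IsProbabilityMeasure Q]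

/-- Under unconfoundedness, restricting to a treatment arm reweights the joint law of `(X, Y(0))`
by the conditional probability of that arm. -/
theorem setLIntegral_arm (hunconf : Unconfounded Q) (a : Bool)
    {G : (Fin p → ℝ) × ℝ → ℝ≥0∞} (hG : Measurable G) :
    ∫⁻ z in {z | trt z = a}, G (cov z, y0 z) ∂Q
      = ∫⁻ z, condDistrib trt cov Q (cov z) {a} * G (cov z, y0 z) ∂Q := by
  have hci : CondIndepFun (MeasurableSpace.comap (cov (p := p)) inferInstance)
      measurable_cov.comap_le trt y0 Q := by
    have h : CondIndepFun (MeasurableSpace.comap (cov (p := p)) inferInstance)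
      measurable_cov.comap_le trt (fun z => (y0 z, y1 z)) Q := hunconf
    exact CondIndepFun.comp (φ := id) (ψ := Prod.fst) h measurable_id measurable_fst
  -- Given X = x, the pair (T, Y(0)) now has a product law, so the indicator of the arm integrates
  -- out separately from G.
  rw [condIndepFun_iff_map_prod_eq_prod_condDistrib_prod_condDistrib measurable_trt measurable_y0
    measurable_cov]
    at hci
  have hms : MeasurableSet {z : FullRecord p | trt z = a} :=
    measurable_trt (measurableSet_singleton a)
  have hκ : Measurable fun x => condDistrib trt cov Q x {a} :=
    Kernel.measurable_coe _ (measurableSet_singleton a)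
  have hF : Measurable fun q : (Fin p → ℝ) × Bool × ℝ =>
      Set.indicator {q : (Fin p → ℝ) × Bool × ℝ | q.2.1 = a} (fun q => G (q.1, q.2.2)) q := by
    refine Measurable.indicator (by fun_prop) ?_
    exact (measurable_fst.comp measurable_snd) (measurableSet_singleton a)
  have h1 : ∫⁻ z in {z | trt z = a}, G (cov z, y0 z) ∂Q
      = ∫⁻ q, Set.indicator {q : (Fin p → ℝ) × Bool × ℝ | q.2.1 = a} (fun q => G (q.1, q.2.2)) q
        ∂(Q.map fun z => (cov z, trt z, y0 z)) := by
    rw [lintegral_map hF (measurable_cov.prodMk (measurable_trt.prodMk measurable_y0)),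
      ← lintegral_indicator hms]
    rfl
  have h2 : ∫⁻ z, condDistrib trt cov Q (cov z) {a} * G (cov z, y0 z) ∂Q
      = ∫⁻ q, condDistrib trt cov Q q.1 {a} * G q ∂(Q.map fun z => (cov z, y0 z)) := by
    rw [lintegral_map (by fun_prop) (measurable_cov.prodMk measurable_y0)]
  rw [h1, h2, hci, ← compProd_map_condDistrib measurable_y0.aemeasurable,
    Measure.lintegral_compProd (by fun_prop), Measure.lintegral_bind (by fun_prop) hF.aemeasurable]
  refine lintegral_congr fun x => ?_
  rw [Kernel.prod_apply, Kernel.prod_apply, Kernel.id_apply,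
    lintegral_prod _ hF.aemeasurable, lintegral_dirac' _ (by fun_prop),
    lintegral_prod _ (by fun_prop)]
  change _ = ∫⁻ y, condDistrib trt cov Q x {a} * G (x, y) ∂(condDistrib y0 cov Q x)
  rw [lintegral_const_mul _ (by fun_prop)]
  have : ∀ b : Bool, ∫⁻ y, Set.indicator {q : (Fin p → ℝ) × Bool × ℝ | q.2.1 = a}
      (fun q => G (q.1, q.2.2)) (x, b, y) ∂(condDistrib y0 cov Q x)
      = Set.indicator {a} (fun _ => ∫⁻ y, G (x, y) ∂(condDistrib y0 cov Q x)) b := by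
    intro b
    by_cases hb : b = a
    · simp [hb]
    · simp [hb]
  simp_rw [this]
  rw [lintegral_indicator_const (measurableSet_singleton a), mul_comm]

theorem measurableSet_arm (a : Bool) : MeasurableSet {z : FullRecord p | trt z = a} :=
  measurable_trt (measurableSet_singleton a)

theorem measurable_propensity : Measurable (propensity Q) :=
  (Kernel.measurable_coe _ (measurableSet_singleton true)).ennreal_toReal

theorem measurable_prognostic : Measurable (prognostic Q) :=
  (StronglyMeasurable.integral_condDistrib (X := cov) (Y := y0) (μ := Q)
    (f := fun q : (Fin p → ℝ) × ℝ => q.2) measurable_snd.stronglyMeasurable).measurable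

theorem measurable_wStar : Measurable (wStar Q) := by
  have := measurable_propensity (Q := Q)
  unfold wStar
  fun_prop

/-- The conditional probability of arm `a` given the covariates. -/
theorem condDistrib_trt_apply (x : Fin p → ℝ) (a : Bool) :
    condDistrib trt cov Q x {a}
      = ENNReal.ofReal (bif a then propensity Q x else 1 - propensity Q x) := by
  cases a
  · have h : ({false} : Set Bool) = {true}ᶜ := by ext b; cases b <;> simp
    rw [h, prob_compl_eq_one_sub (measurableSet_singleton _)]
    simp only [cond_false, propensity, Measure.real]
    rw [ENNReal.ofReal_sub _ ENNReal.toReal_nonneg, ENNReal.ofReal_toReal (measure_ne_top _ _),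
      ENNReal.ofReal_one]
  · simp only [cond_true, propensity, Measure.real]
    rw [ENNReal.ofReal_toReal (measure_ne_top _ _)]

theorem overlap_ae (hoverlap : Overlap Q) :
    ∀ᵐ z ∂Q, 0 < propensity Q (cov z) ∧ propensity Q (cov z) < 1 :=
  ae_of_ae_map measurable_cov.aemeasurable hoverlap

/-- A property of the covariates that holds almost surely in one arm holds almost surely. -/
theorem ae_of_ae_restrict_arm (hunconf : Unconfounded Q) (hoverlap : Overlap Q) (a : Bool)
    {S : Set (Fin p → ℝ)} (hS : MeasurableSet S)
    (h : ∀ᵐ z ∂(Q.restrict {z | trt z = a}), cov z ∈ S) : ∀ᵐ z ∂Q, cov z ∈ S := by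
  have hG : Measurable fun q : (Fin p → ℝ) × ℝ => Sᶜ.indicator (1 : (Fin p → ℝ) → ℝ≥0∞) q.1 :=
    (measurable_one.indicator hS.compl).comp measurable_fst
  have hκ : Measurable fun x => condDistrib trt cov Q x {a} :=
    Kernel.measurable_coe _ (measurableSet_singleton a)
  have hS1 : Measurable (Sᶜ.indicator (1 : (Fin p → ℝ) → ℝ≥0∞)) := measurable_one.indicator hS.compl
  -- Tested on the complement of S the left side vanishes, so the arm probability times that
  -- indicator is almost surely zero. Overlap makes the arm probability positive.
  have h1 := setLIntegral_arm hunconf a hG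
  have h2 : ∫⁻ z in {z | trt z = a}, Sᶜ.indicator (1 : (Fin p → ℝ) → ℝ≥0∞) (cov z) ∂Q = 0 := by
    rw [lintegral_eq_zero_iff (by fun_prop)]
    filter_upwards [h] with z hz
    simp [hz]
  simp only at h1
  rw [h2, eq_comm, lintegral_eq_zero_iff (by fun_prop)] at h1
  filter_upwards [h1, overlap_ae hoverlap] with z hz ho
  by_contra hc
  have : condDistrib trt cov Q (cov z) {a} = 0 := by simpa [hc] using hz
  rw [condDistrib_trt_apply] at this
  cases a <;> simp at this <;> linarith [ho.1, ho.2]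

/-- In a null arm every covariate event holds almost surely, even the empty one, and the previous
transfer would carry this to `Q`. -/
theorem measure_arm_ne_zero (hunconf : Unconfounded Q) (hoverlap : Overlap Q) (a : Bool) :
    Q {z | trt z = a} ≠ 0 := by
  intro h
  have := ae_of_ae_restrict_arm hunconf hoverlap a (S := ∅) MeasurableSet.empty
    (by rw [Measure.restrict_eq_zero.2 h]; simp)
  simp only [Set.mem_empty_iff_false, Filter.eventually_false_iff_eq_bot, ae_eq_bot] at this
  exact IsProbabilityMeasure.ne_zero Q this

/-- The conditional law of a record given its treatment arm. -/
noncomputable def armLaw (Q : Measure (FullRecord p)) (a : Bool) : Measure (FullRecord p) :=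
  ProbabilityTheory.cond Q {z | trt z = a}

/-- The probability of a treatment arm. -/
noncomputable def pArm (Q : Measure (FullRecord p)) (a : Bool) : ℝ := Q.real {z | trt z = a}

theorem controlLaw_eq : controlLaw Q = armLaw Q false := rfl

theorem treatedLaw_eq : treatedLaw Q = armLaw Q true := rfl

theorem pArm_true : pArm Q true = pTreat Q := rfl

theorem pArm_false : pArm Q false = 1 - pTreat Q := by
  have h : {z : FullRecord p | trt z = false} = {z | trt z = true}ᶜ := by
    ext z; simp
  rw [pArm, h, probReal_compl_eq_one_sub (measurableSet_arm true)]
  rfl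

theorem ofReal_pArm (a : Bool) : ENNReal.ofReal (pArm Q a) = Q {z | trt z = a} :=
  ENNReal.ofReal_toReal (measure_ne_top _ _)

theorem pArm_pos (hunconf : Unconfounded Q) (hoverlap : Overlap Q) (a : Bool) : 0 < pArm Q a :=
  ENNReal.toReal_pos (measure_arm_ne_zero hunconf hoverlap a) (measure_ne_top _ _)

theorem isProbabilityMeasure_armLaw (hunconf : Unconfounded Q) (hoverlap : Overlap Q) (a : Bool) :
    IsProbabilityMeasure (armLaw Q a) :=
  cond_isProbabilityMeasure (measure_arm_ne_zero hunconf hoverlap a)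

instance isFiniteMeasure_armLaw (a : Bool) : IsFiniteMeasure (armLaw Q a) := by
  unfold armLaw; infer_instance

theorem armLaw_eq_smul (a : Bool) :
    armLaw Q a = (Q {z | trt z = a})⁻¹ • Q.restrict {z | trt z = a} := rfl

theorem lintegral_armLaw (a : Bool) (f : FullRecord p → ℝ≥0∞) :
    ∫⁻ z, f z ∂(armLaw Q a) = (Q {z | trt z = a})⁻¹ * ∫⁻ z in {z | trt z = a}, f z ∂Q := by
  rw [armLaw_eq_smul, lintegral_smul_measure, smul_eq_mul]

theorem integral_armLaw (a : Bool) (f : FullRecord p → ℝ) :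
    ∫ z, f z ∂(armLaw Q a) = (pArm Q a)⁻¹ * ∫ z in {z | trt z = a}, f z ∂Q := by
  rw [armLaw_eq_smul, integral_smul_measure, smul_eq_mul, ENNReal.toReal_inv]
  rfl

theorem integrable_armLaw_iff (ha : Q {z | trt z = a} ≠ 0) {f : FullRecord p → ℝ} :
    Integrable f (armLaw Q a) ↔ IntegrableOn f {z | trt z = a} Q := by
  rw [armLaw_eq_smul, integrable_smul_measure (ENNReal.inv_ne_zero.2 (measure_ne_top _ _))
    (ENNReal.inv_ne_top.2 ha)]
  rfl

theorem armLaw_absolutelyContinuous (a : Bool) : armLaw Q a ≪ Q := cond_absolutelyContinuous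

theorem lintegral_armLaw_le (a : Bool) (f : FullRecord p → ℝ≥0∞) :
    ∫⁻ z, f z ∂(armLaw Q a) ≤ (Q {z | trt z = a})⁻¹ * ∫⁻ z, f z ∂Q := by
  rw [lintegral_armLaw]
  gcongr
  exact Measure.restrict_le_self

theorem ae_cov_of_ae_armLaw (hunconf : Unconfounded Q) (hoverlap : Overlap Q) (a : Bool)
    {S : Set (Fin p → ℝ)} (hS : MeasurableSet S)
    (h : ∀ᵐ z ∂(armLaw Q a), cov z ∈ S) : ∀ᵐ x ∂(covLaw Q), x ∈ S := by
  refine (ae_map_iff (p := fun x => x ∈ S) measurable_cov.aemeasurable hS).2 ?_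
  refine ae_of_ae_restrict_arm hunconf hoverlap a hS ?_
  rw [armLaw_eq_smul, Measure.ae_ennreal_smul_measure_iff (by simp)] at h
  exact h

theorem wStar_nonneg_ae (hoverlap : Overlap Q) : ∀ᵐ z ∂Q, 0 ≤ wStar Q (cov z) := by
  filter_upwards [overlap_ae hoverlap] with z hz
  have h1 : 0 ≤ pTreat Q := measureReal_nonneg
  have h2 : pTreat Q ≤ 1 := measureReal_le_one
  have := hz.1.le
  have h3 : 0 ≤ 1 - propensity Q (cov z) := by linarith [hz.2]
  have h4 : 0 ≤ 1 - pTreat Q := by linarith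
  unfold wStar
  positivity

/-- `w*` is the density of the treated covariates with respect to the control covariates. -/
theorem lintegral_wStar (hunconf : Unconfounded Q) (hoverlap : Overlap Q)
    {g : (Fin p → ℝ) → ℝ≥0∞} (hg : Measurable g) :
    ∫⁻ z, ENNReal.ofReal (wStar Q (cov z)) * g (cov z) ∂(armLaw Q false)
      = ∫⁻ z, g (cov z) ∂(armLaw Q true) := by
  have hw := measurable_wStar (Q := Q)
  have hpos := pArm_pos hunconf hoverlap
  rw [lintegral_armLaw, lintegral_armLaw,
    setLIntegral_arm hunconf false (G := fun q => ENNReal.ofReal (wStar Q q.1) * g q.1)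
      (by fun_prop),
    setLIntegral_arm hunconf true (G := fun q => g q.1) (by fun_prop),
    ← lintegral_const_mul' _ _ (by simpa using measure_arm_ne_zero hunconf hoverlap false),
    ← lintegral_const_mul' _ _ (by simpa using measure_arm_ne_zero hunconf hoverlap true)]
  -- Both sides are integrals over all of `Q` by now, and the integrands agree because w*(1 − e)/(1
  -- − p₁) = e/p₁.
  refine lintegral_congr_ae ?_
  filter_upwards [overlap_ae hoverlap, wStar_nonneg_ae hoverlap] with z hz hwz
  simp only [condDistrib_trt_apply, cond_true, cond_false]
  rw [← ofReal_pArm, ← ofReal_pArm, ← ENNReal.ofReal_inv_of_pos (hpos _),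
    ← ENNReal.ofReal_inv_of_pos (hpos _), ← mul_assoc, ← mul_assoc, ← mul_assoc,
    ← ENNReal.ofReal_mul (by have := hpos false; positivity),
    ← ENNReal.ofReal_mul (by
      have := hpos false; have : 0 < 1 - propensity Q (cov z) := by linarith [hz.2]
      positivity),
    ← ENNReal.ofReal_mul (by have := hpos true; positivity)]
  congr 2
  have h0 : 1 - propensity Q (cov z) ≠ 0 := by linarith [hz.2]
  have h1 := (hpos true).ne'
  have h2 := (hpos false).ne'
  rw [pArm_true] at h1
  rw [pArm_false] at h2
  rw [wStar, pArm_true, pArm_false]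
  field_simp

/-- Conditional second moments of the outcome residual are bounded in the control arm. -/
theorem lintegral_residual_sq_le {M : ℝ} (hvar : CondVarianceBounded Q M)
    {g : (Fin p → ℝ) → ℝ≥0∞} (hg : Measurable g) :
    ∫⁻ z, g (cov z) * ENNReal.ofReal ((y0 z - prognostic Q (cov z)) ^ 2) ∂(armLaw Q false)
      ≤ ENNReal.ofReal M * ∫⁻ z, g (cov z) ∂(armLaw Q false) := by
  have hm := measurable_prognostic (Q := Q)
  have hct : Measurable fun z : FullRecord p => (cov z, trt z) :=
    measurable_cov.prodMk measurable_trt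
  set κ := condDistrib y0 (fun z : FullRecord p => (cov z, trt z)) Q with hκ
  set F : ((Fin p → ℝ) × Bool) × ℝ → ℝ≥0∞ := fun q =>
    g q.1.1 * ENNReal.ofReal ((q.2 - prognostic Q q.1.1) ^ 2) with hF
  have hFm : Measurable F := by fun_prop
  have hst : MeasurableSet {q : (Fin p → ℝ) × Bool | q.2 = false} :=
    measurable_snd (measurableSet_singleton false)
  -- The disintegration is over (X, T), not over X alone, because the variance hypothesis is stated
  -- for the conditional law given X and T = 0.
  have key : ∫⁻ z in {z | trt z = false},
      g (cov z) * ENNReal.ofReal ((y0 z - prognostic Q (cov z)) ^ 2) ∂Q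
      = ∫⁻ z in {z | trt z = false}, ∫⁻ y, F ((cov z, trt z), y) ∂(κ (cov z, trt z)) ∂Q := by
    calc _ = ∫⁻ q in {q : ((Fin p → ℝ) × Bool) × ℝ | q.1.2 = false}, F q
          ∂(Q.map fun z => ((cov z, trt z), y0 z)) := by
          exact (setLIntegral_map (measurable_fst hst) hFm (hct.prodMk measurable_y0)).symm
      _ = ∫⁻ q in {q | q.2 = false} ×ˢ Set.univ, F q
          ∂((Q.map fun z => (cov z, trt z)) ⊗ₘ κ) := by
          rw [hκ, compProd_map_condDistrib measurable_y0.aemeasurable]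
          congr 2
          ext q; simp
      _ = _ := by
          rw [Measure.setLIntegral_compProd hFm hst MeasurableSet.univ]
          rw [setLIntegral_map hst (by
            simp only [Measure.restrict_univ]; exact hFm.lintegral_kernel_prod_right') hct]
          simp only [Measure.restrict_univ]
          rfl
  rw [lintegral_armLaw, lintegral_armLaw, key, mul_left_comm]
  gcongr
  rw [← lintegral_const_mul _ (by fun_prop)]
  have hv : ∀ᵐ z ∂(Q.restrict {z | trt z = false}),
      ∫⁻ y, ENNReal.ofReal ((y - prognostic Q (cov z)) ^ 2) ∂(κ (cov z, false))
        ≤ ENNReal.ofReal M := by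
    have h := hvar
    unfold CondVarianceBounded at h
    rw [controlLaw_eq, armLaw_eq_smul, Measure.ae_ennreal_smul_measure_iff (by simp)] at h
    exact h
  refine lintegral_mono_ae ?_
  filter_upwards [hv, ae_restrict_mem (measurableSet_arm false)] with z hz ht
  have ht' : trt z = false := ht
  simp only [hF, ht']
  rw [lintegral_const_mul _ (by fun_prop), mul_comm]
  gcongr

/-- The joint law of `(X, Y(0))` in a treatment arm. -/
theorem map_restrict_arm (hunconf : Unconfounded Q) (a : Bool) :
    (Q.restrict {z | trt z = a}).map (fun z => (cov z, y0 z))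
      = (Q.map fun z => (cov z, y0 z)).withDensity fun q => condDistrib trt cov Q q.1 {a} := by
  have hκ : Measurable fun x => condDistrib trt cov Q x {a} :=
    Kernel.measurable_coe _ (measurableSet_singleton a)
  refine Measure.ext_of_lintegral _ fun G hG => ?_
  rw [lintegral_map hG (measurable_cov.prodMk measurable_y0), setLIntegral_arm hunconf a hG,
    lintegral_withDensity_eq_lintegral_mul _ (by fun_prop) hG,
    lintegral_map (by fun_prop) (measurable_cov.prodMk measurable_y0)]
  rfl

theorem integrable_prognostic (hY0 : Integrable y0 Q) :
    Integrable (fun z => prognostic Q (cov z)) Q := by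
  have h : Integrable (fun q : (Fin p → ℝ) × ℝ => q.2) (Q.map fun z => (cov z, y0 z)) := by
    rw [integrable_map_measure (by fun_prop) (measurable_cov.prodMk measurable_y0).aemeasurable]
    exact hY0
  exact h.integral_condDistrib measurable_cov.aemeasurable measurable_y0.aemeasurable

/-- Within each arm the outcome residual is orthogonal to functions of the covariates. -/
theorem setIntegral_mul_residual (hunconf : Unconfounded Q) (hY0 : Integrable y0 Q) (a : Bool)
    {g : (Fin p → ℝ) → ℝ} (hg : Measurable g)
    (hint : IntegrableOn (fun z => g (cov z) * (y0 z - prognostic Q (cov z)))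
      {z | trt z = a} Q) :
    ∫ z in {z | trt z = a}, g (cov z) * (y0 z - prognostic Q (cov z)) ∂Q = 0 := by
  have hm := measurable_prognostic (Q := Q)
  have hcy : Measurable fun z : FullRecord p => (cov z, y0 z) :=
    measurable_cov.prodMk measurable_y0
  have hκ : Measurable fun x => condDistrib trt cov Q x {a} :=
    Kernel.measurable_coe _ (measurableSet_singleton a)
  set G : (Fin p → ℝ) × ℝ → ℝ := fun q => g q.1 * (q.2 - prognostic Q q.1) with hG
  have hGm : Measurable G := by fun_prop
  have hint' : Integrable G ((Q.restrict {z | trt z = a}).map fun z => (cov z, y0 z)) := by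
    rw [integrable_map_measure hGm.aestronglyMeasurable hcy.aemeasurable]
    exact hint
  have h1 : ∫ z in {z | trt z = a}, g (cov z) * (y0 z - prognostic Q (cov z)) ∂Q
      = ∫ q, G q ∂((Q.restrict {z | trt z = a}).map fun z => (cov z, y0 z)) := by
    rw [integral_map hcy.aemeasurable hGm.aestronglyMeasurable]
  rw [map_restrict_arm hunconf a] at h1 hint'
  have hlt : ∀ᵐ q ∂(Q.map fun z => (cov z, y0 z)), condDistrib trt cov Q q.1 {a} < ∞ :=
    ae_of_all _ fun q => measure_lt_top _ _
  rw [integral_withDensity_eq_integral_toReal_smul (by fun_prop) hlt,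
    ← compProd_map_condDistrib measurable_y0.aemeasurable] at h1
  rw [integrable_withDensity_iff_integrable_smul' (by fun_prop) hlt,
    ← compProd_map_condDistrib measurable_y0.aemeasurable] at hint'
  rw [h1, Measure.integral_compProd hint']
  have hy : ∀ᵐ x ∂(Q.map cov), Integrable (fun y : ℝ => y) (condDistrib y0 cov Q x) := by
    have h : Integrable (fun q : (Fin p → ℝ) × ℝ => q.2) (Q.map fun z => (cov z, y0 z)) := by
      rw [integrable_map_measure (by fun_prop) hcy.aemeasurable]
      exact hY0
    exact h.condDistrib_ae_map measurable_y0.aemeasurable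
  -- Given x, the arm probability and g(x) are constants, and y − m₀(x) has mean zero under the
  -- conditional law of Y(0).
  refine integral_eq_zero_of_ae ?_
  filter_upwards [hy] with x hx
  simp only [hG, smul_eq_mul, Pi.zero_apply]
  rw [integral_const_mul, integral_const_mul, integral_sub hx (integrable_const _)]
  simp [prognostic]

theorem integral_mul_residual (hunconf : Unconfounded Q) (hY0 : Integrable y0 Q)
    (hoverlap : Overlap Q) (a : Bool) {g : (Fin p → ℝ) → ℝ} (hg : Measurable g)
    (hint : Integrable (fun z => g (cov z) * (y0 z - prognostic Q (cov z))) (armLaw Q a)) :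
    ∫ z, g (cov z) * (y0 z - prognostic Q (cov z)) ∂(armLaw Q a) = 0 := by
  rw [integrable_armLaw_iff (measure_arm_ne_zero hunconf hoverlap a)] at hint
  rw [integral_armLaw, setIntegral_mul_residual hunconf hY0 a hg hint, mul_zero]

/-- The estimand is the treated mean of the prognostic score. -/
theorem theta0_eq_integral_prognostic (hunconf : Unconfounded Q) (hY0 : Integrable y0 Q)
    (hoverlap : Overlap Q) :
    theta0 Q = ∫ z, prognostic Q (cov z) ∂(armLaw Q true) := by
  have h := measure_arm_ne_zero hunconf hoverlap true
  have h1 : Integrable y0 (armLaw Q true) := (integrable_armLaw_iff h).2 hY0.integrableOn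
  have h2 : Integrable (fun z => prognostic Q (cov z)) (armLaw Q true) :=
    (integrable_armLaw_iff h).2 (integrable_prognostic hY0).integrableOn
  have h3 := integral_mul_residual hunconf hY0 hoverlap true (g := fun _ => 1) measurable_const
    (by simp only [one_mul]; exact h1.sub h2)
  simp only [one_mul] at h3
  rw [integral_sub h1 h2] at h3
  rw [theta0, treatedLaw_eq]
  linarith

end PopulationFacts
end CrossBalancing

namespace CrossBalancing

/-! ### Tilted laws: odds functions and the treated mean of the control regression. -/

section Efficiency

set_option linter.unusedSectionVars false

/-- The observed records in treatment arm `a`. -/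
def obsArm (p : ℕ) (a : Bool) : Set (ObsRecord p) := {o | o.2.1 = a}

theorem measurableSet_obsArm {p : ℕ} (a : Bool) : MeasurableSet (obsArm p a) :=
  (measurable_fst.comp measurable_snd) (measurableSet_singleton a)

/-- A law of observed records with overlap: `v` is the odds of treatment, `m` the control
regression function, `M` a bound on the control residual variance. -/
structure RegressionModel {p : ℕ} (R : Measure (ObsRecord p)) (v m : (Fin p → ℝ) → ℝ) (M : ℝ) :
    Prop where
  measurable_odds : Measurable v
  measurable_reg : Measurable m
  odds_nonneg : ∀ x, 0 ≤ v x
  lintegral_odds : ∀ g : (Fin p → ℝ) → ℝ≥0∞, Measurable g →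
    ∫⁻ o in obsArm p false, ENNReal.ofReal (v o.1) * g o.1 ∂(R) = ∫⁻ o in obsArm p true, g o.1 ∂(R)
  memLp_odds : MemLp (fun o : ObsRecord p => v o.1) 2 R
  memLp_reg : MemLp (fun o : ObsRecord p => m o.1) 2 R
  lintegral_residual : ∀ g : (Fin p → ℝ) → ℝ≥0∞, Measurable g →
    ∫⁻ o in obsArm p false, g o.1 * ENNReal.ofReal ((o.2.2 - m o.1) ^ 2) ∂(R)
      ≤ ENNReal.ofReal M * ∫⁻ o in obsArm p false, g o.1 ∂(R)
  integral_residual : ∀ g : (Fin p → ℝ) → ℝ, Measurable g →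
    IntegrableOn (fun o : ObsRecord p => g o.1 * (o.2.2 - m o.1)) (obsArm p false) R →
    ∫ o in obsArm p false, g o.1 * (o.2.2 - m o.1) ∂(R) = 0
  treated_ne_zero : R (obsArm p true) ≠ 0
  control_ne_zero : R (obsArm p false) ≠ 0

/-- The control regression function of a law of observed records. -/
noncomputable def controlRegression {p : ℕ} (R : Measure (ObsRecord p)) [IsFiniteMeasure R]
    (x : Fin p → ℝ) : ℝ :=
  ∫ y, y ∂(condDistrib (fun o : ObsRecord p => o.2.2) (fun o : ObsRecord p => (o.1, o.2.1)) R
    (x, false))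

theorem measurable_controlRegression {p : ℕ} (R : Measure (ObsRecord p)) [IsFiniteMeasure R] :
    Measurable (controlRegression R) := by
  have h := (StronglyMeasurable.integral_condDistrib (mβ := inferInstance)
    (X := fun o : ObsRecord p => (o.1, o.2.1))
    (Y := fun o : ObsRecord p => o.2.2) (μ := R)
    (f := fun q : ((Fin p → ℝ) × Bool) × ℝ => q.2) measurable_snd.stronglyMeasurable).measurable
  exact h.comp (measurable_id.prodMk measurable_const)

/-- This is the defining property of the conditional mean given (X, T), tested on functions of X
that are cut to T = 0. Only the product with u has to be integrable, which matters because Y itself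
is not assumed integrable under tilted laws. -/
theorem setIntegral_mul_controlRegression {p : ℕ} (R : Measure (ObsRecord p)) [IsFiniteMeasure R]
    {u : (Fin p → ℝ) → ℝ} (hu : Measurable u)
    (hint : IntegrableOn (fun o : ObsRecord p => u o.1 * o.2.2) (obsArm p false) R) :
    ∫ o in obsArm p false, u o.1 * controlRegression R o.1 ∂(R)
      = ∫ o in obsArm p false, u o.1 * o.2.2 ∂(R) := by
  set XT : ObsRecord p → (Fin p → ℝ) × Bool := fun o => (o.1, o.2.1) with hXT
  have hXTm : Measurable XT := by fun_prop
  set κ := condDistrib (fun o : ObsRecord p => o.2.2) XT R with hκ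
  have hym : Measurable fun o : ObsRecord p => o.2.2 := by fun_prop
  set S : Set ((Fin p → ℝ) × Bool) := {q | q.2 = false} with hS
  have hSm : MeasurableSet S := measurable_snd (measurableSet_singleton false)
  set F : ((Fin p → ℝ) × Bool) × ℝ → ℝ := fun q =>
    S.indicator (fun r => u r.1 * q.2) q.1 with hF
  have hFm : Measurable F := by
    have : F = Set.indicator (Prod.fst ⁻¹' S) fun q => u q.1.1 * q.2 := by
      funext q
      by_cases hq : q.1 ∈ S <;> simp [hF, hq]
    rw [this]
    exact Measurable.indicator (by fun_prop) (measurable_fst hSm)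
  have hFo : (fun o : ObsRecord p => F (XT o, o.2.2))
      = (obsArm p false).indicator fun o => u o.1 * o.2.2 := by
    funext o
    by_cases ho : o.2.1 = false <;> simp [hF, hXT, hS, obsArm, ho]
  have hFint : Integrable F (R.map fun o => (XT o, o.2.2)) := by
    rw [integrable_map_measure hFm.aestronglyMeasurable (hXTm.prodMk hym).aemeasurable]
    change Integrable (fun o : ObsRecord p => F (XT o, o.2.2)) R
    rw [hFo, integrable_indicator_iff (measurableSet_obsArm false)]
    exact hint
  have h1 : ∫ o in obsArm p false, u o.1 * o.2.2 ∂(R) = ∫ q, F q ∂(R.map fun o => (XT o, o.2.2)) := by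
    rw [integral_map (hXTm.prodMk hym).aemeasurable hFm.aestronglyMeasurable, hFo,
      integral_indicator (measurableSet_obsArm false)]
  rw [← compProd_map_condDistrib hym.aemeasurable] at h1 hFint
  rw [h1, Measure.integral_compProd hFint]
  have hin : ∀ q, ∫ y, F (q, y) ∂(κ q)
      = S.indicator (fun r => u r.1 * controlRegression R r.1) q := by
    rintro ⟨x, t⟩
    cases t
    · simp only [hF, hS, Set.mem_ofPred_eq, Set.indicator_of_mem, controlRegression]
      rw [integral_const_mul]
    · simp [hF, hS]
  simp_rw [← hκ, hin]
  have hm := measurable_controlRegression R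
  rw [integral_map hXTm.aemeasurable
    (Measurable.indicator (by fun_prop) hSm).aestronglyMeasurable]
  rw [← integral_indicator (measurableSet_obsArm false)]
  refine integral_congr_ae (ae_of_all _ fun o => ?_)
  by_cases ho : o.2.1 = false <;> simp [hXT, hS, obsArm, ho]

/-- Separates numerator and denominator, which are differentiated one at a time along a submodel. -/
theorem identifiedMean_eq {p : ℕ} (R : ProbabilityMeasure (ObsRecord p)) :
    identifiedMean R = ((R : Measure (ObsRecord p)).real (obsArm p true))⁻¹
      * ∫ o in obsArm p true, controlRegression (R : Measure (ObsRecord p)) o.1 ∂(R) := by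
  unfold identifiedMean ProbabilityTheory.cond
  rw [integral_smul_measure, smul_eq_mul, ENNReal.toReal_inv]
  rfl

namespace RegressionModel

variable {p : ℕ} {R : Measure (ObsRecord p)} [IsProbabilityMeasure R]
  {v m : (Fin p → ℝ) → ℝ} {M : ℝ}

/-- The odds are a density of the treated covariate law with respect to the control one, so control
null sets are treated null sets. -/
theorem ae_treated_of_ae_control (h : RegressionModel R v m M) {S : Set (Fin p → ℝ)}
    (hS : MeasurableSet S)
    (hae : ∀ᵐ o ∂(R.restrict (obsArm p false)), o.1 ∈ S) :
    ∀ᵐ o ∂(R.restrict (obsArm p true)), o.1 ∈ S := by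
  have hv := h.measurable_odds
  have hi : Measurable (Sᶜ.indicator (1 : (Fin p → ℝ) → ℝ≥0∞)) := measurable_one.indicator hS.compl
  have h1 := h.lintegral_odds (Sᶜ.indicator 1) hi
  have h2 : ∫⁻ o in obsArm p false, ENNReal.ofReal (v o.1) * Sᶜ.indicator 1 o.1 ∂(R) = 0 := by
    rw [lintegral_eq_zero_iff (by fun_prop)]
    filter_upwards [hae] with o ho
    simp [ho]
  rw [h2, eq_comm, lintegral_eq_zero_iff (by fun_prop)] at h1
  filter_upwards [h1] with o ho
  by_contra hc
  simp [hc] at ho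

/-- Integrating the squared residual conditionally on X leaves at most M u², so u may be unbounded.
-/
theorem memLp_mul_residual (h : RegressionModel R v m M) {u : (Fin p → ℝ) → ℝ} (hu : Measurable u)
    (hu2 : MemLp (fun o : ObsRecord p => u o.1) 2 (R.restrict (obsArm p false))) :
    MemLp (fun o : ObsRecord p => u o.1 * (o.2.2 - m o.1)) 2 (R.restrict (obsArm p false)) := by
  have hm := h.measurable_reg
  rw [memLp_two_iff_integrable_sq (by fun_prop)]
  replace hu2 := (memLp_two_iff_integrable_sq
    (hu.comp (measurable_fst (β := Bool × ℝ))).aestronglyMeasurable).1 hu2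
  refine ⟨by fun_prop, ?_⟩
  rw [hasFiniteIntegral_iff_ofReal (ae_of_all _ fun o => sq_nonneg _)]
  have h1 := h.lintegral_residual (fun x => ENNReal.ofReal (u x ^ 2)) (by fun_prop)
  simp_rw [mul_pow, ENNReal.ofReal_mul (sq_nonneg _)]
  refine h1.trans_lt (ENNReal.mul_lt_top ENNReal.ofReal_lt_top ?_)
  have h2 := hu2.2
  rwa [hasFiniteIntegral_iff_ofReal (ae_of_all _ fun o => sq_nonneg _)] at h2

/-- The odds function of a law `f R`, with the representation of the treated mean of its control
regression function. -/
theorem exists_odds_withDensity (h : RegressionModel R v m M) {f : ObsRecord p → ℝ} {c K : ℝ}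
    (hc : 0 < c) (hf : Measurable f) (hb : ∀ o, c ≤ f o ∧ f o ≤ K)
    {R' : Measure (ObsRecord p)} [IsProbabilityMeasure R']
    (hR' : R' = R.withDensity fun o => ENNReal.ofReal (f o)) :
    ∃ u : (Fin p → ℝ) → ℝ, Measurable u ∧ (∀ x, 0 ≤ u x) ∧
      (∀ᵐ o ∂(R.restrict (obsArm p false)), u o.1 ≤ K / c * v o.1) ∧
      (∀ g : (Fin p → ℝ) → ℝ, Measurable g →
        ∫ o in obsArm p true, f o * g o.1 ∂(R) = ∫ o in obsArm p false, f o * (u o.1 * g o.1) ∂(R)) ∧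
      ∫ o in obsArm p true, controlRegression R' o.1 ∂(R')
        = ∫ o in obsArm p true, f o * m o.1 ∂(R)
          + ∫ o in obsArm p false, f o * (u o.1 * (o.2.2 - m o.1)) ∂(R) := by
  have hv := h.measurable_odds
  have hm := h.measurable_reg
  have hf0 : ∀ o, 0 ≤ f o := fun o => hc.le.trans (hb o).1
  have hK : 0 ≤ K := by
    obtain ⟨o⟩ : Nonempty (ObsRecord p) := inferInstance
    exact (hf0 o).trans (hb o).2
  have hset : ∀ (a : Bool) (g : ObsRecord p → ℝ),
      ∫ o in obsArm p a, g o ∂(R') = ∫ o in obsArm p a, f o * g o ∂(R) := by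
    intro a g
    rw [hR', setIntegral_withDensity_eq_setIntegral_toReal_smul (by fun_prop)
      (ae_of_all _ fun o => ENNReal.ofReal_lt_top) _ (measurableSet_obsArm a)]
    simp_rw [ENNReal.toReal_ofReal (hf0 _), smul_eq_mul]
  have hlset : ∀ (a : Bool) (g : ObsRecord p → ℝ≥0∞), Measurable g →
      ∫⁻ o in obsArm p a, g o ∂(R') = ∫⁻ o in obsArm p a, ENNReal.ofReal (f o) * g o ∂(R) := by
    intro a g hg
    rw [hR', setLIntegral_withDensity_eq_setLIntegral_mul _ (by fun_prop) hg
      (measurableSet_obsArm a)]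
    rfl
  set α : Bool → Measure (Fin p → ℝ) := fun a => (R'.restrict (obsArm p a)).map Prod.fst with hα
  have hαl : ∀ a (g : (Fin p → ℝ) → ℝ≥0∞), Measurable g →
      ∫⁻ x, g x ∂(α a) = ∫⁻ o in obsArm p a, ENNReal.ofReal (f o) * g o.1 ∂(R) := by
    intro a g hg
    rw [hα, lintegral_map hg measurable_fst, hlset a _ (by fun_prop)]
  -- Because f ≥ c > 0, `R'` and `R` have the same null sets in the control arm, so absolute
  -- continuity is inherited from `R`.
  have hac : α true ≪ α false := by
    intro S hS
    obtain ⟨S', hSS', hS'm, hS'0⟩ := exists_measurable_superset_of_null hS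
    refine measure_mono_null hSS' ?_
    have hi : Measurable (S'.indicator (1 : (Fin p → ℝ) → ℝ≥0∞)) := measurable_one.indicator hS'm
    have h0 := hαl false _ hi
    rw [lintegral_indicator_one hS'm, hS'0, eq_comm, lintegral_eq_zero_iff (by fun_prop)] at h0
    have h1 : ∀ᵐ o ∂(R.restrict (obsArm p false)), o.1 ∈ S'ᶜ := by
      filter_upwards [h0] with o ho hS
      simp only [hS, Set.indicator_of_mem, Pi.one_apply, mul_one, Pi.zero_apply,
        ENNReal.ofReal_eq_zero] at ho
      linarith [(hb o).1]
    have h2 := h.ae_treated_of_ae_control hS'm.compl h1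
    have h3 := hαl true _ hi
    rw [lintegral_indicator_one hS'm] at h3
    rw [h3, lintegral_eq_zero_iff (by fun_prop)]
    filter_upwards [h2] with o ho
    have : o.1 ∉ S' := ho
    simp [this]
  set ρ := (α true).rnDeriv (α false) with hρ
  have hρm : Measurable ρ := Measure.measurable_rnDeriv _ _
  have hρd : (α false).withDensity ρ = α true := Measure.withDensity_rnDeriv_eq _ _ hac
  have hρlt : ∀ᵐ x ∂(α false), ρ x < ∞ := Measure.rnDeriv_lt_top _ _
  -- the density ratio is controlled by that of `R`
  have hρle : ∀ᵐ o ∂(R.restrict (obsArm p false)),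
      ENNReal.ofReal c * ρ o.1 ≤ ENNReal.ofReal K * ENNReal.ofReal (v o.1) := by
    have hγ : (fun x => ENNReal.ofReal c * ρ x)
        ≤ᵐ[(R.restrict (obsArm p false)).map Prod.fst]
          fun x => ENNReal.ofReal K * ENNReal.ofReal (v x) := by
      -- On an arbitrary covariate set, f is bounded below by c on the controls and above by K on
      -- the treated, with the two odds identities in between.
      refine ae_le_of_forall_setLIntegral_le_of_sigmaFinite (by fun_prop) fun S hS _ => ?_
      rw [← lintegral_indicator hS, ← lintegral_indicator hS,
        lintegral_map (Measurable.indicator (by fun_prop) hS) measurable_fst,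
        lintegral_map (Measurable.indicator (by fun_prop) hS) measurable_fst]
      have hi : Measurable (S.indicator (1 : (Fin p → ℝ) → ℝ≥0∞)) := measurable_one.indicator hS
      have e1 : ∀ (F : (Fin p → ℝ) → ℝ≥0∞) x, S.indicator F x = F x * S.indicator 1 x := by
        intro F x
        by_cases hx : x ∈ S <;> simp [hx]
      calc ∫⁻ o in obsArm p false, S.indicator (fun x => ENNReal.ofReal c * ρ x) o.1 ∂(R)
          ≤ ∫⁻ o in obsArm p false, ENNReal.ofReal (f o) * (ρ o.1 * S.indicator 1 o.1) ∂(R) := by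
            refine lintegral_mono fun o => ?_
            simp only
            rw [e1, mul_assoc]
            gcongr
            exact (hb o).1
        _ = ∫⁻ x, ρ x * S.indicator 1 x ∂(α false) := 
            (hαl false (fun x => ρ x * S.indicator 1 x) (hρm.mul hi)).symm
        _ = ∫⁻ x, S.indicator 1 x ∂(α true) := by
            rw [← hρd, lintegral_withDensity_eq_lintegral_mul _ hρm hi]
            rfl
        _ = ∫⁻ o in obsArm p true, ENNReal.ofReal (f o) * S.indicator 1 o.1 ∂(R) :=
            hαl true _ hi
        _ ≤ ∫⁻ o in obsArm p true, ENNReal.ofReal K * S.indicator 1 o.1 ∂(R) := by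
            refine lintegral_mono fun o => ?_
            gcongr
            exact (hb o).2
        _ = ∫⁻ o in obsArm p false, ENNReal.ofReal (v o.1)
              * (ENNReal.ofReal K * S.indicator 1 o.1) ∂(R) :=
            (h.lintegral_odds (fun x => ENNReal.ofReal K * S.indicator 1 x) (by fun_prop)).symm
        _ = _ := by
            refine lintegral_congr fun o => ?_
            rw [e1 (fun x => ENNReal.ofReal K * ENNReal.ofReal (v x)), mul_left_comm, mul_assoc]
    exact ae_of_ae_map measurable_fst.aemeasurable hγ
  have hule : ∀ᵐ o ∂(R.restrict (obsArm p false)), (ρ o.1).toReal ≤ K / c * v o.1 := by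
    filter_upwards [hρle] with o ho
    have h1 := ENNReal.toReal_mono
      (ENNReal.mul_ne_top ENNReal.ofReal_ne_top ENNReal.ofReal_ne_top) ho
    rw [ENNReal.toReal_mul, ENNReal.toReal_mul, ENNReal.toReal_ofReal hc.le,
      ENNReal.toReal_ofReal hK, ENNReal.toReal_ofReal (h.odds_nonneg _)] at h1
    rw [div_mul_eq_mul_div, le_div_iff₀ hc]
    linarith
  have hrep : ∀ g : (Fin p → ℝ) → ℝ, Measurable g →
      ∫ o in obsArm p true, g o.1 ∂(R') = ∫ o in obsArm p false, (ρ o.1).toReal * g o.1 ∂(R') := by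
    intro g hg
    have h1 : ∫ o in obsArm p true, g o.1 ∂(R') = ∫ x, g x ∂(α true) := by
      rw [hα, integral_map measurable_fst.aemeasurable hg.aestronglyMeasurable]
    rw [h1, ← hρd, integral_withDensity_eq_integral_toReal_smul hρm hρlt, hα, integral_map
      measurable_fst.aemeasurable (by fun_prop)]
    rfl
  refine ⟨fun x => (ρ x).toReal, hρm.ennreal_toReal, fun x => ENNReal.toReal_nonneg, hule, ?_, ?_⟩
  · intro g hg
    rw [← hset true fun o => g o.1, hrep g hg, hset]
  -- square integrability
  have hu2 : MemLp (fun o : ObsRecord p => (ρ o.1).toReal) 2 (R.restrict (obsArm p false)) := by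
    refine ((h.memLp_odds.restrict (obsArm p false)).const_mul (K / c)).mono'
      (hρm.ennreal_toReal.comp measurable_fst).aestronglyMeasurable ?_
    filter_upwards [hule] with o ho
    rwa [Real.norm_of_nonneg ENNReal.toReal_nonneg]
  have hfb : ∀ g : ObsRecord p → ℝ, IntegrableOn g (obsArm p false) R →
      IntegrableOn (fun o => f o * g o) (obsArm p false) R := by
    intro g hg
    refine Integrable.bdd_mul (c := K) hg (by fun_prop) (ae_of_all _ fun o => ?_)
    rw [Real.norm_of_nonneg (hf0 o)]
    exact (hb o).2
  have hi1 : IntegrableOn (fun o : ObsRecord p => (ρ o.1).toReal * (o.2.2 - m o.1))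
      (obsArm p false) R :=
    (h.memLp_mul_residual (u := fun x => (ρ x).toReal) hρm.ennreal_toReal hu2).integrable
      (by norm_num)
  have hi2 : IntegrableOn (fun o : ObsRecord p => (ρ o.1).toReal * m o.1)
      (obsArm p false) R := hu2.integrable_mul (h.memLp_reg.restrict _)
  -- Integrability comes from Y = (Y − m) + m: the odds times the residual is square integrable, and
  -- the odds times m is a product of two square-integrable functions.
  have hY : IntegrableOn (fun o : ObsRecord p => (ρ o.1).toReal * o.2.2) (obsArm p false) R' := by
    have h1 : IntegrableOn (fun o : ObsRecord p => (ρ o.1).toReal * o.2.2) (obsArm p false) R := by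
      refine (hi1.add hi2).congr (ae_of_all _ fun o => ?_)
      simp only [Pi.add_apply]
      ring
    rw [IntegrableOn, hR', restrict_withDensity (measurableSet_obsArm false),
      integrable_withDensity_iff_integrable_smul' (by fun_prop)
        (ae_of_all _ fun o => ENNReal.ofReal_lt_top)]
    simp_rw [ENNReal.toReal_ofReal (hf0 _), smul_eq_mul]
    exact hfb _ h1
  -- The regression of `R'` is moved to the controls by its odds and replaced there by Y. Then Y = m
  -- + (Y − m), and m is moved back to the treated. This eliminates the unknown regression of `R'`.
  rw [hrep _ (measurable_controlRegression R'),
    setIntegral_mul_controlRegression R' hρm.ennreal_toReal hY, ← hset true fun o => m o.1,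
    hrep m hm, hset, hset, ← integral_add (hfb _ hi2) (hfb _ hi1)]
  refine integral_congr_ae (ae_of_all _ fun o => ?_)
  simp only
  ring

end RegressionModel

end Efficiency
end CrossBalancing

namespace CrossBalancing

/-! ### Tools on square-integrable functions. -/

section SquareIntegrable

variable {α : Type*} [MeasurableSpace α] {μ : Measure α}

theorem lintegral_norm_sq_eq {E : Type*} [NormedAddCommGroup E] (f : α → E) :
    ∫⁻ x, ENNReal.ofReal (‖f x‖ ^ 2) ∂μ = eLpNorm f 2 μ ^ 2 := by
  have h := eLpNorm_nnreal_pow_eq_lintegral (f := f) (μ := μ) (p := 2) (by norm_num)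
  simp only [NNReal.coe_ofNat, ENNReal.coe_ofNat, ENNReal.rpow_ofNat] at h
  rw [h]
  refine lintegral_congr fun x => ?_
  rw [ENNReal.ofReal_pow (norm_nonneg _), ofReal_norm]

theorem lintegral_sq_eq (f : α → ℝ) :
    ∫⁻ x, ENNReal.ofReal (f x ^ 2) ∂μ = eLpNorm f 2 μ ^ 2 := by
  rw [← lintegral_norm_sq_eq]
  simp

theorem integral_sq_eq {f : α → ℝ} (hf : AEStronglyMeasurable f μ) :
    ∫ x, f x ^ 2 ∂μ = (eLpNorm f 2 μ ^ 2).toReal := by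
  rw [← lintegral_sq_eq, integral_eq_lintegral_of_nonneg_ae (ae_of_all _ fun x => sq_nonneg _)
    (hf.pow 2)]

/-- The Cauchy-Schwarz inequality for square integrable functions. -/
theorem sq_integral_mul_le {f g : α → ℝ} (hf : MemLp f 2 μ) (hg : MemLp g 2 μ) :
    (∫ x, f x * g x ∂μ) ^ 2 ≤ (∫ x, f x ^ 2 ∂μ) * ∫ x, g x ^ 2 ∂μ := by
  have hfg : Integrable (fun x => f x * g x) μ := hf.integrable_mul hg
  have hff : Integrable (fun x => f x ^ 2) μ := hf.integrable_sq
  have hgg : Integrable (fun x => g x ^ 2) μ := hg.integrable_sq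
  have h : ∀ t : ℝ, 0 ≤ (∫ x, g x ^ 2 ∂μ) * (t * t) + (2 * ∫ x, f x * g x ∂μ) * t
      + ∫ x, f x ^ 2 ∂μ := by
    intro t
    have h1 : ∫ x, (f x + t * g x) ^ 2 ∂μ = (∫ x, g x ^ 2 ∂μ) * (t * t)
        + (2 * ∫ x, f x * g x ∂μ) * t + ∫ x, f x ^ 2 ∂μ := by
      have h2 : ∀ x, (f x + t * g x) ^ 2
          = (t * t) * g x ^ 2 + (2 * t) * (f x * g x) + f x ^ 2 := fun x => by ring
      simp_rw [h2]
      have h3 : Integrable (fun x => (t * t) * g x ^ 2 + (2 * t) * (f x * g x)) μ :=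
        (hgg.const_mul _).add (hfg.const_mul _)
      rw [integral_add h3 hff,
        integral_add (hgg.const_mul _) (hfg.const_mul _), integral_const_mul, integral_const_mul]
      ring
    rw [← h1]
    exact integral_nonneg fun x => sq_nonneg _
  have := discrim_le_zero h
  unfold discrim at this
  nlinarith

/-- Cauchy–Schwarz on q − s. With q the difference quotient of the densities and s the score,
quadratic mean differentiability becomes a derivative of integrals. -/
theorem tendsto_integral_mul_of_eLpNorm {ι : Type*} {l : Filter ι} {q : ι → α → ℝ} {s g : α → ℝ}
    (hq : ∀ᶠ t in l, MemLp (q t) 2 μ) (hs : MemLp s 2 μ) (hg : MemLp g 2 μ)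
    (h : Tendsto (fun t => eLpNorm (fun x => q t x - s x) 2 μ) l (𝓝 0)) :
    Tendsto (fun t => ∫ x, q t x * g x ∂μ) l (𝓝 (∫ x, s x * g x ∂μ)) := by
  have h1 : Tendsto (fun t => (eLpNorm (fun x => q t x - s x) 2 μ ^ 2).toReal
      * ∫ x, g x ^ 2 ∂μ) l (𝓝 0) := by
    have h2 : Tendsto (fun t => (eLpNorm (fun x => q t x - s x) 2 μ ^ 2).toReal) l (𝓝 0) := by
      have h3 := (ENNReal.tendsto_toReal (a := 0) (by simp)).comp h
      have h4 := h3.pow 2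
      simp only [ENNReal.toReal_zero, ne_eq, OfNat.ofNat_ne_zero, not_false_eq_true, zero_pow,
        Function.comp_def] at h4
      simpa only [ENNReal.toReal_pow] using h4
    simpa using h2.mul_const (∫ x, g x ^ 2 ∂μ)
  rw [tendsto_iff_norm_sub_tendsto_zero]
  have h3 : Tendsto (fun t => √((eLpNorm (fun x => q t x - s x) 2 μ ^ 2).toReal
      * ∫ x, g x ^ 2 ∂μ)) l (𝓝 0) := by
    simpa using h1.sqrt
  refine squeeze_zero' (Eventually.of_forall fun _ => norm_nonneg _) ?_ h3
  filter_upwards [hq] with t ht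
  rw [Real.norm_eq_abs]
  refine Real.abs_le_sqrt ?_
  rw [← integral_sq_eq (f := fun x => q t x - s x) (ht.sub hs).1,
    ← integral_sub (f := fun x => q t x * g x) (g := fun x => s x * g x)
      (ht.integrable_mul hg) (hs.integrable_mul hg)]
  simp_rw [← sub_mul]
  exact sq_integral_mul_le (f := fun x => q t x - s x) (ht.sub hs) hg

/-- Bounded functions that tend to `0` in `L²` integrate to `0` against integrable functions. -/
theorem tendsto_integral_abs_mul_of_bounded [IsFiniteMeasure μ] {ι : Type*} {l : Filter ι}
    [l.IsCountablyGenerated] {q : ι → α → ℝ} {g : α → ℝ} {K : ℝ}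
    (hqm : ∀ t, AEStronglyMeasurable (q t) μ) (hqb : ∀ᶠ t in l, ∀ x, |q t x| ≤ K)
    (h : Tendsto (fun t => eLpNorm (q t) 2 μ) l (𝓝 0)) (hg : Integrable g μ) :
    Tendsto (fun t => ∫ x, |q t x| * g x ∂μ) l (𝓝 0) := by
  -- Here g is merely integrable, so Cauchy–Schwarz is not available. A subsequence of q converges
  -- almost everywhere, and K‖g‖ dominates.
  refine tendsto_of_subseq_tendsto fun ns hns => ?_
  have hm : TendstoInMeasure μ (fun n => q (ns n)) atTop (fun _ => (0 : ℝ)) := by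
    refine tendstoInMeasure_of_tendsto_eLpNorm (p := 2) (by norm_num) (fun n => hqm _)
      aestronglyMeasurable_const ?_
    refine (h.comp hns).congr fun n => ?_
    simp only [Function.comp_def]
    congr 1
    funext x
    simp
  obtain ⟨ms, hms, hae⟩ := hm.exists_seq_tendsto_ae
  refine ⟨ms, ?_⟩
  have hb := (hns.comp hms.tendsto_atTop).eventually hqb
  have := tendsto_integral_filter_of_dominated_convergence (μ := μ) (l := atTop)
    (F := fun n x => |q (ns (ms n)) x| * g x) (f := fun _ => (0 : ℝ)) (fun x => K * ‖g x‖)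
    (Eventually.of_forall fun n => (hqm _).norm.mul hg.1)
    (by
      filter_upwards [hb] with n hn
      refine ae_of_all _ fun x => ?_
      rw [norm_mul, Real.norm_eq_abs, abs_abs]
      gcongr
      exact hn x)
    (hg.norm.const_mul K)
    (by
      filter_upwards [hae] with x hx
      simpa using hx.abs.mul_const (g x))
  simpa using this

end SquareIntegrable

end CrossBalancing

namespace CrossBalancing

/-! ### Pathwise differentiability and the efficiency bound. -/

section EfficiencyBound

namespace RegressionModel

variable {p : ℕ} {v m : (Fin p → ℝ) → ℝ} {M : ℝ}

theorem integral_odds {R : Measure (ObsRecord p)} (h : RegressionModel R v m M)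
    {g : (Fin p → ℝ) → ℝ} (hg : Measurable g) :
    ∫ o in obsArm p true, g o.1 ∂(R) = ∫ o in obsArm p false, v o.1 * g o.1 ∂(R) := by
  have hv := h.measurable_odds
  have h1 : (R.restrict (obsArm p true)).map Prod.fst
      = ((R.restrict (obsArm p false)).map Prod.fst).withDensity fun x => ENNReal.ofReal (v x) := by
    refine Measure.ext_of_lintegral _ fun G hG => ?_
    rw [lintegral_withDensity_eq_lintegral_mul _ (by fun_prop) hG, lintegral_map hG measurable_fst,
      lintegral_map (by fun_prop) measurable_fst, ← h.lintegral_odds G hG]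
    rfl
  have h2 : ∫ o in obsArm p true, g o.1 ∂(R)
      = ∫ x, g x ∂((R.restrict (obsArm p true)).map Prod.fst) := by
    rw [integral_map measurable_fst.aemeasurable hg.aestronglyMeasurable]
  rw [h2, h1, integral_withDensity_eq_integral_toReal_smul (by fun_prop)
    (ae_of_all _ fun _ => ENNReal.ofReal_lt_top),
    integral_map measurable_fst.aemeasurable (by fun_prop)]
  simp_rw [ENNReal.toReal_ofReal (h.odds_nonneg _), smul_eq_mul]

/-- The squared distance between the odds functions of `f R` and `R`. -/
theorem integral_odds_sub_sq_le {R : Measure (ObsRecord p)} [IsProbabilityMeasure R]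
    (h : RegressionModel R v m M) {f : ObsRecord p → ℝ} {c K : ℝ}
    (hc : 0 < c) (hf : Measurable f) (hb : ∀ o, c ≤ f o ∧ f o ≤ K)
    {u : (Fin p → ℝ) → ℝ} (hu : Measurable u) (hu0 : ∀ x, 0 ≤ u x)
    (hule : ∀ᵐ o ∂(R.restrict (obsArm p false)), u o.1 ≤ K / c * v o.1)
    (hodds : ∀ g : (Fin p → ℝ) → ℝ, Measurable g →
        ∫ o in obsArm p true, f o * g o.1 ∂(R)
          = ∫ o in obsArm p false, f o * (u o.1 * g o.1) ∂(R)) :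
    c * ∫ o in obsArm p false, (u o.1 - v o.1) ^ 2 ∂(R)
      ≤ ∫ o, |f o - 1| * (obsArm p true).indicator (fun o => (K / c + 1) * v o.1) o ∂(R)
        + ∫ o, |f o - 1| * (obsArm p false).indicator (fun o => (K / c + 1) * v o.1 ^ 2) o
          ∂(R) := by
  have hv := h.measurable_odds
  have hv0 := h.odds_nonneg
  have hule' : ∀ᵐ o ∂(R.restrict (obsArm p true)), u o.1 ≤ K / c * v o.1 :=
    h.ae_treated_of_ae_control (S := {x | u x ≤ K / c * v x})
      (measurableSet_le hu (by fun_prop)) hule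
  have hfb : ∀ {a : Bool} {g : ObsRecord p → ℝ}, IntegrableOn g (obsArm p a) R →
      IntegrableOn (fun o => f o * g o) (obsArm p a) R := by
    intro a g hg
    refine Integrable.bdd_mul (c := K) hg (by fun_prop) (ae_of_all _ fun o => ?_)
    rw [Real.norm_of_nonneg (hc.le.trans (hb o).1)]
    exact (hb o).2
  have hv2 : ∀ a, MemLp (fun o : ObsRecord p => v o.1) 2 (R.restrict (obsArm p a)) :=
    fun a => h.memLp_odds.restrict _
  have hu2 : ∀ a, MemLp (fun o : ObsRecord p => u o.1) 2 (R.restrict (obsArm p a)) := by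
    intro a
    refine ((hv2 a).const_mul (K / c)).mono'
      (hu.comp (measurable_fst (β := Bool × ℝ))).aestronglyMeasurable ?_
    have : ∀ᵐ o ∂(R.restrict (obsArm p a)), u o.1 ≤ K / c * v o.1 := by
      cases a
      exacts [hule, hule']
    filter_upwards [this] with o ho
    rwa [Real.norm_of_nonneg (hu0 _)]
  have hd2 : ∀ a, MemLp (fun o : ObsRecord p => u o.1 - v o.1) 2 (R.restrict (obsArm p a)) :=
    fun a => (hu2 a).sub (hv2 a)
  have hd1 : ∀ a, IntegrableOn (fun o : ObsRecord p => u o.1 - v o.1) (obsArm p a) R :=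
    fun a => (hd2 a).integrable (by norm_num)
  have hud : IntegrableOn (fun o : ObsRecord p => u o.1 * (u o.1 - v o.1)) (obsArm p false) R :=
    (hu2 _).integrable_mul (hd2 _)
  have hvd : IntegrableOn (fun o : ObsRecord p => v o.1 * (u o.1 - v o.1)) (obsArm p false) R :=
    (hv2 _).integrable_mul (hd2 _)
  have hdd : IntegrableOn (fun o : ObsRecord p => (u o.1 - v o.1) ^ 2) (obsArm p false) R :=
    (hd2 _).integrable_sq
  -- Both odds identities are tested on u − v itself. Subtracting them expresses the f-weighted
  -- square of u − v through integrals that carry the small factor f − 1.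
  have e1 := hodds (fun x => u x - v x) (hu.sub hv)
  have e2 := h.integral_odds (g := fun x => u x - v x) (hu.sub hv)
  have e3 : ∫ o in obsArm p false, f o * (u o.1 - v o.1) ^ 2 ∂(R)
      = ∫ o in obsArm p true, (f o - 1) * (u o.1 - v o.1) ∂(R)
        - ∫ o in obsArm p false, (f o - 1) * (v o.1 * (u o.1 - v o.1)) ∂(R) := by
    have a1 : ∫ o in obsArm p true, (f o - 1) * (u o.1 - v o.1) ∂(R)
        = ∫ o in obsArm p true, f o * (u o.1 - v o.1) ∂(R)
          - ∫ o in obsArm p true, (u o.1 - v o.1) ∂(R) := by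
      rw [← integral_sub (hfb (hd1 _)) (hd1 _)]
      congr 1; funext o; ring
    have a2 : ∫ o in obsArm p false, (f o - 1) * (v o.1 * (u o.1 - v o.1)) ∂(R)
        = ∫ o in obsArm p false, f o * (v o.1 * (u o.1 - v o.1)) ∂(R)
          - ∫ o in obsArm p false, v o.1 * (u o.1 - v o.1) ∂(R) := by
      rw [← integral_sub (hfb hvd) hvd]
      congr 1; funext o; ring
    have a3 : ∫ o in obsArm p false, f o * (u o.1 - v o.1) ^ 2 ∂(R)
        = ∫ o in obsArm p false, f o * (u o.1 * (u o.1 - v o.1)) ∂(R)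
          - ∫ o in obsArm p false, f o * (v o.1 * (u o.1 - v o.1)) ∂(R) := by
      rw [← integral_sub (hfb hud) (hfb hvd)]
      congr 1; funext o; ring
    rw [a1, a2, a3, e1, e2]
    ring
  have hK : 0 ≤ K := by
    obtain ⟨o⟩ : Nonempty (ObsRecord p) := inferInstance
    exact (hc.le.trans (hb o).1).trans (hb o).2
  have hfK : ∀ o, |f o - 1| ≤ K + 1 := fun o => by
    rw [abs_le]
    constructor <;> linarith [(hb o).1, (hb o).2]
  have hqb : ∀ {a : Bool} {g : ObsRecord p → ℝ}, IntegrableOn g (obsArm p a) R →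
      IntegrableOn (fun o => |f o - 1| * g o) (obsArm p a) R := by
    intro a g hg
    refine Integrable.bdd_mul (c := K + 1) hg (by fun_prop) (ae_of_all _ fun o => ?_)
    rw [Real.norm_eq_abs, abs_abs]
    exact hfK o
  -- Since 0 ≤ u ≤ (K/c) v, the difference is dominated by a multiple of v that depends on f only
  -- through c and K.
  have hdle : ∀ o : ObsRecord p, u o.1 ≤ K / c * v o.1 →
      |u o.1 - v o.1| ≤ (K / c + 1) * v o.1 := fun o ho => by
    rw [abs_le]
    constructor <;> nlinarith [hu0 o.1, hv0 o.1, mul_nonneg (div_nonneg hK hc.le) (hv0 o.1)]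
  have b0 : c * ∫ o in obsArm p false, (u o.1 - v o.1) ^ 2 ∂(R)
      ≤ ∫ o in obsArm p false, f o * (u o.1 - v o.1) ^ 2 ∂(R) := by
    rw [← integral_const_mul]
    refine integral_mono (hdd.const_mul c) (hfb hdd) fun o => ?_
    exact mul_le_mul_of_nonneg_right (hb o).1 (sq_nonneg _)
  have i1 : ∫ o, |f o - 1| * (obsArm p true).indicator (fun o => (K / c + 1) * v o.1) o ∂(R)
      = ∫ o in obsArm p true, |f o - 1| * ((K / c + 1) * v o.1) ∂(R) := by
    rw [← integral_indicator (measurableSet_obsArm true)]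
    congr 1; funext o
    by_cases ho : o ∈ obsArm p true <;> simp [ho]
  have i2 : ∫ o, |f o - 1| * (obsArm p false).indicator (fun o => (K / c + 1) * v o.1 ^ 2) o ∂(R)
      = ∫ o in obsArm p false, |f o - 1| * ((K / c + 1) * v o.1 ^ 2) ∂(R) := by
    rw [← integral_indicator (measurableSet_obsArm false)]
    congr 1; funext o
    by_cases ho : o ∈ obsArm p false <;> simp [ho]
  have b1 : ∫ o in obsArm p true, (f o - 1) * (u o.1 - v o.1) ∂(R)
      ≤ ∫ o in obsArm p true, |f o - 1| * ((K / c + 1) * v o.1) ∂(R) := by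
    refine (Real.le_norm_self _).trans ((norm_integral_le_integral_norm _).trans ?_)
    refine integral_mono_of_nonneg (ae_of_all _ fun o => norm_nonneg _)
      (hqb (((hv2 true).integrable (by norm_num)).const_mul _)) ?_
    filter_upwards [hule'] with o ho
    rw [norm_mul, Real.norm_eq_abs, Real.norm_eq_abs]
    gcongr
    exact hdle o ho
  have b2 : -∫ o in obsArm p false, (f o - 1) * (v o.1 * (u o.1 - v o.1)) ∂(R)
      ≤ ∫ o in obsArm p false, |f o - 1| * ((K / c + 1) * v o.1 ^ 2) ∂(R) := by
    rw [← integral_neg]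
    refine (Real.le_norm_self _).trans ((norm_integral_le_integral_norm _).trans ?_)
    refine integral_mono_of_nonneg (ae_of_all _ fun o => norm_nonneg _)
      (hqb ((hv2 false).integrable_sq.const_mul _)) ?_
    filter_upwards [hule] with o ho
    rw [norm_neg, norm_mul, norm_mul, Real.norm_eq_abs, Real.norm_eq_abs, Real.norm_eq_abs,
      abs_of_nonneg (hv0 _)]
    have := mul_le_mul_of_nonneg_left (hdle o ho) (hv0 o.1)
    refine mul_le_mul_of_nonneg_left ?_ (abs_nonneg _)
    linarith
  rw [i1, i2]
  linarith

end RegressionModel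

/-- The efficient influence function of `identifiedMean` at a law with treatment odds `v` and
control regression function `m`. -/
noncomputable def obsInfluence {p : ℕ} (R : Measure (ObsRecord p)) (v m : (Fin p → ℝ) → ℝ) (θ : ℝ)
    (o : ObsRecord p) : ℝ :=
  ((obsArm p true).indicator (fun o => m o.1 - θ) o
    + (obsArm p false).indicator (fun o => v o.1 * (o.2.2 - m o.1)) o) / R.real (obsArm p true)

variable {p : ℕ} {v m : (Fin p → ℝ) → ℝ} {M : ℝ} {R : ProbabilityMeasure (ObsRecord p)}

/-- The trivial tilt f = 1: the residual term vanishes by orthogonality, so m may stand for the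
regression defined through `condDistrib`. -/
theorem RegressionModel.identifiedMean_eq (h : RegressionModel (R : Measure (ObsRecord p)) v m M) :
    identifiedMean R = ((R : Measure (ObsRecord p)).real (obsArm p true))⁻¹
      * ∫ o in obsArm p true, m o.1 ∂(R) := by
  obtain ⟨u, hu, hu0, hule, hodds, hrep⟩ := h.exists_odds_withDensity (f := fun _ => 1) (c := 1)
    (K := 1) one_pos measurable_const (fun _ => ⟨le_rfl, le_rfl⟩) (R' := R)
    (by simp)
  have hu2 : MemLp (fun o : ObsRecord p => u o.1) 2
      ((R : Measure (ObsRecord p)).restrict (obsArm p false)) := by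
    refine ((h.memLp_odds.restrict _).const_mul (1 / 1)).mono'
      (hu.comp (measurable_fst (β := Bool × ℝ))).aestronglyMeasurable ?_
    filter_upwards [hule] with o ho
    rwa [Real.norm_of_nonneg (hu0 _)]
  rw [CrossBalancing.identifiedMean_eq, hrep]
  simp only [one_mul]
  rw [h.integral_residual u hu ((h.memLp_mul_residual hu hu2).integrable (by norm_num)), add_zero]

theorem RegressionModel.memLp_obsInfluence
    (h : RegressionModel (R : Measure (ObsRecord p)) v m M) (θ : ℝ) :
    MemLp (obsInfluence (R : Measure (ObsRecord p)) v m θ) 2 (R : Measure (ObsRecord p)) := by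
  have h1 : MemLp ((obsArm p true).indicator fun o : ObsRecord p => m o.1 - θ) 2
      (R : Measure (ObsRecord p)) :=
    (h.memLp_reg.sub (memLp_const θ)).indicator (measurableSet_obsArm true)
  have h2 : MemLp ((obsArm p false).indicator fun o : ObsRecord p => v o.1 * (o.2.2 - m o.1)) 2
      (R : Measure (ObsRecord p)) := by
    rw [memLp_indicator_iff_restrict (measurableSet_obsArm false)]
    exact h.memLp_mul_residual h.measurable_odds (h.memLp_odds.restrict _)
  have h3 := (h1.add h2).const_mul ((R : Measure (ObsRecord p)).real (obsArm p true))⁻¹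
  refine h3.ae_eq (ae_of_all _ fun o => ?_)
  simp only [Pi.add_apply, obsInfluence]
  ring

/-- The density minus one is t times (quotient − score + score), and the norm of the bracket stays
bounded. -/
theorem tendsto_eLpNorm_density_sub_one (S : RegularSubmodel R) :
    Tendsto (fun t => eLpNorm (fun o => S.density t o - 1) 2 (R : Measure (ObsRecord p)))
      (𝓝[≠] 0) (𝓝 0) := by
  have hs := S.memLp_score
  have h1 : Tendsto (fun t : ℝ => ‖t‖ₑ * (eLpNorm (fun o => (S.density t o - 1) / t - S.score o) 2
      (R : Measure (ObsRecord p)) + eLpNorm S.score 2 (R : Measure (ObsRecord p))))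
      (𝓝[≠] 0) (𝓝 0) := by
    have h2 : Tendsto (fun t : ℝ => ‖t‖ₑ) (𝓝[≠] 0) (𝓝 0) := by
      have : Tendsto (fun t : ℝ => ‖t‖ₑ) (𝓝 0) (𝓝 ‖(0 : ℝ)‖ₑ) := continuous_enorm.tendsto 0
      rw [enorm_zero] at this
      exact this.mono_left nhdsWithin_le_nhds
    have h3 := ENNReal.Tendsto.mul h2 (Or.inr (by simpa using hs.2.ne))
      (S.tendsto_score.add_const (eLpNorm S.score 2 (R : Measure (ObsRecord p)))) (Or.inr (by simp))
    simpa using h3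
  refine tendsto_of_tendsto_of_tendsto_of_le_of_le' tendsto_const_nhds h1
    (Eventually.of_forall fun _ => bot_le) ?_
  filter_upwards [self_mem_nhdsWithin] with t ht
  have ht0 : t ≠ 0 := ht
  have e1 : (fun o => S.density t o - 1)
      = t • ((fun o => (S.density t o - 1) / t - S.score o) + S.score) := by
    funext o
    simp only [Pi.smul_apply, Pi.add_apply, smul_eq_mul]
    field_simp
    ring
  rw [e1, eLpNorm_const_smul]
  gcongr
  refine eLpNorm_add_le ?_ hs.1 (by norm_num)
  exact (((S.measurable_density t).sub_const 1).div_const t).aestronglyMeasurable.sub hs.1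

/-- Pathwise differentiability of `identifiedMean`. -/
theorem hasDerivAt_identifiedMean (h : RegressionModel (R : Measure (ObsRecord p)) v m M)
    (S : RegularSubmodel R) :
    HasDerivAt (fun t => identifiedMean (S.law t))
      (∫ o, S.score o * obsInfluence (R : Measure (ObsRecord p)) v m (identifiedMean R) o ∂(R))
      0 := by
  obtain ⟨c, K, hc, hbd⟩ := S.density_bounds
  have hs := S.memLp_score
  have hv := h.measurable_odds
  have hm := h.measurable_reg
  set μ : Measure (ObsRecord p) := (R : Measure (ObsRecord p)) with hμ
  set good : ℝ → Prop := fun t => ((S.law t : Measure (ObsRecord p))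
    = μ.withDensity fun o => ENNReal.ofReal (S.density t o)) ∧
    ∀ o, c ≤ S.density t o ∧ S.density t o ≤ K with hgood
  have hgood0 : ∀ᶠ t in 𝓝 (0 : ℝ), good t := S.law_eq.and hbd
  -- The implication form gives a choice of u at every t, with the value 0 where the submodel is not
  -- yet regular.
  have hex : ∀ t, ∃ u : (Fin p → ℝ) → ℝ, good t → Measurable u ∧ (∀ x, 0 ≤ u x) ∧
      (∀ᵐ o ∂(μ.restrict (obsArm p false)), u o.1 ≤ K / c * v o.1) ∧
      (∀ g : (Fin p → ℝ) → ℝ, Measurable g →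
        ∫ o in obsArm p true, S.density t o * g o.1 ∂μ
          = ∫ o in obsArm p false, S.density t o * (u o.1 * g o.1) ∂μ) ∧
      ∫ o in obsArm p true, controlRegression (S.law t : Measure (ObsRecord p)) o.1 ∂(S.law t)
        = ∫ o in obsArm p true, S.density t o * m o.1 ∂μ
          + ∫ o in obsArm p false, S.density t o * (u o.1 * (o.2.2 - m o.1)) ∂μ := by
    intro t
    by_cases ht : good t
    · obtain ⟨u, hu⟩ := h.exists_odds_withDensity hc (S.measurable_density t) ht.2 ht.1
      exact ⟨u, fun _ => hu⟩
    · exact ⟨0, fun hg => absurd hg ht⟩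
  choose u hu using hex
  set q : ℝ → ObsRecord p → ℝ := fun t o => (S.density t o - 1) / t with hq
  have hgood' : ∀ᶠ t in 𝓝[≠] (0 : ℝ), good t := hgood0.filter_mono nhdsWithin_le_nhds
  have hqm : ∀ t, Measurable (q t) := fun t => ((S.measurable_density t).sub_const 1).div_const t
  have hq2 : ∀ t, good t → MemLp (q t) 2 μ := by
    intro t ht
    refine MemLp.of_bound (hqm t).aestronglyMeasurable ((K + 1) / |t|) (ae_of_all _ fun o => ?_)
    rw [hq, norm_div, Real.norm_eq_abs, Real.norm_eq_abs]
    gcongr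
    rw [abs_le]
    constructor <;> linarith [(ht.2 o).1, (ht.2 o).2]
  have hlim : ∀ g : ObsRecord p → ℝ, MemLp g 2 μ →
      Tendsto (fun t => ∫ o, q t o * g o ∂μ) (𝓝[≠] 0) (𝓝 (∫ o, S.score o * g o ∂μ)) :=
    fun g hg => tendsto_integral_mul_of_eLpNorm (hgood'.mono hq2) hs hg S.tendsto_score
  have hind : ∀ (a : Bool) (F G : ObsRecord p → ℝ),
      ∫ o, F o * (obsArm p a).indicator G o ∂μ = ∫ o in obsArm p a, F o * G o ∂μ := by
    intro a F G
    rw [← integral_indicator (measurableSet_obsArm a)]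
    congr 1; funext o
    by_cases ho : o ∈ obsArm p a <;> simp [ho]
  have hfb : ∀ t, good t → ∀ {a : Bool} {g : ObsRecord p → ℝ}, IntegrableOn g (obsArm p a) μ →
      IntegrableOn (fun o => S.density t o * g o) (obsArm p a) μ := by
    intro t ht a g hg
    refine Integrable.bdd_mul (c := K) hg (S.measurable_density t).aestronglyMeasurable
      (ae_of_all _ fun o => ?_)
    rw [Real.norm_of_nonneg (hc.le.trans (ht.2 o).1)]
    exact (ht.2 o).2
  have hv2 : ∀ a, MemLp (fun o : ObsRecord p => v o.1) 2 (μ.restrict (obsArm p a)) :=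
    fun a => h.memLp_odds.restrict _
  have hu2 : ∀ t, good t →
      MemLp (fun o : ObsRecord p => u t o.1) 2 (μ.restrict (obsArm p false)) := by
    intro t ht
    obtain ⟨h1, h2, h3, -⟩ := hu t ht
    refine ((hv2 false).const_mul (K / c)).mono'
      (h1.comp (measurable_fst (β := Bool × ℝ))).aestronglyMeasurable ?_
    filter_upwards [h3] with o ho
    rwa [Real.norm_of_nonneg (h2 _)]
  -- the odds functions converge
  have hE : Tendsto (fun t => ∫ o in obsArm p false, (u t o.1 - v o.1) ^ 2 ∂μ) (𝓝[≠] 0) (𝓝 0) := by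
    have hb' : ∀ᶠ t in 𝓝[≠] (0 : ℝ), ∀ o, |S.density t o - 1| ≤ K + 1 := by
      filter_upwards [hgood'] with t ht o
      rw [abs_le]
      constructor <;> linarith [(ht.2 o).1, (ht.2 o).2]
    have hlim2 := fun g hg => tendsto_integral_abs_mul_of_bounded (μ := μ) (g := g)
      (fun t => ((S.measurable_density t).sub_const 1).aestronglyMeasurable) hb'
      (tendsto_eLpNorm_density_sub_one S) hg
    have i1 : Integrable ((obsArm p true).indicator fun o => (K / c + 1) * v o.1) μ := by
      rw [integrable_indicator_iff (measurableSet_obsArm true)]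
      exact ((hv2 true).integrable (by norm_num)).const_mul _
    have i2 : Integrable ((obsArm p false).indicator fun o => (K / c + 1) * v o.1 ^ 2) μ := by
      rw [integrable_indicator_iff (measurableSet_obsArm false)]
      exact (hv2 false).integrable_sq.const_mul _
    have h3 := ((hlim2 _ i1).add (hlim2 _ i2)).const_mul c⁻¹
    simp only [add_zero, mul_zero] at h3
    refine squeeze_zero' (Eventually.of_forall fun t => integral_nonneg fun o => sq_nonneg _) ?_ h3
    filter_upwards [hgood'] with t ht
    obtain ⟨h1, h2, h4, h5, -⟩ := hu t ht
    rw [le_inv_mul_iff₀ hc]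
    exact h.integral_odds_sub_sq_le hc (S.measurable_density t) ht.2 h1 h2 h4 h5
  -- the remainder of the numerator
  have hrem : Tendsto (fun t => ∫ o in obsArm p false,
      q t o * ((u t o.1 - v o.1) * (o.2.2 - m o.1)) ∂μ) (𝓝[≠] 0) (𝓝 0) := by
    -- Uses q² = (q − s)² + 2 q s − s², whose first term tends to zero and whose second term
    -- converges weakly.
    have hq_bdd : Tendsto (fun t => (∫ o, q t o ^ 2 ∂μ)) (𝓝[≠] 0) (𝓝 (∫ o, S.score o ^ 2 ∂μ)) := by
      have h0 : Tendsto (fun t => ∫ o, (q t o - S.score o) ^ 2 ∂μ) (𝓝[≠] 0) (𝓝 0) := by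
        have h3 := (ENNReal.tendsto_toReal (a := 0) (by simp)).comp S.tendsto_score
        have h4 := h3.pow 2
        simp only [ENNReal.toReal_zero, ne_eq, OfNat.ofNat_ne_zero, not_false_eq_true, zero_pow,
          Function.comp_def] at h4
        refine h4.congr fun t => ?_
        rw [integral_sq_eq (f := fun o => q t o - S.score o)
          ((hqm t).aestronglyMeasurable.sub hs.1), ENNReal.toReal_pow]
      have h1 := (h0.add ((hlim _ hs).const_mul 2)).sub_const (∫ o, S.score o ^ 2 ∂μ)
      have e1 : ∫ o, S.score o * S.score o ∂μ = ∫ o, S.score o ^ 2 ∂μ := by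
        congr 1; funext o; ring
      rw [e1, zero_add, two_mul, add_sub_cancel_right] at h1
      refine h1.congr' ?_
      filter_upwards [hgood'] with t ht
      have a1 := (hq2 t ht).integrable_sq
      have a2 : Integrable (fun o => q t o * S.score o) μ := (hq2 t ht).integrable_mul hs
      have a3 := hs.integrable_sq
      have a4 : Integrable (fun o => (q t o - S.score o) ^ 2) μ := ((hq2 t ht).sub hs).integrable_sq
      rw [← integral_const_mul, ← integral_add a4 (a2.const_mul 2)]
      have a5 : Integrable (fun o => (q t o - S.score o) ^ 2 + 2 * (q t o * S.score o)) μ :=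
        a4.add (a2.const_mul 2)
      rw [← integral_sub a5 a3]
      congr 1; funext o; ring
    have hprod : Tendsto (fun t => (∫ o, q t o ^ 2 ∂μ)
        * (max M 0 * ∫ o in obsArm p false, (u t o.1 - v o.1) ^ 2 ∂μ)) (𝓝[≠] 0) (𝓝 0) := by
      simpa using hq_bdd.mul (hE.const_mul (max M 0))
    rw [tendsto_zero_iff_norm_tendsto_zero]
    have hsq : Tendsto (fun t => √((∫ o, q t o ^ 2 ∂μ)
        * (max M 0 * ∫ o in obsArm p false, (u t o.1 - v o.1) ^ 2 ∂μ))) (𝓝[≠] 0) (𝓝 0) := by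
      simpa using hprod.sqrt
    refine squeeze_zero' (Eventually.of_forall fun _ => norm_nonneg _) ?_ hsq
    filter_upwards [hgood'] with t ht
    obtain ⟨h1, h2, h4, h5, -⟩ := hu t ht
    have hd2 : MemLp (fun o : ObsRecord p => u t o.1 - v o.1) 2 (μ.restrict (obsArm p false)) :=
      (hu2 t ht).sub (hv2 false)
    have hde : MemLp (fun o : ObsRecord p => (u t o.1 - v o.1) * (o.2.2 - m o.1)) 2
        (μ.restrict (obsArm p false)) :=
      h.memLp_mul_residual (u := fun x => u t x - v x) (h1.sub hv) hd2
    rw [Real.norm_eq_abs]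
    refine Real.abs_le_sqrt ((sq_integral_mul_le ((hq2 t ht).restrict _) hde).trans ?_)
    have hle1 : ∫ o in obsArm p false, q t o ^ 2 ∂μ ≤ ∫ o, q t o ^ 2 ∂μ :=
      setIntegral_le_integral (hq2 t ht).integrable_sq (ae_of_all _ fun o => sq_nonneg _)
    -- The residual is integrated out given X, which leaves the squared distance of the odds. The
    -- constant is `max M 0` because M may be negative.
    have hle2 : ∫ o in obsArm p false, ((u t o.1 - v o.1) * (o.2.2 - m o.1)) ^ 2 ∂μ
        ≤ max M 0 * ∫ o in obsArm p false, (u t o.1 - v o.1) ^ 2 ∂μ := by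
      have hl := h.lintegral_residual (fun x => ENNReal.ofReal ((u t x - v x) ^ 2))
        (by fun_prop)
      rw [integral_eq_lintegral_of_nonneg_ae (ae_of_all _ fun o => sq_nonneg _)
          hde.integrable_sq.1,
        integral_eq_lintegral_of_nonneg_ae (ae_of_all _ fun o => sq_nonneg _)
          hd2.integrable_sq.1]
      have hfin : ∫⁻ o in obsArm p false, ENNReal.ofReal ((u t o.1 - v o.1) ^ 2) ∂μ ≠ ∞ := by
        have := hd2.integrable_sq.2
        rw [hasFiniteIntegral_iff_ofReal (ae_of_all _ fun o => sq_nonneg _)] at this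
        exact this.ne
      have h6 := ENNReal.toReal_mono (ENNReal.mul_ne_top ENNReal.ofReal_ne_top hfin) hl
      rw [ENNReal.toReal_mul, ENNReal.toReal_ofReal'] at h6
      simpa only [mul_pow, ENNReal.ofReal_mul (sq_nonneg _)] using h6
    exact mul_le_mul hle1 hle2 (integral_nonneg fun o => sq_nonneg _)
      (integral_nonneg fun o => sq_nonneg _)
  set N : ℝ → ℝ := fun t => ∫ o in obsArm p true,
    controlRegression (S.law t : Measure (ObsRecord p)) o.1 ∂(S.law t) with hN
  set Dn : ℝ → ℝ := fun t => (S.law t : Measure (ObsRecord p)).real (obsArm p true) with hDn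
  have hm1 : IntegrableOn (fun o : ObsRecord p => m o.1) (obsArm p true) μ :=
    (h.memLp_reg.restrict _).integrable (by norm_num)
  have hD0 : Dn 0 = μ.real (obsArm p true) := by rw [hDn]; simp only [S.law_zero, hμ]
  have hpos : 0 < Dn 0 := by
    rw [hD0]
    exact ENNReal.toReal_pos h.treated_ne_zero (measure_ne_top _ _)
  have hid : ∀ t, identifiedMean (S.law t) = (Dn t)⁻¹ * N t := fun t => identifiedMean_eq _
  have hN0 : N 0 = ∫ o in obsArm p true, m o.1 ∂μ := by
    have h1 := hid 0
    rw [S.law_zero, h.identifiedMean_eq, ← hμ, ← hD0] at h1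
    exact (mul_left_cancel₀ (inv_ne_zero hpos.ne') h1).symm
  have hDd : HasDerivAt Dn (∫ o, S.score o * (obsArm p true).indicator (fun _ => 1) o ∂μ) 0 := by
    rw [hasDerivAt_iff_tendsto_slope_zero]
    refine (hlim ((obsArm p true).indicator fun _ => 1)
      ((memLp_const 1).indicator (measurableSet_obsArm true))).congr' ?_
    filter_upwards [hgood'] with t ht
    have e1 : Dn t = ∫ o in obsArm p true, S.density t o * 1 ∂μ := by
      have h1 : Dn t = ∫ o in obsArm p true, (1 : ℝ) ∂(S.law t : Measure (ObsRecord p)) := by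
        simp [hDn]
      rw [h1, ht.1, setIntegral_withDensity_eq_setIntegral_toReal_smul
        (S.measurable_density t).ennreal_ofReal (ae_of_all _ fun o => ENNReal.ofReal_lt_top) _
        (measurableSet_obsArm true)]
      simp_rw [ENNReal.toReal_ofReal (hc.le.trans (ht.2 _).1), smul_eq_mul]
    have e2 : Dn 0 = ∫ o in obsArm p true, (1 : ℝ) ∂μ := by rw [hD0]; simp
    have hone : IntegrableOn (fun _ : ObsRecord p => (1 : ℝ)) (obsArm p true) μ :=
      integrable_const _
    rw [zero_add, e1, e2, hind, ← integral_sub (hfb t ht hone) hone, smul_eq_mul,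
      ← integral_const_mul]
    congr 1; funext o; rw [hq]; ring
  have hNd : HasDerivAt N (∫ o, S.score o * (obsArm p true).indicator (fun o => m o.1) o ∂μ
      + ∫ o, S.score o * (obsArm p false).indicator (fun o => v o.1 * (o.2.2 - m o.1)) o ∂μ) 0 := by
    rw [hasDerivAt_iff_tendsto_slope_zero]
    have hve2 := h.memLp_mul_residual hv (hv2 false)
    have l1 := hlim ((obsArm p true).indicator fun o => m o.1)
      (h.memLp_reg.indicator (measurableSet_obsArm true))
    have l2 := hlim ((obsArm p false).indicator fun o => v o.1 * (o.2.2 - m o.1))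
      ((memLp_indicator_iff_restrict (measurableSet_obsArm false)).2 hve2)
    have l3 := (l1.add l2).add hrem
    rw [add_zero] at l3
    refine l3.congr' ?_
    filter_upwards [hgood'] with t ht
    obtain ⟨h1, h2, h4, h5, h6⟩ := hu t ht
    have hue : IntegrableOn (fun o : ObsRecord p => u t o.1 * (o.2.2 - m o.1)) (obsArm p false) μ :=
      (h.memLp_mul_residual h1 (hu2 t ht)).integrable (by norm_num)
    have hve : IntegrableOn (fun o : ObsRecord p => v o.1 * (o.2.2 - m o.1)) (obsArm p false) μ :=
      hve2.integrable (by norm_num)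
    have hqi : ∀ {a : Bool} {g : ObsRecord p → ℝ}, IntegrableOn g (obsArm p a) μ →
        IntegrableOn (fun o => q t o * g o) (obsArm p a) μ := by
      intro a g hg
      refine (((hfb t ht hg).sub hg).const_mul t⁻¹).congr (ae_of_all _ fun o => ?_)
      simp only [hq, Pi.sub_apply]
      ring
    -- Under `R` itself the residual term is zero, so subtracting it is free. It turns the density
    -- into the difference quotient.
    have z1 := h.integral_residual (u t) h1 hue
    have a1 : ∫ o in obsArm p false, q t o * (u t o.1 * (o.2.2 - m o.1)) ∂μ
        = ∫ o in obsArm p false, q t o * (v o.1 * (o.2.2 - m o.1)) ∂μ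
          + ∫ o in obsArm p false, q t o * ((u t o.1 - v o.1) * (o.2.2 - m o.1)) ∂μ := by
      have hde : IntegrableOn (fun o : ObsRecord p => (u t o.1 - v o.1) * (o.2.2 - m o.1))
          (obsArm p false) μ := by
        refine (hue.sub hve).congr (ae_of_all _ fun o => ?_)
        simp only [Pi.sub_apply]
        ring
      rw [← integral_add (hqi hve) (hqi hde)]
      congr 1; funext o; ring
    have a2 : ∫ o in obsArm p false, q t o * (u t o.1 * (o.2.2 - m o.1)) ∂μ
        = t⁻¹ * (∫ o in obsArm p false, S.density t o * (u t o.1 * (o.2.2 - m o.1)) ∂μ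
          - ∫ o in obsArm p false, u t o.1 * (o.2.2 - m o.1) ∂μ) := by
      rw [← integral_sub (hfb t ht hue) hue, ← integral_const_mul]
      congr 1; funext o; rw [hq]; ring
    have a3 : ∫ o in obsArm p true, q t o * m o.1 ∂μ
        = t⁻¹ * (∫ o in obsArm p true, S.density t o * m o.1 ∂μ
          - ∫ o in obsArm p true, m o.1 ∂μ) := by
      rw [← integral_sub (hfb t ht hm1) hm1, ← integral_const_mul]
      congr 1; funext o; rw [hq]; ring
    have hNt : N t = ∫ o in obsArm p true, S.density t o * m o.1 ∂μ
          + ∫ o in obsArm p false, S.density t o * (u t o.1 * (o.2.2 - m o.1)) ∂μ := h6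
    rw [hind, hind, add_assoc, ← a1, a2, a3, z1, zero_add, hN0, hNt, smul_eq_mul]
    ring
  have hfun : (fun t => identifiedMean (S.law t)) = fun t => (Dn t)⁻¹ * N t := funext hid
  rw [hfun]
  -- Quotient rule: the derivative is (N′ − θ D′)/D, and the term −θ D′ produces the centring of the
  -- treated part of the influence function.
  have hder := (hDd.inv hpos.ne').mul hNd
  refine hder.congr_deriv ?_
  have hidR : identifiedMean R = (Dn 0)⁻¹ * N 0 := by rw [← hid 0, S.law_zero]
  have t1 : Integrable (fun o => S.score o * (obsArm p true).indicator (fun o => m o.1) o) μ :=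
    hs.integrable_mul (h.memLp_reg.indicator (measurableSet_obsArm true))
  have t2 : Integrable (fun o => S.score o
      * (obsArm p false).indicator (fun o => v o.1 * (o.2.2 - m o.1)) o) μ :=
    hs.integrable_mul ((memLp_indicator_iff_restrict (measurableSet_obsArm false)).2
      (h.memLp_mul_residual hv (hv2 false)))
  have t3' : MemLp ((obsArm p true).indicator fun _ => (1 : ℝ)) 2 μ :=
    (memLp_const 1).indicator (measurableSet_obsArm true)
  have t3 : Integrable (fun o => S.score o * (obsArm p true).indicator (fun _ => 1) o) μ :=
    hs.integrable_mul t3'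
  have e : ∫ o, S.score o * obsInfluence μ v m (identifiedMean R) o ∂μ
      = (Dn 0)⁻¹ * (∫ o, S.score o * (obsArm p true).indicator (fun o => m o.1) o ∂μ
        + ∫ o, S.score o * (obsArm p false).indicator (fun o => v o.1 * (o.2.2 - m o.1)) o ∂μ
        - identifiedMean R * ∫ o, S.score o * (obsArm p true).indicator (fun _ => 1) o ∂μ) := by
    rw [← integral_add t1 t2, ← integral_const_mul]
    have t12 : Integrable (fun o => S.score o * (obsArm p true).indicator (fun o => m o.1) o
      + S.score o * (obsArm p false).indicator (fun o => v o.1 * (o.2.2 - m o.1)) o) μ := t1.add t2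
    rw [← integral_sub t12 (t3.const_mul _), ← integral_const_mul]
    congr 1; funext o
    rw [obsInfluence, hD0]
    by_cases ho : o ∈ obsArm p true
    · simp only [ho, Set.indicator_of_mem]
      ring
    · simp only [ho, not_false_eq_true, Set.indicator_of_notMem]
      ring
  rw [e, hidR, Pi.inv_apply]
  have := hpos.ne'
  field_simp
  ring

/-- The submodel `(1 + t s) R` with a bounded mean-zero score. -/
noncomputable def boundedSubmodel (R : ProbabilityMeasure (ObsRecord p)) {s : ObsRecord p → ℝ}
    (hs : Measurable s) {B : ℝ} (hB : 0 < B) (hb : ∀ o, |s o| ≤ B) (h0 : ∫ o, s o ∂(R) = 0) :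
    RegularSubmodel R :=
  have hint : Integrable s (R : Measure (ObsRecord p)) :=
    Integrable.of_bound hs.aestronglyMeasurable B (ae_of_all _ hb)
  -- The radius 1/(2B) keeps |t s| ≤ 1/2. This makes the density positive and bounded, and s having
  -- mean zero gives total mass one.
  have hbd : ∀ t : ℝ, |t| ≤ (2 * B)⁻¹ → ∀ o, 1 / 2 ≤ 1 + t * s o ∧ 1 + t * s o ≤ 3 / 2 := by
    intro t ht o
    have h1 : |t * s o| ≤ 1 / 2 := by
      rw [abs_mul]
      calc |t| * |s o| ≤ (2 * B)⁻¹ * B := by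
            gcongr
            exact hb o
        _ = 1 / 2 := by field_simp
    rw [abs_le] at h1
    constructor <;> linarith [h1.1, h1.2]
  have hev : ∀ᶠ t in 𝓝 (0 : ℝ), |t| ≤ (2 * B)⁻¹ := by
    have := Metric.closedBall_mem_nhds (0 : ℝ) (ε := (2 * B)⁻¹) (by positivity)
    filter_upwards [this] with t ht
    simpa using ht
  have hprob : ∀ t : ℝ, |t| ≤ (2 * B)⁻¹ → IsProbabilityMeasure
      ((R : Measure (ObsRecord p)).withDensity fun o => ENNReal.ofReal (1 + t * s o)) := by
    intro t ht
    constructor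
    have hi : Integrable (fun o => 1 + t * s o) (R : Measure (ObsRecord p)) :=
      (integrable_const _).add (hint.const_mul t)
    rw [withDensity_apply _ MeasurableSet.univ, Measure.restrict_univ,
      ← ofReal_integral_eq_lintegral_ofReal hi
        (ae_of_all _ fun o => by simp only [Pi.zero_apply]; linarith [(hbd t ht o).1]),
      integral_add (integrable_const _) (hint.const_mul t), integral_const_mul, h0]
    simp
  -- Outside the radius the law is set to `R`; only a neighbourhood of 0 matters.
  have hex : ∀ t : ℝ, ∃ L : ProbabilityMeasure (ObsRecord p), (|t| ≤ (2 * B)⁻¹ →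
      (L : Measure (ObsRecord p))
        = (R : Measure (ObsRecord p)).withDensity fun o => ENNReal.ofReal (1 + t * s o)) := by
    intro t
    by_cases ht : |t| ≤ (2 * B)⁻¹
    · exact ⟨⟨_, hprob t ht⟩, fun _ => rfl⟩
    · exact ⟨R, fun h => absurd h ht⟩
  { law := fun t => (hex t).choose
    density := fun t o => 1 + t * s o
    score := s
    measurable_density := fun t => by fun_prop
    law_zero := by
      apply Subtype.ext
      have h1 := (hex 0).choose_spec (by simp; positivity)
      refine h1.trans ?_
      simp
    law_eq := by
      filter_upwards [hev] with t ht
      exact (hex t).choose_spec ht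
    density_bounds := by
      refine ⟨1 / 2, 3 / 2, by norm_num, ?_⟩
      filter_upwards [hev] with t ht
      exact hbd t ht
    memLp_score := MemLp.of_bound hs.aestronglyMeasurable B (ae_of_all _ hb)
    tendsto_score := by
      refine tendsto_const_nhds.congr' ?_
      filter_upwards [self_mem_nhdsWithin] with t ht
      have ht0 : t ≠ 0 := ht
      have : (fun o => (1 + t * s o - 1) / t - s o) = 0 := by
        funext o
        simp only [Pi.zero_apply]
        field_simp
        ring
      rw [this, eLpNorm_zero] }

/-- The truncation of a real number to `[-n, n]`. -/
def clip (n : ℕ) (x : ℝ) : ℝ := max (-(n : ℝ)) (min n x)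

theorem abs_clip_le (n : ℕ) (x : ℝ) : |clip n x| ≤ n := by
  rw [clip, abs_le]
  exact ⟨le_max_left _ _, max_le (by linarith [n.cast_nonneg (α := ℝ)]) (min_le_left _ _)⟩

theorem abs_clip_le_abs (n : ℕ) (x : ℝ) : |clip n x| ≤ |x| := by
  have hn := n.cast_nonneg (α := ℝ)
  rw [clip, abs_le]
  constructor
  · exact le_max_of_le_right (le_min (by linarith [abs_nonneg x]) (neg_abs_le x))
  · exact max_le (by linarith [abs_nonneg x]) ((min_le_right _ _).trans (le_abs_self x))

theorem tendsto_clip (x : ℝ) : Tendsto (fun n : ℕ => clip n x) atTop (𝓝 x) := by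
  refine tendsto_const_nhds.congr' ?_
  have h : ∀ᶠ n : ℕ in atTop, |x| ≤ n := tendsto_natCast_atTop_atTop.eventually_ge_atTop _
  filter_upwards [h] with n hn
  rw [abs_le] at hn
  rw [clip, min_eq_right hn.2, max_eq_right hn.1]

@[fun_prop]
theorem measurable_clip (n : ℕ) : Measurable (clip n) := by
  unfold clip
  fun_prop

/-- If a differentiable functional has derivative `𝔼[s ψ]` along every submodel with score `s`,
with `ψ` of mean zero, then its efficiency bound is `𝔼[ψ²]`. -/
theorem isEfficiencyBound_of_influence {Ψ : ProbabilityMeasure (ObsRecord p) → ℝ}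
    {ψ : ObsRecord p → ℝ} (hψm : Measurable ψ) (hψ : MemLp ψ 2 (R : Measure (ObsRecord p)))
    (hψ0 : ∫ o, ψ o ∂(R) = 0)
    (hd : ∀ S : RegularSubmodel R,
      HasDerivAt (fun t => Ψ (S.law t)) (∫ o, S.score o * ψ o ∂(R)) 0)
    (hne : ∃ s : ObsRecord p → ℝ, Measurable s ∧ (∃ B, ∀ o, |s o| ≤ B) ∧ ∫ o, s o ∂(R) = 0 ∧
      0 < ∫ o, s o ^ 2 ∂(R)) :
    IsEfficiencyBound Ψ R (∫ o, ψ o ^ 2 ∂(R)) := by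
  set μ : Measure (ObsRecord p) := (R : Measure (ObsRecord p)) with hμ
  refine ⟨fun S => (hd S).differentiableAt, ?_, ?_⟩
  · rintro b ⟨S, hpos, rfl⟩
    rw [(hd S).deriv, div_le_iff₀ hpos, mul_comm]
    exact sq_integral_mul_le S.memLp_score hψ
  intro b hb
  have key : ∀ s : ObsRecord p → ℝ, Measurable s → (∃ B, ∀ o, |s o| ≤ B) → ∫ o, s o ∂μ = 0 →
      0 < ∫ o, s o ^ 2 ∂μ → (∫ o, s o * ψ o ∂μ) ^ 2 ≤ b * ∫ o, s o ^ 2 ∂μ := by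
    rintro s hs ⟨B, hB⟩ h0 hpos
    have hB' : ∀ o, |s o| ≤ |B| + 1 := fun o => by linarith [hB o, le_abs_self B]
    have h1 := hb ⟨boundedSubmodel R hs (by positivity) hB' h0, hpos, rfl⟩
    rw [(hd _).deriv] at h1
    exact (div_le_iff₀ hpos).1 h1
  -- One nondegenerate score is needed here: without any, the set of Cramér–Rao bounds could be
  -- empty and its upper bounds arbitrary.
  have hb0 : 0 ≤ b := by
    obtain ⟨s, hs, hB, h0, hpos⟩ := hne
    have h1 := (sq_nonneg _).trans (key s hs hB h0 hpos)
    exact nonneg_of_mul_nonneg_left h1 hpos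
  -- A score without information has zero covariance with ψ, so the positivity condition can be
  -- dropped.
  have key' : ∀ s : ObsRecord p → ℝ, Measurable s → (∃ B, ∀ o, |s o| ≤ B) → ∫ o, s o ∂μ = 0 →
      (∫ o, s o * ψ o ∂μ) ^ 2 ≤ b * ∫ o, s o ^ 2 ∂μ := by
    rintro s hs ⟨B, hB⟩ h0
    have h1 : 0 ≤ ∫ o, s o ^ 2 ∂μ := integral_nonneg fun o => sq_nonneg _
    rcases h1.eq_or_lt with h2 | h2
    · have hsL : MemLp s 2 μ := MemLp.of_bound hs.aestronglyMeasurable B (ae_of_all _ hB)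
      have h3 := sq_integral_mul_le hsL hψ
      rw [← h2] at h3 ⊢
      linarith
    · exact key s hs ⟨B, hB⟩ h0 h2
  have hψ1 : Integrable ψ μ := hψ.integrable (by norm_num)
  have hψ2 : Integrable (fun o => ψ o ^ 2) μ := hψ.integrable_sq
  have hcm : ∀ n : ℕ, Measurable fun o => clip n (ψ o) := fun n => by fun_prop
  have hcL : ∀ n : ℕ, MemLp (fun o => clip n (ψ o)) 2 μ := fun n =>
    MemLp.of_bound (hcm n).aestronglyMeasurable n (ae_of_all _ fun o => abs_clip_le n _)
  have hci : ∀ n : ℕ, Integrable (fun o => clip n (ψ o)) μ := fun n =>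
    (hcL n).integrable (by norm_num)
  have l1 : Tendsto (fun n : ℕ => ∫ o, clip n (ψ o) ∂μ) atTop (𝓝 0) := by
    rw [← hψ0]
    refine tendsto_integral_of_dominated_convergence (fun o => ‖ψ o‖)
      (fun n => (hcm n).aestronglyMeasurable) hψ1.norm
      (fun n => ae_of_all _ fun o => abs_clip_le_abs n _) (ae_of_all _ fun o => tendsto_clip _)
  have l2 : Tendsto (fun n : ℕ => ∫ o, clip n (ψ o) * ψ o ∂μ) atTop (𝓝 (∫ o, ψ o ^ 2 ∂μ)) := by
    refine tendsto_integral_of_dominated_convergence (fun o => ψ o ^ 2)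
      (fun n => ((hcm n).mul hψm).aestronglyMeasurable) hψ2 (fun n => ae_of_all _ fun o => ?_)
      (ae_of_all _ fun o => ?_)
    · rw [norm_mul, Real.norm_eq_abs, Real.norm_eq_abs, ← sq_abs (ψ o), sq]
      exact mul_le_mul_of_nonneg_right (abs_clip_le_abs n _) (abs_nonneg _)
    · simpa [sq] using (tendsto_clip (ψ o)).mul_const (ψ o)
  have l3 : Tendsto (fun n : ℕ => ∫ o, clip n (ψ o) ^ 2 ∂μ) atTop (𝓝 (∫ o, ψ o ^ 2 ∂μ)) := by
    refine tendsto_integral_of_dominated_convergence (fun o => ψ o ^ 2)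
      (fun n => ((hcm n).pow_const 2).aestronglyMeasurable) hψ2 (fun n => ae_of_all _ fun o => ?_)
      (ae_of_all _ fun o => (tendsto_clip (ψ o)).pow 2)
    rw [norm_pow, Real.norm_eq_abs, ← sq_abs (ψ o)]
    exact pow_le_pow_left₀ (abs_nonneg _) (abs_clip_le_abs n _) 2
  -- The scores are truncations of ψ, recentred. Centring does not change the covariance with ψ,
  -- which has mean zero, and it lowers the second moment.
  have hn : ∀ n : ℕ, (∫ o, clip n (ψ o) * ψ o ∂μ) ^ 2 ≤ b * ∫ o, clip n (ψ o) ^ 2 ∂μ := by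
    intro n
    set e := ∫ o, clip n (ψ o) ∂μ with he
    have h1 := key' (fun o => clip n (ψ o) - e) ((hcm n).sub_const e)
      ⟨n + |e|, fun o => (abs_sub _ _).trans (by gcongr; exact abs_clip_le n _)⟩
      (by rw [integral_sub (hci n) (integrable_const _)]; simp [he])
    have h2 : ∫ o, (clip n (ψ o) - e) * ψ o ∂μ = ∫ o, clip n (ψ o) * ψ o ∂μ := by
      have a1 : Integrable (fun o => clip n (ψ o) * ψ o) μ := (hcL n).integrable_mul hψ
      simp_rw [sub_mul]
      rw [integral_sub a1 (hψ1.const_mul e), integral_const_mul, hψ0, mul_zero, sub_zero]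
    have h3 : ∫ o, (clip n (ψ o) - e) ^ 2 ∂μ ≤ ∫ o, clip n (ψ o) ^ 2 ∂μ := by
      have a1 : Integrable (fun o => clip n (ψ o) ^ 2) μ := (hcL n).integrable_sq
      have a2 : ∫ o, (clip n (ψ o) - e) ^ 2 ∂μ = ∫ o, clip n (ψ o) ^ 2 ∂μ - e ^ 2 := by
        have a3 : ∀ o, (clip n (ψ o) - e) ^ 2 = clip n (ψ o) ^ 2 - (2 * e * clip n (ψ o) - e ^ 2) :=
          fun o => by ring
        simp_rw [a3]
        have a4 : Integrable (fun o => 2 * e * clip n (ψ o) - e ^ 2) μ :=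
          ((hci n).const_mul _).sub (integrable_const _)
        rw [integral_sub a1 a4, integral_sub ((hci n).const_mul _) (integrable_const _),
          integral_const_mul, ← he]
        simp
        ring
      rw [a2]
      linarith [sq_nonneg e]
    rw [h2] at h1
    exact h1.trans (mul_le_mul_of_nonneg_left h3 hb0)
  have hfin := le_of_tendsto_of_tendsto' (l2.pow 2) (l3.const_mul b) hn
  have hσ : 0 ≤ ∫ o, ψ o ^ 2 ∂μ := integral_nonneg fun o => sq_nonneg _
  -- In the limit (𝔼ψ²)² ≤ b 𝔼ψ², and a factor 𝔼ψ² cancels unless it is zero.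
  rcases hσ.eq_or_lt with h | h
  · rwa [← h]
  · nlinarith

/-- The treated part is centred by the formula for `identifiedMean`, and the control part vanishes
by orthogonality of the residual. -/
theorem RegressionModel.integral_obsInfluence
    (h : RegressionModel (R : Measure (ObsRecord p)) v m M) :
    ∫ o, obsInfluence (R : Measure (ObsRecord p)) v m (identifiedMean R) o ∂(R) = 0 := by
  have hv := h.measurable_odds
  have hA := measurableSet_obsArm (p := p) true
  have hA' := measurableSet_obsArm (p := p) false
  have hpos : 0 < (R : Measure (ObsRecord p)).real (obsArm p true) :=
    ENNReal.toReal_pos h.treated_ne_zero (measure_ne_top _ _)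
  have hve := h.memLp_mul_residual hv (h.memLp_odds.restrict _)
  have i1 : IntegrableOn (fun o : ObsRecord p => m o.1) (obsArm p true)
      (R : Measure (ObsRecord p)) := (h.memLp_reg.restrict _).integrable (by norm_num)
  have i2 : IntegrableOn (fun o : ObsRecord p => v o.1 * (o.2.2 - m o.1)) (obsArm p false)
      (R : Measure (ObsRecord p)) := hve.integrable (by norm_num)
  have i3 : IntegrableOn (fun o : ObsRecord p => m o.1 - identifiedMean R) (obsArm p true)
      (R : Measure (ObsRecord p)) := i1.sub (integrable_const _)
  unfold obsInfluence
  rw [integral_div, integral_add ((integrable_indicator_iff hA).2 i3)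
    ((integrable_indicator_iff hA').2 i2), integral_indicator hA, integral_indicator hA',
    h.integral_residual v hv i2, integral_sub i1 (integrable_const _), h.identifiedMean_eq]
  simp only [integral_const, MeasurableSet.univ, measureReal_restrict_apply, Set.univ_inter,
    smul_eq_mul]
  field_simp
  simp

theorem RegressionModel.isEfficiencyBound
    (h : RegressionModel (R : Measure (ObsRecord p)) v m M) :
    IsEfficiencyBound identifiedMean R
      (∫ o, obsInfluence (R : Measure (ObsRecord p)) v m (identifiedMean R) o ^ 2 ∂(R)) := by
  have hv := h.measurable_odds
  have hm := h.measurable_reg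
  have hA := measurableSet_obsArm (p := p) true
  have hA' := measurableSet_obsArm (p := p) false
  have hpos : 0 < (R : Measure (ObsRecord p)).real (obsArm p true) :=
    ENNReal.toReal_pos h.treated_ne_zero (measure_ne_top _ _)
  have hcompl : obsArm p false = (obsArm p true)ᶜ := by
    ext o
    simp [obsArm]
  refine isEfficiencyBound_of_influence ?_ (h.memLp_obsInfluence _) ?_
    (hasDerivAt_identifiedMean h) ?_
  · unfold obsInfluence
    exact ((Measurable.indicator (by fun_prop) hA).add
      (Measurable.indicator (by fun_prop) hA')).div_const _
  · exact h.integral_obsInfluence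
  · set P₁ := (R : Measure (ObsRecord p)).real (obsArm p true) with hP
    have hP1 : P₁ < 1 := by
      have h1 : 0 < (R : Measure (ObsRecord p)).real (obsArm p false) :=
        ENNReal.toReal_pos h.control_ne_zero (measure_ne_top _ _)
      rw [hcompl, probReal_compl_eq_one_sub hA] at h1
      linarith
    have i1 : Integrable ((obsArm p true).indicator fun _ => (1 : ℝ))
        (R : Measure (ObsRecord p)) := (integrable_const _).indicator hA
    have e1 : ∫ o, (obsArm p true).indicator (fun _ => (1 : ℝ)) o ∂(R) = P₁ := by
      rw [integral_indicator hA]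
      simp [hP]
    -- The centred treatment indicator has variance P₁(1 − P₁) > 0, as both arms have positive mass.
    refine ⟨fun o => (obsArm p true).indicator (fun _ => 1) o - P₁,
      (measurable_const.indicator hA).sub_const _, ⟨1, fun o => ?_⟩, ?_, ?_⟩
    · by_cases ho : o ∈ obsArm p true
      · simp only [ho, Set.indicator_of_mem]
        rw [abs_le]
        constructor <;> linarith
      · simp only [ho, not_false_eq_true, Set.indicator_of_notMem]
        rw [abs_le]
        constructor <;> linarith
    · rw [integral_sub i1 (integrable_const _), e1]
      simp
    · have e2 : ∀ o : ObsRecord p, ((obsArm p true).indicator (fun _ => (1 : ℝ)) o - P₁) ^ 2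
          = (1 - 2 * P₁) * (obsArm p true).indicator (fun _ => (1 : ℝ)) o + P₁ ^ 2 := by
        intro o
        by_cases ho : o ∈ obsArm p true
        · simp only [ho, Set.indicator_of_mem]
          ring
        · simp only [ho, not_false_eq_true, Set.indicator_of_notMem]
          ring
      simp_rw [e2]
      rw [integral_add (i1.const_mul _) (integrable_const _), integral_const_mul, e1]
      simp only [integral_const, probReal_univ, smul_eq_mul, one_mul]
      nlinarith

end EfficiencyBound

end CrossBalancing

namespace CrossBalancing

/-! ### From the causal model to the observed law. -/

section ObservedLaw

set_option linter.unusedSectionVars false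

variable {p : ℕ} {Q : Measure (FullRecord p)} [IsProbabilityMeasure Q]

/-- The odds of treatment, `e(x) / (1 - e(x))`. -/
noncomputable def treatmentOdds (Q : Measure (FullRecord p)) [IsProbabilityMeasure Q]
    (x : Fin p → ℝ) : ℝ :=
  -- The factor undoes the normalization of w*. The maximum yields nonnegativity at every point, as
  -- `RegressionModel` asks.
  max 0 (pTreat Q / (1 - pTreat Q) * wStar Q x)

theorem measurable_treatmentOdds : Measurable (treatmentOdds Q) := by
  have := measurable_wStar (Q := Q)
  unfold treatmentOdds
  fun_prop

theorem treatmentOdds_ae (hoverlap : Overlap Q) :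
    ∀ᵐ z ∂Q, treatmentOdds Q (cov z) = pTreat Q / (1 - pTreat Q) * wStar Q (cov z) := by
  filter_upwards [wStar_nonneg_ae hoverlap] with z hz
  have h1 : 0 ≤ pTreat Q := measureReal_nonneg
  have h2 : pTreat Q ≤ 1 := measureReal_le_one
  exact max_eq_right (mul_nonneg (div_nonneg h1 (by linarith)) hz)

theorem coe_obsLaw : (obsLaw Q : Measure (ObsRecord p)) = Q.map observe := rfl

theorem restrict_obsLaw (a : Bool) :
    (obsLaw Q : Measure (ObsRecord p)).restrict (obsArm p a)
      = (Q.restrict {z | trt z = a}).map observe := by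
  rw [coe_obsLaw, Measure.restrict_map measurable_observe (measurableSet_obsArm a)]
  rfl

theorem observe_of_control {z : FullRecord p} (hz : trt z = false) :
    observe z = (cov z, false, y0 z) := by
  simp [observe, hz]

theorem lintegral_obsArm_cov (a : Bool) {g : (Fin p → ℝ) → ℝ≥0∞} (hg : Measurable g) :
    ∫⁻ o in obsArm p a, g o.1 ∂(obsLaw Q : Measure (ObsRecord p))
      = ∫⁻ z in {z | trt z = a}, g (cov z) ∂Q := by
  rw [restrict_obsLaw, lintegral_map (by fun_prop) measurable_observe]
  rfl

theorem obsLaw_obsArm (a : Bool) :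
    (obsLaw Q : Measure (ObsRecord p)) (obsArm p a) = Q {z | trt z = a} := by
  rw [coe_obsLaw, Measure.map_apply measurable_observe (measurableSet_obsArm a)]
  rfl

/-- In the control arm the observed outcome is Y(0), so the odds and residual fields pull back along
`observe` to statements on an arm under `Q`. -/
theorem regressionModel_obsLaw (hunconf : Unconfounded Q) (hoverlap : Overlap Q)
    (hY0 : Integrable y0 Q) {M : ℝ} (hvar : CondVarianceBounded Q M)
    (hw : MemLp (fun z => wStar Q (cov z)) 2 Q)
    (hm : MemLp (fun z => prognostic Q (cov z)) 2 Q) :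
    RegressionModel (obsLaw Q : Measure (ObsRecord p)) (treatmentOdds Q) (prognostic Q) M where
  measurable_odds := measurable_treatmentOdds
  measurable_reg := measurable_prognostic
  odds_nonneg := fun x => le_max_left _ _
  lintegral_odds := by
    intro g hg
    have hto := measurable_treatmentOdds (Q := Q)
    have hwm := measurable_wStar (Q := Q)
    rw [lintegral_obsArm_cov true hg,
      lintegral_obsArm_cov false (g := fun x => ENNReal.ofReal (treatmentOdds Q x) * g x)
        (by fun_prop)]
    have h1 := lintegral_wStar hunconf hoverlap hg
    have hpos := pArm_pos hunconf hoverlap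
    rw [lintegral_armLaw, lintegral_armLaw, ← ofReal_pArm, ← ofReal_pArm] at h1
    have h2 : ∫⁻ z in {z | trt z = false}, ENNReal.ofReal (treatmentOdds Q (cov z)) * g (cov z) ∂Q
        = ENNReal.ofReal (pArm Q true / pArm Q false)
          * ∫⁻ z in {z | trt z = false}, ENNReal.ofReal (wStar Q (cov z)) * g (cov z) ∂Q := by
      rw [← lintegral_const_mul' _ _ ENNReal.ofReal_ne_top]
      refine lintegral_congr_ae ?_
      filter_upwards [ae_restrict_of_ae (treatmentOdds_ae hoverlap)] with z hz
      rw [hz, pArm_true, pArm_false, ← mul_assoc, ENNReal.ofReal_mul]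
      have h1 : 0 ≤ pTreat Q := measureReal_nonneg
      have h2 : pTreat Q ≤ 1 := measureReal_le_one
      exact div_nonneg h1 (by linarith)
    rw [h2, ENNReal.ofReal_div_of_pos (hpos false), div_eq_mul_inv, mul_assoc, h1, ← mul_assoc,
      ENNReal.mul_inv_cancel (by simpa using hpos true) ENNReal.ofReal_ne_top, one_mul]
  memLp_odds := by
    have h1 : MemLp (fun z => treatmentOdds Q (cov z)) 2 Q := by
      refine (hw.const_mul (pTreat Q / (1 - pTreat Q))).ae_eq ?_
      filter_upwards [treatmentOdds_ae hoverlap] with z hz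
      rw [hz]
    exact (memLp_map_measure_iff
      (measurable_treatmentOdds.comp (measurable_fst (β := Bool × ℝ))).aestronglyMeasurable
      measurable_observe.aemeasurable).2 h1
  memLp_reg := (memLp_map_measure_iff
      (measurable_prognostic.comp (measurable_fst (β := Bool × ℝ))).aestronglyMeasurable
      measurable_observe.aemeasurable).2 hm
  lintegral_residual := by
    intro g hg
    have hmm := measurable_prognostic (Q := Q)
    have h1 := lintegral_residual_sq_le hvar hg
    rw [lintegral_armLaw, lintegral_armLaw, mul_left_comm,
      ENNReal.mul_le_mul_iff_right (by simp)
      (by simpa using measure_arm_ne_zero hunconf hoverlap false)] at h1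
    rw [lintegral_obsArm_cov false hg, restrict_obsLaw,
      lintegral_map (by fun_prop) measurable_observe]
    refine le_trans (le_of_eq (setLIntegral_congr_fun (measurableSet_arm false) fun z hz => ?_)) h1
    have hz' : trt z = false := hz
    rw [observe_of_control hz']
  integral_residual := by
    intro g hg hint
    have hmm := measurable_prognostic (Q := Q)
    rw [IntegrableOn, restrict_obsLaw, integrable_map_measure (by fun_prop)
      measurable_observe.aemeasurable] at hint
    have hint' : IntegrableOn (fun z => g (cov z) * (y0 z - prognostic Q (cov z)))
        {z | trt z = false} Q := by
      refine hint.congr ?_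
      filter_upwards [ae_restrict_mem (measurableSet_arm false)] with z hz
      have hz' : trt z = false := hz
      simp only [Function.comp_apply]
      rw [observe_of_control hz']
    rw [restrict_obsLaw, integral_map measurable_observe.aemeasurable (by fun_prop),
      ← setIntegral_mul_residual hunconf hY0 false hg hint']
    refine setIntegral_congr_fun (measurableSet_arm false) fun z hz => ?_
    have hz' : trt z = false := hz
    rw [observe_of_control hz']
  treated_ne_zero := by
    rw [obsLaw_obsArm]; exact measure_arm_ne_zero hunconf hoverlap true
  control_ne_zero := by
    rw [obsLaw_obsArm]; exact measure_arm_ne_zero hunconf hoverlap false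

/-- Efficiency bound, identification and square integrability of the influence function. -/
theorem efficiency_summary (hunconf : Unconfounded Q) (hoverlap : Overlap Q)
    (hY0 : Integrable y0 Q) {M : ℝ} (hvar : CondVarianceBounded Q M)
    (hw : MemLp (fun z => wStar Q (cov z)) 2 Q)
    (hm : MemLp (fun z => prognostic Q (cov z)) 2 Q) :
    MemLp (influence Q) 2 Q ∧ ∫ z, influence Q z ∂Q = 0 ∧
      identifiedMean (obsLaw Q) = theta0 Q ∧
      IsEfficiencyBound identifiedMean (obsLaw Q) (sigmaSq Q) := by
  have h := regressionModel_obsLaw hunconf hoverlap hY0 hvar hw hm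
  have hpos := pArm_pos hunconf hoverlap
  have hreal : (obsLaw Q : Measure (ObsRecord p)).real (obsArm p true) = pTreat Q := by
    rw [Measure.real, obsLaw_obsArm]; rfl
  have hmm := measurable_prognostic (Q := Q)
  have hto := measurable_treatmentOdds (Q := Q)
  have hid : identifiedMean (obsLaw Q) = theta0 Q := by
    rw [h.identifiedMean_eq, hreal, theta0_eq_integral_prognostic hunconf hY0 hoverlap,
      integral_armLaw, restrict_obsLaw]
    exact congrArg _ (integral_map measurable_observe.aemeasurable
        (hmm.comp (measurable_fst (β := Bool × ℝ))).aestronglyMeasurable)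
  set ψ := obsInfluence (obsLaw Q : Measure (ObsRecord p)) (treatmentOdds Q) (prognostic Q)
    (identifiedMean (obsLaw Q)) with hψ
  have hψm : Measurable ψ := by
    rw [hψ]
    unfold obsInfluence
    exact ((Measurable.indicator (by fun_prop) (measurableSet_obsArm true)).add
      (Measurable.indicator (by fun_prop) (measurableSet_obsArm false))).div_const _
  -- The odds are w* p₁/(1 − p₁), so division by p₁ leaves the factor 1/(1 − p₁) of the causal
  -- formula.
  have hae : ∀ᵐ z ∂Q, ψ (observe z) = influence Q z := by
    filter_upwards [treatmentOdds_ae hoverlap] with z hz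
    have h1 := (hpos true).ne'
    have h2 := (hpos false).ne'
    rw [pArm_true] at h1
    rw [pArm_false] at h2
    rw [hψ, hid, obsInfluence, hreal, influence]
    cases ht : trt z
    · have m1 : observe z ∉ obsArm p true := by simp [obsArm, observe, ht]
      have m2 : observe z ∈ obsArm p false := by simp [obsArm, observe, ht]
      simp only [m1, m2, not_false_eq_true, Set.indicator_of_notMem, Set.indicator_of_mem,
        cond_false]
      rw [observe_of_control ht]
      simp only
      rw [hz]
      field_simp
      ring
    · have m1 : observe z ∈ obsArm p true := by simp [obsArm, observe, ht]
      have m2 : observe z ∉ obsArm p false := by simp [obsArm, observe, ht]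
      simp only [m1, m2, not_false_eq_true, Set.indicator_of_notMem, Set.indicator_of_mem,
        cond_true]
      simp [observe]
  have hL : MemLp (influence Q) 2 Q :=
    ((memLp_map_measure_iff hψm.aestronglyMeasurable measurable_observe.aemeasurable).1
      (h.memLp_obsInfluence _)).ae_eq hae
  have hint : ∀ F : ℝ → ℝ, Measurable F → ∫ o, F (ψ o) ∂(obsLaw Q : Measure (ObsRecord p))
      = ∫ z, F (influence Q z) ∂Q := by
    intro F hF
    rw [coe_obsLaw]
    refine (integral_map measurable_observe.aemeasurable
      (hF.comp hψm).aestronglyMeasurable).trans ?_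
    refine integral_congr_ae ?_
    filter_upwards [hae] with z hz
    exact congrArg F hz
  have h0 : ∫ z, influence Q z ∂Q = 0 := by
    refine (hint id measurable_id).symm.trans ?_
    exact h.integral_obsInfluence
  refine ⟨hL, h0, hid, ?_⟩
  have hs : sigmaSq Q = ∫ o, ψ o ^ 2 ∂(obsLaw Q : Measure (ObsRecord p)) := by
    rw [sigmaSq, variance_of_integral_eq_zero hL.1.aemeasurable h0,
      hint (fun x => x ^ 2) (by fun_prop)]
  rw [hs]
  exact h.isEfficiencyBound

end ObservedLaw

end CrossBalancing

namespace CrossBalancing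

/-! ### Convergence in probability as convergence along a filter. -/

section ProbFilter

variable {Ω : Type*} [MeasurableSpace Ω]

/-- The filter on `ℕ × Ω` of the events whose probability tends to one along the sample size.
Convergence along this filter is convergence in probability, and `=o` is `o_P`. -/
def probFilter (P : Measure Ω) : Filter (ℕ × Ω) where
  sets := {A | Tendsto (fun n => P {ω | (n, ω) ∉ A}) atTop (𝓝 0)}
  univ_sets := by simp
  sets_of_superset := by
    intro A B hA hAB
    refine tendsto_of_tendsto_of_tendsto_of_le_of_le tendsto_const_nhds hA (fun _ => bot_le) ?_
    exact fun n => measure_mono fun ω hω h => hω (hAB h)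
  inter_sets := by
    intro A B hA hB
    have h := Tendsto.add (M := ℝ≥0∞) hA hB
    rw [add_zero] at h
    refine tendsto_of_tendsto_of_tendsto_of_le_of_le tendsto_const_nhds h (fun _ => bot_le) ?_
    intro n
    refine (measure_mono ?_).trans (measure_union_le _ _)
    intro ω hω
    by_contra hc
    simp only [Set.mem_union, Set.mem_ofPred_eq, not_or, not_not] at hc
    exact hω hc

variable {P : Measure Ω}

theorem eventually_probFilter {s : ℕ × Ω → Prop} :
    (∀ᶠ q in probFilter P, s q) ↔ Tendsto (fun n => P {ω | ¬ s (n, ω)}) atTop (𝓝 0) := Iff.rfl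

theorem eventually_probFilter_iff {s : ℕ × Ω → Prop} :
    (∀ᶠ q in probFilter P, s q) ↔
      ∀ δ : ℝ, 0 < δ → ∀ᶠ n in atTop, P {ω | ¬ s (n, ω)} ≤ ENNReal.ofReal δ := by
  rw [eventually_probFilter, ENNReal.tendsto_nhds_zero]
  constructor
  · exact fun h δ hδ => h _ (ENNReal.ofReal_pos.2 hδ)
  · intro h ε hε
    by_cases htop : ε = ⊤
    · simp [htop]
    · filter_upwards [h ε.toReal (ENNReal.toReal_pos hε.ne' htop)] with n hn
      rwa [ENNReal.ofReal_toReal htop] at hn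

theorem eventually_probFilter_of_ae {s : ℕ × Ω → Prop}
    (h : ∀ᶠ n in atTop, ∀ᵐ ω ∂P, s (n, ω)) : ∀ᶠ q in probFilter P, s q := by
  rw [eventually_probFilter]
  refine tendsto_const_nhds.congr' ?_
  filter_upwards [h] with n hn
  exact (ae_iff.1 hn).symm

theorem tendsto_fst_probFilter : Tendsto Prod.fst (probFilter P) (atTop : Filter ℕ) := by
  intro s hs
  refine eventually_probFilter_of_ae (s := fun q => q.1 ∈ s) ?_
  filter_upwards [hs] with n hn
  exact Eventually.of_forall fun _ => hn

theorem tendstoInMeasure_iff_probFilter {f : ℕ → Ω → ℝ} {c : ℝ} :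
    TendstoInMeasure P f atTop (fun _ => c) ↔
      Tendsto (fun q : ℕ × Ω => f q.1 q.2) (probFilter P) (𝓝 c) := by
  rw [tendstoInMeasure_iff_dist, Metric.tendsto_nhds]
  refine forall₂_congr fun ε hε => ?_
  rw [eventually_probFilter]
  simp only [not_lt]

end ProbFilter

/-! ### Redrawing a record within its arm. -/

section Resampling

variable {p : ℕ} {Q : Measure (FullRecord p)} [IsProbabilityMeasure Q] {n : ℕ}

/-- Fubini in coordinate i: both integrands have the same marginal over that coordinate, so
redrawing it from `Q` changes nothing. -/
theorem lintegral_pi_update {f : (Fin n → FullRecord p) → ℝ≥0∞} (hf : Measurable f) (i : Fin n) :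
    ∫⁻ z, f z ∂(Measure.pi fun _ => Q)
      = ∫⁻ z, ∫⁻ x, f (Function.update z i x) ∂Q ∂(Measure.pi fun _ => Q) := by
  have hm : Measurable fun z => ∫⁻ x, f (Function.update z i x) ∂Q := by
    have := hf.lmarginal (μ := fun _ : Fin n => Q) (s := {i})
    rwa [lmarginal_singleton] at this
  refine lintegral_eq_of_lmarginal_eq {i} hf hm ?_
  rw [lmarginal_singleton, lmarginal_singleton]
  funext z
  simp

/-- Given its arm and all other records, record i has the law `armLaw Q a`. The hypothesis says that
F sees coordinate i of its first argument only through the arm, so that argument is as good as fixed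
while the second one is drawn. This is sample splitting without conditional expectations. -/
theorem lintegral_resample {a : Bool} (ha : Q {z | trt z = a} ≠ 0)
    {F : (Fin n → FullRecord p) → FullRecord p → ℝ≥0∞} (hF : Measurable (Function.uncurry F))
    (i : Fin n) (hinv : ∀ z x y, trt x = a → trt y = a →
      F (Function.update z i x) y = F (Function.update z i y) y) :
    ∫⁻ z in {z | trt (z i) = a}, F z (z i) ∂(Measure.pi fun _ => Q)
      = ∫⁻ z in {z | trt (z i) = a}, ∫⁻ y, F z y ∂(armLaw Q a) ∂(Measure.pi fun _ => Q) := by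
  set A : Set (FullRecord p) := {z | trt z = a} with hA
  have hAm : MeasurableSet A := measurableSet_arm a
  have hAi : MeasurableSet {z : Fin n → FullRecord p | trt (z i) = a} :=
    (by fun_prop : Measurable fun z : Fin n → FullRecord p => z i) hAm
  have hFz : ∀ z, Measurable (F z) := fun z => hF.comp measurable_prodMk_left
  have hFd : Measurable fun z : Fin n → FullRecord p => F z (z i) :=
    hF.comp (measurable_id.prodMk (measurable_pi_apply i))
  have hFi : Measurable fun z => ∫⁻ y, F z y ∂(armLaw Q a) := hF.lintegral_prod_right
  -- With the other records fixed, the arm mean does not depend on x in the arm, so integrating over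
  -- x only cancels the normalization of the arm law.
  have key : ∀ z, ∫⁻ x in A, F (Function.update z i x) x ∂Q
      = ∫⁻ x in A, (∫⁻ y, F (Function.update z i x) y ∂(armLaw Q a)) ∂Q := by
    intro z
    have : ∀ x ∈ A, ∫⁻ y, F (Function.update z i x) y ∂(armLaw Q a)
        = (Q A)⁻¹ * ∫⁻ y in A, F (Function.update z i y) y ∂Q := by
      intro x hx
      rw [lintegral_armLaw]
      congr 1
      exact setLIntegral_congr_fun hAm fun y hy => hinv z x y hx hy
    rw [setLIntegral_congr_fun hAm this, setLIntegral_const, mul_right_comm,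
      ENNReal.inv_mul_cancel ha (measure_ne_top _ _), one_mul]
  rw [← lintegral_indicator hAi, ← lintegral_indicator hAi,
    lintegral_pi_update (hFd.indicator hAi) i, lintegral_pi_update (hFi.indicator hAi) i]
  refine lintegral_congr fun z => ?_
  have h1 := key z
  rw [← lintegral_indicator hAm, ← lintegral_indicator hAm] at h1
  refine Eq.trans (lintegral_congr fun x => ?_) (h1.trans (lintegral_congr fun x => ?_)) <;>
  · by_cases hx : trt x = a
    · have h1 : Function.update z i x ∈ {z : Fin n → FullRecord p | trt (z i) = a} := by simpa using hx
      have h2 : x ∈ A := hx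
      simp only [Set.indicator_of_mem h1, Set.indicator_of_mem h2, Function.update_self]
    · have h1 : Function.update z i x ∉ {z : Fin n → FullRecord p | trt (z i) = a} := by simpa using hx
      have h2 : x ∉ A := hx
      simp only [Set.indicator_of_notMem h1, Set.indicator_of_notMem h2]

/-- Positive and negative parts are resampled separately and have equal arm means. If the left side
is not integrable, it is zero by convention. -/
theorem integral_resample_eq_zero {a : Bool} (ha : Q {z | trt z = a} ≠ 0)
    {F : (Fin n → FullRecord p) → FullRecord p → ℝ} (hF : Measurable (Function.uncurry F))
    (i : Fin n) (hinv : ∀ z x y, trt x = a → trt y = a →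
      F (Function.update z i x) y = F (Function.update z i y) y)
    (hint : ∀ z, Integrable (F z) (armLaw Q a)) (h0 : ∀ z, ∫ y, F z y ∂(armLaw Q a) = 0) :
    ∫ z in {z | trt (z i) = a}, F z (z i) ∂(Measure.pi fun _ => Q) = 0 := by
  by_cases hI : Integrable (fun z => F z (z i))
      ((Measure.pi fun _ => Q).restrict {z | trt (z i) = a})
  swap
  · exact integral_undef hI
  have hp := lintegral_resample ha (F := fun z y => ENNReal.ofReal (F z y)) (by
    exact hF.ennreal_ofReal) i (fun z x y hx hy => by rw [hinv z x y hx hy])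
  have hm := lintegral_resample ha (F := fun z y => ENNReal.ofReal (-F z y)) (by
    exact hF.neg.ennreal_ofReal) i (fun z x y hx hy => by rw [hinv z x y hx hy])
  have heq : ∀ z, ∫⁻ y, ENNReal.ofReal (F z y) ∂(armLaw Q a)
      = ∫⁻ y, ENNReal.ofReal (-F z y) ∂(armLaw Q a) := by
    intro z
    have h := integral_eq_lintegral_pos_part_sub_lintegral_neg_part (hint z)
    rw [h0 z] at h
    have h1 : ∫⁻ y, ENNReal.ofReal (F z y) ∂(armLaw Q a) ≠ ⊤ := (hint z).lintegral_lt_top.ne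
    have h2 : ∫⁻ y, ENNReal.ofReal (-F z y) ∂(armLaw Q a) ≠ ⊤ := (hint z).neg.lintegral_lt_top.ne
    exact (ENNReal.toReal_eq_toReal_iff' h1 h2).1 (sub_eq_zero.1 h.symm)
  rw [integral_eq_lintegral_pos_part_sub_lintegral_neg_part hI, hp, hm]
  simp only [heq, sub_self]

end Resampling

end CrossBalancing

namespace CrossBalancing

/-! ### First and second moments of averages of adapted functions. -/

section AdaptedMoments

set_option linter.unusedSectionVars false

variable {p : ℕ} {Q : Measure (FullRecord p)} [IsProbabilityMeasure Q] {n : ℕ}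

/-- The treatment indicators of a vector of records. -/
def trts (z : Fin n → FullRecord p) : Fin n → Bool := fun i => trt (z i)

theorem measurable_trts : Measurable (trts : (Fin n → FullRecord p) → Fin n → Bool) := by
  unfold trts; fun_prop

theorem measurable_comp_trts {β : Type*} [MeasurableSpace β] (f : (Fin n → Bool) → β) :
    Measurable fun z : Fin n → FullRecord p => f (trts z) :=
  (Measurable.of_discrete (f := f)).comp measurable_trts

theorem trts_update (z : Fin n → FullRecord p) (i : Fin n) (x : FullRecord p) :
    trts (Function.update z i x) = Function.update (trts z) i (trt x) := by
  funext j
  by_cases h : j = i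
  · subst h; simp [trts]
  · simp [trts, h]

variable {a : Bool} {J : (Fin n → Bool) → Finset (Fin n)}

/-- A function of a further record that may depend on the sample, but not on the values of the
records in the random set `J` beyond their treatment. -/
structure AdaptedOff {β : Type*} [MeasurableSpace β] (a : Bool) (J : (Fin n → Bool) → Finset (Fin n))
    (G : (Fin n → FullRecord p) → FullRecord p → β) : Prop where
  measurable : Measurable (Function.uncurry G)
  update_eq : ∀ z i y, i ∈ J (trts z) → trt y = a → G (Function.update z i y) = G z

/-- Membership in J already forces the arm; the restriction is added to match `lintegral_resample`.
-/
theorem lintegral_indicator_mem (hJ : ∀ t, ∀ i ∈ J t, t i = a) (i : Fin n)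
    (f : (Fin n → FullRecord p) → ℝ≥0∞) :
    ∫⁻ z, (if i ∈ J (trts z) then f z else 0) ∂(Measure.pi fun _ => Q)
      = ∫⁻ z in {z | trt (z i) = a}, (if i ∈ J (trts z) then f z else 0)
        ∂(Measure.pi fun _ => Q) := by
  have hAi : MeasurableSet {z : Fin n → FullRecord p | trt (z i) = a} :=
    (by fun_prop : Measurable fun z : Fin n → FullRecord p => z i) (measurableSet_arm a)
  rw [← lintegral_indicator hAi]
  refine lintegral_congr fun z => ?_
  by_cases h : i ∈ J (trts z)
  · rw [Set.indicator_of_mem (by exact hJ _ _ h)]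
  · simp [h, Set.indicator_apply]

theorem update_trts_eq {i : Fin n} (z : Fin n → FullRecord p) {x y : FullRecord p}
    (hx : trt x = a) (hy : trt y = a) :
    trts (Function.update z i x) = trts (Function.update z i y) := by
  rw [trts_update, trts_update, hx, hy]

theorem AdaptedOff.update_update {β : Type*} [MeasurableSpace β]
    {G : (Fin n → FullRecord p) → FullRecord p → β} (hG : AdaptedOff a J G) {i : Fin n}
    (z : Fin n → FullRecord p) {x y : FullRecord p} (hy : trt y = a)
    (hi : i ∈ J (trts (Function.update z i x))) :
    G (Function.update z i x) = G (Function.update z i y) := by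
  have := hG.update_eq (Function.update z i x) i y hi hy
  rw [Function.update_idem] at this
  exact this.symm

/-- The expected average of an adapted function over `J` is at most its expected mean. -/
theorem AdaptedOff.lintegral_average_le {G : (Fin n → FullRecord p) → FullRecord p → ℝ≥0∞}
    (hG : AdaptedOff a J G) (ha : Q {z | trt z = a} ≠ 0) (hJ : ∀ t, ∀ i ∈ J t, t i = a) :
    ∫⁻ z, (∑ i ∈ J (trts z), G z (z i)) * ((J (trts z)).card : ℝ≥0∞)⁻¹ ∂(Measure.pi fun _ => Q)
      ≤ ∫⁻ z, ∫⁻ y, G z y ∂(armLaw Q a) ∂(Measure.pi fun _ => Q) := by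
  have hGm := hG.measurable
  have hmem : ∀ i, MeasurableSet {z : Fin n → FullRecord p | i ∈ J (trts z)} := fun i =>
    (measurable_comp_trts (p := p) fun t => i ∈ J t).setOf
  have hcard : Measurable fun z : Fin n → FullRecord p => ((J (trts z)).card : ℝ≥0∞)⁻¹ :=
    measurable_comp_trts fun t => ((J t).card : ℝ≥0∞)⁻¹
  have hdiag : ∀ i : Fin n, Measurable fun z : Fin n → FullRecord p => G z (z i) := fun i =>
    hGm.comp (measurable_id.prodMk (measurable_pi_apply i))
  have hmean : Measurable fun z => ∫⁻ y, G z y ∂(armLaw Q a) := hGm.lintegral_prod_right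
  -- The set J and its size depend on the treatments only, and a redraw within the arm does not
  -- change these.
  have key : ∀ i, ∫⁻ z, (if i ∈ J (trts z) then G z (z i) * ((J (trts z)).card : ℝ≥0∞)⁻¹ else 0)
        ∂(Measure.pi fun _ => Q)
      = ∫⁻ z, (if i ∈ J (trts z) then
          (∫⁻ y, G z y ∂(armLaw Q a)) * ((J (trts z)).card : ℝ≥0∞)⁻¹ else 0)
        ∂(Measure.pi fun _ => Q) := by
    intro i
    rw [lintegral_indicator_mem hJ, lintegral_indicator_mem hJ]
    have h := lintegral_resample ha
      (F := fun z y => if i ∈ J (trts z) then G z y * ((J (trts z)).card : ℝ≥0∞)⁻¹ else 0)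
      (by
        refine Measurable.ite (measurable_fst (hmem i)) ?_ measurable_const
        exact hGm.mul (hcard.comp measurable_fst)) i
      (by
        intro z x y hx hy
        rw [update_trts_eq z hx hy]
        split_ifs with h
        · rw [hG.update_update z hy (by rwa [update_trts_eq z hx hy])]
        · rfl)
    refine h.trans (lintegral_congr fun z => ?_)
    by_cases h : i ∈ J (trts z)
    · simp only [h, if_true]
      exact lintegral_mul_const _ (hGm.comp measurable_prodMk_left)
    · simp [h]
  have hsum : ∀ f : (Fin n → FullRecord p) → Fin n → ℝ≥0∞, ∀ z,
      (∑ i ∈ J (trts z), f z i) * ((J (trts z)).card : ℝ≥0∞)⁻¹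
        = ∑ i, if i ∈ J (trts z) then f z i * ((J (trts z)).card : ℝ≥0∞)⁻¹ else 0 := by
    intro f z
    rw [Finset.sum_mul, Finset.sum_ite_mem, Finset.univ_inter]
  calc _ = ∑ i, ∫⁻ z, (if i ∈ J (trts z) then G z (z i) * ((J (trts z)).card : ℝ≥0∞)⁻¹ else 0)
        ∂(Measure.pi fun _ => Q) := by
        rw [← lintegral_finsetSum]
        · exact lintegral_congr fun z => hsum (fun z i => G z (z i)) z
        · intro i _
          exact Measurable.ite (hmem i) ((hdiag i).mul hcard) measurable_const
    _ = ∫⁻ z, ∑ i, (if i ∈ J (trts z) then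
          (∫⁻ y, G z y ∂(armLaw Q a)) * ((J (trts z)).card : ℝ≥0∞)⁻¹ else 0)
        ∂(Measure.pi fun _ => Q) := by
        rw [lintegral_finsetSum]
        · exact Finset.sum_congr rfl fun i _ => key i
        · intro i _
          exact Measurable.ite (hmem i) (hmean.mul hcard) measurable_const
    _ ≤ _ := by
        refine lintegral_mono fun z => ?_
        rw [← hsum (fun z _ => ∫⁻ y, G z y ∂(armLaw Q a)) z, Finset.sum_const, nsmul_eq_mul,
          mul_right_comm]
        -- Only an inequality: for empty J the size times its inverse is 0 rather than 1.
        exact mul_le_of_le_one_left bot_le (ENNReal.mul_inv_le_one _)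

/-- The variance bound for the average over `J` of an adapted function with mean zero. -/
theorem AdaptedOff.lintegral_sq_average_le {g : (Fin n → FullRecord p) → FullRecord p → ℝ}
    (hg : AdaptedOff a J g) (ha : Q {z | trt z = a} ≠ 0) (hJ : ∀ t, ∀ i ∈ J t, t i = a)
    {κ : ℝ} (hκ : ∀ z, ∫⁻ y, ENNReal.ofReal (g z y ^ 2) ∂(armLaw Q a) ≤ ENNReal.ofReal κ)
    (h0 : ∀ z, ∫ y, g z y ∂(armLaw Q a) = 0) :
    ∫⁻ z, ENNReal.ofReal ((∑ i ∈ J (trts z), g z (z i)) ^ 2 * ((J (trts z)).card : ℝ)⁻¹)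
      ∂(Measure.pi fun _ => Q) ≤ ENNReal.ofReal κ := by
  have hgm := hg.measurable
  have hmem : ∀ i, MeasurableSet {z : Fin n → FullRecord p | i ∈ J (trts z)} := fun i =>
    (measurable_comp_trts (p := p) fun t => i ∈ J t).setOf
  have hcard : Measurable fun z : Fin n → FullRecord p => ((J (trts z)).card : ℝ)⁻¹ :=
    measurable_comp_trts fun t => ((J t).card : ℝ)⁻¹
  have hdiag : ∀ i : Fin n, Measurable fun z : Fin n → FullRecord p => g z (z i) := fun i =>
    hgm.comp (measurable_id.prodMk (measurable_pi_apply i))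
  have hL2 : ∀ z, MemLp (g z) 2 (armLaw Q a) := by
    intro z
    have hm : Measurable (g z) := hgm.comp measurable_prodMk_left
    refine ⟨hm.aestronglyMeasurable, ?_⟩
    have h := lintegral_sq_eq (μ := armLaw Q a) (g z)
    by_contra hc
    rw [not_lt, top_le_iff] at hc
    rw [hc] at h
    have := hκ z
    rw [h] at this
    simp at this
  -- the diagonal part
  have hsq : AdaptedOff a J fun z y => ENNReal.ofReal (g z y ^ 2) :=
    ⟨(hgm.pow_const 2).ennreal_ofReal, fun z i y hi hy => by rw [hg.update_eq z i y hi hy]⟩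
  have hdiagsum := hsq.lintegral_average_le ha hJ
  have hdiag_le : ∫⁻ z, (∑ i ∈ J (trts z), ENNReal.ofReal (g z (z i) ^ 2))
      * ((J (trts z)).card : ℝ≥0∞)⁻¹ ∂(Measure.pi fun _ => Q) ≤ ENNReal.ofReal κ := by
    refine hdiagsum.trans ((lintegral_mono fun z => hκ z).trans ?_)
    simp
  set T : (Fin n → FullRecord p) → Fin n → Fin n → ℝ := fun z i j =>
    if i ∈ J (trts z) then (if j ∈ J (trts z) then
      g z (z i) * g z (z j) * ((J (trts z)).card : ℝ)⁻¹ else 0) else 0 with hT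
  have hTm : ∀ i j, Measurable fun z => T z i j := fun i j =>
    Measurable.ite (hmem i) (Measurable.ite (hmem j)
      (((hdiag i).mul (hdiag j)).mul hcard) measurable_const) measurable_const
  have hTii : ∀ i, Integrable (fun z => T z i i) (Measure.pi fun _ => Q) := by
    intro i
    have h0 : ∀ z, 0 ≤ T z i i := by
      intro z
      simp only [hT]
      split_ifs
      · exact mul_nonneg (mul_self_nonneg _) (by positivity)
      · exact le_rfl
    refine ⟨(hTm i i).aestronglyMeasurable, ?_⟩
    rw [hasFiniteIntegral_iff_ofReal (Eventually.of_forall h0)]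
    refine lt_of_le_of_lt (le_trans (lintegral_mono fun z => ?_) hdiag_le) ENNReal.ofReal_lt_top
    simp only [hT]
    split_ifs with h
    · have hpos : (0 : ℝ) < ((J (trts z)).card : ℝ) := by
        exact_mod_cast Finset.card_pos.2 ⟨i, h⟩
      rw [ENNReal.ofReal_mul (mul_self_nonneg _), ENNReal.ofReal_inv_of_pos hpos,
        ENNReal.ofReal_natCast, ← sq]
      gcongr
      exact Finset.single_le_sum (f := fun i => ENNReal.ofReal (g z (z i) ^ 2))
        (fun _ _ => bot_le) h
    · simp
  -- Cross terms are dominated by the sum of the two diagonal terms, so their integrability needs no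
  -- further moments.
  have hTij : ∀ i j, Integrable (fun z => T z i j) (Measure.pi fun _ => Q) := by
    intro i j
    refine ((hTii i).add (hTii j)).mono' (hTm i j).aestronglyMeasurable
      (Eventually.of_forall fun z => ?_)
    simp only [hT, Pi.add_apply, Real.norm_eq_abs]
    have hN : (0 : ℝ) ≤ ((J (trts z)).card : ℝ)⁻¹ := by positivity
    by_cases hi : i ∈ J (trts z) <;> by_cases hj : j ∈ J (trts z) <;>
      simp only [hi, hj, if_true, if_false, abs_zero, add_zero, zero_add]
    · rw [← add_mul, abs_mul, abs_of_nonneg hN]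
      gcongr
      rw [abs_le]
      constructor <;> nlinarith [sq_nonneg (g z (z i) + g z (z j)),
        sq_nonneg (g z (z i) - g z (z j)), sq_nonneg (g z (z i)), sq_nonneg (g z (z j))]
    · exact mul_nonneg (mul_self_nonneg _) hN
    · exact mul_nonneg (mul_self_nonneg _) hN
    · exact le_rfl
  -- Record i is redrawn while record j is held. Neither the function g z nor its value at record j
  -- depends on record i beyond its arm, so the mean-zero factor kills the product.
  have hcross : ∀ i j, i ≠ j → ∫ z, T z i j ∂(Measure.pi fun _ => Q) = 0 := by
    intro i j hij
    have hAi : MeasurableSet {z : Fin n → FullRecord p | trt (z i) = a} :=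
      (by fun_prop : Measurable fun z : Fin n → FullRecord p => z i) (measurableSet_arm a)
    have h := integral_resample_eq_zero (Q := Q) ha
      (F := fun z y => if i ∈ J (trts z) then (if j ∈ J (trts z) then
        g z y * g z (z j) * ((J (trts z)).card : ℝ)⁻¹ else 0) else 0)
      (by
        refine Measurable.ite (measurable_fst (hmem i)) (Measurable.ite (measurable_fst (hmem j))
          ?_ measurable_const) measurable_const
        exact (hgm.mul ((hdiag j).comp measurable_fst)).mul (hcard.comp measurable_fst)) i
      (by
        intro z x y hx hy
        rw [update_trts_eq z hx hy, Function.update_of_ne hij.symm, Function.update_of_ne hij.symm]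
        split_ifs with h h'
        · rw [hg.update_update z hy (by rwa [update_trts_eq z hx hy])]
        · rfl
        · rfl)
      (by
        intro z
        have hi1 : Integrable (g z) (armLaw Q a) := (hL2 z).integrable (by norm_num)
        by_cases hi : i ∈ J (trts z) <;> by_cases hj : j ∈ J (trts z) <;>
          simp only [hi, hj, if_true, if_false]
        · exact (hi1.mul_const _).mul_const _
        all_goals exact integrable_zero _ _ _)
      (by
        intro z
        by_cases hi : i ∈ J (trts z) <;> by_cases hj : j ∈ J (trts z) <;>
          simp only [hi, hj, if_true, if_false, integral_zero]
        rw [integral_mul_const, integral_mul_const, h0 z, zero_mul, zero_mul])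
    rw [← h, ← integral_indicator hAi]
    refine integral_congr_ae (Eventually.of_forall fun z => ?_)
    simp only [hT]
    by_cases hi : i ∈ J (trts z)
    · rw [Set.indicator_of_mem (by exact hJ _ _ hi)]
    · simp [hi, Set.indicator_apply]
  have hexp : ∀ z, (∑ i ∈ J (trts z), g z (z i)) ^ 2 * ((J (trts z)).card : ℝ)⁻¹
      = ∑ i, ∑ j, T z i j := by
    intro z
    have hin : ∀ i, ∑ j, T z i j = if i ∈ J (trts z) then
        ∑ j ∈ J (trts z), g z (z i) * g z (z j) * ((J (trts z)).card : ℝ)⁻¹ else 0 := by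
      intro i
      by_cases hi : i ∈ J (trts z)
      · simp only [hT, hi, if_true, Finset.sum_ite_mem, Finset.univ_inter]
      · simp [hT, hi]
    rw [Finset.sum_congr rfl fun i _ => hin i, Finset.sum_ite_mem, Finset.univ_inter, sq,
      Finset.sum_mul_sum, Finset.sum_mul]
    exact Finset.sum_congr rfl fun i _ => Finset.sum_mul ..
  have hI1 : Integrable (fun z => ∑ i, ∑ j, T z i j) (Measure.pi fun _ => Q) :=
    integrable_finsetSum _ fun i _ => integrable_finsetSum _ fun j _ => hTij i j
  have hval : ∫ z, ∑ i, ∑ j, T z i j ∂(Measure.pi fun _ => Q)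
      = ∫ z, ∑ i, T z i i ∂(Measure.pi fun _ => Q) := by
    rw [integral_finsetSum _ fun i _ => integrable_finsetSum _ fun j _ => hTij i j,
      integral_finsetSum _ fun i _ => hTii i]
    refine Finset.sum_congr rfl fun i _ => ?_
    rw [integral_finsetSum _ fun j _ => hTij i j]
    exact Finset.sum_eq_single i (fun j _ hj => hcross i j hj.symm) (by simp)
  have hnn : ∀ z, 0 ≤ ∑ i, ∑ j, T z i j := fun z => by rw [← hexp]; positivity
  have hTnn : ∀ z, 0 ≤ ∑ i, T z i i := fun z => Finset.sum_nonneg fun i _ => by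
    simp only [hT]
    split_ifs
    · exact mul_nonneg (mul_self_nonneg _) (by positivity)
    · exact le_rfl
  simp only [hexp]
  rw [← ofReal_integral_eq_lintegral_ofReal hI1 (Eventually.of_forall hnn), hval,
    ofReal_integral_eq_lintegral_ofReal (integrable_finsetSum _ fun i _ => hTii i)
      (Eventually.of_forall hTnn)]
  refine le_trans (lintegral_mono fun z => ?_) hdiag_le
  by_cases hemp : (J (trts z)).card = 0
  · rw [Finset.card_eq_zero] at hemp
    simp [hT, hemp]
  have hpos : (0 : ℝ) < ((J (trts z)).card : ℝ) := by
    exact_mod_cast Nat.pos_of_ne_zero hemp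
  have : ∑ i, T z i i = (∑ i ∈ J (trts z), g z (z i) ^ 2) * ((J (trts z)).card : ℝ)⁻¹ := by
    simp only [hT, ← sq]
    rw [Finset.sum_mul, ← Finset.sum_filter]
    simp
  rw [this, ENNReal.ofReal_mul (Finset.sum_nonneg fun i _ => sq_nonneg _),
    ENNReal.ofReal_inv_of_pos hpos, ENNReal.ofReal_natCast,
    ENNReal.ofReal_sum_of_nonneg fun i _ => sq_nonneg _]

end AdaptedMoments

end CrossBalancing

namespace CrossBalancing

/-! ### Conditional Markov and Chebyshev inequalities for the random sample. -/

section SamplingLaw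

set_option linter.unusedSectionVars false

variable {p d : ℕ} {Ω 𝒰 : Type*} [MeasurableSpace Ω] [MeasurableSpace 𝒰]
  {P : Measure Ω} [IsProbabilityMeasure P] {Q : Measure (FullRecord p)} [IsProbabilityMeasure Q]
  {D : ℕ → Ω → FullRecord p} {U : ℕ → Ω → 𝒰} {n : ℕ}

/-- Independent records with law `Q`, and auxiliary randomness independent of the records. -/
structure IsSampling (P : Measure Ω) (Q : Measure (FullRecord p)) (D : ℕ → Ω → FullRecord p)
    (U : ℕ → Ω → 𝒰) : Prop where
  hasLaw : ∀ i, HasLaw (D i) Q P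
  indep : iIndepFun D P
  measurable_aux : ∀ n, Measurable (U n)
  indep_aux : ∀ n, IndepFun (U n) (fun ω (i : Fin n) => D i ω) P

/-- The first `n` records. -/
def records (D : ℕ → Ω → FullRecord p) (n : ℕ) (ω : Ω) : Fin n → FullRecord p := fun i => D i ω

theorem IsSampling.hasLaw_records (hs : IsSampling P Q D U) (n : ℕ) :
    HasLaw (records D n) (Measure.pi fun _ => Q) P :=
  iIndepFun.hasLaw_pi (fun i : Fin n => hs.hasLaw i) (hs.indep.precomp Fin.val_injective)

/-- Records and auxiliary randomness have a product law, so the randomness can be frozen and bounds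
uniform in it suffice. -/
theorem IsSampling.lintegral_eq (hs : IsSampling P Q D U)
    {F : (Fin n → FullRecord p) × 𝒰 → ℝ≥0∞} (hF : Measurable F) :
    ∫⁻ ω, F (records D n ω, U n ω) ∂P
      = ∫⁻ u, ∫⁻ z, F (z, u) ∂(Measure.pi fun _ => Q) ∂(P.map (U n)) := by
  have hr := hs.hasLaw_records n
  have hi := (indepFun_iff_map_prod_eq_prod_map_map hr.aemeasurable
    (hs.measurable_aux n).aemeasurable).1 (hs.indep_aux n).symm
  rw [hr.map_eq] at hi
  have : IsProbabilityMeasure (P.map (U n)) :=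
    Measure.isProbabilityMeasure_map (hs.measurable_aux n).aemeasurable
  rw [← lintegral_prod_symm _ hF.aemeasurable, ← hi,
    lintegral_map' hF.aemeasurable (hr.aemeasurable.prodMk (hs.measurable_aux n).aemeasurable)]

theorem IsSampling.prob_ge_le (hs : IsSampling P Q D U)
    {F : (Fin n → FullRecord p) × 𝒰 → ℝ≥0∞} (hF : Measurable F) {κ η : ℝ} (hη : 0 < η)
    (hle : ∀ u, ∫⁻ z, F (z, u) ∂(Measure.pi fun _ => Q) ≤ ENNReal.ofReal κ) :
    P {ω | ENNReal.ofReal η ≤ F (records D n ω, U n ω)} ≤ ENNReal.ofReal (κ / η) := by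
  have : IsProbabilityMeasure (P.map (U n)) :=
    Measure.isProbabilityMeasure_map (hs.measurable_aux n).aemeasurable
  have hm : AEMeasurable (fun ω => F (records D n ω, U n ω)) P :=
    hF.comp_aemeasurable ((hs.hasLaw_records n).aemeasurable.prodMk
      (hs.measurable_aux n).aemeasurable)
  refine (meas_ge_le_lintegral_div hm (ENNReal.ofReal_pos.2 hη).ne' ENNReal.ofReal_ne_top).trans ?_
  rw [ENNReal.ofReal_div_of_pos hη, hs.lintegral_eq hF]
  gcongr
  refine (lintegral_mono hle).trans ?_
  simp

variable {a : Bool} {J : 𝒰 → (Fin n → Bool) → Finset (Fin n)}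

/-- There are finitely many treatment vectors, so joint measurability is checked slice by slice. -/
theorem measurableSet_mem_trts (hJm : ∀ t i, MeasurableSet {u | i ∈ J u t}) (i : Fin n) :
    MeasurableSet {q : (Fin n → FullRecord p) × 𝒰 | i ∈ J q.2 (trts q.1)} := by
  have h : MeasurableSet {q : (Fin n → Bool) × 𝒰 | i ∈ J q.2 q.1} := by
    have : Measurable fun q : (Fin n → Bool) × 𝒰 => i ∈ J q.2 q.1 :=
      measurable_from_prod_countable_right fun t => measurableSet_setOfPred.1 (hJm t i)
    exact measurableSet_setOfPred.2 this
  exact ((measurable_trts.comp measurable_fst).prodMk measurable_snd) h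

theorem measurable_card_trts (hJm : ∀ t i, MeasurableSet {u | i ∈ J u t}) :
    Measurable fun q : (Fin n → FullRecord p) × 𝒰 => ((J q.2 (trts q.1)).card : ℝ) := by
  have : (fun q : (Fin n → FullRecord p) × 𝒰 => ((J q.2 (trts q.1)).card : ℝ))
      = fun q => ∑ i, if i ∈ J q.2 (trts q.1) then (1 : ℝ) else 0 := by
    funext q; simp
  rw [this]
  exact Finset.measurable_fun_sum _ fun i _ =>
    Measurable.ite (measurableSet_mem_trts hJm i) measurable_const measurable_const

theorem measurable_sum_mem_trts (hJm : ∀ t i, MeasurableSet {u | i ∈ J u t})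
    {g : (Fin n → FullRecord p) × 𝒰 → FullRecord p → ℝ} (hg : Measurable (Function.uncurry g)) :
    Measurable fun q : (Fin n → FullRecord p) × 𝒰 => ∑ i ∈ J q.2 (trts q.1), g q (q.1 i) := by
  have : (fun q : (Fin n → FullRecord p) × 𝒰 => ∑ i ∈ J q.2 (trts q.1), g q (q.1 i))
      = fun q => ∑ i, if i ∈ J q.2 (trts q.1) then g q (q.1 i) else 0 := by
    funext q; rw [Finset.sum_ite_mem, Finset.univ_inter]
  rw [this]
  refine Finset.measurable_fun_sum _ fun i _ =>
    Measurable.ite (measurableSet_mem_trts hJm i) ?_ measurable_const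
  exact hg.comp (measurable_id.prodMk ((measurable_pi_apply i).comp measurable_fst))

/-- Markov's inequality given the other fold. The moment bound holds only on an event, so g is
replaced by 0 off that event. This keeps it adapted, since its arm mean is adapted too. -/
theorem IsSampling.prob_average_ge_le (hs : IsSampling P Q D U) (ha : Q {z | trt z = a} ≠ 0)
    (hJ : ∀ u t, ∀ i ∈ J u t, t i = a) (hJm : ∀ t i, MeasurableSet {u | i ∈ J u t})
    {g : (Fin n → FullRecord p) × 𝒰 → FullRecord p → ℝ} (hg : Measurable (Function.uncurry g))
    (hgu : ∀ z u i y, i ∈ J u (trts z) → trt y = a → g (Function.update z i y, u) = g (z, u))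
    {κ η : ℝ} (hη : 0 < η) :
    P {ω | ∫⁻ y, ENNReal.ofReal |g (records D n ω, U n ω) y| ∂(armLaw Q a) ≤ ENNReal.ofReal κ ∧
        η ≤ |avg (J (U n ω) (trts (records D n ω)))
          fun i => g (records D n ω, U n ω) (D i ω)|} ≤ ENNReal.ofReal (κ / η) := by
  have hmean : Measurable fun q => ∫⁻ y, ENNReal.ofReal |g q y| ∂(armLaw Q a) :=
    Measurable.lintegral_prod_right (f := fun q y => ENNReal.ofReal |g q y|)
      (hg.abs.ennreal_ofReal)
  have hset : MeasurableSet {q | ∫⁻ y, ENNReal.ofReal |g q y| ∂(armLaw Q a) ≤ ENNReal.ofReal κ} :=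
    measurableSet_le hmean measurable_const
  set g' : (Fin n → FullRecord p) × 𝒰 → FullRecord p → ℝ := fun q y =>
    if ∫⁻ y, ENNReal.ofReal |g q y| ∂(armLaw Q a) ≤ ENNReal.ofReal κ then |g q y| else 0 with hg'
  have hg'm : Measurable (Function.uncurry g') :=
    Measurable.ite (measurable_fst hset) hg.abs measurable_const
  have hg'0 : ∀ q y, 0 ≤ g' q y := by
    intro q y; simp only [hg']; split_ifs; exacts [abs_nonneg _, le_rfl]
  set F : (Fin n → FullRecord p) × 𝒰 → ℝ≥0∞ := fun q => ENNReal.ofReal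
    ((∑ i ∈ J q.2 (trts q.1), g' q (q.1 i)) * ((J q.2 (trts q.1)).card : ℝ)⁻¹) with hF
  have hFm : Measurable F :=
    ((measurable_sum_mem_trts hJm hg'm).mul (measurable_card_trts hJm).inv).ennreal_ofReal
  have hFle : ∀ u, ∫⁻ z, F (z, u) ∂(Measure.pi fun _ => Q) ≤ ENNReal.ofReal κ := by
    intro u
    have had : AdaptedOff a (J u) fun z y => ENNReal.ofReal (g' (z, u) y) := by
      refine ⟨(hg'm.comp (f := fun q : (Fin n → FullRecord p) × FullRecord p => ((q.1, u), q.2))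
        (by fun_prop)).ennreal_ofReal, fun z i y hi hy => ?_⟩
      simp only [hg']
      rw [hgu z u i y hi hy]
    refine le_trans (lintegral_mono fun z => ?_) ((had.lintegral_average_le ha (hJ u)).trans
      ((lintegral_mono (g := fun _ => ENNReal.ofReal κ) fun z => ?_).trans (by simp)))
    · simp only [hF]
      by_cases hc : (J u (trts z)).card = 0
      · simp [hc]
      · rw [ENNReal.ofReal_mul (Finset.sum_nonneg fun i _ => hg'0 _ _),
          ENNReal.ofReal_inv_of_pos (by positivity), ENNReal.ofReal_natCast,
          ENNReal.ofReal_sum_of_nonneg fun i _ => hg'0 _ _]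
    · simp only [hg']
      split_ifs with h
      · exact h
      · simp
  refine (measure_mono ?_).trans (hs.prob_ge_le hFm hη hFle)
  rintro ω ⟨h1, h2⟩
  simp only [Set.mem_ofPred_eq, hF]
  refine ENNReal.ofReal_le_ofReal (h2.trans ?_)
  simp only [hg', h1, if_true, avg, div_eq_mul_inv]
  rw [abs_mul,
    abs_of_nonneg (a := ((J (U n ω) (trts (records D n ω))).card : ℝ)⁻¹) (by positivity)]
  gcongr
  exact Finset.abs_sum_le_sum_abs _ _

/-- Chebyshev's inequality given the other fold, with the same cutoff and with g centred at its arm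
mean. The moment bound controls the size of J times the squared deviation, which is at least ν η² on
the event. -/
theorem IsSampling.prob_average_sub_ge_le (hs : IsSampling P Q D U)
    [IsProbabilityMeasure (armLaw Q a)] (ha : Q {z | trt z = a} ≠ 0)
    (hJ : ∀ u t, ∀ i ∈ J u t, t i = a) (hJm : ∀ t i, MeasurableSet {u | i ∈ J u t})
    {g : (Fin n → FullRecord p) × 𝒰 → FullRecord p → ℝ} (hg : Measurable (Function.uncurry g))
    (hgu : ∀ z u i y, i ∈ J u (trts z) → trt y = a → g (Function.update z i y, u) = g (z, u))
    {κ η ν : ℝ} (hη : 0 < η) (hν : 0 < ν) :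
    P {ω | (∫⁻ y, ENNReal.ofReal (g (records D n ω, U n ω) y ^ 2) ∂(armLaw Q a)
          ≤ ENNReal.ofReal κ ∧ ν ≤ ((J (U n ω) (trts (records D n ω))).card : ℝ)) ∧
        η ≤ |avg (J (U n ω) (trts (records D n ω)))
          (fun i => g (records D n ω, U n ω) (D i ω))
          - ∫ y, g (records D n ω, U n ω) y ∂(armLaw Q a)|} ≤ ENNReal.ofReal (κ / (ν * η ^ 2)) := by
  have hmean : Measurable fun q => ∫⁻ y, ENNReal.ofReal (g q y ^ 2) ∂(armLaw Q a) :=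
    Measurable.lintegral_prod_right (f := fun q y => ENNReal.ofReal (g q y ^ 2))
      (hg.pow_const 2).ennreal_ofReal
  have hint : Measurable fun q => ∫ y, g q y ∂(armLaw Q a) :=
    (hg.stronglyMeasurable.integral_prod_right (ν := armLaw Q a)).measurable
  have hset : MeasurableSet {q | ∫⁻ y, ENNReal.ofReal (g q y ^ 2) ∂(armLaw Q a)
      ≤ ENNReal.ofReal κ} := measurableSet_le hmean measurable_const
  set g' : (Fin n → FullRecord p) × 𝒰 → FullRecord p → ℝ := fun q y =>
    if ∫⁻ y, ENNReal.ofReal (g q y ^ 2) ∂(armLaw Q a) ≤ ENNReal.ofReal κ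
    then g q y - ∫ y, g q y ∂(armLaw Q a) else 0 with hg'
  have hg'm : Measurable (Function.uncurry g') :=
    Measurable.ite (measurable_fst hset) (hg.sub (hint.comp measurable_fst)) measurable_const
  have hL2 : ∀ q, ∫⁻ y, ENNReal.ofReal (g q y ^ 2) ∂(armLaw Q a) ≤ ENNReal.ofReal κ →
      MemLp (g q) 2 (armLaw Q a) := by
    intro q hq
    have hm : Measurable (g q) := hg.comp measurable_prodMk_left
    refine ⟨hm.aestronglyMeasurable, ?_⟩
    by_contra hc
    rw [not_lt, top_le_iff] at hc
    rw [lintegral_sq_eq, hc] at hq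
    simp at hq
  set F : (Fin n → FullRecord p) × 𝒰 → ℝ≥0∞ := fun q => ENNReal.ofReal
    ((∑ i ∈ J q.2 (trts q.1), g' q (q.1 i)) ^ 2 * ((J q.2 (trts q.1)).card : ℝ)⁻¹) with hF
  have hFm : Measurable F :=
    (((measurable_sum_mem_trts hJm hg'm).pow_const 2).mul
      (measurable_card_trts hJm).inv).ennreal_ofReal
  have hFle : ∀ u, ∫⁻ z, F (z, u) ∂(Measure.pi fun _ => Q) ≤ ENNReal.ofReal κ := by
    intro u
    have had : AdaptedOff a (J u) fun z y => g' (z, u) y := by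
      refine ⟨hg'm.comp (f := fun q : (Fin n → FullRecord p) × FullRecord p => ((q.1, u), q.2))
        (by fun_prop), fun z i y hi hy => ?_⟩
      simp only [hg']
      rw [hgu z u i y hi hy]
    refine had.lintegral_sq_average_le ha (hJ u) ?_ ?_
    · intro z
      simp only [hg']
      split_ifs with h
      · have hmem := hL2 _ h
        refine le_trans ?_ h
        have hi1 : Integrable (g (z, u)) (armLaw Q a) := hmem.integrable (by norm_num)
        have hi2 : Integrable (fun y => g (z, u) y ^ 2) (armLaw Q a) := hmem.integrable_sq
        set c := ∫ y, g (z, u) y ∂(armLaw Q a) with hc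
        have hi3 : Integrable (fun y => (g (z, u) y - c) ^ 2) (armLaw Q a) :=
          (hmem.sub (memLp_const c)).integrable_sq
        rw [← ofReal_integral_eq_lintegral_ofReal hi3 (Eventually.of_forall fun _ => sq_nonneg _),
          ← ofReal_integral_eq_lintegral_ofReal hi2 (Eventually.of_forall fun _ => sq_nonneg _)]
        refine ENNReal.ofReal_le_ofReal ?_
        have : ∫ y, (g (z, u) y - c) ^ 2 ∂(armLaw Q a)
            = (∫ y, g (z, u) y ^ 2 ∂(armLaw Q a)) - c ^ 2 := by
          have hv := variance_eq_sub hmem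
          rw [variance_eq_integral hmem.1.aemeasurable] at hv
          exact hv
        rw [this]
        linarith [sq_nonneg c]
      · simp
    · intro z
      simp only [hg']
      split_ifs with h
      · have hi1 : Integrable (g (z, u)) (armLaw Q a) := (hL2 _ h).integrable (by norm_num)
        rw [integral_sub hi1 (integrable_const _)]
        simp
      · simp
  have hpos : 0 < ν * η ^ 2 := by positivity
  refine (measure_mono ?_).trans (hs.prob_ge_le hFm hpos hFle)
  rintro ω ⟨⟨h1, hN⟩, h2⟩
  simp only [Set.mem_ofPred_eq, hF]
  refine ENNReal.ofReal_le_ofReal ?_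
  set I := J (U n ω) (trts (records D n ω)) with hI
  have hNpos : (0 : ℝ) < (I.card : ℝ) := hν.trans_le hN
  simp only [hg', h1, if_true, Finset.sum_sub_distrib, Finset.sum_const, nsmul_eq_mul]
  set c := ∫ y, g (records D n ω, U n ω) y ∂(armLaw Q a)
  have hav : (∑ i ∈ I, g (records D n ω, U n ω) (records D n ω i)) - I.card * c
      = I.card * (avg I (fun i => g (records D n ω, U n ω) (D i ω)) - c) := by
    rw [avg, mul_sub, mul_div_cancel₀ _ hNpos.ne']
    rfl
  rw [hav]
  calc ν * η ^ 2 ≤ (I.card : ℝ) * |avg I (fun i => g (records D n ω, U n ω) (D i ω)) - c| ^ 2 := by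
        gcongr
    _ = _ := by rw [sq_abs]; field_simp

end SamplingLaw

/-! ### Stochastic order of fold averages. -/

section FoldAverages

set_option linter.unusedSectionVars false

variable {p d : ℕ} {Ω 𝒰 : Type*} [MeasurableSpace Ω] [MeasurableSpace 𝒰]
  {P : Measure Ω} [IsProbabilityMeasure P] {Q : Measure (FullRecord p)} [IsProbabilityMeasure Q]
  {D : ℕ → Ω → FullRecord p} {U : ℕ → Ω → 𝒰} {C : Procedure p d 𝒰}

/-- A union bound. The good event may depend on the tolerated failure probability, as moment bounds
of the form "eventually at most ε" require. -/
theorem eventually_probFilter_of_forall {t : ℕ × Ω → Prop}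
    (h : ∀ δ : ℝ, 0 < δ → ∃ s : ℕ × Ω → Prop, (∀ᶠ q in probFilter P, s q) ∧
      ∀ᶠ n in atTop, P {ω | s (n, ω) ∧ ¬ t (n, ω)} ≤ ENNReal.ofReal δ) :
    ∀ᶠ q in probFilter P, t q := by
  rw [eventually_probFilter_iff]
  intro δ hδ
  obtain ⟨s, hs, hst⟩ := h (δ / 2) (by positivity)
  rw [eventually_probFilter_iff] at hs
  filter_upwards [hs (δ / 2) (by positivity), hst] with n h1 h2
  calc P {ω | ¬ t (n, ω)} ≤ P ({ω | ¬ s (n, ω)} ∪ {ω | s (n, ω) ∧ ¬ t (n, ω)}) := by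
        refine measure_mono fun ω hω => ?_
        by_cases hsω : s (n, ω)
        · exact Or.inr ⟨hsω, hω⟩
        · exact Or.inl hsω
    _ ≤ ENNReal.ofReal (δ / 2) + ENNReal.ofReal (δ / 2) :=
        (measure_union_le _ _).trans (add_le_add h1 h2)
    _ = ENNReal.ofReal δ := by
        rw [← ENNReal.ofReal_add (by positivity) (by positivity), add_halves]

/-- The units in arm `a` and fold `k`. -/
def fold (C : Procedure p d 𝒰) (D : ℕ → Ω → FullRecord p) (U : ℕ → Ω → 𝒰) (a : Bool) (k : Fin 2)
    (q : ℕ × Ω) : Finset (Fin q.1) :=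
  armFold (trts (records D q.1 q.2)) (C.split q.1 (trts (records D q.1 q.2)) (U q.1 q.2)) a k

/-- A function of the sample, the auxiliary randomness and a further record that does not depend
on the values of the records in fold `k` beyond their treatment. -/
structure FoldAdapted (C : Procedure p d 𝒰) (k : Fin 2)
    (G : ∀ n, (Fin n → FullRecord p) → 𝒰 → FullRecord p → ℝ) : Prop where
  measurable : ∀ n, Measurable fun q : ((Fin n → FullRecord p) × 𝒰) × FullRecord p =>
    G n q.1.1 q.1.2 q.2
  update_eq : ∀ n z u i y, C.split n (trts z) u i = k → trt y = trt (z i) →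
    G n (Function.update z i y) u = G n z u

/-- An adapted function at the sample. -/
def atSample (D : ℕ → Ω → FullRecord p) (U : ℕ → Ω → 𝒰)
    (G : ∀ n, (Fin n → FullRecord p) → 𝒰 → FullRecord p → ℝ) (q : ℕ × Ω) : FullRecord p → ℝ :=
  G q.1 (records D q.1 q.2) (U q.1 q.2)

theorem FoldAdapted.const {f : ℕ → FullRecord p → ℝ} (hf : ∀ n, Measurable (f n)) (k : Fin 2) :
    FoldAdapted C k fun n _ _ => f n :=
  ⟨fun n => (hf n).comp measurable_snd, fun _ _ _ _ _ _ _ => rfl⟩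

theorem mem_armFold {t : Fin n → Bool} {s : Fin n → Fin 2} {a : Bool} {k : Fin 2} {i : Fin n} :
    i ∈ armFold t s a k ↔ t i = a ∧ s i = k := by
  simp [armFold]

theorem measurableSet_mem_armFold (C : Procedure p d 𝒰) (n : ℕ) (a : Bool) (k : Fin 2)
    (t : Fin n → Bool) (i : Fin n) :
    MeasurableSet {u | i ∈ armFold t (C.split n t u) a k} := by
  have : {u | i ∈ armFold t (C.split n t u) a k} = {u | t i = a ∧ C.split n t u i = k} := by
    ext u; simp [mem_armFold]
  rw [this]
  refine MeasurableSet.inter (MeasurableSet.const (t i = a)) ?_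
  exact (measurable_pi_apply i).comp (C.measurable_split n t) (measurableSet_singleton k)

/-- By the conditional Markov inequality an absolute arm mean of order o_P(r) is enough. Taking ε =
δ c makes the failure probability δ. -/
theorem isLittleO_foldAvg (hs : IsSampling P Q D U) {a : Bool} (ha : Q {z | trt z = a} ≠ 0)
    {k : Fin 2} {G : ∀ n, (Fin n → FullRecord p) → 𝒰 → FullRecord p → ℝ}
    (hG : FoldAdapted C k G) {r : ℕ → ℝ} (hr : ∀ᶠ n in atTop, 0 < r n)
    (h : ∀ ε : ℝ, 0 < ε → ∀ᶠ q in probFilter P,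
      ∫⁻ y, ENNReal.ofReal |atSample D U G q y| ∂(armLaw Q a) ≤ ENNReal.ofReal (ε * r q.1)) :
    (fun q => avg (fold C D U a k q) fun i => atSample D U G q (D i q.2))
      =o[probFilter P] fun q => r q.1 := by
  rw [isLittleO_iff]
  intro c hc
  refine eventually_probFilter_of_forall fun δ hδ => ⟨_, h (δ * c) (by positivity), ?_⟩
  filter_upwards [hr] with n hn
  have hb := hs.prob_average_ge_le (n := n) ha
    (J := fun u t => armFold t (C.split n t u) a k) (fun u t i hi => (mem_armFold.1 hi).1)
    (measurableSet_mem_armFold C n a k) (g := fun q => G n q.1 q.2) (hG.measurable n)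
    (fun z u i y hi hy => by
      have := mem_armFold.1 hi
      exact hG.update_eq n z u i y this.2 (hy.trans this.1.symm))
    (κ := δ * c * r n) (η := c * r n) (by positivity)
  have : δ * c * r n / (c * r n) = δ := by field_simp
  rw [this] at hb
  refine (measure_mono ?_).trans hb
  rintro ω ⟨h1, h2⟩
  refine ⟨h1, ?_⟩
  rw [Real.norm_eq_abs, Real.norm_eq_abs, abs_of_pos hn, not_le] at h2
  exact h2.le

/-- By the conditional Chebyshev inequality on folds of size at least c₀ n, an arm second moment of
order o_P(n r²) is enough. -/
theorem isLittleO_foldAvg_sub (hs : IsSampling P Q D U) {a : Bool}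
    [IsProbabilityMeasure (armLaw Q a)] (ha : Q {z | trt z = a} ≠ 0)
    {k : Fin 2} {c₀ : ℝ} (hc₀ : 0 < c₀)
    (hN : ∀ᶠ q in probFilter P, c₀ * (q.1 : ℝ) ≤ ((fold C D U a k q).card : ℝ))
    {G : ∀ n, (Fin n → FullRecord p) → 𝒰 → FullRecord p → ℝ}
    (hG : FoldAdapted C k G) {r : ℕ → ℝ} (hr : ∀ᶠ n in atTop, 0 < r n)
    (h : ∀ ε : ℝ, 0 < ε → ∀ᶠ q in probFilter P,
      ∫⁻ y, ENNReal.ofReal (atSample D U G q y ^ 2) ∂(armLaw Q a)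
        ≤ ENNReal.ofReal (ε * (q.1 * r q.1 ^ 2))) :
    (fun q => avg (fold C D U a k q) (fun i => atSample D U G q (D i q.2))
        - ∫ y, atSample D U G q y ∂(armLaw Q a))
      =o[probFilter P] fun q => r q.1 := by
  rw [isLittleO_iff]
  intro c hc
  refine eventually_probFilter_of_forall fun δ hδ =>
    -- This ε makes the Chebyshev bound κ/(ν η²) exactly δ.
    ⟨_, (h (δ * c₀ * c ^ 2) (by positivity)).and hN, ?_⟩
  filter_upwards [hr, eventually_gt_atTop 0] with n hn hn0
  have hn0' : (0 : ℝ) < n := by exact_mod_cast hn0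
  have hb := hs.prob_average_sub_ge_le (n := n) ha
    (J := fun u t => armFold t (C.split n t u) a k) (fun u t i hi => (mem_armFold.1 hi).1)
    (measurableSet_mem_armFold C n a k) (g := fun q => G n q.1 q.2) (hG.measurable n)
    (fun z u i y hi hy => by
      have := mem_armFold.1 hi
      exact hG.update_eq n z u i y this.2 (hy.trans this.1.symm))
    (κ := δ * c₀ * c ^ 2 * (n * r n ^ 2)) (η := c * r n) (ν := c₀ * n) (by positivity)
    (by positivity)
  have : δ * c₀ * c ^ 2 * (n * r n ^ 2) / (c₀ * n * (c * r n) ^ 2) = δ := by field_simp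
  rw [this] at hb
  refine (measure_mono ?_).trans hb
  rintro ω ⟨h1, h2⟩
  refine ⟨h1, ?_⟩
  rw [Real.norm_eq_abs, Real.norm_eq_abs, abs_of_pos hn, not_le] at h2
  exact h2.le

end FoldAverages

end CrossBalancing

namespace CrossBalancing

/-! ### The rate n^{-1/4} and its powers. -/

section Rate

/-- The rate `n^{-1/4}`. -/
noncomputable def rate (n : ℕ) : ℝ := (n : ℝ) ^ (-(1 / 4) : ℝ)

theorem rate_pos {n : ℕ} (hn : 0 < n) : 0 < rate n :=
  Real.rpow_pos_of_pos (by exact_mod_cast hn) _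

theorem rate_nonneg (n : ℕ) : 0 ≤ rate n := Real.rpow_nonneg (Nat.cast_nonneg n) _

theorem eventually_rate_pos : ∀ᶠ n in atTop, 0 < rate n := by
  filter_upwards [eventually_gt_atTop 0] with n hn using rate_pos hn

theorem rate_sq (n : ℕ) : rate n ^ 2 = (n : ℝ) ^ (-(1 / 2) : ℝ) := by
  rw [rate, ← Real.rpow_natCast, ← Real.rpow_mul (Nat.cast_nonneg n)]
  norm_num

theorem mul_rate_pow_four {n : ℕ} (hn : 0 < n) : (n : ℝ) * rate n ^ 4 = 1 := by
  have hn' : (0 : ℝ) < n := by exact_mod_cast hn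
  rw [rate, ← Real.rpow_natCast, ← Real.rpow_mul hn'.le]
  norm_num
  rw [Real.rpow_neg_one, mul_inv_cancel₀ hn'.ne']

theorem tendsto_rate : Tendsto rate atTop (𝓝 0) :=
  (tendsto_rpow_neg_atTop (by norm_num : (0 : ℝ) < 1 / 4)).comp tendsto_natCast_atTop_atTop

/-- The square of the rate is the scale of the central limit theorem, so remainders of smaller order
than it are negligible. -/
theorem sqrt_mul_rate_sq {n : ℕ} (hn : 0 < n) : √(n : ℝ) * rate n ^ 2 = 1 := by
  have hn' : (0 : ℝ) < n := by exact_mod_cast hn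
  rw [rate_sq, Real.sqrt_eq_rpow, ← Real.rpow_add hn']
  norm_num

theorem inv_natCast_eq {n : ℕ} (hn : 0 < n) : (n : ℝ)⁻¹ = rate n ^ 4 := by
  have hn' : (0 : ℝ) < n := by exact_mod_cast hn
  have := mul_rate_pow_four hn
  field_simp
  linarith

variable {Ω : Type*} [MeasurableSpace Ω] {P : Measure Ω}

theorem isLittleO_fst {f g : ℕ → ℝ} (h : f =o[atTop] g) :
    (fun q : ℕ × Ω => f q.1) =o[probFilter P] fun q => g q.1 :=
  h.comp_tendsto tendsto_fst_probFilter

theorem eventually_fst {s : ℕ → Prop} (h : ∀ᶠ n in atTop, s n) :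
    ∀ᶠ q : ℕ × Ω in probFilter P, s q.1 := tendsto_fst_probFilter.eventually h

theorem isLittleO_rate_one :
    (fun q : ℕ × Ω => rate q.1) =o[probFilter P] fun _ => (1 : ℝ) :=
  (isLittleO_one_iff ℝ).2 (tendsto_rate.comp tendsto_fst_probFilter)

theorem isLittleO_rate_sq_rate :
    (fun q : ℕ × Ω => rate q.1 ^ 2) =o[probFilter P] fun q => rate q.1 := by
  have := (isLittleO_rate_one (P := P)).mul_isBigO
    (isBigO_refl (fun q : ℕ × Ω => rate q.1) (probFilter P))
  simpa [sq] using this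

end Rate

/-! ### Sizes of arms and folds. -/

section Counts

set_option linter.unusedSectionVars false

variable {p d : ℕ} {Ω 𝒰 : Type*} [MeasurableSpace Ω] [MeasurableSpace 𝒰]
  {P : Measure Ω} [IsProbabilityMeasure P] {Q : Measure (FullRecord p)} [IsProbabilityMeasure Q]
  {D : ℕ → Ω → FullRecord p} {U : ℕ → Ω → 𝒰} {C : Procedure p d 𝒰}

/-- The units in arm `a`. -/
def armSet (D : ℕ → Ω → FullRecord p) (a : Bool) (q : ℕ × Ω) : Finset (Fin q.1) :=
  arm (trts (records D q.1 q.2)) a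

theorem sum_ite_trt_eq_card (D : ℕ → Ω → FullRecord p) (a : Bool) (q : ℕ × Ω) :
    ∑ i ∈ Finset.range q.1, (if trt (D i q.2) = a then (1 : ℝ) else 0)
      = ((armSet D a q).card : ℝ) := by
  rw [← Fin.sum_univ_eq_sum_range (fun i => if trt (D i q.2) = a then (1 : ℝ) else 0)]
  simp [armSet, arm, trts, records]
  rfl

/-- The count has variance at most n/4, so the error is O_P(n^{-1/2}). The weaker order is recorded
because later the error only multiplies another o_P(n^{-1/4}) term. -/
theorem IsSampling.isLittleO_proportion (hs : IsSampling P Q D U) (a : Bool) :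
    (fun q => ((armSet D a q).card : ℝ) / q.1 - pArm Q a)
      =o[probFilter P] fun q => rate q.1 := by
  set f : FullRecord p → ℝ := fun z => if trt z = a then 1 else 0 with hf
  have hfm : Measurable f :=
    Measurable.ite (measurableSet_arm a) measurable_const measurable_const
  have hD : ∀ i, AEMeasurable (D i) P := fun i => (hs.hasLaw i).aemeasurable
  have hX : ∀ i, AEMeasurable (fun ω => f (D i ω)) P := fun i => hfm.comp_aemeasurable (hD i)
  have hb : ∀ z, f z ∈ Set.Icc (0 : ℝ) 1 := by
    intro z; simp only [hf]; split_ifs <;> simp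
  have hL2 : ∀ i, MemLp (fun ω => f (D i ω)) 2 P := fun i =>
    MemLp.of_bound (hX i).aestronglyMeasurable 1 (Eventually.of_forall fun ω => by
      have := hb (D i ω); rw [Real.norm_eq_abs, abs_of_nonneg this.1]; exact this.2)
  have hmean : ∀ i, ∫ ω, f (D i ω) ∂P = pArm Q a := by
    intro i
    have h := integral_map (hD i) hfm.aestronglyMeasurable (f := f)
    rw [(hs.hasLaw i).map_eq] at h
    rw [← h]
    have : f = Set.indicator {z | trt z = a} (fun _ => (1 : ℝ)) := by
      funext z; simp [hf, Set.indicator_apply]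
    rw [this, integral_indicator (measurableSet_arm a)]
    simp [pArm]
  rw [isLittleO_iff]
  intro c hc
  refine eventually_probFilter_of_forall fun δ hδ => ⟨fun _ => True, by simp, ?_⟩
  have hlim : Tendsto (fun n : ℕ => rate n ^ 2 / (4 * c ^ 2)) atTop (𝓝 0) := by
    have := (tendsto_rate.pow 2).div_const (4 * c ^ 2)
    simpa using this
  filter_upwards [eventually_gt_atTop 0, hlim.eventually (gt_mem_nhds hδ)] with n hn hsmall
  have hn' : (0 : ℝ) < n := by exact_mod_cast hn
  have hρ := rate_pos hn
  set S : Ω → ℝ := ∑ i ∈ Finset.range n, fun ω => f (D i ω) with hS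
  have hSL2 : MemLp S 2 P := memLp_finsetSum' _ fun i _ => hL2 i
  have hSmean : ∫ ω, S ω ∂P = n * pArm Q a := by
    simp only [hS, Finset.sum_apply]
    rw [integral_finsetSum _ fun i _ => (hL2 i).integrable (by norm_num)]
    simp [hmean]
  have hvar : Var[S; P] ≤ n * (1 / 4) := by
    rw [hS, IndepFun.variance_sum (fun i _ => hL2 i) (fun i _ j _ hij => by
      exact (hs.indep.indepFun hij).comp hfm hfm)]
    calc _ ≤ ∑ i ∈ Finset.range n, (1 / 4 : ℝ) := by
          refine Finset.sum_le_sum fun i _ => ?_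
          refine (variance_le_sq_of_bounded (Eventually.of_forall fun ω => hb (D i ω))
            (hX i)).trans ?_
          norm_num
      _ = _ := by simp
  have hch := meas_ge_le_variance_div_sq hSL2 (c := n * (c * rate n)) (by positivity)
  refine (measure_mono ?_).trans (hch.trans (ENNReal.ofReal_le_ofReal ?_))
  · rintro ω ⟨-, h⟩
    rw [not_le, Real.norm_eq_abs, Real.norm_eq_abs, abs_of_pos hρ] at h
    simp only [Set.mem_ofPred_eq]
    rw [hSmean]
    have hSω : S ω = ((armSet D a (n, ω)).card : ℝ) := by
      rw [← sum_ite_trt_eq_card, hS, Finset.sum_apply]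
    rw [hSω]
    have : ((armSet D a (n, ω)).card : ℝ) - n * pArm Q a
        = n * (((armSet D a (n, ω)).card : ℝ) / n - pArm Q a) := by field_simp
    rw [this, abs_mul, abs_of_pos hn']
    exact mul_le_mul_of_nonneg_left h.le hn'.le
  · refine le_trans ?_ hsmall.le
    rw [div_le_div_iff₀ (by positivity) (by positivity)]
    have h4 := mul_rate_pow_four hn
    calc Var[S; P] * (4 * c ^ 2) ≤ n * (1 / 4) * (4 * c ^ 2) := by gcongr
      _ = (n * rate n ^ 4) * (n * c ^ 2) := by rw [h4]; ring
      _ = _ := by ring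

theorem sum_fold_eq (C : Procedure p d 𝒰) (U : ℕ → Ω → 𝒰) (a : Bool) (q : ℕ × Ω)
    (f : Fin q.1 → ℝ) :
    ∑ i ∈ armSet D a q, f i = ∑ k, ∑ i ∈ fold C D U a k q, f i := by
  have : ∀ k, fold C D U a k q = (armSet D a q).filter fun i =>
      C.split q.1 (trts (records D q.1 q.2)) (U q.1 q.2) i = k := by
    intro k
    ext i
    simp [fold, armFold, armSet, arm]
  simp only [this]
  exact (Finset.sum_fiberwise _ _ _).symm

theorem card_fold_add (C : Procedure p d 𝒰) (U : ℕ → Ω → 𝒰) (a : Bool) (q : ℕ × Ω) :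
    ((armSet D a q).card : ℝ) = ((fold C D U a 0 q).card : ℝ) + ((fold C D U a 1 q).card : ℝ) := by
  have := sum_fold_eq (D := D) C U a q fun _ => 1
  simpa [Fin.sum_univ_two] using this

theorem abs_card_fold_sub_le (C : Procedure p d 𝒰) (U : ℕ → Ω → 𝒰) (a : Bool) (k : Fin 2)
    (q : ℕ × Ω) :
    |((fold C D U a k q).card : ℝ) - ((armSet D a q).card : ℝ) / 2| ≤ 1 / 2 := by
  have h1 := card_fold_add (D := D) C U a q
  obtain ⟨h2, h3⟩ := C.balanced_split q.1 (trts (records D q.1 q.2)) (U q.1 q.2) a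
  have h2' : ((fold C D U a 0 q).card : ℝ) ≤ ((fold C D U a 1 q).card : ℝ) + 1 := by
    exact_mod_cast h2
  have h3' : ((fold C D U a 1 q).card : ℝ) ≤ ((fold C D U a 0 q).card : ℝ) + 1 := by
    exact_mod_cast h3
  rw [h1, abs_le]
  fin_cases k <;> simp only [Fin.zero_eta, Fin.mk_one] <;> constructor <;> linarith

theorem IsSampling.tendsto_proportion (hs : IsSampling P Q D U) (a : Bool) :
    Tendsto (fun q => ((armSet D a q).card : ℝ) / q.1) (probFilter P) (𝓝 (pArm Q a)) := by
  have h := (isLittleO_one_iff ℝ).1 ((hs.isLittleO_proportion a).trans isLittleO_rate_one)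
  simpa using h.add_const (pArm Q a)

theorem IsSampling.eventually_le_card_arm (hs : IsSampling P Q D U) {a : Bool}
    (ha : 0 < pArm Q a) :
    ∀ᶠ q in probFilter P, pArm Q a / 2 * (q.1 : ℝ) ≤ ((armSet D a q).card : ℝ) := by
  filter_upwards [(hs.tendsto_proportion a).eventually (lt_mem_nhds (half_lt_self ha)),
    eventually_fst (eventually_gt_atTop 0)] with q h1 h2
  have : (0 : ℝ) < q.1 := by exact_mod_cast h2
  exact ((lt_div_iff₀ this).1 h1).le

theorem IsSampling.eventually_le_card_fold (hs : IsSampling P Q D U) {a : Bool}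
    (ha : 0 < pArm Q a) (C : Procedure p d 𝒰) (k : Fin 2) :
    ∀ᶠ q in probFilter P, pArm Q a / 8 * (q.1 : ℝ) ≤ ((fold C D U a k q).card : ℝ) := by
  -- Half of an arm of size at least (p/2) n is (p/4) n. One half of that absorbs the rounding error
  -- 1/2 of the split.
  have hlarge : ∀ᶠ n : ℕ in atTop, 1 / 2 ≤ pArm Q a / 8 * (n : ℝ) :=
    (tendsto_natCast_atTop_atTop.const_mul_atTop (by positivity)).eventually_ge_atTop _
  filter_upwards [hs.eventually_le_card_arm ha, eventually_fst hlarge] with q h1 h2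
  have h3 := (abs_le.1 (abs_card_fold_sub_le (D := D) C U a k q)).1
  linarith

theorem IsSampling.eventually_card_fold_pos (hs : IsSampling P Q D U) {a : Bool}
    (ha : 0 < pArm Q a) (C : Procedure p d 𝒰) (k : Fin 2) :
    ∀ᶠ q in probFilter P, (0 : ℝ) < ((fold C D U a k q).card : ℝ) := by
  filter_upwards [hs.eventually_le_card_fold ha C k,
    eventually_fst (eventually_gt_atTop 0)] with q h1 h2
  have : (0 : ℝ) < q.1 := by exact_mod_cast h2
  exact lt_of_lt_of_le (by positivity) h1

/-- The share of fold `k` in arm `a`. -/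
noncomputable def share (C : Procedure p d 𝒰) (D : ℕ → Ω → FullRecord p)
    (U : ℕ → Ω → 𝒰) (a : Bool) (k : Fin 2) (q : ℕ × Ω) : ℝ := ((fold C D U a k q).card : ℝ) / ((armSet D a q).card : ℝ)

theorem avg_arm_eq {a : Bool} {q : ℕ × Ω} (h : ∀ k, (0 : ℝ) < ((fold C D U a k q).card : ℝ))
    (f : Fin q.1 → ℝ) :
    avg (armSet D a q) f = ∑ k, share C D U a k q * avg (fold C D U a k q) f := by
  rw [avg, sum_fold_eq C U, Finset.sum_div]
  refine Finset.sum_congr rfl fun k _ => ?_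
  rw [share, avg]
  have := (h k).ne'
  field_simp

theorem sum_share {a : Bool} {q : ℕ × Ω} (h : ∀ k, (0 : ℝ) < ((fold C D U a k q).card : ℝ)) :
    ∑ k, share C D U a k q = 1 := by
  have h1 := card_fold_add (D := D) C U a q
  have h2 : (0 : ℝ) < ((armSet D a q).card : ℝ) := by rw [h1]; exact add_pos (h 0) (h 1)
  simp only [share, ← Finset.sum_div, Fin.sum_univ_two]
  rw [← h1, div_self h2.ne']

/-- The deviation is at most half a unit divided by an arm size of order n, hence of order 1/n, the
fourth power of the rate. -/
theorem IsSampling.isLittleO_share_sub (hs : IsSampling P Q D U) {a : Bool}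
    (ha : 0 < pArm Q a) (C : Procedure p d 𝒰) (k : Fin 2) :
    (fun q => share C D U a k q - 1 / 2) =o[probFilter P] fun q => rate q.1 := by
  have hO : (fun q => share C D U a k q - 1 / 2)
      =O[probFilter P] fun q : ℕ × Ω => rate q.1 ^ 4 := by
    refine IsBigO.of_bound (1 / pArm Q a) ?_
    filter_upwards [hs.eventually_le_card_arm ha, eventually_fst (eventually_gt_atTop 0)]
      with q h1 h2
    have hq : (0 : ℝ) < q.1 := by exact_mod_cast h2
    have hc : (0 : ℝ) < ((armSet D a q).card : ℝ) := lt_of_lt_of_le (by positivity) h1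
    have h3 := abs_card_fold_sub_le (D := D) C U a k q
    have : share C D U a k q - 1 / 2
        = (((fold C D U a k q).card : ℝ) - ((armSet D a q).card : ℝ) / 2)
          / ((armSet D a q).card : ℝ) := by
      rw [share]; field_simp
    rw [this, Real.norm_eq_abs (rate q.1 ^ 4), abs_of_nonneg (a := rate q.1 ^ 4) (by positivity),
      ← inv_natCast_eq h2, Real.norm_eq_abs, abs_div, abs_of_pos hc]
    calc |((fold C D U a k q).card : ℝ) - ((armSet D a q).card : ℝ) / 2|
          / ((armSet D a q).card : ℝ) ≤ (1 / 2) / (pArm Q a / 2 * (q.1 : ℝ)) := by gcongr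
      _ = _ := by field_simp
  refine hO.trans_isLittleO ?_
  have h2 := isLittleO_rate_sq_rate (Ω := Ω) (P := P)
  have h3 : (fun q : ℕ × Ω => rate q.1 ^ 4) =O[probFilter P] fun q => rate q.1 ^ 2 := by
    have := (h2.trans isLittleO_rate_one).isBigO.mul (isBigO_refl (fun q : ℕ × Ω => rate q.1 ^ 2) (probFilter P))
    refine (this.congr ?_ ?_)
    · intro q; ring
    · intro q; ring
  exact h3.trans_isLittleO h2

theorem IsSampling.tendsto_share (hs : IsSampling P Q D U) {a : Bool}
    (ha : 0 < pArm Q a) (C : Procedure p d 𝒰) (k : Fin 2) :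
    Tendsto (share C D U a k) (probFilter P) (𝓝 (1 / 2)) := by
  have h := (isLittleO_one_iff ℝ).1 ((hs.isLittleO_share_sub ha C k).trans isLittleO_rate_one)
  simpa using h.add_const (1 / 2 : ℝ)

end Counts

end CrossBalancing

namespace CrossBalancing

/-! ### Averages over finite sets and the empirical L² norm. -/

section Averages

variable {ι : Type*} {I : Finset ι} {f g : ι → ℝ}

theorem avg_congr (h : ∀ i ∈ I, f i = g i) : avg I f = avg I g := by
  rw [avg, avg, Finset.sum_congr rfl h]

theorem avg_add : avg I (fun i => f i + g i) = avg I f + avg I g := by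
  rw [avg, avg, avg, Finset.sum_add_distrib, add_div]

theorem avg_sub : avg I (fun i => f i - g i) = avg I f - avg I g := by
  rw [avg, avg, avg, Finset.sum_sub_distrib, sub_div]

theorem avg_const_mul (c : ℝ) : avg I (fun i => c * f i) = c * avg I f := by
  rw [avg, avg, ← Finset.mul_sum, mul_div_assoc]

theorem avg_mul_const (c : ℝ) : avg I (fun i => f i * c) = avg I f * c := by
  rw [mul_comm, ← avg_const_mul]
  simp only [mul_comm]

theorem avg_sum {κ : Type*} (s : Finset κ) (F : κ → ι → ℝ) :
    avg I (fun i => ∑ j ∈ s, F j i) = ∑ j ∈ s, avg I (F j) := by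
  simp only [avg]
  rw [Finset.sum_comm, Finset.sum_div]

theorem avg_const (hI : (0 : ℝ) < (I.card : ℝ)) (c : ℝ) : avg I (fun _ => c) = c := by
  rw [avg, Finset.sum_const, nsmul_eq_mul, mul_div_cancel_left₀ _ hI.ne']

theorem avg_nonneg (h : ∀ i ∈ I, 0 ≤ f i) : 0 ≤ avg I f :=
  div_nonneg (Finset.sum_nonneg h) (Nat.cast_nonneg _)

theorem avg_mono (h : ∀ i ∈ I, f i ≤ g i) : avg I f ≤ avg I g :=
  div_le_div_of_nonneg_right (Finset.sum_le_sum h) (Nat.cast_nonneg _)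

/-- The empirical `L²` norm over `I`. -/
noncomputable def l2 (I : Finset ι) (f : ι → ℝ) : ℝ := √(avg I fun i => f i ^ 2)

theorem l2_nonneg : 0 ≤ l2 I f := Real.sqrt_nonneg _

theorem l2_sq : l2 I f ^ 2 = avg I fun i => f i ^ 2 :=
  Real.sq_sqrt (avg_nonneg fun _ _ => sq_nonneg _)

theorem l2_congr (h : ∀ i ∈ I, f i = g i) : l2 I f = l2 I g := by
  rw [l2, l2, avg_congr fun i hi => by rw [h i hi]]

theorem l2_mono (h : ∀ i ∈ I, |f i| ≤ |g i|) : l2 I f ≤ l2 I g :=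
  Real.sqrt_le_sqrt (avg_mono fun i hi => sq_le_sq.2 (h i hi))

theorem abs_avg_mul_le : |avg I fun i => f i * g i| ≤ l2 I f * l2 I g := by
  refine abs_le_of_sq_le_sq ?_ (mul_nonneg l2_nonneg l2_nonneg)
  rw [mul_pow, l2_sq, l2_sq, avg, avg, avg, div_pow, div_mul_div_comm, ← sq]
  exact div_le_div_of_nonneg_right (Finset.sum_mul_sq_le_sq_mul_sq _ _ _) (sq_nonneg _)

theorem l2_add_le : l2 I (fun i => f i + g i) ≤ l2 I f + l2 I g := by
  refine le_of_sq_le_sq ?_ (add_nonneg l2_nonneg l2_nonneg)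
  have h : (l2 I fun i => f i + g i) ^ 2
      = l2 I f ^ 2 + 2 * (avg I fun i => f i * g i) + l2 I g ^ 2 := by
    rw [l2_sq, l2_sq, l2_sq, ← avg_const_mul, ← avg_add, ← avg_add]
    exact avg_congr fun i _ => by ring
  rw [h]
  nlinarith [le_abs_self (avg I fun i => f i * g i), abs_avg_mul_le (I := I) (f := f) (g := g)]

theorem l2_const_mul (c : ℝ) : l2 I (fun i => c * f i) = |c| * l2 I f := by
  simp only [l2, mul_pow]
  rw [avg_const_mul, Real.sqrt_mul (sq_nonneg c), Real.sqrt_sq_eq_abs]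

theorem l2_neg : l2 I (fun i => -f i) = l2 I f := by simp only [l2, neg_sq]

theorem l2_sum_le {κ : Type*} (s : Finset κ) (F : κ → ι → ℝ) :
    l2 I (fun i => ∑ j ∈ s, F j i) ≤ ∑ j ∈ s, l2 I (F j) := by
  classical
  induction s using Finset.induction_on with
  | empty => simp [l2, avg]
  | insert a s ha ih =>
    simp only [Finset.sum_insert ha]
    exact l2_add_le.trans (by gcongr)

theorem abs_l2_sub_le : |l2 I f - l2 I g| ≤ l2 I fun i => f i - g i := by
  rw [abs_sub_le_iff]
  constructor
  · have := l2_add_le (I := I) (f := fun i => f i - g i) (g := g)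
    simp only [sub_add_cancel] at this
    linarith
  · have := l2_add_le (I := I) (f := fun i => g i - f i) (g := f)
    simp only [sub_add_cancel] at this
    have h2 : (l2 I fun i => g i - f i) = l2 I fun i => f i - g i := by
      rw [← l2_neg]; simp only [neg_sub]
    linarith

theorem abs_avg_le_l2 : |avg I f| ≤ l2 I f := by
  by_cases h : (I.card : ℝ) = 0
  · rw [avg, h, div_zero, abs_zero]; exact l2_nonneg
  · have hpos : (0 : ℝ) < (I.card : ℝ) := lt_of_le_of_ne (Nat.cast_nonneg _) (Ne.symm h)
    have h1 := abs_avg_mul_le (I := I) (f := f) (g := fun _ => 1)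
    have h2 : (l2 I fun _ => (1 : ℝ)) = 1 := by
      rw [l2]; simp only [one_pow]; rw [avg_const hpos, Real.sqrt_one]
    simpa [h2] using h1

/-- Each g² is at most the sum of all of them. The loss √n is affordable when both factors are
o_P(n^{-1/4}). -/
theorem l2_mul_le : l2 I (fun i => f i * g i) ≤ √(I.card : ℝ) * (l2 I f * l2 I g) := by
  refine le_of_sq_le_sq ?_ (by have := l2_nonneg (I := I) (f := f)
                               have := l2_nonneg (I := I) (f := g); positivity)
  rw [mul_pow, mul_pow, Real.sq_sqrt (Nat.cast_nonneg _), l2_sq, l2_sq, l2_sq]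
  by_cases h : (I.card : ℝ) = 0
  · simp [avg, h]
  · have hpos : (0 : ℝ) < (I.card : ℝ) := lt_of_le_of_ne (Nat.cast_nonneg _) (Ne.symm h)
    have : (I.card : ℝ) * ((avg I fun i => f i ^ 2) * avg I fun i => g i ^ 2)
        = ((∑ i ∈ I, f i ^ 2) * ∑ i ∈ I, g i ^ 2) / (I.card : ℝ) := by
      simp only [avg]; field_simp
    rw [this, avg]
    refine div_le_div_of_nonneg_right ?_ hpos.le
    simp only [mul_pow]
    rw [Finset.sum_mul]
    refine Finset.sum_le_sum fun i hi => ?_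
    refine mul_le_mul_of_nonneg_left ?_ (sq_nonneg _)
    exact Finset.single_le_sum (f := fun i => g i ^ 2) (fun _ _ => sq_nonneg _) hi

end Averages

/-! ### Little-o calculus for empirical averages and norms. -/

section AverageAsymptotics

variable {α : Type*} {l : Filter α} {ι : α → Type*} {I : ∀ q, Finset (ι q)} {f g : ∀ q, ι q → ℝ}
  {r s : α → ℝ}

theorem isLittleO_l2_of_avg_sq (h : (fun q => avg (I q) fun i => f q i ^ 2) =o[l] fun q => r q ^ 2) :
    (fun q => l2 (I q) (f q)) =o[l] r := by
  rw [isLittleO_iff] at h ⊢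
  intro c hc
  filter_upwards [h (pow_pos hc 2)] with q hq
  rw [Real.norm_eq_abs, Real.norm_eq_abs, abs_of_nonneg l2_nonneg]
  refine abs_le_of_sq_le_sq' ?_ (by positivity) |>.2
  rw [l2_sq, mul_pow, sq_abs]
  rw [Real.norm_eq_abs, Real.norm_eq_abs, abs_of_nonneg (sq_nonneg (r q))] at hq
  exact (le_abs_self _).trans hq

theorem isBigO_l2_of_tendsto {c : ℝ} (h : Tendsto (fun q => avg (I q) fun i => f q i ^ 2) l (𝓝 c)) :
    (fun q => l2 (I q) (f q)) =O[l] fun _ => (1 : ℝ) :=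
  ((Real.continuous_sqrt.tendsto c).comp h).isBigO_one ℝ

theorem IsLittleO.avg_mul (hf : (fun q => l2 (I q) (f q)) =o[l] r)
    (hg : (fun q => l2 (I q) (g q)) =O[l] s) :
    (fun q => avg (I q) fun i => f q i * g q i) =o[l] fun q => r q * s q :=
  (IsBigO.of_bound 1 (Eventually.of_forall fun q => by
    rw [one_mul, Real.norm_eq_abs, Real.norm_eq_abs]
    exact abs_avg_mul_le.trans (le_abs_self _))).trans_isLittleO (hf.mul_isBigO hg)

theorem isLittleO_l2_add (hf : (fun q => l2 (I q) (f q)) =o[l] r)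
    (hg : (fun q => l2 (I q) (g q)) =o[l] r) :
    (fun q => l2 (I q) fun i => f q i + g q i) =o[l] r :=
  (IsBigO.of_bound 1 (Eventually.of_forall fun q => by
    rw [one_mul, Real.norm_eq_abs, Real.norm_eq_abs, abs_of_nonneg l2_nonneg]
    exact l2_add_le.trans (le_abs_self _))).trans_isLittleO (hf.add hg)

theorem isBigO_l2_add (hf : (fun q => l2 (I q) (f q)) =O[l] r)
    (hg : (fun q => l2 (I q) (g q)) =O[l] r) :
    (fun q => l2 (I q) fun i => f q i + g q i) =O[l] r :=
  (IsBigO.of_bound 1 (Eventually.of_forall fun q => by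
    rw [one_mul, Real.norm_eq_abs, Real.norm_eq_abs, abs_of_nonneg l2_nonneg]
    exact l2_add_le.trans (le_abs_self _))).trans (hf.add hg)

theorem isLittleO_l2_sum {κ : Type*} {t : Finset κ} {F : κ → ∀ q, ι q → ℝ}
    (hF : ∀ j ∈ t, (fun q => l2 (I q) (F j q)) =o[l] r) :
    (fun q => l2 (I q) fun i => ∑ j ∈ t, F j q i) =o[l] r :=
  (IsBigO.of_bound 1 (Eventually.of_forall fun q => by
    rw [one_mul, Real.norm_eq_abs, Real.norm_eq_abs, abs_of_nonneg l2_nonneg]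
    exact (l2_sum_le t fun j => F j q).trans (le_abs_self _))).trans_isLittleO
    (IsLittleO.fun_sum hF)

theorem isLittleO_l2_const_mul {c : α → ℝ} (hc : c =o[l] r)
    (hf : (fun q => l2 (I q) (f q)) =O[l] s) :
    (fun q => l2 (I q) fun i => c q * f q i) =o[l] fun q => r q * s q :=
  (IsBigO.of_bound 1 (Eventually.of_forall fun q => by
    rw [one_mul, l2_const_mul, norm_mul, norm_mul, Real.norm_eq_abs |c q|, abs_abs,
      Real.norm_eq_abs (c q)])).trans_isLittleO (hc.mul_isBigO hf)

theorem isLittleO_l2_mul_const (c : ℝ) (hf : (fun q => l2 (I q) (f q)) =o[l] r) :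
    (fun q => l2 (I q) fun i => c * f q i) =o[l] r := by
  simp only [l2_const_mul]
  exact hf.const_mul_left _

/-- A perturbation that vanishes in the empirical `L²` norm does not change the limit of the
second moments. -/
theorem tendsto_avg_sq_of_l2_sub {c : ℝ}
    (hf : Tendsto (fun q => avg (I q) fun i => f q i ^ 2) l (𝓝 c))
    (h : (fun q => l2 (I q) fun i => g q i - f q i) =o[l] fun _ => (1 : ℝ)) :
    Tendsto (fun q => avg (I q) fun i => g q i ^ 2) l (𝓝 c) := by
  have h1 : Tendsto (fun q => l2 (I q) (f q)) l (𝓝 √c) := (Real.continuous_sqrt.tendsto c).comp hf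
  have h2 : Tendsto (fun q => l2 (I q) (g q) - l2 (I q) (f q)) l (𝓝 0) :=
    squeeze_zero_norm (fun q => by rw [Real.norm_eq_abs]; exact abs_l2_sub_le)
      ((isLittleO_one_iff ℝ).1 h)
  have h3 : Tendsto (fun q => l2 (I q) (g q)) l (𝓝 √c) := by simpa using h2.add h1
  have h4 := h3.pow 2
  -- For a proper filter the limit c is nonnegative, so (√c)² = c; for the trivial filter there is
  -- nothing to show.
  by_cases hl : l.NeBot
  · have hc : 0 ≤ c := ge_of_tendsto' hf fun q => avg_nonneg fun _ _ => sq_nonneg _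
    rw [Real.sq_sqrt hc] at h4
    simpa only [l2_sq] using h4
  · rw [not_neBot.1 hl]; exact tendsto_bot

theorem tendsto_avg_of_l2_sub {c : ℝ}
    (hf : Tendsto (fun q => avg (I q) (f q)) l (𝓝 c))
    (h : (fun q => l2 (I q) fun i => g q i - f q i) =o[l] fun _ => (1 : ℝ)) :
    Tendsto (fun q => avg (I q) (g q)) l (𝓝 c) := by
  have h2 : Tendsto (fun q => avg (I q) (g q) - avg (I q) (f q)) l (𝓝 0) :=
    squeeze_zero_norm (fun q => by rw [Real.norm_eq_abs, ← avg_sub]; exact abs_avg_le_l2)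
      ((isLittleO_one_iff ℝ).1 h)
  simpa using h2.add hf

theorem isLittleO_l2_congr {r : α → ℝ} (h : ∀ᶠ q in l, ∀ i ∈ I q, f q i = g q i)
    (hg : (fun q => l2 (I q) (g q)) =o[l] r) : (fun q => l2 (I q) (f q)) =o[l] r :=
  hg.congr' (by filter_upwards [h] with q hq using (l2_congr hq).symm) EventuallyEq.rfl

end AverageAsymptotics

end CrossBalancing

namespace CrossBalancing

/-! ### Laws of large numbers for fixed functions. -/

section FixedFunctions

set_option linter.unusedSectionVars false

variable {p d : ℕ} {Ω 𝒰 : Type*} [MeasurableSpace Ω] [MeasurableSpace 𝒰]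
  {P : Measure Ω} [IsProbabilityMeasure P] {Q : Measure (FullRecord p)} [IsProbabilityMeasure Q]
  {D : ℕ → Ω → FullRecord p} {U : ℕ → Ω → 𝒰} {C : Procedure p d 𝒰}

theorem measure_arm_ne_zero_of_pos {a : Bool} (ha : 0 < pArm Q a) : Q {z | trt z = a} ≠ 0 := by
  rw [← ofReal_pArm]
  exact (ENNReal.ofReal_pos.2 ha).ne'

/-- Chebyshev's inequality: fold averages of a square-integrable function. -/
theorem IsSampling.isLittleO_avg_sub (hs : IsSampling P Q D U) {a : Bool}
    [IsProbabilityMeasure (armLaw Q a)] (ha : 0 < pArm Q a) (C : Procedure p d 𝒰) (k : Fin 2)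
    {f : FullRecord p → ℝ} (hf : Measurable f) (hf2 : MemLp f 2 (armLaw Q a)) :
    (fun q => avg (fold C D U a k q) (fun i => f (D i q.2)) - ∫ y, f y ∂(armLaw Q a))
      =o[probFilter P] fun q => rate q.1 := by
  refine isLittleO_foldAvg_sub hs (measure_arm_ne_zero_of_pos ha) (c₀ := pArm Q a / 8)
    (by positivity) (hs.eventually_le_card_fold ha C k)
    (G := fun _ _ _ => f) (FoldAdapted.const (fun _ => hf) k) eventually_rate_pos ?_
  intro ε hε
  refine eventually_fst (s := fun n : ℕ => ∫⁻ y, ENNReal.ofReal (f y ^ 2) ∂(armLaw Q a)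
    ≤ ENNReal.ofReal (ε * (n * rate n ^ 2))) ?_
  have hfin : ∫⁻ y, ENNReal.ofReal (f y ^ 2) ∂(armLaw Q a) ≠ ⊤ := by
    rw [lintegral_sq_eq]
    exact ENNReal.pow_ne_top hf2.2.ne
  set K := (∫⁻ y, ENNReal.ofReal (f y ^ 2) ∂(armLaw Q a)).toReal with hK
  have hlim : Tendsto (fun n => K * rate n ^ 2) atTop (𝓝 0) := by
    simpa using (tendsto_rate.pow 2).const_mul K
  filter_upwards [hlim.eventually (gt_mem_nhds hε), eventually_gt_atTop 0] with n h1 h2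
  rw [← ENNReal.ofReal_toReal hfin]
  refine ENNReal.ofReal_le_ofReal ?_
  rw [← hK]
  have h4 := mul_rate_pow_four h2
  have hρ := rate_pos h2
  have hn : (0 : ℝ) < n := by exact_mod_cast h2
  calc K = (n * rate n ^ 2) * (K * rate n ^ 2) := by linear_combination (-K) * h4
    _ ≤ (n * rate n ^ 2) * ε := by gcongr
    _ = _ := by ring

/-- The weak law of large numbers for fold averages. -/
theorem IsSampling.tendsto_avg (hs : IsSampling P Q D U) {a : Bool}
    [IsProbabilityMeasure (armLaw Q a)] (ha : 0 < pArm Q a) (C : Procedure p d 𝒰) (k : Fin 2)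
    {f : FullRecord p → ℝ} (hf : Measurable f) (hf1 : Integrable f (armLaw Q a)) :
    Tendsto (fun q => avg (fold C D U a k q) fun i => f (D i q.2)) (probFilter P)
      (𝓝 (∫ y, f y ∂(armLaw Q a))) := by
  -- Truncation at n^{1/4}. The second moment is then at most n^{1/4} 𝔼|f| = o(n), as Chebyshev
  -- needs, and the discarded part tends to zero in L¹, as Markov needs.
  set g : ℕ → FullRecord p → ℝ := fun n y => if |f y| * rate n ≤ 1 then f y else 0 with hg
  have hgm : ∀ n, Measurable (g n) := fun n =>
    Measurable.ite (measurableSet_le (hf.abs.mul_const _) measurable_const) hf measurable_const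
  have hgle : ∀ n y, |g n y| ≤ |f y| := by
    intro n y; simp only [hg]; split_ifs
    · exact le_rfl
    · simp
  have hfg : ∀ n y, |f y - g n y| ≤ |f y| := by
    intro n y; simp only [hg]; split_ifs <;> simp
  have hlim : ∀ y, Tendsto (fun n => g n y) atTop (𝓝 (f y)) := by
    intro y
    have h0 : Tendsto (fun n => |f y| * rate n) atTop (𝓝 0) := by
      simpa using tendsto_rate.const_mul |f y|
    refine tendsto_const_nhds.congr' ?_
    filter_upwards [h0.eventually (gt_mem_nhds one_pos)] with n hn
    simp only [hg, hn.le, if_true]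
  have hE : Tendsto (fun n => ∫ y, g n y ∂(armLaw Q a)) atTop (𝓝 (∫ y, f y ∂(armLaw Q a))) :=
    tendsto_integral_of_dominated_convergence (fun y => |f y|)
      (fun n => (hgm n).aestronglyMeasurable) hf1.abs
      (fun n => Eventually.of_forall (hgle n)) (Eventually.of_forall hlim)
  have hE2 : Tendsto (fun n => ∫ y, |f y - g n y| ∂(armLaw Q a)) atTop (𝓝 0) := by
    have := tendsto_integral_of_dominated_convergence (μ := armLaw Q a)
      (F := fun n y => |f y - g n y|) (f := fun _ => 0) (fun y => |f y|)
      (fun n => ((hf.sub (hgm n)).abs).aestronglyMeasurable) hf1.abs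
      (fun n => Eventually.of_forall fun y => by
        rw [Real.norm_eq_abs, abs_abs]; exact hfg n y)
      (Eventually.of_forall fun y => by
        have := ((tendsto_const_nhds (x := f y)).sub (hlim y)).abs
        simpa using this)
    simpa using this
  have hne := measure_arm_ne_zero_of_pos ha
  have h1 := isLittleO_foldAvg hs hne (C := C) (k := k) (G := fun n _ _ y => f y - g n y)
    (FoldAdapted.const (fun n => hf.sub (hgm n)) k) (r := fun _ => 1) (by simp) (by
      intro ε hε
      refine eventually_fst (s := fun n : ℕ => ∫⁻ y, ENNReal.ofReal |f y - g n y| ∂(armLaw Q a)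
        ≤ ENNReal.ofReal (ε * 1)) ?_
      filter_upwards [hE2.eventually (gt_mem_nhds hε)] with n hn
      have hint : Integrable (fun y => |f y - g n y|) (armLaw Q a) :=
        hf1.abs.mono' (hf.sub (hgm n)).abs.aestronglyMeasurable (Eventually.of_forall fun y => by
          rw [Real.norm_eq_abs, abs_abs]; exact hfg n y)
      rw [← ofReal_integral_eq_lintegral_ofReal hint (Eventually.of_forall fun _ => abs_nonneg _)]
      exact ENNReal.ofReal_le_ofReal (by linarith))
  have h2 := isLittleO_foldAvg_sub hs hne (C := C) (k := k) (c₀ := pArm Q a / 8)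
    (by positivity) (hs.eventually_le_card_fold ha C k) (G := fun n _ _ => g n)
    (FoldAdapted.const hgm k) (r := fun _ => 1) (by simp) (by
      intro ε hε
      refine eventually_fst (s := fun n : ℕ => ∫⁻ y, ENNReal.ofReal (g n y ^ 2) ∂(armLaw Q a)
        ≤ ENNReal.ofReal (ε * (n * 1 ^ 2))) ?_
      set K := ∫ y, |f y| ∂(armLaw Q a) with hK
      have hK0 : 0 ≤ K := integral_nonneg fun _ => abs_nonneg _
      have hlim : Tendsto (fun n => K * rate n ^ 3) atTop (𝓝 0) := by
        simpa using (tendsto_rate.pow 3).const_mul K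
      filter_upwards [hlim.eventually (gt_mem_nhds hε), eventually_gt_atTop 0] with n h1 h2
      have h4 := mul_rate_pow_four h2
      have hρ := rate_pos h2
      have hn : (0 : ℝ) < n := by exact_mod_cast h2
      have hb : ∀ y, g n y ^ 2 ≤ (rate n)⁻¹ * |f y| := by
        intro y
        simp only [hg]
        split_ifs with h
        · rw [← sq_abs, sq, ← div_eq_inv_mul, le_div_iff₀ hρ]
          nlinarith [abs_nonneg (f y)]
        · simp only [ne_eq, OfNat.ofNat_ne_zero, not_false_eq_true, zero_pow]
          positivity
      calc ∫⁻ y, ENNReal.ofReal (g n y ^ 2) ∂(armLaw Q a)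
          ≤ ∫⁻ y, ENNReal.ofReal ((rate n)⁻¹ * |f y|) ∂(armLaw Q a) :=
            lintegral_mono fun y => ENNReal.ofReal_le_ofReal (hb y)
        _ = ENNReal.ofReal ((rate n)⁻¹ * K) := by
            rw [← ofReal_integral_eq_lintegral_ofReal (hf1.abs.const_mul _)
              (Eventually.of_forall fun _ => by positivity), integral_const_mul]
        _ ≤ _ := by
            refine ENNReal.ofReal_le_ofReal ?_
            rw [← div_eq_inv_mul, div_le_iff₀ hρ]
            calc K = (n * rate n) * (K * rate n ^ 3) := by linear_combination (-K) * h4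
              _ ≤ (n * rate n) * ε := by gcongr
              _ = _ := by ring)
  have h1' := (isLittleO_one_iff ℝ).1 h1
  have h2' := (isLittleO_one_iff ℝ).1 h2
  have h3 := (h1'.add h2').add (hE.comp tendsto_fst_probFilter)
  rw [add_zero, zero_add] at h3
  refine h3.congr fun q => ?_
  simp only [atSample, Function.comp_apply, avg_sub]
  ring

end FixedFunctions

/-! ### Learned features: adaptedness and error averages. -/

section LearnedFeatures

set_option linter.unusedSectionVars false

variable {p d : ℕ} {Ω 𝒰 : Type*} [MeasurableSpace Ω] [MeasurableSpace 𝒰]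
  {P : Measure Ω} [IsProbabilityMeasure P] {Q : Measure (FullRecord p)} [IsProbabilityMeasure Q]
  {D : ℕ → Ω → FullRecord p} {U : ℕ → Ω → 𝒰} {C : Procedure p d 𝒰}
  {φs : (Fin p → ℝ) → EuclideanSpace ℝ (Fin d)}

/-- The features learned on the sample for fold `k`. -/
noncomputable def feat (C : Procedure p d 𝒰) (D : ℕ → Ω → FullRecord p)
    (U : ℕ → Ω → 𝒰) (k : Fin 2) (q : ℕ × Ω) :
    (Fin p → ℝ) → EuclideanSpace ℝ (Fin d) :=
  C.features (sample D q.1 q.2) (U q.1 q.2) k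

/-- The split takes finitely many values, so measurability of the learner at each fixed training set
gives joint measurability. -/
theorem Procedure.measurable_features (C : Procedure p d 𝒰) (n : ℕ) (k : Fin 2) :
    Measurable fun q : ((Fin n → FullRecord p) × 𝒰) × (Fin p → ℝ) =>
      C.features (fun i => observe (q.1.1 i)) q.1.2 k q.2 := by
  have hsplit : Measurable fun q : (Fin n → FullRecord p) × 𝒰 => C.split n (trts q.1) q.2 := by
    have : Measurable fun q : (Fin n → Bool) × 𝒰 => C.split n q.1 q.2 :=
      measurable_from_prod_countable_right fun t => C.measurable_split n t
    exact this.comp ((measurable_trts.comp measurable_fst).prodMk measurable_snd)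
  have hfit : Measurable fun q : (Fin n → Fin 2) ×
      ((Fin n → ObsRecord p) × 𝒰 × (Fin p → ℝ)) =>
      (C.learner k).fit n {i | q.1 i ≠ k} q.2.1 q.2.2.1 q.2.2.2 :=
    measurable_from_prod_countable_right fun s => (C.learner k).measurable_fit n {i | s i ≠ k}
  have hobs : Measurable fun q : ((Fin n → FullRecord p) × 𝒰) × (Fin p → ℝ) =>
      (fun i => observe (q.1.1 i)) :=
    measurable_pi_lambda _ fun i =>
      measurable_observe.comp ((measurable_pi_apply i).comp (measurable_fst.comp measurable_fst))
  exact hfit.comp ((hsplit.comp measurable_fst).prodMk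
    (hobs.prodMk ((measurable_snd.comp measurable_fst).prodMk measurable_snd)))

/-- The point of cross-fitting: if a record of fold k changes while its treatment does not, the
split and all the training records stay the same. -/
theorem Procedure.features_update (C : Procedure p d 𝒰) {n : ℕ} {k : Fin 2}
    (z : Fin n → FullRecord p) (u : 𝒰) (i : Fin n) (y : FullRecord p)
    (hi : C.split n (trts z) u i = k) (hy : trt y = trt (z i)) :
    C.features (fun j => observe (Function.update z i y j)) u k
      = C.features (fun j => observe (z j)) u k := by
  have ht : trts (Function.update z i y) = trts z := by
    rw [trts_update, hy]; exact Function.update_eq_self i (trts z)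
  have hfolds : C.folds (fun j => observe (Function.update z i y j)) u
      = C.folds (fun j => observe (z j)) u := by
    have : (fun j => (observe (Function.update z i y j)).2.1) = fun j => (observe (z j)).2.1 := ht
    simp only [Procedure.folds, this]
  rw [Procedure.features, Procedure.features, hfolds]
  refine (C.learner k).fit_congr n _ _ _ u fun j hj => ?_
  have hji : j ≠ i := by
    rintro rfl
    simp only [Finset.mem_filter, Finset.mem_univ, true_and] at hj
    exact hj hi
  rw [Function.update_of_ne hji]

theorem FoldAdapted.features (C : Procedure p d 𝒰) (k : Fin 2)
    {g : ℕ → EuclideanSpace ℝ (Fin d) → FullRecord p → ℝ}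
    (hg : ∀ n, Measurable (Function.uncurry (g n))) :
    FoldAdapted C k fun n z u y =>
      g n (C.features (fun i => observe (z i)) u k (cov y)) y := by
  refine ⟨fun n => ?_, fun n z u i y hi hy => ?_⟩
  · exact (hg n).comp (((C.measurable_features n k).comp
      (measurable_fst.prodMk (measurable_cov.comp measurable_snd))).prodMk measurable_snd)
  · funext y'
    rw [C.features_update z u i y hi hy]

theorem measurable_feat (k : Fin 2) (q : ℕ × Ω) : Measurable (feat C D U k q) :=
  (C.measurable_features q.1 k).comp
    (measurable_prodMk_left (x := (records D q.1 q.2, U q.1 q.2)))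

/-- Square-integrable limits of the learned features, with the rate `o_P(n^{-1/4})`. -/
structure FeatureRate (P : Measure Ω) (Q : Measure (FullRecord p)) (D : ℕ → Ω → FullRecord p)
    (U : ℕ → Ω → 𝒰) (C : Procedure p d 𝒰) (φs : (Fin p → ℝ) → EuclideanSpace ℝ (Fin d)) :
    Prop where
  measurable : Measurable φs
  memLp : MemLp (fun z => φs (cov z)) 2 Q
  rate_le : ∀ k, ∀ ε : ℝ, 0 < ε → ∀ᶠ q in probFilter P,
    ∫⁻ z, ENNReal.ofReal (‖feat C D U k q (cov z) - φs (cov z)‖ ^ 2) ∂Q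
      ≤ ENNReal.ofReal (ε * rate q.1 ^ 2)

/-- The error of the `j`-th learned feature. -/
noncomputable def featErr (C : Procedure p d 𝒰) (D : ℕ → Ω → FullRecord p) (U : ℕ → Ω → 𝒰)
    (φs : (Fin p → ℝ) → EuclideanSpace ℝ (Fin d)) (k : Fin 2) (j : Fin d) (q : ℕ × Ω)
    (z : FullRecord p) : ℝ :=
  feat C D U k q (cov z) j - φs (cov z) j

theorem FeatureRate.featErr_le (hF : FeatureRate P Q D U C φs) (k : Fin 2) (j : Fin d) {ε : ℝ}
    (hε : 0 < ε) : ∀ᶠ q in probFilter P,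
    ∫⁻ z, ENNReal.ofReal (featErr C D U φs k j q z ^ 2) ∂Q ≤ ENNReal.ofReal (ε * rate q.1 ^ 2) := by
  filter_upwards [hF.rate_le k ε hε] with q hq
  refine le_trans (lintegral_mono fun z => ENNReal.ofReal_le_ofReal ?_) hq
  have h := EuclideanSpace.real_norm_sq_eq (feat C D U k q (cov z) - φs (cov z))
  rw [h]
  exact Finset.single_le_sum (f := fun j => (feat C D U k q (cov z) - φs (cov z)) j ^ 2)
    (fun _ _ => sq_nonneg _) (Finset.mem_univ j)

theorem FeatureRate.adapted (hF : FeatureRate P Q D U C φs) (k : Fin 2) (j : Fin d)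
    {g : ℕ → ℝ → FullRecord p → ℝ} (hg : ∀ n, Measurable (Function.uncurry (g n))) :
    FoldAdapted C k fun n z u y =>
      g n (C.features (fun i => observe (z i)) u k (cov y) j - φs (cov y) j) y := by
  refine FoldAdapted.features C k (g := fun n v y => g n (v j - φs (cov y) j) y) fun n => ?_
  refine (hg n).comp (Measurable.prodMk (Measurable.sub ?_ ?_) measurable_snd)
  · exact (by fun_prop : Measurable fun v : EuclideanSpace ℝ (Fin d) => v j).comp measurable_fst
  · exact (by fun_prop : Measurable fun v : EuclideanSpace ℝ (Fin d) => v j).comp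
      (hF.measurable.comp (measurable_cov.comp measurable_snd))

theorem FeatureRate.measurable_featErr (hF : FeatureRate P Q D U C φs) (k : Fin 2) (j : Fin d)
    (q : ℕ × Ω) : Measurable (featErr C D U φs k j q) := by
  refine Measurable.sub ?_ ?_
  · exact (by fun_prop : Measurable fun v : EuclideanSpace ℝ (Fin d) => v j).comp
      ((measurable_feat k q).comp measurable_cov)
  · exact (by fun_prop : Measurable fun v : EuclideanSpace ℝ (Fin d) => v j).comp
      (hF.measurable.comp measurable_cov)

/-- The envelope hypothesis says that g² weighs functions of X at most like K times `Q`. Applied to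
the squared feature error, it transfers the rate under `Q` to the product with g. -/
theorem FeatureRate.lintegral_mul_le (hF : FeatureRate P Q D U C φs) {a : Bool} (k : Fin 2)
    (j : Fin d) {g : ℕ → FullRecord p → ℝ} {K : ℕ → ℝ} (hK : ∀ n, 0 ≤ K n)
    (hgK : ∀ n, ∀ v : (Fin p → ℝ) → ℝ≥0∞, Measurable v →
      ∫⁻ z, v (cov z) * ENNReal.ofReal (g n z ^ 2) ∂(armLaw Q a)
        ≤ ENNReal.ofReal (K n) * ∫⁻ z, v (cov z) ∂Q) {ε : ℝ} (hε : 0 < ε) :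
    ∀ᶠ q in probFilter P,
      ∫⁻ z, ENNReal.ofReal ((g q.1 z * featErr C D U φs k j q z) ^ 2) ∂(armLaw Q a)
        ≤ ENNReal.ofReal (K q.1 * (ε * rate q.1 ^ 2)) := by
  filter_upwards [hF.featErr_le k j hε] with q hq
  have hm : Measurable fun x => ENNReal.ofReal ((feat C D U k q x j - φs x j) ^ 2) := by
    refine ((Measurable.sub ?_ ?_).pow_const 2).ennreal_ofReal
    · exact (by fun_prop : Measurable fun v : EuclideanSpace ℝ (Fin d) => v j).comp
        (measurable_feat k q)
    · exact (by fun_prop : Measurable fun v : EuclideanSpace ℝ (Fin d) => v j).comp hF.measurable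
  have h := hgK q.1 _ hm
  rw [ENNReal.ofReal_mul (hK _)]
  refine le_trans (le_of_eq ?_) (h.trans (mul_le_mul_right hq _))
  refine lintegral_congr fun z => ?_
  rw [mul_pow, mul_comm, ENNReal.ofReal_mul (sq_nonneg _)]
  rfl

/-- Conditional Markov inequality for the square of g times the feature error, whose arm mean is
o_P(n^{-1/2}). -/
theorem FeatureRate.isLittleO_l2 (hs : IsSampling P Q D U) (hF : FeatureRate P Q D U C φs)
    {a : Bool} (ha : 0 < pArm Q a) (k : Fin 2) (j : Fin d) {g : FullRecord p → ℝ}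
    (hg : Measurable g) {K : ℝ} (hK : 0 ≤ K)
    (hgK : ∀ v : (Fin p → ℝ) → ℝ≥0∞, Measurable v →
      ∫⁻ z, v (cov z) * ENNReal.ofReal (g z ^ 2) ∂(armLaw Q a)
        ≤ ENNReal.ofReal K * ∫⁻ z, v (cov z) ∂Q) :
    (fun q => l2 (fold C D U a k q) fun i => g (D i q.2) * featErr C D U φs k j q (D i q.2))
      =o[probFilter P] fun q => rate q.1 := by
  refine isLittleO_l2_of_avg_sq ?_
  refine isLittleO_foldAvg hs (measure_arm_ne_zero_of_pos ha)
    (hF.adapted k j (g := fun _ h y => (g y * h) ^ 2) fun n => by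
      exact ((hg.comp measurable_snd).mul measurable_fst).pow_const 2) (r := fun n => rate n ^ 2)
    (by filter_upwards [eventually_rate_pos] with n hn using by positivity) ?_
  intro ε hε
  filter_upwards [hF.lintegral_mul_le k j (g := fun _ => g) (K := fun _ => K) (fun _ => hK)
    (fun _ => hgK) (ε := ε / (K + 1)) (by positivity)] with q hq
  refine le_trans (le_of_eq (lintegral_congr fun z => ?_))
    (hq.trans (ENNReal.ofReal_le_ofReal ?_))
  · change ENNReal.ofReal |(g z * featErr C D U φs k j q z) ^ 2| = _
    rw [abs_of_nonneg (sq_nonneg _)]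
  · have : K * (ε / (K + 1)) ≤ ε := by
      rw [mul_div_assoc', div_le_iff₀ (by positivity)]; nlinarith
    calc K * (ε / (K + 1) * rate q.1 ^ 2) = K * (ε / (K + 1)) * rate q.1 ^ 2 := by ring
      _ ≤ _ := by gcongr

/-- Conditional Chebyshev inequality. At the target order n^{-1/2} the second moment only has to be
o_P(1), so the envelope constant may grow like √n, which leaves room for truncated weights. -/
theorem FeatureRate.isLittleO_avg_sub (hs : IsSampling P Q D U) (hF : FeatureRate P Q D U C φs)
    {a : Bool} [IsProbabilityMeasure (armLaw Q a)] (ha : 0 < pArm Q a) (k : Fin 2) (j : Fin d)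
    {g : ℕ → FullRecord p → ℝ} (hg : ∀ n, Measurable (g n)) {K : ℕ → ℝ} (hK : ∀ n, 0 ≤ K n)
    {K₀ : ℝ} (hK₀ : ∀ᶠ n in atTop, K n * rate n ^ 2 ≤ K₀)
    (hgK : ∀ n, ∀ v : (Fin p → ℝ) → ℝ≥0∞, Measurable v →
      ∫⁻ z, v (cov z) * ENNReal.ofReal (g n z ^ 2) ∂(armLaw Q a)
        ≤ ENNReal.ofReal (K n) * ∫⁻ z, v (cov z) ∂Q) :
    (fun q => avg (fold C D U a k q)
        (fun i => g q.1 (D i q.2) * featErr C D U φs k j q (D i q.2))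
        - ∫ z, g q.1 z * featErr C D U φs k j q z ∂(armLaw Q a))
      =o[probFilter P] fun q => rate q.1 ^ 2 := by
  refine isLittleO_foldAvg_sub hs (measure_arm_ne_zero_of_pos ha) (c₀ := pArm Q a / 8)
    (by positivity) (hs.eventually_le_card_fold ha C k)
    (hF.adapted k j (g := fun n h y => g n y * h) fun n => by
      exact ((hg n).comp measurable_snd).mul measurable_fst) (r := fun n => rate n ^ 2)
    (by filter_upwards [eventually_rate_pos] with n hn using by positivity) ?_
  intro ε hε
  filter_upwards [hF.lintegral_mul_le k j hK hgK (ε := ε / (|K₀| + 1)) (by positivity),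
    eventually_fst hK₀, eventually_fst (eventually_gt_atTop 0)] with q hq h1 h2
  refine le_trans hq (ENNReal.ofReal_le_ofReal ?_)
  have h4 := mul_rate_pow_four h2
  rw [← pow_mul, h4, mul_one]
  calc K q.1 * (ε / (|K₀| + 1) * rate q.1 ^ 2) = (K q.1 * rate q.1 ^ 2) * (ε / (|K₀| + 1)) := by
        ring
    _ ≤ |K₀| * (ε / (|K₀| + 1)) := by
        gcongr
        exact h1.trans (le_abs_self _)
    _ ≤ ε := by
      rw [mul_div_assoc', div_le_iff₀ (by positivity)]
      nlinarith [abs_nonneg K₀]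

end LearnedFeatures

end CrossBalancing

namespace CrossBalancing

/-! ### Change of measure by w* and envelopes. -/

section CausalModel

set_option linter.unusedSectionVars false

variable {p : ℕ} {Q : Measure (FullRecord p)} [IsProbabilityMeasure Q] {M : ℝ}

/-- The outcome residual `Y(0) - m₀(X)`. -/
noncomputable def resid (Q : Measure (FullRecord p)) [IsProbabilityMeasure Q]
    (z : FullRecord p) : ℝ := y0 z - prognostic Q (cov z)

/-- The weight `w*(X)` of a record. -/
noncomputable def wt (Q : Measure (FullRecord p)) [IsProbabilityMeasure Q]
    (z : FullRecord p) : ℝ := wStar Q (cov z)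

/-- The prognostic score `m₀(X)` of a record. -/
noncomputable def prog (Q : Measure (FullRecord p)) [IsProbabilityMeasure Q]
    (z : FullRecord p) : ℝ := prognostic Q (cov z)

theorem measurable_wt : Measurable (wt Q) := measurable_wStar.comp measurable_cov

theorem measurable_prog : Measurable (prog Q) := measurable_prognostic.comp measurable_cov

theorem measurable_resid : Measurable (resid Q) := measurable_y0.sub measurable_prog

/-- The causal assumptions, with square-integrable weights and prognostic scores. -/
structure CausalModel (Q : Measure (FullRecord p)) [IsProbabilityMeasure Q] (M : ℝ) : Prop where
  unconfounded : Unconfounded Q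
  overlap : Overlap Q
  integrable_y0 : Integrable y0 Q
  condVariance : CondVarianceBounded Q M
  memLp_wt : MemLp (wt Q) 2 Q
  memLp_prog : MemLp (prog Q) 2 Q

namespace CausalModel

theorem pArm_pos (hc : CausalModel Q M) (a : Bool) : 0 < pArm Q a := CrossBalancing.pArm_pos hc.unconfounded hc.overlap a

theorem isProbabilityMeasure (hc : CausalModel Q M) (a : Bool) : IsProbabilityMeasure (armLaw Q a) :=
  isProbabilityMeasure_armLaw hc.unconfounded hc.overlap a

theorem lintegral_arm_le (hc : CausalModel Q M) (a : Bool) (f : FullRecord p → ℝ≥0∞) :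
    ∫⁻ z, f z ∂(armLaw Q a) ≤ ENNReal.ofReal (pArm Q a)⁻¹ * ∫⁻ z, f z ∂Q := by
  rw [ENNReal.ofReal_inv_of_pos (hc.pArm_pos a), ofReal_pArm]
  exact lintegral_armLaw_le a f

theorem memLp_arm (hc : CausalModel Q M) (a : Bool) {f : FullRecord p → ℝ} {r : ℝ≥0∞} (hf : MemLp f r Q) :
    MemLp f r (armLaw Q a) := by
  rw [armLaw_eq_smul]
  exact (hf.restrict _).smul_measure
    (ENNReal.inv_ne_top.2 (measure_arm_ne_zero hc.unconfounded hc.overlap a))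

theorem wt_nonneg_arm (hc : CausalModel Q M) (a : Bool) : ∀ᵐ z ∂(armLaw Q a), 0 ≤ wt Q z :=
  (armLaw_absolutelyContinuous a).ae_le (wStar_nonneg_ae hc.overlap)

theorem lintegral_wt (hc : CausalModel Q M) {g : (Fin p → ℝ) → ℝ≥0∞} (hg : Measurable g) :
    ∫⁻ z, ENNReal.ofReal (wt Q z) * g (cov z) ∂(armLaw Q false)
      = ∫⁻ z, g (cov z) ∂(armLaw Q true) :=
  lintegral_wStar hc.unconfounded hc.overlap hg

theorem lintegral_ofReal_wt_mul (hc : CausalModel Q M) {g : (Fin p → ℝ) → ℝ} (hg : Measurable g) :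
    ∫⁻ z, ENNReal.ofReal (wt Q z * g (cov z)) ∂(armLaw Q false)
      = ∫⁻ z, ENNReal.ofReal (g (cov z)) ∂(armLaw Q true) := by
  rw [← hc.lintegral_wt (g := fun x => ENNReal.ofReal (g x)) hg.ennreal_ofReal]
  refine lintegral_congr_ae ?_
  filter_upwards [hc.wt_nonneg_arm false] with z hz
  rw [ENNReal.ofReal_mul hz]

theorem integrable_wt_mul (hc : CausalModel Q M) {g : (Fin p → ℝ) → ℝ} (hg : Measurable g)
    (hint : Integrable (fun z => g (cov z)) (armLaw Q true)) :
    Integrable (fun z => wt Q z * g (cov z)) (armLaw Q false) := by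
  refine ⟨(measurable_wt.mul (hg.comp measurable_cov)).aestronglyMeasurable, ?_⟩
  have h := hc.lintegral_ofReal_wt_mul hg.abs
  have h2 := hint.abs.lintegral_lt_top
  rw [hasFiniteIntegral_iff_norm]
  refine lt_of_le_of_lt (le_of_eq ?_) (h.trans_lt h2)
  refine lintegral_congr_ae ?_
  filter_upwards [hc.wt_nonneg_arm false] with z hz
  rw [Real.norm_eq_abs, abs_mul, abs_of_nonneg hz]

/-- Signed form of `lintegral_wt`, by positive and negative parts. -/
theorem integral_wt_mul (hc : CausalModel Q M) {g : (Fin p → ℝ) → ℝ} (hg : Measurable g)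
    (hint : Integrable (fun z => g (cov z)) (armLaw Q true)) :
    ∫ z, wt Q z * g (cov z) ∂(armLaw Q false) = ∫ z, g (cov z) ∂(armLaw Q true) := by
  rw [integral_eq_lintegral_pos_part_sub_lintegral_neg_part (hc.integrable_wt_mul hg hint),
    integral_eq_lintegral_pos_part_sub_lintegral_neg_part hint, hc.lintegral_ofReal_wt_mul hg]
  have := hc.lintegral_ofReal_wt_mul hg.neg
  simp only [Pi.neg_apply, mul_neg] at this
  rw [this]

theorem envelope_one (hc : CausalModel Q M) (a : Bool) (v : (Fin p → ℝ) → ℝ≥0∞) :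
    ∫⁻ z, v (cov z) * ENNReal.ofReal ((fun _ : FullRecord p => (1 : ℝ)) z ^ 2) ∂(armLaw Q a)
      ≤ ENNReal.ofReal (pArm Q a)⁻¹ * ∫⁻ z, v (cov z) ∂Q := by
  simpa using hc.lintegral_arm_le a fun z => v (cov z)

theorem envelope_resid (hc : CausalModel Q M) {v : (Fin p → ℝ) → ℝ≥0∞} (hv : Measurable v) :
    ∫⁻ z, v (cov z) * ENNReal.ofReal (resid Q z ^ 2) ∂(armLaw Q false)
      ≤ ENNReal.ofReal (max M 0 * (pArm Q false)⁻¹) * ∫⁻ z, v (cov z) ∂Q := by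
  rw [ENNReal.ofReal_mul (le_max_right _ _), mul_assoc]
  refine (lintegral_residual_sq_le hc.condVariance hv).trans ?_
  exact mul_le_mul' (ENNReal.ofReal_le_ofReal (le_max_left _ _))
    (hc.lintegral_arm_le false fun z => v (cov z))

/-- The square of √w* is a density that turns controls into treated, so √w* has an envelope even
when w* is unbounded. -/
theorem envelope_sqrt_wt (hc : CausalModel Q M) {v : (Fin p → ℝ) → ℝ≥0∞} (hv : Measurable v) :
    ∫⁻ z, v (cov z) * ENNReal.ofReal (√(wt Q z) ^ 2) ∂(armLaw Q false)
      ≤ ENNReal.ofReal (pArm Q true)⁻¹ * ∫⁻ z, v (cov z) ∂Q := by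
  refine le_trans (le_of_eq ?_) (hc.lintegral_arm_le true fun z => v (cov z))
  rw [← hc.lintegral_wt hv]
  refine lintegral_congr_ae ?_
  filter_upwards [hc.wt_nonneg_arm false] with z hz
  rw [Real.sq_sqrt hz, mul_comm]

/-- No integrability is asked for, since the integral of a non-integrable function is 0 by
convention. -/
theorem integral_mul_resid (hc : CausalModel Q M) {g : (Fin p → ℝ) → ℝ} (hg : Measurable g) :
    ∫ z, resid Q z * g (cov z) ∂(armLaw Q false) = 0 := by
  by_cases h : Integrable (fun z => resid Q z * g (cov z)) (armLaw Q false)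
  · simp only [mul_comm (resid Q _)] at h ⊢
    exact integral_mul_residual hc.unconfounded hc.integrable_y0 hc.overlap false hg h
  · exact integral_undef h

theorem memLp_mul_resid (hc : CausalModel Q M) {g : (Fin p → ℝ) → ℝ} (hg : Measurable g)
    (hg2 : MemLp (fun z => g (cov z)) 2 Q) :
    MemLp (fun z => resid Q z * g (cov z)) 2 (armLaw Q false) := by
  refine ⟨(measurable_resid.mul (hg.comp measurable_cov)).aestronglyMeasurable, ?_⟩
  have h := hc.envelope_resid (v := fun x => ENNReal.ofReal (g x ^ 2))
    (hg.pow_const 2).ennreal_ofReal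
  rw [lintegral_sq_eq (fun z => g (cov z))] at h
  have h2 : eLpNorm (fun z => resid Q z * g (cov z)) 2 (armLaw Q false) ^ 2 < ⊤ := by
    rw [← lintegral_sq_eq]
    refine lt_of_le_of_lt (le_trans (le_of_eq (lintegral_congr fun z => ?_)) h)
      (ENNReal.mul_lt_top ENNReal.ofReal_lt_top (ENNReal.pow_lt_top hg2.2))
    rw [mul_pow, mul_comm, ENNReal.ofReal_mul (sq_nonneg _)]
  by_contra hcon
  rw [not_lt, top_le_iff] at hcon
  simp [hcon] at h2

end CausalModel

end CausalModel

/-! ### Truncation of the weights at n^{3/8}. -/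

section Truncation

set_option linter.unusedSectionVars false

/-- The square root `n^{-1/8}` of the rate. -/
noncomputable def halfRate (n : ℕ) : ℝ := √(rate n)

theorem halfRate_sq (n : ℕ) : halfRate n ^ 2 = rate n := Real.sq_sqrt (rate_nonneg n)

theorem halfRate_pos {n : ℕ} (hn : 0 < n) : 0 < halfRate n := Real.sqrt_pos.2 (rate_pos hn)

theorem tendsto_halfRate : Tendsto halfRate atTop (𝓝 0) := by
  have h := (Real.continuous_sqrt.tendsto 0).comp tendsto_rate
  rw [Real.sqrt_zero] at h
  exact h

theorem mul_halfRate_pow {n : ℕ} (hn : 0 < n) : (n : ℝ) * halfRate n ^ 8 = 1 := by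
  have : halfRate n ^ 8 = rate n ^ 4 := by rw [← halfRate_sq]; ring
  rw [this, mul_rate_pow_four hn]

/-- The truncation level `n^{3/8}` of the weights. -/
noncomputable def level (n : ℕ) : ℝ := (halfRate n ^ 3)⁻¹

theorem level_pos {n : ℕ} (hn : 0 < n) : 0 < level n := by
  have := halfRate_pos hn
  unfold level
  positivity

theorem level_nonneg (n : ℕ) : 0 ≤ level n := by
  have : 0 ≤ halfRate n := Real.sqrt_nonneg _
  unfold level
  positivity

/-- Explains the exponent 3/8, which lies between 1/3 and 1/2: above n^{1/3}, a finite third moment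
excludes larger weights by Markov and a union bound; below n^{1/2}, the level times the squared rate
tends to zero, as the variance bounds require. -/
theorem level_mul_rate_sq {n : ℕ} (hn : 0 < n) : level n * rate n ^ 2 = halfRate n := by
  have := halfRate_pos hn
  rw [level, ← halfRate_sq]
  field_simp

variable {p : ℕ} {Q : Measure (FullRecord p)} [IsProbabilityMeasure Q] {M : ℝ}

/-- The weight, truncated at `n^{3/8}`. -/
noncomputable def truncWt (Q : Measure (FullRecord p)) [IsProbabilityMeasure Q] (n : ℕ)
    (z : FullRecord p) : ℝ :=
  if 0 ≤ wt Q z ∧ wt Q z ≤ level n then wt Q z else 0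

theorem measurable_truncWt (n : ℕ) : Measurable (truncWt Q n) :=
  Measurable.ite ((measurableSet_le measurable_const measurable_wt).inter
    (measurableSet_le measurable_wt measurable_const)) measurable_wt measurable_const

/-- One power of the weight is bounded by the level; the other is kept as the density of the treated
law. -/
theorem truncWt_sq_le (n : ℕ) (z : FullRecord p) :
    ENNReal.ofReal (truncWt Q n z ^ 2) ≤ ENNReal.ofReal (level n) * ENNReal.ofReal (wt Q z) := by
  rw [← ENNReal.ofReal_mul (level_nonneg n)]
  unfold truncWt
  split_ifs with h
  · refine ENNReal.ofReal_le_ofReal ?_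
    rw [sq]
    exact mul_le_mul_of_nonneg_right h.2 h.1
  · simp

namespace CausalModel

theorem envelope_truncWt (hc : CausalModel Q M) (n : ℕ) {v : (Fin p → ℝ) → ℝ≥0∞} (hv : Measurable v) :
    ∫⁻ z, v (cov z) * ENNReal.ofReal (truncWt Q n z ^ 2) ∂(armLaw Q false)
      ≤ ENNReal.ofReal (level n) * ∫⁻ z, v (cov z) ∂(armLaw Q true) := by
  rw [← hc.lintegral_wt hv, ← lintegral_const_mul]
  · refine lintegral_mono fun z => ?_
    calc _ ≤ v (cov z) * (ENNReal.ofReal (level n) * ENNReal.ofReal (wt Q z)) := by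
          gcongr; exact truncWt_sq_le n z
      _ = _ := by ring
  · exact measurable_wt.ennreal_ofReal.mul (hv.comp measurable_cov)

theorem envelope_truncWt' (hc : CausalModel Q M) (n : ℕ) {v : (Fin p → ℝ) → ℝ≥0∞} (hv : Measurable v) :
    ∫⁻ z, v (cov z) * ENNReal.ofReal (truncWt Q n z ^ 2) ∂(armLaw Q false)
      ≤ ENNReal.ofReal (level n * (pArm Q true)⁻¹) * ∫⁻ z, v (cov z) ∂Q := by
  rw [ENNReal.ofReal_mul (level_nonneg n), mul_assoc]
  refine (hc.envelope_truncWt n hv).trans ?_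
  gcongr
  exact hc.lintegral_arm_le true fun z => v (cov z)

/-- After the change of measure, the bias is the treated integral of v over the event that w*
exceeds the level. There 1 ≤ w*/level, and Cauchy–Schwarz applies because w* is square integrable.
-/
theorem abs_integral_truncWt_sub_le (hc : CausalModel Q M) {n : ℕ} (hn : 0 < n) {v : (Fin p → ℝ) → ℝ} (hv : Measurable v)
    (hv2 : MemLp (fun z => v (cov z)) 2 (armLaw Q true)) :
    |∫ z, truncWt Q n z * v (cov z) ∂(armLaw Q false) - ∫ z, v (cov z) ∂(armLaw Q true)|
      ≤ (level n)⁻¹ * √(∫ z, wt Q z ^ 2 ∂(armLaw Q true)) *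
        √(∫ z, v (cov z) ^ 2 ∂(armLaw Q true)) := by
  have hB := level_pos hn
  have hpr := hc.isProbabilityMeasure true
  have hw2 : MemLp (wt Q) 2 (armLaw Q true) := hc.memLp_arm true hc.memLp_wt
  set S : Set (Fin p → ℝ) := {x | 0 ≤ wStar Q x ∧ wStar Q x ≤ level n} with hS
  have hSm : MeasurableSet S := (measurableSet_le measurable_const measurable_wStar).inter
    (measurableSet_le measurable_wStar measurable_const)
  have hv1 : Integrable (fun z => v (cov z)) (armLaw Q true) := hv2.integrable (by norm_num)
  have hi : Integrable (fun z => S.indicator v (cov z)) (armLaw Q true) := by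
    refine hv1.mono ((hv.indicator hSm).comp measurable_cov).aestronglyMeasurable
      (Eventually.of_forall fun z => ?_)
    rw [Real.norm_eq_abs, Real.norm_eq_abs, Set.indicator_apply]
    split_ifs
    · exact le_rfl
    · simp
  have h1 : ∫ z, truncWt Q n z * v (cov z) ∂(armLaw Q false)
      = ∫ z, S.indicator v (cov z) ∂(armLaw Q true) := by
    rw [← hc.integral_wt_mul (hv.indicator hSm) hi]
    refine integral_congr_ae (Eventually.of_forall fun z => ?_)
    by_cases hz : 0 ≤ wStar Q (cov z) ∧ wStar Q (cov z) ≤ level n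
    · have hzS : cov z ∈ S := hz
      have e : truncWt Q n z = wt Q z := if_pos hz
      simp only [e, Set.indicator_of_mem hzS]
    · have hzS : cov z ∉ S := hz
      have e : truncWt Q n z = 0 := if_neg hz
      simp only [e, Set.indicator_of_notMem hzS, zero_mul, mul_zero]
  rw [h1, ← integral_sub hi hv1]
  have hww : MemLp (fun z => |wt Q z|) 2 (armLaw Q true) := hw2.abs
  have hvv : MemLp (fun z => |v (cov z)|) 2 (armLaw Q true) := hv2.abs
  have hprod : Integrable (fun z => |wt Q z| * |v (cov z)|) (armLaw Q true) :=
    hww.integrable_mul hvv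
  have hcs := sq_integral_mul_le hww hvv
  simp only [sq_abs] at hcs
  calc |∫ z, (S.indicator v (cov z) - v (cov z)) ∂(armLaw Q true)|
      ≤ ∫ z, |S.indicator v (cov z) - v (cov z)| ∂(armLaw Q true) := abs_integral_le_integral_abs
    _ ≤ ∫ z, (level n)⁻¹ * (|wt Q z| * |v (cov z)|) ∂(armLaw Q true) := by
        refine integral_mono_ae (hi.sub hv1).abs (hprod.const_mul _) ?_
        filter_upwards [hc.wt_nonneg_arm true] with z hz
        by_cases hzS : cov z ∈ S
        · simp only [Set.indicator_of_mem hzS, sub_self, abs_zero]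
          positivity
        · simp only [Set.indicator_of_notMem hzS, zero_sub, abs_neg]
          have hgt : level n < wt Q z := by
            by_contra hle
            exact hzS ⟨hz, not_lt.1 hle⟩
          rw [← mul_assoc, abs_of_nonneg hz]
          refine le_mul_of_one_le_left (abs_nonneg _) ?_
          rw [← div_eq_inv_mul, one_le_div hB]
          exact hgt.le
    _ = (level n)⁻¹ * ∫ z, |wt Q z| * |v (cov z)| ∂(armLaw Q true) := integral_const_mul _ _
    _ ≤ _ := by
        rw [mul_assoc]
        refine mul_le_mul_of_nonneg_left ?_ (inv_nonneg.2 hB.le)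
        rw [← Real.sqrt_mul (integral_nonneg fun _ => sq_nonneg _)]
        exact Real.le_sqrt_of_sq_le hcs

/-- One of the three powers changes the control law into the treated law, where w* is square
integrable. -/
theorem lintegral_wt_pow_three_lt_top (hc : CausalModel Q M) :
    ∫⁻ z, ENNReal.ofReal (wt Q z) ^ 3 ∂(armLaw Q false) < ⊤ := by
  have h := hc.lintegral_wt (g := fun x => ENNReal.ofReal (wStar Q x) ^ 2)
    (measurable_wStar.ennreal_ofReal.pow_const 2)
  have h2 : ∫⁻ z, ENNReal.ofReal (wt Q z) ^ 3 ∂(armLaw Q false)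
      = ∫⁻ z, ENNReal.ofReal (wStar Q (cov z)) ^ 2 ∂(armLaw Q true) := by
    rw [← h]
    refine lintegral_congr fun z => ?_
    rw [wt, ← pow_succ']
  rw [h2]
  have h3 : ∫⁻ z, ENNReal.ofReal (wt Q z ^ 2) ∂(armLaw Q true) < ⊤ := by
    rw [lintegral_sq_eq]
    exact ENNReal.pow_lt_top (hc.memLp_arm true hc.memLp_wt).2
  refine lt_of_le_of_lt (le_of_eq (lintegral_congr_ae ?_)) h3
  filter_upwards [hc.wt_nonneg_arm true] with z hz
  rw [ENNReal.ofReal_pow hz]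
  rfl

/-- Markov's inequality with the third moment: n divided by the cube of n^{3/8} is n^{-1/8}. -/
theorem tendsto_measure_level_lt (hc : CausalModel Q M) :
    Tendsto (fun n : ℕ => (n : ℝ≥0∞) * Q {z | trt z = false ∧ ¬(0 ≤ wt Q z ∧ wt Q z ≤ level n)})
      atTop (𝓝 0) := by
  set K := ∫⁻ z, ENNReal.ofReal (wt Q z) ^ 3 ∂(armLaw Q false) with hK
  have hKtop := hc.lintegral_wt_pow_three_lt_top
  have hlim : Tendsto (fun n => ENNReal.ofReal (halfRate n) * K) atTop (𝓝 0) := by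
    have h1 : Tendsto (fun n => ENNReal.ofReal (halfRate n)) atTop (𝓝 0) := by
      simpa using ENNReal.tendsto_ofReal tendsto_halfRate
    simpa using ENNReal.Tendsto.mul_const h1 (Or.inr hKtop.ne)
  refine tendsto_of_tendsto_of_tendsto_of_le_of_le' tendsto_const_nhds hlim
    (Eventually.of_forall fun _ => bot_le) ?_
  filter_upwards [eventually_gt_atTop 0] with n hn
  have hB := level_pos hn
  have hσ := halfRate_pos hn
  have hB3 : ENNReal.ofReal (level n) ^ 3 ≠ 0 := pow_ne_zero _ (ENNReal.ofReal_pos.2 hB).ne'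
  have h1 : Q {z | trt z = false ∧ ¬(0 ≤ wt Q z ∧ wt Q z ≤ level n)}
      ≤ armLaw Q false {z | ENNReal.ofReal (level n) ^ 3 ≤ ENNReal.ofReal (wt Q z) ^ 3} := by
    have hsub : Q {z | trt z = false ∧ ¬(0 ≤ wt Q z ∧ wt Q z ≤ level n)}
        ≤ armLaw Q false {z | ¬(0 ≤ wt Q z ∧ wt Q z ≤ level n)} := by
      have hne := measure_arm_ne_zero hc.unconfounded hc.overlap false
      have hms : MeasurableSet {z : FullRecord p | ¬(0 ≤ wt Q z ∧ wt Q z ≤ level n)} :=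
        ((measurableSet_le measurable_const measurable_wt).inter
          (measurableSet_le measurable_wt measurable_const)).compl
      rw [armLaw_eq_smul, Measure.smul_apply, Measure.restrict_apply hms, smul_eq_mul]
      have hsubset : {z : FullRecord p | trt z = false ∧ ¬(0 ≤ wt Q z ∧ wt Q z ≤ level n)}
          ⊆ {z | ¬(0 ≤ wt Q z ∧ wt Q z ≤ level n)} ∩ {z | trt z = false} :=
        fun z hz => ⟨hz.2, hz.1⟩
      refine (measure_mono hsubset).trans (le_mul_of_one_le_left bot_le ?_)
      exact ENNReal.one_le_inv.2 prob_le_one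
    refine hsub.trans (measure_mono_ae ?_)
    filter_upwards [hc.wt_nonneg_arm false] with z hz hzS
    have hgt : level n ≤ wt Q z := by
      by_contra hle
      exact hzS ⟨hz, (not_le.1 hle).le⟩
    exact pow_le_pow_left₀ bot_le (ENNReal.ofReal_le_ofReal hgt) 3
  have h2 := meas_ge_le_lintegral_div (μ := armLaw Q false)
    (f := fun z => ENNReal.ofReal (wt Q z) ^ 3)
    (measurable_wt.ennreal_ofReal.pow_const 3).aemeasurable hB3
    (ENNReal.pow_ne_top ENNReal.ofReal_ne_top)
  refine (mul_le_mul_right (h1.trans h2) _).trans (le_of_eq ?_)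
  rw [← hK, ENNReal.div_eq_inv_mul, ← mul_assoc, ← ENNReal.ofReal_natCast,
    ← ENNReal.ofReal_pow hB.le, ← ENNReal.ofReal_inv_of_pos (by positivity),
    ← ENNReal.ofReal_mul (Nat.cast_nonneg n)]
  congr 2
  rw [level, inv_pow, inv_inv, ← pow_mul]
  linear_combination halfRate n * mul_halfRate_pow hn

end CausalModel

variable {Ω 𝒰 : Type*} [MeasurableSpace Ω] [MeasurableSpace 𝒰]
  {P : Measure Ω} [IsProbabilityMeasure P] {D : ℕ → Ω → FullRecord p} {U : ℕ → Ω → 𝒰}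

/-- With probability tending to one no control weight exceeds `n^{3/8}`. -/
theorem IsSampling.eventually_wt_le (hs : IsSampling P Q D U) (hc : CausalModel Q M) :
    ∀ᶠ q in probFilter P, ∀ i : Fin q.1, trt (D i q.2) = false →
      0 ≤ wt Q (D i q.2) ∧ wt Q (D i q.2) ≤ level q.1 := by
  rw [eventually_probFilter]
  refine tendsto_of_tendsto_of_tendsto_of_le_of_le tendsto_const_nhds hc.tendsto_measure_level_lt
    (fun _ => bot_le) fun n => ?_
  set S : Set (FullRecord p) := {z | trt z = false ∧ ¬(0 ≤ wt Q z ∧ wt Q z ≤ level n)} with hS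
  have hSm : MeasurableSet S := (measurableSet_arm false).inter
    ((measurableSet_le measurable_const measurable_wt).inter
      (measurableSet_le measurable_wt measurable_const)).compl
  have hDi : ∀ i, P {ω | D i ω ∈ S} = Q S := by
    intro i
    rw [← (hs.hasLaw i).map_eq, Measure.map_apply_of_aemeasurable (hs.hasLaw i).aemeasurable hSm]
    rfl
  calc P {ω | ¬ ∀ i : Fin n, trt (D i ω) = false → 0 ≤ wt Q (D i ω) ∧ wt Q (D i ω) ≤ level n}
      ≤ P (⋃ i : Fin n, {ω | D i ω ∈ S}) := by
        refine measure_mono fun ω hω => ?_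
        simp only [Set.mem_ofPred_eq, not_forall] at hω
        obtain ⟨i, h1, h2⟩ := hω
        exact Set.mem_iUnion.2 ⟨i, h1, h2⟩
    _ ≤ ∑ i : Fin n, P {ω | D i ω ∈ S} := measure_iUnion_fintype_le _ _
    _ = (n : ℝ≥0∞) * Q S := by simp [hDi]

end Truncation

end CrossBalancing

namespace CrossBalancing

/-! ### Averages of feature errors against 1, the residual and w*. -/

section FeatureErrors

set_option linter.unusedSectionVars false

theorem memLp_two_of_lintegral_le {α : Type*} [MeasurableSpace α] {μ : Measure α} {f : α → ℝ}
    (hf : AEStronglyMeasurable f μ) {b : ℝ} (hb : 0 ≤ b)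
    (h : ∫⁻ x, ENNReal.ofReal (f x ^ 2) ∂μ ≤ ENNReal.ofReal b) :
    MemLp f 2 μ ∧ ∫ x, f x ^ 2 ∂μ ≤ b := by
  rw [lintegral_sq_eq] at h
  refine ⟨⟨hf, ?_⟩, ?_⟩
  · by_contra hcon
    rw [not_lt, top_le_iff] at hcon
    simp [hcon] at h
  · rw [integral_sq_eq hf]
    exact ENNReal.toReal_le_of_le_ofReal hb h

variable {p d : ℕ} {Ω 𝒰 : Type*} [MeasurableSpace Ω] [MeasurableSpace 𝒰]
  {P : Measure Ω} [IsProbabilityMeasure P] {Q : Measure (FullRecord p)} [IsProbabilityMeasure Q]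
  {D : ℕ → Ω → FullRecord p} {U : ℕ → Ω → 𝒰} {C : Procedure p d 𝒰}
  {φs : (Fin p → ℝ) → EuclideanSpace ℝ (Fin d)} {M : ℝ}

theorem FeatureRate.measurable_coord (hF : FeatureRate P Q D U C φs) (j : Fin d) :
    Measurable fun x => φs x j :=
  (by fun_prop : Measurable fun v : EuclideanSpace ℝ (Fin d) => v j).comp hF.measurable

theorem FeatureRate.memLp_coord (hF : FeatureRate P Q D U C φs) (j : Fin d) :
    MemLp (fun z => φs (cov z) j) 2 Q :=
  hF.memLp.mono ((hF.measurable_coord j).comp measurable_cov).aestronglyMeasurable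
    (Eventually.of_forall fun z => PiLp.norm_apply_le (φs (cov z)) j)

theorem FeatureRate.measurable_coord_sub (hF : FeatureRate P Q D U C φs) (k : Fin 2) (j : Fin d)
    (q : ℕ × Ω) : Measurable fun x => feat C D U k q x j - φs x j :=
  ((by fun_prop : Measurable fun v : EuclideanSpace ℝ (Fin d) => v j).comp
    (measurable_feat k q)).sub (hF.measurable_coord j)

theorem FeatureRate.eventually_memLp (hc : CausalModel Q M) (hF : FeatureRate P Q D U C φs)
    (a : Bool) (k : Fin 2) (j : Fin d) {ε : ℝ} (hε : 0 < ε) : ∀ᶠ q in probFilter P,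
    MemLp (featErr C D U φs k j q) 2 (armLaw Q a) ∧
      ∫ z, featErr C D U φs k j q z ^ 2 ∂(armLaw Q a) ≤ ε * rate q.1 ^ 2 := by
  have ha := hc.pArm_pos a
  filter_upwards [hF.featErr_le k j (ε := pArm Q a * ε) (by positivity)] with q hq
  refine memLp_two_of_lintegral_le (hF.measurable_featErr k j q).aestronglyMeasurable
    (by positivity) ?_
  refine (hc.lintegral_arm_le a _).trans ((mul_le_mul_right hq _).trans (le_of_eq ?_))
  rw [← ENNReal.ofReal_mul (by positivity)]
  congr 1
  field_simp

theorem FeatureRate.isLittleO_l2_featErr (hs : IsSampling P Q D U) (hc : CausalModel Q M)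
    (hF : FeatureRate P Q D U C φs) (a : Bool) (k : Fin 2) (j : Fin d) :
    (fun q => l2 (fold C D U a k q) fun i => featErr C D U φs k j q (D i q.2))
      =o[probFilter P] fun q => rate q.1 := by
  have ha := hc.pArm_pos a
  have h := hF.isLittleO_l2 hs ha k j (g := fun _ => 1) measurable_const
    (K := (pArm Q a)⁻¹) (by positivity) fun v _ => hc.envelope_one a v
  simpa only [one_mul] using h

theorem FeatureRate.isLittleO_l2_sqrt_wt_featErr (hs : IsSampling P Q D U) (hc : CausalModel Q M)
    (hF : FeatureRate P Q D U C φs) (k : Fin 2) (j : Fin d) :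
    (fun q => l2 (fold C D U false k q) fun i =>
      √(wt Q (D i q.2)) * featErr C D U φs k j q (D i q.2))
      =o[probFilter P] fun q => rate q.1 :=
  hF.isLittleO_l2 hs (hc.pArm_pos false) k j (g := fun z => √(wt Q z)) measurable_wt.sqrt
    (inv_nonneg.2 (hc.pArm_pos true).le) fun _ hv => hc.envelope_sqrt_wt hv

theorem FeatureRate.isLittleO_l2_resid_featErr (hs : IsSampling P Q D U) (hc : CausalModel Q M)
    (hF : FeatureRate P Q D U C φs) (k : Fin 2) (j : Fin d) :
    (fun q => l2 (fold C D U false k q) fun i =>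
      resid Q (D i q.2) * featErr C D U φs k j q (D i q.2))
      =o[probFilter P] fun q => rate q.1 :=
  hF.isLittleO_l2 hs (hc.pArm_pos false) k j measurable_resid
    (mul_nonneg (le_max_right _ _) (inv_nonneg.2 (hc.pArm_pos false).le))
    fun _ hv => hc.envelope_resid hv

theorem tendsto_const_mul_rate_sq (K : ℝ) : ∀ᶠ n in atTop, K * rate n ^ 2 ≤ 1 := by
  have h : Tendsto (fun n => K * rate n ^ 2) atTop (𝓝 0) := by
    simpa using (tendsto_rate.pow 2).const_mul K
  exact (h.eventually (gt_mem_nhds one_pos)).mono fun _ hn => hn.le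

theorem FeatureRate.isLittleO_avg_featErr_sub (hs : IsSampling P Q D U) (hc : CausalModel Q M)
    (hF : FeatureRate P Q D U C φs) (a : Bool) (k : Fin 2) (j : Fin d) :
    (fun q => avg (fold C D U a k q) (fun i => featErr C D U φs k j q (D i q.2))
        - ∫ z, featErr C D U φs k j q z ∂(armLaw Q a))
      =o[probFilter P] fun q => rate q.1 ^ 2 := by
  have ha := hc.pArm_pos a
  have := hc.isProbabilityMeasure a
  have h := hF.isLittleO_avg_sub hs ha k j (g := fun _ _ => 1) (fun _ => measurable_const)
    (K := fun _ => (pArm Q a)⁻¹) (fun _ => by positivity) (tendsto_const_mul_rate_sq _)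
    fun _ v _ => hc.envelope_one a v
  simpa only [one_mul] using h

/-- The feature error is a function of X once the other fold is fixed, so its product with the
residual has mean zero and only the fluctuation remains. -/
theorem FeatureRate.isLittleO_avg_resid_featErr (hs : IsSampling P Q D U) (hc : CausalModel Q M)
    (hF : FeatureRate P Q D U C φs) (k : Fin 2) (j : Fin d) :
    (fun q => avg (fold C D U false k q) fun i =>
        resid Q (D i q.2) * featErr C D U φs k j q (D i q.2))
      =o[probFilter P] fun q => rate q.1 ^ 2 := by
  have := hc.isProbabilityMeasure false
  have h := hF.isLittleO_avg_sub hs (hc.pArm_pos false) k j (g := fun _ => resid Q)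
    (fun _ => measurable_resid) (K := fun _ => max M 0 * (pArm Q false)⁻¹)
    (fun _ => mul_nonneg (le_max_right _ _) (inv_nonneg.2 (hc.pArm_pos false).le))
    (tendsto_const_mul_rate_sq _) fun _ v hv => hc.envelope_resid hv
  refine h.congr_left fun q => ?_
  have h0 := hc.integral_mul_resid (hF.measurable_coord_sub k j q)
  have h1 : ∫ z, resid Q z * featErr C D U φs k j q z ∂(armLaw Q false) = 0 := h0
  rw [h1, sub_zero]

/-- By Cauchy–Schwarz. This bias is not o_P(n^{-1/2}), so it has to cancel in the expansion of the
estimator. -/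
theorem FeatureRate.isLittleO_integral_featErr (hc : CausalModel Q M)
    (hF : FeatureRate P Q D U C φs) (a : Bool) (k : Fin 2) (j : Fin d) :
    (fun q => ∫ z, featErr C D U φs k j q z ∂(armLaw Q a))
      =o[probFilter P] fun q => rate q.1 := by
  have := hc.isProbabilityMeasure a
  rw [isLittleO_iff]
  intro c hcpos
  filter_upwards [hF.eventually_memLp hc a k j (pow_pos hcpos 2)] with q hq
  have h := sq_integral_mul_le hq.1 (memLp_const (1 : ℝ))
  simp only [mul_one, one_pow, integral_const, probReal_univ, smul_eq_mul] at h
  rw [Real.norm_eq_abs, Real.norm_eq_abs, abs_of_nonneg (rate_nonneg _)]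
  refine abs_le_of_sq_le_sq ?_ (mul_nonneg hcpos.le (rate_nonneg _))
  rw [mul_pow]
  exact h.trans hq.2

theorem isLittleO_halfRate_mul {r : ℕ × Ω → ℝ} :
    (fun q : ℕ × Ω => halfRate q.1 * r q) =o[probFilter P] r := by
  have h : (fun q : ℕ × Ω => halfRate q.1) =o[probFilter P] fun _ => (1 : ℝ) :=
    (isLittleO_one_iff ℝ).2 (tendsto_halfRate.comp tendsto_fst_probFilter)
  simpa using h.mul_isBigO (isBigO_refl r (probFilter P))

theorem level_inv_eq (n : ℕ) : (level n)⁻¹ = halfRate n * rate n := by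
  rw [level, inv_inv, ← halfRate_sq]; ring

theorem avg_fold_congr {a : Bool} {k : Fin 2} {q : ℕ × Ω} {f g : Fin q.1 → ℝ}
    (h : ∀ i : Fin q.1, trt (D i q.2) = a → f i = g i) :
    avg (fold C D U a k q) f = avg (fold C D U a k q) g :=
  avg_congr fun i hi => h i (mem_armFold.1 hi).1

theorem truncWt_eq {n : ℕ} {z : FullRecord p} (h : 0 ≤ wt Q z ∧ wt Q z ≤ level n) :
    truncWt Q n z = wt Q z := if_pos h

/-- The weight is replaced by its truncation, which agrees with it on all controls with probability
tending to one. The fluctuation has envelope constant n^{3/8} up to a factor, and the truncation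
bias is of order n^{-3/8} times the L² error of the feature. -/
theorem FeatureRate.isLittleO_avg_wt_featErr_sub (hs : IsSampling P Q D U) (hc : CausalModel Q M)
    (hF : FeatureRate P Q D U C φs) (k : Fin 2) (j : Fin d) :
    (fun q => avg (fold C D U false k q)
          (fun i => wt Q (D i q.2) * featErr C D U φs k j q (D i q.2))
        - ∫ z, featErr C D U φs k j q z ∂(armLaw Q true))
      =o[probFilter P] fun q => rate q.1 ^ 2 := by
  have := hc.isProbabilityMeasure false
  have hpt := hc.pArm_pos true
  have hK₀ : ∀ᶠ n in atTop, level n * (pArm Q true)⁻¹ * rate n ^ 2 ≤ (pArm Q true)⁻¹ := by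
    filter_upwards [tendsto_halfRate.eventually (gt_mem_nhds one_pos), eventually_gt_atTop 0]
      with n h1 h2
    calc level n * (pArm Q true)⁻¹ * rate n ^ 2 = halfRate n * (pArm Q true)⁻¹ := by
          rw [← level_mul_rate_sq h2]; ring
      _ ≤ _ := mul_le_of_le_one_left (by positivity) h1.le
  have h := hF.isLittleO_avg_sub hs (hc.pArm_pos false) k j (g := truncWt Q) measurable_truncWt
    (K := fun n => level n * (pArm Q true)⁻¹)
    (fun n => mul_nonneg (level_nonneg n) (by positivity)) hK₀ fun n v hv =>
      hc.envelope_truncWt' n hv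
  have hbias : (fun q => ∫ z, truncWt Q q.1 z * featErr C D U φs k j q z ∂(armLaw Q false)
      - ∫ z, featErr C D U φs k j q z ∂(armLaw Q true))
      =o[probFilter P] fun q => rate q.1 ^ 2 := by
    set W := √(∫ z, wt Q z ^ 2 ∂(armLaw Q true)) with hW
    have hO : (fun q => ∫ z, truncWt Q q.1 z * featErr C D U φs k j q z ∂(armLaw Q false)
        - ∫ z, featErr C D U φs k j q z ∂(armLaw Q true))
        =O[probFilter P] fun q => halfRate q.1 * rate q.1 ^ 2 := by
      refine IsBigO.of_bound W ?_
      filter_upwards [hF.eventually_memLp hc true k j one_pos,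
        eventually_fst (eventually_gt_atTop 0)] with q h1 h2
      have hb := hc.abs_integral_truncWt_sub_le h2 (hF.measurable_coord_sub k j q) h1.1
      refine hb.trans ?_
      have hσ := halfRate_pos h2
      have hρ := rate_pos h2
      have h3 : √(∫ z, featErr C D U φs k j q z ^ 2 ∂(armLaw Q true)) ≤ rate q.1 := by
        rw [one_mul] at h1
        exact (Real.sqrt_le_sqrt h1.2).trans (le_of_eq (Real.sqrt_sq hρ.le))
      rw [level_inv_eq, Real.norm_eq_abs, abs_of_pos (by positivity)]
      calc halfRate q.1 * rate q.1 * W * √(∫ z, featErr C D U φs k j q z ^ 2 ∂(armLaw Q true))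
          ≤ halfRate q.1 * rate q.1 * W * rate q.1 := by gcongr
        _ = _ := by ring
    exact hO.trans_isLittleO isLittleO_halfRate_mul
  refine (h.add hbias).congr' ?_ EventuallyEq.rfl
  filter_upwards [hs.eventually_wt_le hc] with q hq
  rw [sub_add_sub_cancel]
  congr 1
  exact avg_fold_congr fun i hi => by rw [truncWt_eq (hq i hi)]

/-- The product w* v need not be square integrable under the control law, so Chebyshev's inequality
is applied to the truncated weight. -/
theorem IsSampling.isLittleO_avg_wt_mul_sub (hs : IsSampling P Q D U) (hc : CausalModel Q M)
    (C : Procedure p d 𝒰) (k : Fin 2) {v : (Fin p → ℝ) → ℝ} (hv : Measurable v)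
    (hv2 : MemLp (fun z => v (cov z)) 2 Q) :
    (fun q => avg (fold C D U false k q) (fun i => wt Q (D i q.2) * v (cov (D i q.2)))
        - ∫ z, v (cov z) ∂(armLaw Q true))
      =o[probFilter P] fun q => rate q.1 := by
  have := hc.isProbabilityMeasure false
  have hpc := hc.pArm_pos false
  have hvt := hc.memLp_arm true hv2
  have h := isLittleO_foldAvg_sub hs (measure_arm_ne_zero_of_pos hpc) (c₀ := pArm Q false / 8)
    (by positivity) (hs.eventually_le_card_fold hpc C k)
    (G := fun n _ _ z => truncWt Q n z * v (cov z))
    (FoldAdapted.const (fun n => (measurable_truncWt n).mul (hv.comp measurable_cov)) k)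
    eventually_rate_pos (by
      intro ε hε
      refine eventually_fst (s := fun n : ℕ =>
        ∫⁻ z, ENNReal.ofReal ((truncWt Q n z * v (cov z)) ^ 2) ∂(armLaw Q false)
          ≤ ENNReal.ofReal (ε * (n * rate n ^ 2))) ?_
      set K := ∫ z, v (cov z) ^ 2 ∂(armLaw Q true) with hK
      have hKl : ∫⁻ z, ENNReal.ofReal (v (cov z) ^ 2) ∂(armLaw Q true) = ENNReal.ofReal K :=
        (ofReal_integral_eq_lintegral_ofReal hvt.integrable_sq
          (Eventually.of_forall fun _ => sq_nonneg _)).symm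
      have hlim : Tendsto (fun n => K * halfRate n) atTop (𝓝 0) := by
        simpa using tendsto_halfRate.const_mul K
      filter_upwards [hlim.eventually (gt_mem_nhds hε), eventually_gt_atTop 0] with n h1 h2
      have henv := hc.envelope_truncWt n (v := fun x => ENNReal.ofReal (v x ^ 2))
        (hv.pow_const 2).ennreal_ofReal
      rw [hKl, ← ENNReal.ofReal_mul (level_nonneg n)] at henv
      refine le_trans (le_of_eq (lintegral_congr fun z => ?_))
        (henv.trans (ENNReal.ofReal_le_ofReal ?_))
      · rw [mul_pow, mul_comm, ENNReal.ofReal_mul (sq_nonneg _)]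
      · have h4 := mul_rate_pow_four h2
        have hρ := rate_pos h2
        have hn : (0 : ℝ) < n := by exact_mod_cast h2
        calc level n * K = (n * rate n ^ 2) * (K * (level n * rate n ^ 2)) := by
              linear_combination (-(level n * K)) * h4
          _ = (n * rate n ^ 2) * (K * halfRate n) := by rw [level_mul_rate_sq h2]
          _ ≤ (n * rate n ^ 2) * ε := by gcongr
          _ = _ := by ring)
  have hbias : (fun q : ℕ × Ω => ∫ z, truncWt Q q.1 z * v (cov z) ∂(armLaw Q false)
      - ∫ z, v (cov z) ∂(armLaw Q true)) =o[probFilter P] fun q => rate q.1 := by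
    have hO : (fun q : ℕ × Ω => ∫ z, truncWt Q q.1 z * v (cov z) ∂(armLaw Q false)
        - ∫ z, v (cov z) ∂(armLaw Q true))
        =O[probFilter P] fun q => halfRate q.1 * rate q.1 := by
      refine IsBigO.of_bound (√(∫ z, wt Q z ^ 2 ∂(armLaw Q true)) *
        √(∫ z, v (cov z) ^ 2 ∂(armLaw Q true))) ?_
      filter_upwards [eventually_fst (eventually_gt_atTop 0)] with q h2
      refine (hc.abs_integral_truncWt_sub_le h2 hv hvt).trans (le_of_eq ?_)
      have hσ := halfRate_pos h2
      have hρ := rate_pos h2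
      rw [level_inv_eq, Real.norm_eq_abs, abs_of_pos (by positivity)]
      ring
    exact hO.trans_isLittleO isLittleO_halfRate_mul
  refine (h.add hbias).congr' ?_ EventuallyEq.rfl
  filter_upwards [hs.eventually_wt_le hc] with q hq
  simp only [atSample]
  rw [sub_add_sub_cancel]
  congr 1
  exact avg_fold_congr fun i hi => by rw [truncWt_eq (hq i hi)]

theorem IsSampling.isLittleO_avg_resid_mul (hs : IsSampling P Q D U) (hc : CausalModel Q M)
    (C : Procedure p d 𝒰) (k : Fin 2) {v : (Fin p → ℝ) → ℝ} (hv : Measurable v)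
    (hv2 : MemLp (fun z => v (cov z)) 2 Q) :
    (fun q => avg (fold C D U false k q) fun i => resid Q (D i q.2) * v (cov (D i q.2)))
      =o[probFilter P] fun q => rate q.1 := by
  have := hc.isProbabilityMeasure false
  have h := hs.isLittleO_avg_sub (hc.pArm_pos false) C k
    (measurable_resid.mul (hv.comp measurable_cov)) (hc.memLp_mul_resid hv hv2)
  refine h.congr_left fun q => ?_
  have h1 : ∫ z, resid Q z * v (cov z) ∂(armLaw Q false) = 0 := hc.integral_mul_resid hv
  simp only [Pi.mul_apply, Function.comp_apply]
  rw [h1, sub_zero]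

end FeatureErrors

end CrossBalancing

namespace CrossBalancing

/-! ### Least-norm weights with given feature moments. -/

section QuadraticProgram

variable {ι : Type*} {d : ℕ} {I : Finset ι} {F : Fin d → ι → ℝ}

/-- The empirical second-moment matrix of the features `F` over `I`. -/
noncomputable def gram (I : Finset ι) (F : Fin d → ι → ℝ) : Matrix (Fin d) (Fin d) ℝ :=
  Matrix.of fun j l => avg I fun i => F j i * F l i

/-- The coefficient vector with prescribed moments against the features. -/
noncomputable def momentCoef (I : Finset ι) (F : Fin d → ι → ℝ) (τ : Fin d → ℝ) : Fin d → ℝ :=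
  Matrix.mulVec (gram I F)⁻¹ τ

theorem avg_linear_mul (c : Fin d → ℝ) (j : Fin d) :
    (avg I fun i => (∑ l, c l * F l i) * F j i) = Matrix.mulVec (gram I F) c j := by
  simp only [Finset.sum_mul]
  rw [avg_sum]
  refine Finset.sum_congr rfl fun l _ => ?_
  simp only [gram, Matrix.of_apply]
  rw [← avg_mul_const]
  exact avg_congr fun i _ => by ring

theorem mulVec_momentCoef (hdet : (gram I F).det ≠ 0) (τ : Fin d → ℝ) :
    Matrix.mulVec (gram I F) (momentCoef I F τ) = τ := by
  rw [momentCoef, Matrix.mulVec_mulVec, Matrix.mul_nonsing_inv _ (isUnit_iff_ne_zero.2 hdet),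
    Matrix.one_mulVec]

theorem avg_momentCoef_mul (hdet : (gram I F).det ≠ 0) (τ : Fin d → ℝ) (j : Fin d) :
    (avg I fun i => (∑ l, momentCoef I F τ l * F l i) * F j i) = τ j := by
  rw [avg_linear_mul, mulVec_momentCoef hdet]

/-- When the features span 1, the mean of a weight vector is fixed by its feature moments, so
normalization follows from balance. -/
theorem avg_eq_of_intercept {a : Fin d → ℝ} (ha : ∀ i ∈ I, ∑ j, a j * F j i = 1) (w : ι → ℝ) :
    avg I w = ∑ j, a j * avg I fun i => w i * F j i := by
  simp only [← avg_const_mul]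
  rw [← avg_sum]
  refine avg_congr fun i hi => ?_
  calc w i = w i * ∑ j, a j * F j i := by rw [ha i hi, mul_one]
    _ = _ := by rw [Finset.mul_sum]; exact Finset.sum_congr rfl fun j _ => by ring

theorem avg_momentCoef {a : Fin d → ℝ} (ha : ∀ i ∈ I, ∑ j, a j * F j i = 1)
    (hdet : (gram I F).det ≠ 0) (τ : Fin d → ℝ) :
    (avg I fun i => ∑ l, momentCoef I F τ l * F l i) = ∑ j, a j * τ j := by
  rw [avg_eq_of_intercept ha]
  simp only [avg_momentCoef_mul hdet]

/-- A weight vector of least norm among those with the same feature moments is linear in the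
features. -/
theorem eq_linear_of_sum_sq_le (hdet : (gram I F).det ≠ 0) {w : ι → ℝ}
    (hmin : ∑ i ∈ I, w i ^ 2 ≤
      ∑ i ∈ I, (∑ l, momentCoef I F (fun j => avg I fun i => w i * F j i) l * F l i) ^ 2) :
    ∀ i ∈ I, w i = ∑ l, momentCoef I F (fun j => avg I fun i => w i * F j i) l * F l i := by
  set c := momentCoef I F (fun j => avg I fun i => w i * F j i) with hc
  set w' : ι → ℝ := fun i => ∑ l, c l * F l i with hw'
  rcases I.eq_empty_or_nonempty with rfl | hne
  · simp
  have hN : (0 : ℝ) < (I.card : ℝ) := by exact_mod_cast hne.card_pos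
  have hmom : ∀ j, (avg I fun i => w' i * F j i) = avg I fun i => w i * F j i := fun j =>
    avg_momentCoef_mul hdet _ j
  -- Equal moments make w − w' orthogonal to all features, hence to w', which is in their span. By
  -- Pythagoras a vector no longer than w' is w' itself.
  have horth : avg I (fun i => (w i - w' i) * w' i) = 0 := by
    have : avg I (fun i => (w i - w' i) * w' i)
        = ∑ l, c l * ((avg I fun i => w i * F l i) - avg I fun i => w' i * F l i) := by
      simp only [← avg_sub, ← avg_const_mul]
      rw [← avg_sum]
      refine avg_congr fun i _ => ?_
      rw [hw', Finset.mul_sum]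
      exact Finset.sum_congr rfl fun l _ => by ring
    rw [this]
    simp [hmom]
  have hsum : ∑ i ∈ I, (w i - w' i) * w' i = 0 := by
    rw [avg, div_eq_zero_iff] at horth
    exact horth.resolve_right hN.ne'
  have hle : ∑ i ∈ I, (w i - w' i) ^ 2 ≤ 0 := by
    have : ∑ i ∈ I, (w i - w' i) ^ 2
        = ∑ i ∈ I, w i ^ 2 - ∑ i ∈ I, w' i ^ 2 - 2 * ∑ i ∈ I, (w i - w' i) * w' i := by
      rw [Finset.mul_sum, ← Finset.sum_sub_distrib, ← Finset.sum_sub_distrib]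
      exact Finset.sum_congr rfl fun i _ => by ring
    rw [this, hsum]
    linarith
  intro i hi
  have h0 := (Finset.sum_eq_zero_iff_of_nonneg fun i _ => sq_nonneg (w i - w' i)).1
    (le_antisymm hle (Finset.sum_nonneg fun i _ => sq_nonneg _)) i hi
  exact sub_eq_zero.1 (pow_eq_zero_iff two_ne_zero |>.1 h0)

end QuadraticProgram

/-! ### Inversion of convergent random matrices. -/

section GramLimit

variable {α : Type*} {l : Filter α} {d : ℕ}

theorem tendsto_det {A : α → Matrix (Fin d) (Fin d) ℝ} {G : Matrix (Fin d) (Fin d) ℝ}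
    (h : ∀ i j, Tendsto (fun q => A q i j) l (𝓝 (G i j))) :
    Tendsto (fun q => (A q).det) l (𝓝 G.det) := by
  have hA : Tendsto A l (𝓝 G) := tendsto_pi_nhds.2 fun i => tendsto_pi_nhds.2 fun j => h i j
  exact ((continuous_id.matrix_det).tendsto G).comp hA

theorem tendsto_inv_apply {A : α → Matrix (Fin d) (Fin d) ℝ} {G : Matrix (Fin d) (Fin d) ℝ}
    (h : ∀ i j, Tendsto (fun q => A q i j) l (𝓝 (G i j))) (hG : G.det ≠ 0) (i j : Fin d) :
    Tendsto (fun q => (A q)⁻¹ i j) l (𝓝 (G⁻¹ i j)) := by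
  have hA : Tendsto A l (𝓝 G) := tendsto_pi_nhds.2 fun i => tendsto_pi_nhds.2 fun j => h i j
  have hadj : Tendsto (fun q => (A q).adjugate i j) l (𝓝 (G.adjugate i j)) :=
    ((continuous_id.matrix_adjugate.matrix_elem i j).tendsto G).comp hA
  simp only [Matrix.inv_def, Matrix.smul_apply, Ring.inverse_eq_inv', smul_eq_mul]
  exact ((tendsto_det h).inv₀ hG).mul hadj

/-- The inverses are bounded in the limit, so errors of moments become errors of coefficients at the
same rate. -/
theorem isLittleO_mulVec_inv {A : α → Matrix (Fin d) (Fin d) ℝ} {G : Matrix (Fin d) (Fin d) ℝ}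
    (h : ∀ i j, Tendsto (fun q => A q i j) l (𝓝 (G i j))) (hG : G.det ≠ 0)
    {b : α → Fin d → ℝ} {r : α → ℝ} (hb : ∀ j, (fun q => b q j) =o[l] r) (j : Fin d) :
    (fun q => Matrix.mulVec (A q)⁻¹ (b q) j) =o[l] r := by
  simp only [Matrix.mulVec, dotProduct]
  refine IsLittleO.fun_sum fun i _ => ?_
  have h1 := ((tendsto_inv_apply h hG j i).isBigO_one ℝ).mul_isLittleO (hb i)
  simpa using h1

end GramLimit

/-! ### Empirical moments of the learned features. -/

section FeatureMoments

set_option linter.unusedSectionVars false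

variable {p d : ℕ} {Ω 𝒰 : Type*} [MeasurableSpace Ω] [MeasurableSpace 𝒰]
  {P : Measure Ω} [IsProbabilityMeasure P] {Q : Measure (FullRecord p)} [IsProbabilityMeasure Q]
  {D : ℕ → Ω → FullRecord p} {U : ℕ → Ω → 𝒰} {C : Procedure p d 𝒰}
  {φs : (Fin p → ℝ) → EuclideanSpace ℝ (Fin d)} {M : ℝ}

theorem IsSampling.eventually_forall_of_ae (hs : IsSampling P Q D U) {r : FullRecord p → Prop}
    (h : ∀ᵐ z ∂Q, r z) : ∀ᶠ q in probFilter P, ∀ i : Fin q.1, r (D i q.2) := by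
  refine eventually_probFilter_of_ae (Eventually.of_forall fun n => ?_)
  change ∀ᵐ ω ∂P, ∀ i : Fin n, r (D i ω)
  refine ae_all_iff.2 fun i => ?_
  have hi := hs.hasLaw i
  rw [← hi.map_eq] at h
  exact ae_of_ae_map hi.aemeasurable h

/-- The `j`-th learned feature of fold `k` at unit `i`. -/
noncomputable def unitFeat (C : Procedure p d 𝒰) (D : ℕ → Ω → FullRecord p) (U : ℕ → Ω → 𝒰)
    (k : Fin 2) (q : ℕ × Ω) (j : Fin d) (i : Fin q.1) : ℝ :=
  feat C D U k q (cov (D i q.2)) j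

theorem unitFeat_eq (k : Fin 2) (q : ℕ × Ω) (j : Fin d) (i : Fin q.1) :
    unitFeat C D U k q j i = φs (cov (D i q.2)) j + featErr C D U φs k j q (D i q.2) := by
  simp [unitFeat, featErr]

theorem FeatureRate.isBigO_l2_coord (hs : IsSampling P Q D U) (hc : CausalModel Q M)
    (hF : FeatureRate P Q D U C φs) (a : Bool) (k : Fin 2) (j : Fin d) :
    (fun q => l2 (fold C D U a k q) fun i => φs (cov (D i q.2)) j)
      =O[probFilter P] fun _ => (1 : ℝ) := by
  have := hc.isProbabilityMeasure a
  have h := hs.tendsto_avg (hc.pArm_pos a) C k (f := fun z => φs (cov z) j ^ 2)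
    (((hF.measurable_coord j).comp measurable_cov).pow_const 2)
    (hc.memLp_arm a (hF.memLp_coord j)).integrable_sq
  exact isBigO_l2_of_tendsto h

theorem FeatureRate.isBigO_l2_unitFeat (hs : IsSampling P Q D U) (hc : CausalModel Q M)
    (hF : FeatureRate P Q D U C φs) (a : Bool) (k : Fin 2) (j : Fin d) :
    (fun q => l2 (fold C D U a k q) (unitFeat C D U k q j))
      =O[probFilter P] fun _ => (1 : ℝ) := by
  have h := isBigO_l2_add (hF.isBigO_l2_coord hs hc a k j)
    ((hF.isLittleO_l2_featErr hs hc a k j).trans isLittleO_rate_one).isBigO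
  refine h.congr_left fun q => l2_congr fun i _ => (unitFeat_eq k q j i).symm

theorem FeatureRate.isBigO_l2_resid_unitFeat (hs : IsSampling P Q D U) (hc : CausalModel Q M)
    (hF : FeatureRate P Q D U C φs) (k : Fin 2) (j : Fin d) :
    (fun q => l2 (fold C D U false k q) fun i => resid Q (D i q.2) * unitFeat C D U k q j i)
      =O[probFilter P] fun _ => (1 : ℝ) := by
  have := hc.isProbabilityMeasure false
  have h0 := hs.tendsto_avg (hc.pArm_pos false) C k
    (f := fun z => (resid Q z * φs (cov z) j) ^ 2)
    ((measurable_resid.mul ((hF.measurable_coord j).comp measurable_cov)).pow_const 2)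
    (hc.memLp_mul_resid (hF.measurable_coord j) (hF.memLp_coord j)).integrable_sq
  have h := isBigO_l2_add (isBigO_l2_of_tendsto h0)
    ((hF.isLittleO_l2_resid_featErr hs hc k j).trans isLittleO_rate_one).isBigO
  refine h.congr_left fun q => l2_congr fun i _ => ?_
  rw [unitFeat_eq (φs := φs), mul_add]

theorem FeatureRate.isLittleO_avg_resid_unitFeat (hs : IsSampling P Q D U) (hc : CausalModel Q M)
    (hF : FeatureRate P Q D U C φs) (k : Fin 2) (j : Fin d) :
    (fun q => avg (fold C D U false k q) fun i => resid Q (D i q.2) * unitFeat C D U k q j i)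
      =o[probFilter P] fun q => rate q.1 := by
  have h := (hs.isLittleO_avg_resid_mul hc C k (hF.measurable_coord j) (hF.memLp_coord j)).add
    ((hF.isLittleO_avg_resid_featErr hs hc k j).trans isLittleO_rate_sq_rate)
  refine h.congr_left fun q => ?_
  rw [← avg_add]
  refine avg_congr fun i _ => ?_
  rw [unitFeat_eq (φs := φs), mul_add]

/-- Plain Cauchy–Schwarz. The order n^{-1/4} is enough because it is used only for the rates of
coefficients. -/
theorem FeatureRate.isLittleO_avg_unitFeat_mul_featErr (hs : IsSampling P Q D U)
    (hc : CausalModel Q M) (hF : FeatureRate P Q D U C φs) (k : Fin 2) (j : Fin d)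
    (c : Fin d → ℝ) :
    (fun q => avg (fold C D U false k q) fun i =>
        (∑ l, c l * featErr C D U φs k l q (D i q.2)) * unitFeat C D U k q j i)
      =o[probFilter P] fun q => rate q.1 := by
  have h1 : (fun q => l2 (fold C D U false k q) fun i =>
      ∑ l, c l * featErr C D U φs k l q (D i q.2))
      =o[probFilter P] fun q => rate q.1 :=
    isLittleO_l2_sum fun l _ =>
      isLittleO_l2_mul_const (c l) (hF.isLittleO_l2_featErr hs hc false k l)
  simpa using IsLittleO.avg_mul h1 (hF.isBigO_l2_unitFeat hs hc false k j)

theorem FeatureRate.tendsto_gram (hs : IsSampling P Q D U) (hc : CausalModel Q M)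
    (hF : FeatureRate P Q D U C φs) (k : Fin 2) (j l : Fin d) :
    Tendsto (fun q => gram (fold C D U false k q) (unitFeat C D U k q) j l) (probFilter P)
      (𝓝 (controlSecondMoment Q φs j l)) := by
  have := hc.isProbabilityMeasure false
  have h0 := hs.tendsto_avg (hc.pArm_pos false) C k
    (f := fun z => φs (cov z) j * φs (cov z) l)
    (((hF.measurable_coord j).comp measurable_cov).mul
      ((hF.measurable_coord l).comp measurable_cov))
    ((hc.memLp_arm false (hF.memLp_coord j)).integrable_mul
      (hc.memLp_arm false (hF.memLp_coord l)))
  have h1 := (IsLittleO.avg_mul (hF.isLittleO_l2_featErr hs hc false k j)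
    (hF.isBigO_l2_unitFeat hs hc false k l))
  have h2 := (IsLittleO.avg_mul (hF.isLittleO_l2_featErr hs hc false k l)
    (hF.isBigO_l2_coord hs hc false k j))
  simp only [mul_one] at h1 h2
  have h1' := (isLittleO_one_iff ℝ).1 (h1.trans isLittleO_rate_one)
  have h2' := (isLittleO_one_iff ℝ).1 (h2.trans isLittleO_rate_one)
  have h := (h0.add h1').add h2'
  rw [add_zero, add_zero] at h
  refine h.congr fun q => ?_
  rw [← avg_add, ← avg_add]
  simp only [gram, Matrix.of_apply]
  refine avg_congr fun i _ => ?_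
  rw [unitFeat_eq (φs := φs) k q j, unitFeat_eq (φs := φs) k q l]
  ring

theorem FeatureRate.eventually_det_ne_zero (hs : IsSampling P Q D U) (hc : CausalModel Q M)
    (hF : FeatureRate P Q D U C φs) (hG : (controlSecondMoment Q φs).det ≠ 0) (k : Fin 2) :
    ∀ᶠ q in probFilter P, (gram (fold C D U false k q) (unitFeat C D U k q)).det ≠ 0 :=
  (tendsto_det (hF.tendsto_gram hs hc k)).eventually_ne hG

end FeatureMoments

end CrossBalancing

namespace CrossBalancing

/-! ### Structure and convergence of the balancing weights. -/

section BalancingWeights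

set_option linter.unusedSectionVars false

variable {p d : ℕ} {Ω 𝒰 : Type*} [MeasurableSpace Ω] [MeasurableSpace 𝒰]
  {P : Measure Ω} [IsProbabilityMeasure P] {Q : Measure (FullRecord p)} [IsProbabilityMeasure Q]
  {D : ℕ → Ω → FullRecord p} {U : ℕ → Ω → 𝒰} {C : Procedure p d 𝒰}
  {φs : (Fin p → ℝ) → EuclideanSpace ℝ (Fin d)} {M : ℝ}
  {w : ∀ n : ℕ, Ω → Fin n → ℝ} {lam β : Fin d → ℝ}

/-- The standing assumptions on a cross-balancing procedure and its weights: the limits of the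
features span the weights and the prognostic score, and have a nonsingular second moment. -/
structure BalancingModel (P : Measure Ω) (Q : Measure (FullRecord p)) [IsProbabilityMeasure Q]
    (D : ℕ → Ω → FullRecord p) (U : ℕ → Ω → 𝒰) (C : Procedure p d 𝒰)
    (φs : (Fin p → ℝ) → EuclideanSpace ℝ (Fin d)) (M : ℝ) (w : ∀ n : ℕ, Ω → Fin n → ℝ)
    (lam β : Fin d → ℝ) : Prop where
  sampling : IsSampling P Q D U
  causal : CausalModel Q M
  rate : FeatureRate P Q D U C φs
  det_ne_zero : (controlSecondMoment Q φs).det ≠ 0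
  isWeights : ∀ᶠ q in probFilter P, C.IsWeights (sample D q.1 q.2) (U q.1 q.2) (w q.1 q.2)
  tol_isLittleO : ∀ j, (fun n => C.tol n j) =o[atTop] fun n => CrossBalancing.rate n ^ 2
  wt_eq : ∀ᵐ z ∂Q, wt Q z = ∑ j, lam j * φs (cov z) j
  prog_eq : ∀ᵐ z ∂Q, prog Q z = ∑ j, β j * φs (cov z) j

/-- The learned features span the constant `1`, with coefficients `a`. -/
def SpansOne (C : Procedure p d 𝒰) (D : ℕ → Ω → FullRecord p) (U : ℕ → Ω → 𝒰)
    (a : Fin d → ℝ) : Prop :=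
  ∀ k q x, ∑ j, a j * feat C D U k q x j = 1

/-- The share of the treated units of fold `l` in the balancing target of fold `k`. -/
noncomputable def targetShare (C : Procedure p d 𝒰) (D : ℕ → Ω → FullRecord p) (U : ℕ → Ω → 𝒰)
    (k l : Fin 2) (q : ℕ × Ω) : ℝ :=
  match C.target with
  | .allTreated => share C D U true l q
  | .ownFold => if l = k then 1 else 0

/-- The balancing target of fold `k` at the sample. -/
noncomputable def sampleTarget (C : Procedure p d 𝒰) (D : ℕ → Ω → FullRecord p) (U : ℕ → Ω → 𝒰)
    (k : Fin 2) (q : ℕ × Ω) (j : Fin d) : ℝ :=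
  treatedTarget C.target (sample D q.1 q.2) (C.folds (sample D q.1 q.2) (U q.1 q.2))
    (C.features (sample D q.1 q.2) (U q.1 q.2)) k j

/-- Both conventions for the target become mixtures of fold means with shares that sum to one, so
the later analysis can treat them together. -/
theorem sampleTarget_eq {q : ℕ × Ω} (h : ∀ k, (0 : ℝ) < ((fold C D U true k q).card : ℝ))
    (k : Fin 2) (j : Fin d) :
    sampleTarget C D U k q j
      = ∑ l, targetShare C D U k l q * avg (fold C D U true l q) (unitFeat C D U l q j) := by
  unfold sampleTarget targetShare treatedTarget
  cases C.target with
  | ownFold =>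
    simp only [ite_mul, one_mul, zero_mul, Finset.sum_ite_eq', Finset.mem_univ, if_true]
    rfl
  | allTreated =>
    refine (avg_arm_eq (a := true) h _).trans ?_
    refine Finset.sum_congr rfl fun l _ => ?_
    congr 1
    refine avg_congr fun i hi => ?_
    have hl : C.folds (sample D q.1 q.2) (U q.1 q.2) i = l := (mem_armFold.1 hi).2
    rw [hl]
    rfl

theorem sum_targetShare {q : ℕ × Ω} (h : ∀ k, (0 : ℝ) < ((fold C D U true k q).card : ℝ))
    (k : Fin 2) : ∑ l, targetShare C D U k l q = 1 := by
  unfold targetShare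
  cases C.target with
  | ownFold => simp
  | allTreated => exact sum_share h

/-- The coefficients of the weights of fold `k` in the learned features. -/
noncomputable def weightCoef (C : Procedure p d 𝒰) (D : ℕ → Ω → FullRecord p) (U : ℕ → Ω → 𝒰)
    (w : ∀ n : ℕ, Ω → Fin n → ℝ) (k : Fin 2) (q : ℕ × Ω) : Fin d → ℝ :=
  momentCoef (fold C D U false k q) (unitFeat C D U k q)
    fun j => avg (fold C D U false k q) fun i => w q.1 q.2 i * unitFeat C D U k q j i

/-- With an invertible Gram matrix, exact balance is attainable, so the program is feasible and has
a solution by hypothesis. Replacing the solution by the linear weight with the same moments keeps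
feasibility, so minimality makes it linear. -/
theorem weights_eq_linear {a : Fin d → ℝ} (ha : SpansOne C D U a) {q : ℕ × Ω}
    (ht : ∀ k, (0 : ℝ) < ((fold C D U true k q).card : ℝ))
    (hw : C.IsWeights (sample D q.1 q.2) (U q.1 q.2) (w q.1 q.2)) {k : Fin 2}
    (hdet : (gram (fold C D U false k q) (unitFeat C D U k q)).det ≠ 0) :
    (∀ i ∈ fold C D U false k q,
      w q.1 q.2 i = ∑ j, weightCoef C D U w k q j * unitFeat C D U k q j i) ∧
    ∀ j, |avg (fold C D U false k q) (fun i => w q.1 q.2 i * unitFeat C D U k q j i)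
      - sampleTarget C D U k q j| ≤ C.tol q.1 j := by
  have ha1 : ∀ i ∈ fold C D U false k q, ∑ j, a j * unitFeat C D U k q j i = 1 :=
    fun i _ => ha k q _
  -- The target is a mixture of treated means of features, and the same coefficients a span 1 with
  -- the features of either fold.
  have haτ : ∑ j, a j * sampleTarget C D U k q j = 1 := by
    simp only [sampleTarget_eq ht, Finset.mul_sum]
    rw [Finset.sum_comm]
    have : ∀ l, ∑ j, a j * (targetShare C D U k l q
        * avg (fold C D U true l q) (unitFeat C D U l q j)) = targetShare C D U k l q := by
      intro l
      calc ∑ j, a j * (targetShare C D U k l q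
              * avg (fold C D U true l q) (unitFeat C D U l q j))
          = targetShare C D U k l q * avg (fold C D U true l q)
              (fun i => ∑ j, a j * unitFeat C D U l q j i) := by
            rw [avg_sum, Finset.mul_sum]
            refine Finset.sum_congr rfl fun j _ => ?_
            rw [avg_const_mul]; ring
        _ = _ := by
            have e : ∀ i : Fin q.1, ∑ j, a j * unitFeat C D U l q j i = 1 := fun i =>
              ha l q (cov (D i q.2))
            simp only [e, avg_const (ht l), mul_one]
    simp only [this]
    exact sum_targetShare ht k
  have hfeas : ∀ w' : Fin q.1 → ℝ, Feasible C.target (sample D q.1 q.2)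
      (C.folds (sample D q.1 q.2) (U q.1 q.2)) (C.features (sample D q.1 q.2) (U q.1 q.2))
      (C.tol q.1) k w' ↔
      (∀ j, |avg (fold C D U false k q) (fun i => w' i * unitFeat C D U k q j i)
        - sampleTarget C D U k q j| ≤ C.tol q.1 j) ∧ avg (fold C D U false k q) w' = 1 :=
    fun w' => Iff.rfl
  obtain ⟨hsol, hmin⟩ := hw k ⟨fun i => ∑ l, momentCoef (fold C D U false k q)
    (unitFeat C D U k q) (sampleTarget C D U k q) l * unitFeat C D U k q l i, by
      rw [hfeas]
      refine ⟨fun j => ?_, ?_⟩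
      · rw [avg_momentCoef_mul hdet, sub_self, abs_zero]
        exact C.tol_nonneg _ _
      · rw [avg_momentCoef ha1 hdet, haτ]⟩
  rw [hfeas] at hsol
  refine ⟨eq_linear_of_sum_sq_le hdet ?_, hsol.1⟩
  -- The competitor has the moments of w, so it meets the same tolerances, and through a it inherits
  -- the mean one.
  refine hmin _ ?_
  rw [hfeas]
  refine ⟨fun j => ?_, ?_⟩
  · rw [avg_momentCoef_mul hdet]
    exact hsol.1 j
  · rw [avg_momentCoef ha1 hdet, ← avg_eq_of_intercept ha1, hsol.2]

namespace BalancingModel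

theorem eventually_weights_eq (h : BalancingModel P Q D U C φs M w lam β) {a : Fin d → ℝ}
    (ha : SpansOne C D U a) (k : Fin 2) : ∀ᶠ q in probFilter P,
    (∀ i ∈ fold C D U false k q,
      w q.1 q.2 i = ∑ j, weightCoef C D U w k q j * unitFeat C D U k q j i) ∧
    ∀ j, |avg (fold C D U false k q) (fun i => w q.1 q.2 i * unitFeat C D U k q j i)
      - sampleTarget C D U k q j| ≤ C.tol q.1 j := by
  have ht := fun k => h.sampling.eventually_card_fold_pos (h.causal.pArm_pos true) C k
  filter_upwards [h.isWeights, ht 0, ht 1,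
    h.rate.eventually_det_ne_zero h.sampling h.causal h.det_ne_zero k] with q h1 h2 h3 h4
  exact weights_eq_linear ha (Fin.forall_fin_two.2 ⟨h2, h3⟩) h1 h4

theorem eventually_wt_eq (h : BalancingModel P Q D U C φs M w lam β) :
    ∀ᶠ q in probFilter P, ∀ i : Fin q.1,
      wt Q (D i q.2) = ∑ j, lam j * φs (cov (D i q.2)) j :=
  h.sampling.eventually_forall_of_ae h.wt_eq

theorem eventually_prog_eq (h : BalancingModel P Q D U C φs M w lam β) :
    ∀ᶠ q in probFilter P, ∀ i : Fin q.1,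
      prog Q (D i q.2) = ∑ j, β j * φs (cov (D i q.2)) j :=
  h.sampling.eventually_forall_of_ae h.prog_eq

theorem isBigO_targetShare (h : BalancingModel P Q D U C φs M w lam β) (k l : Fin 2) :
    (targetShare C D U k l) =O[probFilter P] fun _ => (1 : ℝ) := by
  have hsh := (h.sampling.tendsto_share (h.causal.pArm_pos true) C l).isBigO_one ℝ
  have : targetShare C D U k l = fun q => match C.target with
    | .allTreated => share C D U true l q
    | .ownFold => if l = k then 1 else 0 := rfl
  rw [this]
  cases C.target with
  | allTreated => exact hsh
  | ownFold => exact isBigO_const_const _ one_ne_zero _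

theorem isLittleO_avg_unitFeat_sub (h : BalancingModel P Q D U C φs M w lam β) (k : Fin 2)
    (j : Fin d) :
    (fun q => avg (fold C D U true k q) (unitFeat C D U k q j)
        - ∫ z, φs (cov z) j ∂(armLaw Q true)) =o[probFilter P] fun q => CrossBalancing.rate q.1 := by
  have := h.causal.isProbabilityMeasure true
  have h1 := h.sampling.isLittleO_avg_sub (h.causal.pArm_pos true) C k
    (f := fun z => φs (cov z) j) ((h.rate.measurable_coord j).comp measurable_cov)
    (h.causal.memLp_arm true (h.rate.memLp_coord j))
  have h2 := ((h.rate.isLittleO_avg_featErr_sub h.sampling h.causal true k j).trans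
    isLittleO_rate_sq_rate).add (h.rate.isLittleO_integral_featErr h.causal true k j)
  refine (h1.add h2).congr_left fun q => ?_
  have : avg (fold C D U true k q) (unitFeat C D U k q j)
      = avg (fold C D U true k q) (fun i => φs (cov (D i q.2)) j)
        + avg (fold C D U true k q) (fun i => featErr C D U φs k j q (D i q.2)) := by
    rw [← avg_add]
    exact avg_congr fun i _ => unitFeat_eq k q j i
  rw [this]
  ring

theorem isLittleO_sampleTarget_sub (h : BalancingModel P Q D U C φs M w lam β) (k : Fin 2)
    (j : Fin d) :
    (fun q => sampleTarget C D U k q j - ∫ z, φs (cov z) j ∂(armLaw Q true))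
      =o[probFilter P] fun q => CrossBalancing.rate q.1 := by
  have h1 : (fun q => ∑ l, targetShare C D U k l q *
      (avg (fold C D U true l q) (unitFeat C D U l q j)
        - ∫ z, φs (cov z) j ∂(armLaw Q true)))
      =o[probFilter P] fun q => CrossBalancing.rate q.1 := by
    refine IsLittleO.fun_sum fun l _ => ?_
    simpa using (h.isBigO_targetShare k l).mul_isLittleO (h.isLittleO_avg_unitFeat_sub l j)
  have ht := fun k => h.sampling.eventually_card_fold_pos (h.causal.pArm_pos true) C k
  refine h1.congr' ?_ EventuallyEq.rfl
  filter_upwards [ht 0, ht 1] with q h2 h3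
  have hpos : ∀ k, (0 : ℝ) < ((fold C D U true k q).card : ℝ) := Fin.forall_fin_two.2 ⟨h2, h3⟩
  rw [sampleTarget_eq hpos]
  simp only [mul_sub, Finset.sum_sub_distrib]
  rw [← Finset.sum_mul, sum_targetShare hpos, one_mul]

/-- The coefficients of the weights converge at the rate `o_P(n^{-1/4})`. -/
theorem isLittleO_weightCoef_sub (h : BalancingModel P Q D U C φs M w lam β) {a : Fin d → ℝ}
    (ha : SpansOne C D U a) (k : Fin 2) (j : Fin d) :
    (fun q => weightCoef C D U w k q j - lam j)
      =o[probFilter P] fun q => CrossBalancing.rate q.1 := by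
  -- This vector is the Gram matrix applied to the coefficient error.
  set b : ℕ × Ω → Fin d → ℝ := fun q j =>
    (avg (fold C D U false k q) fun i => w q.1 q.2 i * unitFeat C D U k q j i)
      - Matrix.mulVec (gram (fold C D U false k q) (unitFeat C D U k q)) lam j with hb
  -- The moments of the weights are within tolerance of the target, which estimates the treated mean
  -- of φ*. The moments of w* estimate the same mean, and λ*ᵀφ̂ differs from w* by feature errors
  -- only.
  have hbo : ∀ j, (fun q => b q j) =o[probFilter P] fun q => CrossBalancing.rate q.1 := by
    intro j
    have e1 : (fun q => avg (fold C D U false k q) (fun i => w q.1 q.2 i * unitFeat C D U k q j i)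
        - sampleTarget C D U k q j) =o[probFilter P] fun q => CrossBalancing.rate q.1 := by
      have : (fun q => avg (fold C D U false k q)
          (fun i => w q.1 q.2 i * unitFeat C D U k q j i) - sampleTarget C D U k q j)
          =O[probFilter P] fun q => C.tol q.1 j := by
        refine IsBigO.of_bound 1 ?_
        filter_upwards [h.eventually_weights_eq ha k] with q hq
        rw [one_mul, Real.norm_eq_abs, Real.norm_eq_abs, abs_of_nonneg (C.tol_nonneg _ _)]
        exact hq.2 j
      exact this.trans_isLittleO ((isLittleO_fst (h.tol_isLittleO j)).trans isLittleO_rate_sq_rate)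
    have e2 := h.isLittleO_sampleTarget_sub k j
    have e3 := h.sampling.isLittleO_avg_wt_mul_sub h.causal C k (h.rate.measurable_coord j)
      (h.rate.memLp_coord j)
    have e4 := ((h.rate.isLittleO_avg_wt_featErr_sub h.sampling h.causal k j).trans
      isLittleO_rate_sq_rate).add (h.rate.isLittleO_integral_featErr h.causal true k j)
    have e5 := h.rate.isLittleO_avg_unitFeat_mul_featErr h.sampling h.causal k j lam
    refine ((((e1.add e2).sub e3).sub e4).sub e5).congr' ?_ EventuallyEq.rfl
    filter_upwards [h.eventually_wt_eq] with q hq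
    have hgram : Matrix.mulVec (gram (fold C D U false k q) (unitFeat C D U k q)) lam j
        = (avg (fold C D U false k q) fun i => wt Q (D i q.2) * φs (cov (D i q.2)) j)
          + (avg (fold C D U false k q) fun i =>
            wt Q (D i q.2) * featErr C D U φs k j q (D i q.2))
          + avg (fold C D U false k q) fun i =>
            (∑ l, lam l * featErr C D U φs k l q (D i q.2)) * unitFeat C D U k q j i := by
      rw [← avg_linear_mul, ← avg_add, ← avg_add]
      refine avg_congr fun i _ => ?_
      have hlin : ∑ l, lam l * unitFeat C D U k q l i
          = wt Q (D i q.2) + ∑ l, lam l * featErr C D U φs k l q (D i q.2) := by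
        rw [hq i, ← Finset.sum_add_distrib]
        refine Finset.sum_congr rfl fun l _ => ?_
        rw [unitFeat_eq (φs := φs), mul_add]
      rw [hlin, add_mul, unitFeat_eq (φs := φs) k q j, mul_add]
    simp only [hb]
    rw [hgram]
    ring
  refine (isLittleO_mulVec_inv (h.rate.tendsto_gram h.sampling h.causal k) h.det_ne_zero hbo
    j).congr' ?_ EventuallyEq.rfl
  filter_upwards [h.rate.eventually_det_ne_zero h.sampling h.causal h.det_ne_zero k] with q hq
  have : b q = (fun j => avg (fold C D U false k q)
      fun i => w q.1 q.2 i * unitFeat C D U k q j i)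
      - Matrix.mulVec (gram (fold C D U false k q) (unitFeat C D U k q)) lam := rfl
  rw [this, Matrix.mulVec_sub, Matrix.mulVec_mulVec,
    Matrix.nonsing_inv_mul _ (isUnit_iff_ne_zero.2 hq), Matrix.one_mulVec]
  rfl

theorem eventually_weight_sub_eq (h : BalancingModel P Q D U C φs M w lam β) {a : Fin d → ℝ}
    (ha : SpansOne C D U a) (k : Fin 2) : ∀ᶠ q in probFilter P,
    ∀ i ∈ fold C D U false k q, w q.1 q.2 i - wt Q (D i q.2)
      = (∑ j, (weightCoef C D U w k q j - lam j) * unitFeat C D U k q j i)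
        + ∑ j, lam j * featErr C D U φs k j q (D i q.2) := by
  filter_upwards [h.eventually_weights_eq ha k, h.eventually_wt_eq] with q h1 h2 i hi
  rw [h1.1 i hi, h2 i, ← Finset.sum_sub_distrib, ← Finset.sum_add_distrib]
  refine Finset.sum_congr rfl fun j _ => ?_
  rw [unitFeat_eq (φs := φs)]
  ring

/-- The weights converge to `w*` in the empirical `L²` norm at the rate `o_P(n^{-1/4})`. -/
theorem isLittleO_l2_weight_sub (h : BalancingModel P Q D U C φs M w lam β) {a : Fin d → ℝ}
    (ha : SpansOne C D U a) (k : Fin 2) :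
    (fun q => l2 (fold C D U false k q) fun i => w q.1 q.2 i - wt Q (D i q.2))
      =o[probFilter P] fun q => CrossBalancing.rate q.1 := by
  refine isLittleO_l2_congr (h.eventually_weight_sub_eq ha k) (isLittleO_l2_add ?_ ?_)
  · refine isLittleO_l2_sum fun j _ => ?_
    simpa using isLittleO_l2_const_mul (h.isLittleO_weightCoef_sub ha k j)
      (h.rate.isBigO_l2_unitFeat h.sampling h.causal false k j)
  · exact isLittleO_l2_sum fun j _ =>
      isLittleO_l2_mul_const _ (h.rate.isLittleO_l2_featErr h.sampling h.causal false k j)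

/-- A Cauchy–Schwarz bound would ask for fourth moments. Instead the weight error is expanded in
features and feature errors, whose products with the residual are controlled by the conditional
variance bound. -/
theorem isLittleO_l2_weight_sub_mul_resid (h : BalancingModel P Q D U C φs M w lam β)
    {a : Fin d → ℝ} (ha : SpansOne C D U a) (k : Fin 2) :
    (fun q => l2 (fold C D U false k q) fun i =>
      (w q.1 q.2 i - wt Q (D i q.2)) * resid Q (D i q.2))
      =o[probFilter P] fun q => CrossBalancing.rate q.1 := by
  refine isLittleO_l2_congr (g := fun (q : ℕ × Ω) (i : Fin q.1) =>
      (∑ j, (weightCoef C D U w k q j - lam j) * (resid Q (D i q.2) * unitFeat C D U k q j i))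
        + ∑ j, lam j * (resid Q (D i q.2) * featErr C D U φs k j q (D i q.2))) ?_
    (isLittleO_l2_add ?_ ?_)
  · filter_upwards [h.eventually_weight_sub_eq ha k] with q hq i hi
    rw [hq i hi, add_mul, Finset.sum_mul, Finset.sum_mul]
    congr 1 <;> exact Finset.sum_congr rfl fun j _ => by ring
  · refine isLittleO_l2_sum fun j _ => ?_
    simpa using isLittleO_l2_const_mul (h.isLittleO_weightCoef_sub ha k j)
      (h.rate.isBigO_l2_resid_unitFeat h.sampling h.causal k j)
  · exact isLittleO_l2_sum fun j _ =>
      isLittleO_l2_mul_const _ (h.rate.isLittleO_l2_resid_featErr h.sampling h.causal k j)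

/-- Products of rates: coefficient errors and residual–feature averages are each o_P(n^{-1/4}). The
part due to feature errors is o_P(n^{-1/2}) because it is centred given the other fold. -/
theorem isLittleO_avg_weight_sub_mul_resid (h : BalancingModel P Q D U C φs M w lam β)
    {a : Fin d → ℝ} (ha : SpansOne C D U a) (k : Fin 2) :
    (fun q => avg (fold C D U false k q) fun i =>
      (w q.1 q.2 i - wt Q (D i q.2)) * resid Q (D i q.2))
      =o[probFilter P] fun q => CrossBalancing.rate q.1 ^ 2 := by
  have h1 : (fun q => ∑ j, (weightCoef C D U w k q j - lam j) *
      avg (fold C D U false k q) fun i => resid Q (D i q.2) * unitFeat C D U k q j i)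
      =o[probFilter P] fun q => CrossBalancing.rate q.1 ^ 2 := by
    refine IsLittleO.fun_sum fun j _ => ?_
    simpa only [sq] using (h.isLittleO_weightCoef_sub ha k j).mul
      (h.rate.isLittleO_avg_resid_unitFeat h.sampling h.causal k j)
  have h2 : (fun q => ∑ j, lam j *
      avg (fold C D U false k q) fun i => resid Q (D i q.2) * featErr C D U φs k j q (D i q.2))
      =o[probFilter P] fun q => CrossBalancing.rate q.1 ^ 2 :=
    IsLittleO.fun_sum fun j _ =>
      (h.rate.isLittleO_avg_resid_featErr h.sampling h.causal k j).const_mul_left _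
  refine (h1.add h2).congr' ?_ EventuallyEq.rfl
  filter_upwards [h.eventually_weight_sub_eq ha k] with q hq
  simp only [← avg_const_mul]
  rw [← avg_sum, ← avg_sum, ← avg_add]
  refine avg_congr fun i hi => ?_
  rw [hq i hi, add_mul, Finset.sum_mul, Finset.sum_mul]
  congr 1 <;> exact Finset.sum_congr rfl fun j _ => by ring

end BalancingModel

end BalancingWeights

end CrossBalancing

namespace CrossBalancing

/-! ### Asymptotic linear expansion of the estimator. -/

section Expansion

set_option linter.unusedSectionVars false

variable {p d : ℕ} {Ω 𝒰 : Type*} [MeasurableSpace Ω] [MeasurableSpace 𝒰]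
  {P : Measure Ω} [IsProbabilityMeasure P] {Q : Measure (FullRecord p)} [IsProbabilityMeasure Q]
  {D : ℕ → Ω → FullRecord p} {U : ℕ → Ω → 𝒰} {C : Procedure p d 𝒰}
  {φs : (Fin p → ℝ) → EuclideanSpace ℝ (Fin d)} {M : ℝ}
  {w : ∀ n : ℕ, Ω → Fin n → ℝ} {lam β : Fin d → ℝ}

/-- The total weight of the treated units of fold `l` in the balancing targets. -/
noncomputable def totalTargetShare (C : Procedure p d 𝒰) (D : ℕ → Ω → FullRecord p)
    (U : ℕ → Ω → 𝒰) (l : Fin 2) (q : ℕ × Ω) : ℝ :=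
  ∑ k, share C D U false k q * targetShare C D U k l q

/-- Under either convention the total is the share of fold l in one of the arms, so it is close to
1/2. This lets the biases cancel. -/
theorem totalTargetShare_eq {q : ℕ × Ω}
    (h : ∀ k, (0 : ℝ) < ((fold C D U false k q).card : ℝ)) (l : Fin 2) :
    totalTargetShare C D U l q = match C.target with
      | .allTreated => share C D U true l q
      | .ownFold => share C D U false l q := by
  unfold totalTargetShare targetShare
  cases C.target with
  | allTreated => simp only [← Finset.sum_mul]; rw [sum_share h, one_mul]
  | ownFold => simp

theorem thetaHat_eq (D : ℕ → Ω → FullRecord p) (w : ∀ n : ℕ, Ω → Fin n → ℝ) (q : ℕ × Ω) :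
    thetaHat (sample D q.1 q.2) (w q.1 q.2)
      = avg (armSet D false q) fun i => w q.1 q.2 i * y0 (D i q.2) := by
  refine avg_congr (I := armSet D false q) fun i hi => ?_
  have hi' : trt (D i q.2) = false := by
    have := hi
    simp only [armSet, arm, Finset.mem_filter, Finset.mem_univ, true_and] at this
    exact this
  simp [sample, observe, hi']

namespace CausalModel

theorem isLittleO_share_sub (hc : CausalModel Q M) (hs : IsSampling P Q D U)
    (C : Procedure p d 𝒰) (a b : Bool) (k : Fin 2) :
    (fun q => share C D U a k q - share C D U b k q)
      =o[probFilter P] fun q => rate q.1 := by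
  refine ((hs.isLittleO_share_sub (hc.pArm_pos a) C k).sub
    (hs.isLittleO_share_sub (hc.pArm_pos b) C k)).congr_left fun q => ?_
  ring

theorem eventually_card_pos (hc : CausalModel Q M) (hs : IsSampling P Q D U)
    (C : Procedure p d 𝒰) (a : Bool) :
    ∀ᶠ q in probFilter P, ∀ k, (0 : ℝ) < ((fold C D U a k q).card : ℝ) := by
  filter_upwards [hs.eventually_card_fold_pos (hc.pArm_pos a) C 0,
    hs.eventually_card_fold_pos (hc.pArm_pos a) C 1] with q h1 h2
  exact Fin.forall_fin_two.2 ⟨h1, h2⟩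

theorem isLittleO_totalTargetShare_sub (hc : CausalModel Q M) (hs : IsSampling P Q D U)
    (C : Procedure p d 𝒰) (a : Bool) (l : Fin 2) :
    (fun q => totalTargetShare C D U l q - share C D U a l q)
      =o[probFilter P] fun q => rate q.1 := by
  have h : (fun q => (match C.target with
      | .allTreated => share C D U true l q
      | .ownFold => share C D U false l q) - share C D U a l q)
      =o[probFilter P] fun q => rate q.1 := by
    cases C.target with
    | allTreated => exact hc.isLittleO_share_sub hs C true a l
    | ownFold => exact hc.isLittleO_share_sub hs C false a l
  refine h.congr' ?_ EventuallyEq.rfl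
  filter_upwards [hc.eventually_card_pos hs C false] with q hq
  rw [totalTargetShare_eq hq]

theorem isBigO_share (hc : CausalModel Q M) (hs : IsSampling P Q D U)
    (C : Procedure p d 𝒰) (a : Bool) (k : Fin 2) :
    (share C D U a k) =O[probFilter P] fun _ => (1 : ℝ) :=
  (hs.tendsto_share (hc.pArm_pos a) C k).isBigO_one ℝ

theorem isLittleO_avg_prog_sub (hc : CausalModel Q M) (hs : IsSampling P Q D U)
    (C : Procedure p d 𝒰) (k : Fin 2) :
    (fun q => avg (fold C D U true k q) (fun i => prog Q (D i q.2)) - theta0 Q)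
      =o[probFilter P] fun q => rate q.1 := by
  have := hc.isProbabilityMeasure true
  have h := hs.isLittleO_avg_sub (hc.pArm_pos true) C k measurable_prog
    (hc.memLp_arm true hc.memLp_prog)
  rwa [show ∫ y, prog Q y ∂(armLaw Q true) = theta0 Q from
    (theta0_eq_integral_prognostic hc.unconfounded hc.integrable_y0 hc.overlap).symm] at h

theorem isLittleO_avg_wt_resid (hc : CausalModel Q M) (hs : IsSampling P Q D U)
    (C : Procedure p d 𝒰) (k : Fin 2) :
    (fun q => avg (fold C D U false k q) fun i => wt Q (D i q.2) * resid Q (D i q.2))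
      =o[probFilter P] fun q => rate q.1 := by
  refine (hs.isLittleO_avg_resid_mul hc C k measurable_wStar hc.memLp_wt).congr_left fun q => ?_
  exact avg_congr fun i _ => mul_comm _ _

end CausalModel

namespace BalancingModel

/-- The treated mean of the error of the fitted prognostic score. -/
noncomputable def bias (C : Procedure p d 𝒰) (D : ℕ → Ω → FullRecord p) (U : ℕ → Ω → 𝒰)
    (φs : (Fin p → ℝ) → EuclideanSpace ℝ (Fin d)) (Q : Measure (FullRecord p))
    (β : Fin d → ℝ) (k : Fin 2) (q : ℕ × Ω) : ℝ :=
  ∑ j, β j * ∫ z, featErr C D U φs k j q z ∂(armLaw Q true)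

theorem isLittleO_bias (h : BalancingModel P Q D U C φs M w lam β) (k : Fin 2) :
    (bias C D U φs Q β k) =o[probFilter P] fun q => CrossBalancing.rate q.1 :=
  IsLittleO.fun_sum fun j _ =>
    (h.rate.isLittleO_integral_featErr h.causal true k j).const_mul_left _

/-- Replacing the weights by w* costs a product of two empirical L² errors. Weighting by w* then
carries the control mean of the feature error to the treated population. -/
theorem isLittleO_avg_weight_featErr_sub (h : BalancingModel P Q D U C φs M w lam β)
    {a : Fin d → ℝ} (ha : SpansOne C D U a) (k : Fin 2) (j : Fin d) :
    (fun q => avg (fold C D U false k q)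
        (fun i => w q.1 q.2 i * featErr C D U φs k j q (D i q.2))
        - ∫ z, featErr C D U φs k j q z ∂(armLaw Q true))
      =o[probFilter P] fun q => CrossBalancing.rate q.1 ^ 2 := by
  have h1 := IsLittleO.avg_mul (h.isLittleO_l2_weight_sub ha k)
    (h.rate.isLittleO_l2_featErr h.sampling h.causal false k j).isBigO
  simp only [← sq] at h1
  refine (h1.add (h.rate.isLittleO_avg_wt_featErr_sub h.sampling h.causal k j)).congr_left
    fun q => ?_
  rw [← add_sub_assoc, ← avg_add]
  congr 1
  exact avg_congr fun i _ => by ring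

/-- The target carries the treated mean of m₀ plus the feature error, which given the other fold is
its population mean up to o_P(n^{-1/2}). -/
theorem isLittleO_sum_sampleTarget_sub (h : BalancingModel P Q D U C φs M w lam β)
    (k : Fin 2) :
    (fun q => (∑ j, β j * sampleTarget C D U k q j)
      - ∑ l, targetShare C D U k l q *
        (avg (fold C D U true l q) (fun i => prog Q (D i q.2)) + bias C D U φs Q β l q))
      =o[probFilter P] fun q => CrossBalancing.rate q.1 ^ 2 := by
  have h1 : (fun q => ∑ l, targetShare C D U k l q * ∑ j, β j *
      (avg (fold C D U true l q) (fun i => featErr C D U φs l j q (D i q.2))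
        - ∫ z, featErr C D U φs l j q z ∂(armLaw Q true)))
      =o[probFilter P] fun q => CrossBalancing.rate q.1 ^ 2 := by
    refine IsLittleO.fun_sum fun l _ => ?_
    have h2 : (fun q => ∑ j, β j *
        (avg (fold C D U true l q) (fun i => featErr C D U φs l j q (D i q.2))
          - ∫ z, featErr C D U φs l j q z ∂(armLaw Q true)))
        =o[probFilter P] fun q => CrossBalancing.rate q.1 ^ 2 :=
      IsLittleO.fun_sum fun j _ =>
        (h.rate.isLittleO_avg_featErr_sub h.sampling h.causal true l j).const_mul_left _
    simpa using (h.isBigO_targetShare k l).mul_isLittleO h2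
  refine h1.congr' ?_ EventuallyEq.rfl
  filter_upwards [h.causal.eventually_card_pos h.sampling C true, h.eventually_prog_eq]
    with q ht hq
  have hcomm : ∑ j, β j * sampleTarget C D U k q j
      = ∑ l, ∑ j, β j * (targetShare C D U k l q
        * avg (fold C D U true l q) (unitFeat C D U l q j)) := by
    simp only [sampleTarget_eq ht, Finset.mul_sum]
    exact Finset.sum_comm
  rw [hcomm, ← Finset.sum_sub_distrib]
  refine Finset.sum_congr rfl fun l _ => ?_
  have e : ∑ j, β j * (targetShare C D U k l q
        * avg (fold C D U true l q) (unitFeat C D U l q j))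
      = targetShare C D U k l q * (avg (fold C D U true l q) (fun i => prog Q (D i q.2))
        + ∑ j, β j * avg (fold C D U true l q)
          (fun i => featErr C D U φs l j q (D i q.2))) := by
    have e1 : avg (fold C D U true l q) (fun i => prog Q (D i q.2))
        = ∑ j, β j * avg (fold C D U true l q) (fun i => φs (cov (D i q.2)) j) := by
      simp only [← avg_const_mul]
      rw [← avg_sum]
      exact avg_congr fun i _ => hq i
    rw [e1, ← Finset.sum_add_distrib, Finset.mul_sum]
    refine Finset.sum_congr rfl fun j _ => ?_
    rw [← mul_add, ← avg_add,
      avg_congr (f := unitFeat C D U l q j) fun i _ => unitFeat_eq (φs := φs) l q j i]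
    ring
  rw [e, bias, ← mul_sub, add_sub_add_left_eq_sub, ← Finset.sum_sub_distrib]
  simp only [mul_sub]

/-- The weighted control mean of one fold. -/
theorem isLittleO_fold_expansion (h : BalancingModel P Q D U C φs M w lam β)
    {a : Fin d → ℝ} (ha : SpansOne C D U a) (k : Fin 2) :
    (fun q => avg (fold C D U false k q) (fun i => w q.1 q.2 i * y0 (D i q.2))
      - (avg (fold C D U false k q) (fun i => wt Q (D i q.2) * resid Q (D i q.2))
        + (∑ l, targetShare C D U k l q *
        (avg (fold C D U true l q) (fun i => prog Q (D i q.2)) + bias C D U φs Q β l q))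
        - bias C D U φs Q β k q))
      =o[probFilter P] fun q => CrossBalancing.rate q.1 ^ 2 := by
  have h1 := h.isLittleO_avg_weight_sub_mul_resid ha k
  have h2 : (fun q => ∑ j, β j * (avg (fold C D U false k q)
      (fun i => w q.1 q.2 i * unitFeat C D U k q j i) - sampleTarget C D U k q j))
      =o[probFilter P] fun q => CrossBalancing.rate q.1 ^ 2 := by
    refine IsLittleO.fun_sum fun j _ => IsLittleO.const_mul_left ?_ _
    have : (fun q => avg (fold C D U false k q)
        (fun i => w q.1 q.2 i * unitFeat C D U k q j i) - sampleTarget C D U k q j)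
        =O[probFilter P] fun q => C.tol q.1 j := by
      refine IsBigO.of_bound 1 ?_
      filter_upwards [h.eventually_weights_eq ha k] with q hq
      rw [one_mul, Real.norm_eq_abs, Real.norm_eq_abs, abs_of_nonneg (C.tol_nonneg _ _)]
      exact hq.2 j
    exact this.trans_isLittleO (isLittleO_fst (h.tol_isLittleO j))
  have h3 := h.isLittleO_sum_sampleTarget_sub k
  have h4 : (fun q => ∑ j, β j * (avg (fold C D U false k q)
        (fun i => w q.1 q.2 i * featErr C D U φs k j q (D i q.2))
        - ∫ z, featErr C D U φs k j q z ∂(armLaw Q true)))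
      =o[probFilter P] fun q => CrossBalancing.rate q.1 ^ 2 :=
    IsLittleO.fun_sum fun j _ => (h.isLittleO_avg_weight_featErr_sub ha k j).const_mul_left _
  refine (((h1.add h2).add h3).sub h4).congr' ?_ EventuallyEq.rfl
  filter_upwards [h.eventually_prog_eq] with q hq
  -- Uses Y(0) = β*ᵀφ̂ − β*ᵀ(φ̂ − φ*) + r, with the weight in front of r split as w* plus its error.
  have e : avg (fold C D U false k q) (fun i => w q.1 q.2 i * y0 (D i q.2))
      = avg (fold C D U false k q) (fun i => wt Q (D i q.2) * resid Q (D i q.2))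
        + avg (fold C D U false k q) (fun i =>
          (w q.1 q.2 i - wt Q (D i q.2)) * resid Q (D i q.2))
        + ((∑ j, β j * avg (fold C D U false k q)
          (fun i => w q.1 q.2 i * unitFeat C D U k q j i))
        - ∑ j, β j * avg (fold C D U false k q)
          (fun i => w q.1 q.2 i * featErr C D U φs k j q (D i q.2))) := by
    rw [← avg_add, ← Finset.sum_sub_distrib]
    simp only [← mul_sub, ← avg_sub, ← avg_const_mul]
    rw [← avg_sum, ← avg_add]
    refine avg_congr fun i _ => ?_
    have : y0 (D i q.2) = prog Q (D i q.2) + resid Q (D i q.2) := by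
      simp [resid, prog]
    rw [this, hq i, mul_add, Finset.mul_sum]
    have e2 : ∑ j, w q.1 q.2 i * (β j * φs (cov (D i q.2)) j)
        = ∑ j, β j * (w q.1 q.2 i * (unitFeat C D U k q j i
          - featErr C D U φs k j q (D i q.2))) := by
      refine Finset.sum_congr rfl fun j _ => ?_
      rw [unitFeat_eq (φs := φs)]
      ring
    rw [e2]
    ring
  rw [e]
  simp only [mul_sub, Finset.sum_sub_distrib, bias]
  ring

/-- The estimator is asymptotically linear. -/
theorem isLittleO_thetaHat_sub (h : BalancingModel P Q D U C φs M w lam β)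
    {a : Fin d → ℝ} (ha : SpansOne C D U a) :
    (fun q => thetaHat (sample D q.1 q.2) (w q.1 q.2)
      - (avg (armSet D false q) (fun i => wt Q (D i q.2) * resid Q (D i q.2))
        + avg (armSet D true q) (fun i => prog Q (D i q.2))))
      =o[probFilter P] fun q => CrossBalancing.rate q.1 ^ 2 := by
  have h1 : (fun q => ∑ k, share C D U false k q *
      (avg (fold C D U false k q) (fun i => w q.1 q.2 i * y0 (D i q.2))
      - (avg (fold C D U false k q) (fun i => wt Q (D i q.2) * resid Q (D i q.2))
        + (∑ l, targetShare C D U k l q *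
        (avg (fold C D U true l q) (fun i => prog Q (D i q.2)) + bias C D U φs Q β l q))
        - bias C D U φs Q β k q)))
      =o[probFilter P] fun q => CrossBalancing.rate q.1 ^ 2 := by
    refine IsLittleO.fun_sum fun k _ => ?_
    simpa using (h.causal.isBigO_share h.sampling C false k).mul_isLittleO
      (h.isLittleO_fold_expansion ha k)
  -- The cancellation of biases: the bias of fold l enters once through the targets and once,
  -- negatively, through its own controls. The coefficients differ by o_P(n^{-1/4}).
  have h2 : (fun q => ∑ l, (totalTargetShare C D U l q - share C D U false l q)
      * bias C D U φs Q β l q)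
      =o[probFilter P] fun q => CrossBalancing.rate q.1 ^ 2 := by
    refine IsLittleO.fun_sum fun l _ => ?_
    simpa only [sq] using (h.causal.isLittleO_totalTargetShare_sub h.sampling C false l).mul
      (h.isLittleO_bias l)
  -- The mixture of treated fold means is replaced by the treated mean. Centring at θ₀ is free
  -- because both sets of shares sum to one.
  have h3 : (fun q => ∑ l, (totalTargetShare C D U l q - share C D U true l q)
      * (avg (fold C D U true l q) (fun i => prog Q (D i q.2)) - theta0 Q))
      =o[probFilter P] fun q => CrossBalancing.rate q.1 ^ 2 := by
    refine IsLittleO.fun_sum fun l _ => ?_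
    simpa only [sq] using (h.causal.isLittleO_totalTargetShare_sub h.sampling C true l).mul
      (h.causal.isLittleO_avg_prog_sub h.sampling C l)
  refine ((h1.add h2).add h3).congr' ?_ EventuallyEq.rfl
  filter_upwards [h.causal.eventually_card_pos h.sampling C false,
    h.causal.eventually_card_pos h.sampling C true] with q hf ht
  rw [thetaHat_eq, avg_arm_eq hf, avg_arm_eq hf, avg_arm_eq ht]
  have s1 := sum_share hf
  have s2 := sum_share ht
  have s3 := sum_targetShare ht 0
  have s4 := sum_targetShare ht 1
  simp only [totalTargetShare, Fin.sum_univ_two] at s1 s2 s3 s4 ⊢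
  linear_combination (-theta0 Q * share C D U false 0 q) * s3
    + (-theta0 Q * share C D U false 1 q) * s4 + (- theta0 Q) * s1 + theta0 Q * s2

end BalancingModel

end Expansion

end CrossBalancing

namespace CrossBalancing

/-! ### Influence function and central limit theorem. -/

section CentralLimit

set_option linter.unusedSectionVars false

variable {p d : ℕ} {Ω 𝒰 : Type*} [MeasurableSpace Ω] [MeasurableSpace 𝒰]
  {P : Measure Ω} [IsProbabilityMeasure P] {Q : Measure (FullRecord p)} [IsProbabilityMeasure Q]
  {D : ℕ → Ω → FullRecord p} {U : ℕ → Ω → 𝒰} {M : ℝ}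
  {w : ∀ n : ℕ, Ω → Fin n → ℝ}

theorem mem_armSet {a : Bool} {q : ℕ × Ω} {i : Fin q.1} :
    i ∈ armSet D a q ↔ trt (D i q.2) = a := by
  rw [armSet, arm]
  exact Finset.mem_filter_univ i

theorem influence_of_control {z : FullRecord p} (h : trt z = false) :
    influence Q z = wt Q z * resid Q z / (1 - pTreat Q) := by
  simp [influence, h, wt, resid]

theorem influence_of_treated {z : FullRecord p} (h : trt z = true) :
    influence Q z = (prog Q z - theta0 Q) / pTreat Q := by
  simp [influence, h, prog]

theorem measurable_influence : Measurable (influence Q) := by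
  have h : influence Q = fun z => if trt z = true then (prog Q z - theta0 Q) / pTreat Q
      else wt Q z * resid Q z / (1 - pTreat Q) := by
    funext z
    by_cases h : trt z = true
    · rw [if_pos h, influence_of_treated h]
    · rw [if_neg h, influence_of_control (Bool.eq_false_iff.2 h)]
  rw [h]
  exact Measurable.ite (measurableSet_arm true)
    ((measurable_prog.sub_const _).div_const _) ((measurable_wt.mul measurable_resid).div_const _)

theorem sum_eq_sum_armSet (D : ℕ → Ω → FullRecord p) (q : ℕ × Ω) (g : Fin q.1 → ℝ) :
    ∑ i, g i = ∑ i ∈ armSet D false q, g i + ∑ i ∈ armSet D true q, g i := by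
  rw [← Finset.sum_fiberwise Finset.univ (fun i : Fin q.1 => trt (D i q.2)) g, Fintype.sum_bool,
    add_comm]
  rfl

theorem sum_influence {q : ℕ × Ω} (hf : (0 : ℝ) < (armSet D false q).card)
    (ht : (0 : ℝ) < (armSet D true q).card) :
    ∑ i ∈ Finset.range q.1, influence Q (D i q.2)
      = (armSet D false q).card / (1 - pTreat Q)
          * avg (armSet D false q) (fun i => wt Q (D i q.2) * resid Q (D i q.2))
        + (armSet D true q).card / pTreat Q
          * (avg (armSet D true q) (fun i => prog Q (D i q.2)) - theta0 Q) := by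
  rw [← Fin.sum_univ_eq_sum_range (fun i => influence Q (D i q.2)), sum_eq_sum_armSet D]
  congr 1
  · rw [Finset.sum_congr rfl fun i hi => influence_of_control (Q := Q) (mem_armSet.1 hi),
      ← Finset.sum_div, avg]
    field_simp
  · rw [Finset.sum_congr rfl fun i hi => influence_of_treated (Q := Q) (mem_armSet.1 hi),
      ← Finset.sum_div, avg, Finset.sum_sub_distrib, Finset.sum_const, nsmul_eq_mul]
    field_simp

namespace CausalModel

theorem isLittleO_avg_arm_wt_resid (hc : CausalModel Q M) (hs : IsSampling P Q D U)
    (C : Procedure p d 𝒰) :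
    (fun q => avg (armSet D false q) fun i => wt Q (D i q.2) * resid Q (D i q.2))
      =o[probFilter P] fun q => rate q.1 := by
  have h : (fun q => ∑ k, share C D U false k q *
      avg (fold C D U false k q) fun i => wt Q (D i q.2) * resid Q (D i q.2))
      =o[probFilter P] fun q => rate q.1 := by
    refine IsLittleO.fun_sum fun k _ => ?_
    simpa using (hc.isBigO_share hs C false k).mul_isLittleO (hc.isLittleO_avg_wt_resid hs C k)
  refine h.congr' ?_ EventuallyEq.rfl
  filter_upwards [hc.eventually_card_pos hs C false] with q hq
  rw [avg_arm_eq hq]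

theorem isLittleO_avg_arm_prog_sub (hc : CausalModel Q M) (hs : IsSampling P Q D U)
    (C : Procedure p d 𝒰) :
    (fun q => avg (armSet D true q) (fun i => prog Q (D i q.2)) - theta0 Q)
      =o[probFilter P] fun q => rate q.1 := by
  have h : (fun q => ∑ k, share C D U true k q *
      (avg (fold C D U true k q) (fun i => prog Q (D i q.2)) - theta0 Q))
      =o[probFilter P] fun q => rate q.1 := by
    refine IsLittleO.fun_sum fun k _ => ?_
    simpa using (hc.isBigO_share hs C true k).mul_isLittleO (hc.isLittleO_avg_prog_sub hs C k)
  refine h.congr' ?_ EventuallyEq.rfl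
  filter_upwards [hc.eventually_card_pos hs C true] with q hq
  rw [avg_arm_eq hq]
  simp only [mul_sub, Finset.sum_sub_distrib]
  rw [← Finset.sum_mul, sum_share hq, one_mul]

theorem eventually_card_arm_pos (hc : CausalModel Q M) (hs : IsSampling P Q D U) (a : Bool) :
    ∀ᶠ q in probFilter P, (0 : ℝ) < ((armSet D a q).card : ℝ) := by
  filter_upwards [hs.eventually_le_card_arm (hc.pArm_pos a),
    eventually_fst (eventually_gt_atTop 0)] with q h1 h2
  have : (0 : ℝ) < q.1 := by exact_mod_cast h2
  exact lt_of_lt_of_le (mul_pos (half_pos (hc.pArm_pos a)) this) h1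

/-- An estimator with the linear expansion of the balancing estimator is asymptotically linear
with the efficient influence function. -/
theorem isLittleO_sub_influence (hc : CausalModel Q M) (hs : IsSampling P Q D U)
    (C : Procedure p d 𝒰) {θ : ℕ × Ω → ℝ}
    (hθ : (fun q => θ q
      - (avg (armSet D false q) (fun i => wt Q (D i q.2) * resid Q (D i q.2))
        + avg (armSet D true q) (fun i => prog Q (D i q.2))))
      =o[probFilter P] fun q => rate q.1 ^ 2) :
    (fun q => θ q - theta0 Q
      - (q.1 : ℝ)⁻¹ * ∑ i ∈ Finset.range q.1, influence Q (D i q.2))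
      =o[probFilter P] fun q => rate q.1 ^ 2 := by
  -- Replacing an arm proportion by its probability costs the error of the proportion times a
  -- centred arm mean, each o_P(n^{-1/4}).
  have h1 := ((hs.isLittleO_proportion false).mul
    (hc.isLittleO_avg_arm_wt_resid hs C)).const_mul_left (1 - pTreat Q)⁻¹
  have h2 := ((hs.isLittleO_proportion true).mul
    (hc.isLittleO_avg_arm_prog_sub hs C)).const_mul_left (pTreat Q)⁻¹
  simp only [← sq] at h1 h2
  have hp := hc.pArm_pos true
  have hp' := hc.pArm_pos false
  rw [pArm_true] at hp
  rw [pArm_false] at hp'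
  refine ((hθ.sub h1).sub h2).congr' ?_ EventuallyEq.rfl
  filter_upwards [hc.eventually_card_arm_pos hs false, hc.eventually_card_arm_pos hs true,
    eventually_fst (eventually_gt_atTop 0)] with q hf ht hq
  have hq' : (0 : ℝ) < q.1 := by exact_mod_cast hq
  rw [sum_influence hf ht, pArm_false, pArm_true]
  field_simp
  ring

theorem tendstoInDistribution_influence (hc : CausalModel Q M) (hs : IsSampling P Q D U)
    (hL2 : MemLp (influence Q) 2 Q) (hmean : ∫ z, influence Q z ∂Q = 0) :
    TendstoInDistribution
      (fun (n : ℕ) ω => (√(n : ℝ))⁻¹ * ∑ i ∈ Finset.range n, influence Q (D i ω)) atTop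
      (id : ℝ → ℝ) (fun _ => P) (gaussianReal 0 (sigmaSq Q).toNNReal) := by
  have hm := measurable_influence (Q := Q)
  have hlaw : ∀ i, HasLaw (fun ω => influence Q (D i ω)) (Q.map (influence Q)) P := fun i =>
    HasLaw.comp ⟨hm.aemeasurable, rfl⟩ (hs.hasLaw i)
  have hvar : Var[fun ω => influence Q (D 0 ω); P] = sigmaSq Q := by
    have h := variance_map (μ := P) (X := influence Q) (Y := D 0)
      hm.aemeasurable (hs.hasLaw 0).aemeasurable
    rw [(hs.hasLaw 0).map_eq] at h
    exact h.symm
  have hint : ∫ ω, influence Q (D 0 ω) ∂P = 0 := by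
    have h := integral_map (hs.hasLaw 0).aemeasurable (f := influence Q) hm.aestronglyMeasurable
    rw [(hs.hasLaw 0).map_eq, hmean] at h
    exact h.symm
  have hmem : MemLp (fun ω => influence Q (D 0 ω)) 2 P := by
    have h : MemLp (influence Q) 2 (P.map (D 0)) := (hs.hasLaw 0).map_eq ▸ hL2
    exact h.comp_of_map (hs.hasLaw 0).aemeasurable
  have h := tendstoInDistribution_inv_sqrt_mul_sum_sub
    (X := fun i ω => influence Q (D i ω)) (P := P)
    (Y := (id : ℝ → ℝ)) (P' := gaussianReal 0 (sigmaSq Q).toNNReal)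
    (by rw [hvar]; exact HasLaw.id) hmem
    (hs.indep.comp (fun _ => influence Q) fun _ => hm)
    (fun i => ⟨(hlaw i).aemeasurable, (hlaw 0).aemeasurable,
      (hlaw i).map_eq.trans (hlaw 0).map_eq.symm⟩)
  simpa only [hint, mul_zero, sub_zero] using h

theorem tendstoInDistribution_of_isLittleO (hc : CausalModel Q M) (hs : IsSampling P Q D U)
    (C : Procedure p d 𝒰) (hL2 : MemLp (influence Q) 2 Q) (hmean : ∫ z, influence Q z ∂Q = 0)
    {θ : ℕ → Ω → ℝ} (hθm : ∀ n, AEMeasurable (θ n) P)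
    (hθ : (fun q : ℕ × Ω => θ q.1 q.2
      - (avg (armSet D false q) (fun i => wt Q (D i q.2) * resid Q (D i q.2))
        + avg (armSet D true q) (fun i => prog Q (D i q.2))))
      =o[probFilter P] fun q => rate q.1 ^ 2) :
    TendstoInDistribution (fun (n : ℕ) ω => √(n : ℝ) * (θ n ω - theta0 Q)) atTop
      (id : ℝ → ℝ) (fun _ => P) (gaussianReal 0 (sigmaSq Q).toNNReal) := by
  refine tendstoInDistribution_of_tendstoInMeasure_sub _ _
    (hc.tendstoInDistribution_influence hs hL2 hmean) ?_
    fun n => ((hθm n).sub_const _).const_mul _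
  refine tendstoInMeasure_iff_probFilter.2 ?_
  have h := (isBigO_refl (fun q : ℕ × Ω => √(q.1 : ℝ)) (probFilter P)).mul_isLittleO
    (hc.isLittleO_sub_influence hs C hθ)
  have h1 : (fun q : ℕ × Ω => √(q.1 : ℝ) * (θ q.1 q.2 - theta0 Q
      - (q.1 : ℝ)⁻¹ * ∑ i ∈ Finset.range q.1, influence Q (D i q.2)))
      =o[probFilter P] fun _ => (1 : ℝ) := by
    refine h.congr' EventuallyEq.rfl ?_
    filter_upwards [eventually_fst (eventually_gt_atTop 0)] with q hq
    exact sqrt_mul_rate_sq hq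
  refine ((isLittleO_one_iff ℝ).1 h1).congr' ?_
  filter_upwards [eventually_fst (eventually_gt_atTop 0)] with q hq
  have hq' : (0 : ℝ) < q.1 := by exact_mod_cast hq
  have e : √(q.1 : ℝ) * (q.1 : ℝ)⁻¹ = (√(q.1 : ℝ))⁻¹ := by
    rw [← div_eq_mul_inv, Real.sqrt_div_self]
  simp only [Pi.sub_apply]
  rw [mul_sub, ← mul_assoc, e]

end CausalModel

theorem aemeasurable_thetaHat (hs : IsSampling P Q D U)
    (hw : ∀ n i, AEMeasurable (fun ω => w n ω i) P) (n : ℕ) :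
    AEMeasurable (fun ω => thetaHat (sample D n ω) (w n ω)) P := by
  have hD : ∀ i, AEMeasurable (D i) P := fun i => (hs.hasLaw i).aemeasurable
  have hsum : ∀ g : Fin n → Ω → ℝ, (∀ i, AEMeasurable (g i) P) →
      AEMeasurable (fun ω => ∑ i ∈ (armSet D false (n, ω) : Finset (Fin n)), g i ω) P := by
    intro g hg
    have e : (fun ω => ∑ i ∈ (armSet D false (n, ω) : Finset (Fin n)), g i ω)
        = fun ω => ∑ i : Fin n, (fun z => if trt z = false then (1 : ℝ) else 0) (D i ω) * g i ω := by
      funext ω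
      simp only [ite_mul, one_mul, zero_mul]
      rw [← Finset.sum_filter]
      rfl
    rw [e]
    exact Finset.aemeasurable_fun_sum _ fun i _ =>
      ((Measurable.ite (measurableSet_arm false) measurable_const measurable_const).comp_aemeasurable
        (hD i)).mul (hg i)
  have e : (fun ω => thetaHat (sample D n ω) (w n ω))
      = fun ω => (∑ i ∈ (armSet D false (n, ω) : Finset (Fin n)), w n ω i * y0 (D i ω))
        / ∑ i ∈ (armSet D false (n, ω) : Finset (Fin n)), (1 : ℝ) := by
    funext ω
    rw [thetaHat_eq D w (n, ω), avg]
    simp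
  rw [e]
  exact (hsum (fun i ω => w n ω i * y0 (D i ω)) fun i => (hw n i).mul (measurable_y0.comp_aemeasurable (hD i))).div
    (hsum (fun _ _ => 1) fun i => aemeasurable_const)

end CentralLimit

end CrossBalancing

namespace CrossBalancing

/-! ### Consistency of the variance estimator. -/

section Variance

set_option linter.unusedSectionVars false

variable {p d : ℕ} {Ω 𝒰 : Type*} [MeasurableSpace Ω] [MeasurableSpace 𝒰]
  {P : Measure Ω} [IsProbabilityMeasure P] {Q : Measure (FullRecord p)} [IsProbabilityMeasure Q]
  {D : ℕ → Ω → FullRecord p} {U : ℕ → Ω → 𝒰} {C : Procedure p d 𝒰}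
  {φs : (Fin p → ℝ) → EuclideanSpace ℝ (Fin d)} {M : ℝ}
  {w : ∀ n : ℕ, Ω → Fin n → ℝ} {β : Fin d → ℝ}

/-- The factor √n of `l2_mul_le` is compensated by the two rates n^{-1/4}. -/
theorem isLittleO_l2_mul {I : ∀ q : ℕ × Ω, Finset (Fin q.1)} {f g : ∀ q : ℕ × Ω, Fin q.1 → ℝ}
    (hf : (fun q => l2 (I q) (f q)) =o[probFilter P] fun q => rate q.1)
    (hg : (fun q => l2 (I q) (g q)) =o[probFilter P] fun q => rate q.1) :
    (fun q => l2 (I q) fun i => f q i * g q i) =o[probFilter P] fun _ => (1 : ℝ) := by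
  have h := (isBigO_refl (fun q : ℕ × Ω => √(q.1 : ℝ)) (probFilter P)).mul_isLittleO (hf.mul hg)
  have h1 : (fun q => √(q.1 : ℝ) * (l2 (I q) (f q) * l2 (I q) (g q)))
      =o[probFilter P] fun _ => (1 : ℝ) := by
    refine h.congr' EventuallyEq.rfl ?_
    filter_upwards [eventually_fst (eventually_gt_atTop 0)] with q hq
    rw [← sq, sqrt_mul_rate_sq hq]
  refine (IsBigO.of_bound 1 (Eventually.of_forall fun q => ?_)).trans_isLittleO h1
  rw [one_mul, Real.norm_eq_abs, Real.norm_eq_abs, abs_of_nonneg l2_nonneg]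
  refine (l2_mul_le.trans ?_).trans (le_abs_self _)
  refine mul_le_mul_of_nonneg_right (Real.sqrt_le_sqrt ?_) (mul_nonneg l2_nonneg l2_nonneg)
  exact_mod_cast (Finset.card_le_univ (I q)).trans (Fintype.card_fin _).le

/-- On the truncation event, w* is at most √w* times the root of the level, which grows slower than
n^{1/4}. -/
theorem isLittleO_l2_wt_mul (hs : IsSampling P Q D U) (hc : CausalModel Q M) (k : Fin 2)
    {f : ∀ q : ℕ × Ω, Fin q.1 → ℝ}
    (hf : (fun q => l2 (fold C D U false k q) fun i => √(wt Q (D i q.2)) * f q i)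
      =o[probFilter P] fun q => rate q.1) :
    (fun q => l2 (fold C D U false k q) fun i => wt Q (D i q.2) * f q i)
      =o[probFilter P] fun _ => (1 : ℝ) := by
  have h := (isBigO_refl (fun q : ℕ × Ω => √(level q.1)) (probFilter P)).mul_isLittleO hf
  have h1 : (fun q : ℕ × Ω => √(level q.1) * rate q.1) =O[probFilter P] fun _ => (1 : ℝ) := by
    have h2 : Tendsto (fun q : ℕ × Ω => √(halfRate q.1)) (probFilter P) (𝓝 (√0)) :=
      (Real.continuous_sqrt.tendsto 0).comp (tendsto_halfRate.comp tendsto_fst_probFilter)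
    refine (h2.isBigO_one ℝ).congr' ?_ EventuallyEq.rfl
    filter_upwards [eventually_fst (eventually_gt_atTop 0)] with q hq
    rw [← level_mul_rate_sq hq, Real.sqrt_mul (level_nonneg _), Real.sqrt_sq (rate_nonneg _)]
  refine (IsBigO.of_bound 1 ?_).trans_isLittleO (h.trans_isBigO h1)
  filter_upwards [hs.eventually_wt_le hc] with q hq
  rw [one_mul, Real.norm_eq_abs, Real.norm_eq_abs, abs_of_nonneg l2_nonneg,
    abs_of_nonneg (mul_nonneg (Real.sqrt_nonneg _) l2_nonneg)]
  have e : √(level q.1) * l2 (fold C D U false k q) (fun i => √(wt Q (D i q.2)) * f q i)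
      = l2 (fold C D U false k q) fun i => √(level q.1) * (√(wt Q (D i q.2)) * f q i) := by
    rw [l2_const_mul, abs_of_nonneg (Real.sqrt_nonneg _)]
  rw [e]
  refine l2_mono fun i hi => ?_
  obtain ⟨h0, h1⟩ := hq i (mem_armFold.1 hi).1
  rw [abs_mul, abs_mul, abs_mul, abs_of_nonneg h0, abs_of_nonneg (Real.sqrt_nonneg _),
    abs_of_nonneg (Real.sqrt_nonneg _), ← mul_assoc]
  refine mul_le_mul_of_nonneg_right ?_ (abs_nonneg _)
  calc wt Q (D i q.2) = √(wt Q (D i q.2)) * √(wt Q (D i q.2)) := (Real.mul_self_sqrt h0).symm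
    _ ≤ _ := mul_le_mul_of_nonneg_right (Real.sqrt_le_sqrt h1) (Real.sqrt_nonneg _)

/-- The control mean of w* φ*² is the treated mean of φ*², which is finite. -/
theorem FeatureRate.isBigO_l2_sqrt_wt_unitFeat (hs : IsSampling P Q D U) (hc : CausalModel Q M)
    (hF : FeatureRate P Q D U C φs) (k : Fin 2) (j : Fin d) :
    (fun q => l2 (fold C D U false k q) fun i => √(wt Q (D i q.2)) * unitFeat C D U k q j i)
      =O[probFilter P] fun _ => (1 : ℝ) := by
  have := hc.isProbabilityMeasure false
  have hint : Integrable (fun z => (√(wt Q z) * φs (cov z) j) ^ 2) (armLaw Q false) := by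
    refine (hc.integrable_wt_mul ((hF.measurable_coord j).pow_const 2)
      (hc.memLp_arm true (hF.memLp_coord j)).integrable_sq).congr ?_
    filter_upwards [hc.wt_nonneg_arm false] with z hz
    rw [mul_pow, Real.sq_sqrt hz]
  have h0 := hs.tendsto_avg (hc.pArm_pos false) C k
    (f := fun z => (√(wt Q z) * φs (cov z) j) ^ 2)
    ((measurable_wt.sqrt.mul ((hF.measurable_coord j).comp measurable_cov)).pow_const 2) hint
  have h := isBigO_l2_add (isBigO_l2_of_tendsto h0)
    ((hF.isLittleO_l2_sqrt_wt_featErr hs hc k j).trans isLittleO_rate_one).isBigO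
  refine h.congr_left fun q => l2_congr fun i _ => ?_
  rw [unitFeat_eq (φs := φs), mul_add]

/-- The OLS coefficients of fold `k` at the sample. -/
noncomputable def fitCoef (C : Procedure p d 𝒰) (D : ℕ → Ω → FullRecord p) (U : ℕ → Ω → 𝒰)
    (k : Fin 2) (q : ℕ × Ω) : Fin d → ℝ :=
  olsCoef (sample D q.1 q.2) (C.folds (sample D q.1 q.2) (U q.1 q.2))
    (C.features (sample D q.1 q.2) (U q.1 q.2)) k

/-- The fitted outcomes at the sample. -/
noncomputable def fit (C : Procedure p d 𝒰) (D : ℕ → Ω → FullRecord p) (U : ℕ → Ω → 𝒰)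
    (q : ℕ × Ω) (i : Fin q.1) : ℝ :=
  fitted (sample D q.1 q.2) (C.folds (sample D q.1 q.2) (U q.1 q.2))
    (C.features (sample D q.1 q.2) (U q.1 q.2)) i

theorem fit_eq {a : Bool} {k : Fin 2} {q : ℕ × Ω} {i : Fin q.1} (hi : i ∈ fold C D U a k q) :
    fit C D U q i = ∑ j, fitCoef C D U k q j * unitFeat C D U k q j i := by
  have hk : C.folds (sample D q.1 q.2) (U q.1 q.2) i = k := (mem_armFold.1 hi).2
  unfold fit fitted
  rw [hk]
  rfl

/-- The fold size that separates sums from averages cancels, and on controls the observed outcome is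
Y(0). -/
theorem fitCoef_eq {k : Fin 2} {q : ℕ × Ω} (hcard : (0 : ℝ) < ((fold C D U false k q).card : ℝ))
    (hdet : (gram (fold C D U false k q) (unitFeat C D U k q)).det ≠ 0) :
    fitCoef C D U k q = momentCoef (fold C D U false k q) (unitFeat C D U k q) fun j =>
      avg (fold C D U false k q) fun i => unitFeat C D U k q j i * y0 (D i q.2) := by
  set c : ℝ := ((fold C D U false k q).card : ℝ) with hcdef
  have e1 : (Matrix.of fun a b => ∑ i ∈ fold C D U false k q,
      unitFeat C D U k q a i * unitFeat C D U k q b i)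
      = c • gram (fold C D U false k q) (unitFeat C D U k q) := by
    ext a b
    simp only [gram, Matrix.of_apply, Matrix.smul_apply, smul_eq_mul, avg]
    rw [← hcdef]
    field_simp
  have e2 : (fun a => ∑ i ∈ fold C D U false k q, unitFeat C D U k q a i * y0 (D i q.2))
      = c • fun j => avg (fold C D U false k q) fun i => unitFeat C D U k q j i * y0 (D i q.2) := by
    funext a
    simp only [Pi.smul_apply, smul_eq_mul, avg]
    rw [← hcdef]
    field_simp
  have e3 : fitCoef C D U k q = Matrix.mulVec (Matrix.of fun a b => ∑ i ∈ fold C D U false k q,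
      unitFeat C D U k q a i * unitFeat C D U k q b i)⁻¹
      (fun a => ∑ i ∈ fold C D U false k q, unitFeat C D U k q a i * y0 (D i q.2)) := by
    have e4 : ∀ a, ∑ i ∈ fold C D U false k q, unitFeat C D U k q a i * y0 (D i q.2)
        = ∑ i ∈ fold C D U false k q, unitFeat C D U k q a i * (sample D q.1 q.2 i).2.2 := by
      intro a
      refine Finset.sum_congr rfl fun i hi => ?_
      have hi' : trt (D i q.2) = false := (mem_armFold.1 hi).1
      simp [sample, observe, hi']
    simp only [e4]
    rfl
  have hinv : (c • gram (fold C D U false k q) (unitFeat C D U k q))⁻¹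
      = c⁻¹ • (gram (fold C D U false k q) (unitFeat C D U k q))⁻¹ := by
    refine Matrix.inv_eq_left_inv ?_
    rw [Matrix.smul_mul, Matrix.mul_smul, smul_smul, inv_mul_cancel₀ hcard.ne', one_smul,
      Matrix.nonsing_inv_mul _ (isUnit_iff_ne_zero.2 hdet)]
  rw [e3, e1, e2, hinv, Matrix.smul_mulVec, Matrix.mulVec_smul, smul_smul,
    inv_mul_cancel₀ hcard.ne', one_smul]
  rfl

namespace FeatureRate

theorem isLittleO_fitCoef_sub (hs : IsSampling P Q D U) (hc : CausalModel Q M)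
    (hF : FeatureRate P Q D U C φs) (hG : (controlSecondMoment Q φs).det ≠ 0)
    (hβ : ∀ᵐ z ∂Q, prog Q z = ∑ j, β j * φs (cov z) j) (k : Fin 2) (j : Fin d) :
    (fun q => fitCoef C D U k q j - β j) =o[probFilter P] fun q => CrossBalancing.rate q.1 := by
  -- The normal equations evaluated at β*: Y − β*ᵀφ̂ is the residual minus β*ᵀ(φ̂ − φ*).
  have hb : ∀ j, (fun q => (avg (fold C D U false k q) fun i =>
        resid Q (D i q.2) * unitFeat C D U k q j i)
      - avg (fold C D U false k q) fun i =>
        (∑ l, β l * featErr C D U φs k l q (D i q.2)) * unitFeat C D U k q j i)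
      =o[probFilter P] fun q => CrossBalancing.rate q.1 := fun j =>
    (hF.isLittleO_avg_resid_unitFeat hs hc k j).sub
      (hF.isLittleO_avg_unitFeat_mul_featErr hs hc k j β)
  refine (isLittleO_mulVec_inv (hF.tendsto_gram hs hc k) hG hb j).congr' ?_ EventuallyEq.rfl
  filter_upwards [hF.eventually_det_ne_zero hs hc hG k, hs.eventually_forall_of_ae hβ,
    hs.eventually_card_fold_pos (hc.pArm_pos false) C k] with q hdet hq hcard
  have e : (fun j => (avg (fold C D U false k q) fun i =>
        resid Q (D i q.2) * unitFeat C D U k q j i)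
      - avg (fold C D U false k q) fun i =>
        (∑ l, β l * featErr C D U φs k l q (D i q.2)) * unitFeat C D U k q j i)
      = (fun j => avg (fold C D U false k q) fun i => unitFeat C D U k q j i * y0 (D i q.2))
        - Matrix.mulVec (gram (fold C D U false k q) (unitFeat C D U k q)) β := by
    funext j
    simp only [Pi.sub_apply]
    rw [← avg_linear_mul, ← avg_sub, ← avg_sub]
    refine avg_congr fun i _ => ?_
    have h1 : y0 (D i q.2) = prog Q (D i q.2) + resid Q (D i q.2) := by
      simp [resid, prog]
    have h2 : ∑ l, β l * unitFeat C D U k q l i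
        = prog Q (D i q.2) + ∑ l, β l * featErr C D U φs k l q (D i q.2) := by
      rw [hq i, ← Finset.sum_add_distrib]
      refine Finset.sum_congr rfl fun l _ => ?_
      rw [unitFeat_eq (φs := φs), mul_add]
    rw [h1, h2]
    ring
  rw [e, fitCoef_eq hcard hdet, Matrix.mulVec_sub, Matrix.mulVec_mulVec,
    Matrix.nonsing_inv_mul _ (isUnit_iff_ne_zero.2 hdet), Matrix.one_mulVec]
  rfl

theorem eventually_fit_sub_eq (hs : IsSampling P Q D U)
    (hβ : ∀ᵐ z ∂Q, prog Q z = ∑ j, β j * φs (cov z) j) (a : Bool) (k : Fin 2) :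
    ∀ᶠ q in probFilter P, ∀ i ∈ fold C D U a k q, fit C D U q i - prog Q (D i q.2)
      = (∑ j, (fitCoef C D U k q j - β j) * unitFeat C D U k q j i)
        + ∑ j, β j * featErr C D U φs k j q (D i q.2) := by
  filter_upwards [hs.eventually_forall_of_ae hβ] with q hq i hi
  rw [fit_eq hi, hq i, ← Finset.sum_sub_distrib, ← Finset.sum_add_distrib]
  refine Finset.sum_congr rfl fun j _ => ?_
  rw [unitFeat_eq (φs := φs)]
  ring

theorem isLittleO_l2_fit_sub (hs : IsSampling P Q D U) (hc : CausalModel Q M)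
    (hF : FeatureRate P Q D U C φs) (hG : (controlSecondMoment Q φs).det ≠ 0)
    (hβ : ∀ᵐ z ∂Q, prog Q z = ∑ j, β j * φs (cov z) j) (a : Bool) (k : Fin 2) :
    (fun q => l2 (fold C D U a k q) fun i => fit C D U q i - prog Q (D i q.2))
      =o[probFilter P] fun q => CrossBalancing.rate q.1 := by
  refine isLittleO_l2_congr (eventually_fit_sub_eq hs hβ a k) (isLittleO_l2_add ?_ ?_)
  · refine isLittleO_l2_sum fun j _ => ?_
    simpa using isLittleO_l2_const_mul (hF.isLittleO_fitCoef_sub hs hc hG hβ k j)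
      (hF.isBigO_l2_unitFeat hs hc a k j)
  · exact isLittleO_l2_sum fun j _ =>
      isLittleO_l2_mul_const _ (hF.isLittleO_l2_featErr hs hc a k j)

theorem isLittleO_l2_sqrt_wt_fit_sub (hs : IsSampling P Q D U) (hc : CausalModel Q M)
    (hF : FeatureRate P Q D U C φs) (hG : (controlSecondMoment Q φs).det ≠ 0)
    (hβ : ∀ᵐ z ∂Q, prog Q z = ∑ j, β j * φs (cov z) j) (k : Fin 2) :
    (fun q => l2 (fold C D U false k q) fun i =>
      √(wt Q (D i q.2)) * (fit C D U q i - prog Q (D i q.2)))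
      =o[probFilter P] fun q => CrossBalancing.rate q.1 := by
  refine isLittleO_l2_congr (g := fun (q : ℕ × Ω) (i : Fin q.1) =>
      (∑ j, (fitCoef C D U k q j - β j) * (√(wt Q (D i q.2)) * unitFeat C D U k q j i))
        + ∑ j, β j * (√(wt Q (D i q.2)) * featErr C D U φs k j q (D i q.2))) ?_
    (isLittleO_l2_add ?_ ?_)
  · filter_upwards [eventually_fit_sub_eq (C := C) hs hβ false k] with q hq i hi
    rw [hq i hi, mul_add, Finset.mul_sum, Finset.mul_sum]
    congr 1 <;> exact Finset.sum_congr rfl fun j _ => by ring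
  · refine isLittleO_l2_sum fun j _ => ?_
    simpa using isLittleO_l2_const_mul (hF.isLittleO_fitCoef_sub hs hc hG hβ k j)
      (hF.isBigO_l2_sqrt_wt_unitFeat hs hc k j)
  · exact isLittleO_l2_sum fun j _ =>
      isLittleO_l2_mul_const _ (hF.isLittleO_l2_sqrt_wt_featErr hs hc k j)

/-- The weighted residuals have the second moment of their limit. -/
theorem tendsto_avg_weighted_residual_sq (hs : IsSampling P Q D U) (hc : CausalModel Q M)
    (hF : FeatureRate P Q D U C φs) (hG : (controlSecondMoment Q φs).det ≠ 0)
    (hβ : ∀ᵐ z ∂Q, prog Q z = ∑ j, β j * φs (cov z) j) (k : Fin 2)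
    (hw : (fun q => l2 (fold C D U false k q) fun i => w q.1 q.2 i - wt Q (D i q.2))
      =o[probFilter P] fun q => CrossBalancing.rate q.1)
    (hwr : (fun q => l2 (fold C D U false k q) fun i =>
      (w q.1 q.2 i - wt Q (D i q.2)) * resid Q (D i q.2))
      =o[probFilter P] fun q => CrossBalancing.rate q.1) :
    Tendsto (fun q => avg (fold C D U false k q) fun i =>
        (w q.1 q.2 i * (y0 (D i q.2) - fit C D U q i)) ^ 2) (probFilter P)
      (𝓝 (∫ z, (wt Q z * resid Q z) ^ 2 ∂(armLaw Q false))) := by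
  have := hc.isProbabilityMeasure false
  have hmem : MemLp (fun z => wt Q z * resid Q z) 2 (armLaw Q false) := by
    simpa only [mul_comm, wt] using hc.memLp_mul_resid measurable_wStar hc.memLp_wt
  have h0 := hs.tendsto_avg (hc.pArm_pos false) C k
    (f := fun z => (wt Q z * resid Q z) ^ 2)
    ((measurable_wt.mul measurable_resid).pow_const 2) hmem.integrable_sq
  refine tendsto_avg_sq_of_l2_sub h0 ?_
  -- With m̂ the fitted outcome, ŵ(Y − m̂) − w* r = (ŵ − w*) r − (ŵ − w*)(m̂ − m₀) − w*(m̂ − m₀).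
  -- Each term vanishes in the empirical L² norm.
  have h1 := hF.isLittleO_l2_fit_sub hs hc hG hβ false k
  have h2 := isLittleO_l2_mul hw h1
  have h3 := isLittleO_l2_wt_mul hs hc k (hF.isLittleO_l2_sqrt_wt_fit_sub hs hc hG hβ k)
  have h4 := isLittleO_l2_add (isLittleO_l2_add (hwr.trans isLittleO_rate_one)
    (isLittleO_l2_mul_const (-1) h2)) (isLittleO_l2_mul_const (-1) h3)
  refine h4.congr_left fun q => l2_congr fun i _ => ?_
  simp only [resid, prog]
  ring

theorem tendsto_avg_centered_fit_sq (hs : IsSampling P Q D U) (hc : CausalModel Q M)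
    (hF : FeatureRate P Q D U C φs) (hG : (controlSecondMoment Q φs).det ≠ 0)
    (hβ : ∀ᵐ z ∂Q, prog Q z = ∑ j, β j * φs (cov z) j) (k : Fin 2) :
    Tendsto (fun q => avg (fold C D U true k q) fun i =>
        (fit C D U q i - avg (fold C D U true k q) (fit C D U q)) ^ 2) (probFilter P)
      (𝓝 (∫ z, (prog Q z - theta0 Q) ^ 2 ∂(armLaw Q true))) := by
  have := hc.isProbabilityMeasure true
  have hmem := hc.memLp_arm true hc.memLp_prog
  have h0 := hs.tendsto_avg (hc.pArm_pos true) C k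
    (f := fun z => (prog Q z - theta0 Q) ^ 2)
    ((measurable_prog.sub_const _).pow_const 2) (hmem.sub (memLp_const _)).integrable_sq
  refine tendsto_avg_sq_of_l2_sub h0 ?_
  have h1 := (hF.isLittleO_l2_fit_sub hs hc hG hβ true k).trans isLittleO_rate_one
  have hm : Tendsto (fun q => avg (fold C D U true k q) fun i => prog Q (D i q.2))
      (probFilter P) (𝓝 (theta0 Q)) := by
    have h := (isLittleO_one_iff ℝ).1
      ((hc.isLittleO_avg_prog_sub hs C k).trans isLittleO_rate_one)
    simpa using h.add_const (theta0 Q)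
  have h2 : (fun q => theta0 Q - avg (fold C D U true k q) (fit C D U q))
      =o[probFilter P] fun _ => (1 : ℝ) := by
    rw [isLittleO_one_iff]
    simpa using (tendsto_avg_of_l2_sub hm h1).const_sub (theta0 Q)
  have h3 : (fun q => l2 (fold C D U true k q) fun _ => (1 : ℝ))
      =O[probFilter P] fun _ => (1 : ℝ) := by
    have h := hs.tendsto_avg (hc.pArm_pos true) C k (f := fun _ => (1 : ℝ) ^ 2)
      measurable_const (integrable_const _)
    exact isBigO_l2_of_tendsto h
  have h4 := isLittleO_l2_const_mul h2 h3
  simp only [mul_one] at h4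
  refine (isLittleO_l2_add h1 h4).congr_left fun q => l2_congr fun i _ => ?_
  ring

end FeatureRate

theorem tendsto_avg_arm_of_fold (hs : IsSampling P Q D U) (hc : CausalModel Q M)
    (C : Procedure p d 𝒰) (a : Bool) {f : ∀ q : ℕ × Ω, Fin q.1 → ℝ} {c : ℝ}
    (h : ∀ k, Tendsto (fun q => avg (fold C D U a k q) (f q)) (probFilter P) (𝓝 c)) :
    Tendsto (fun q => avg (armSet D a q) (f q)) (probFilter P) (𝓝 c) := by
  have h1 := ((hs.tendsto_share (hc.pArm_pos a) C 0).mul (h 0)).add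
    ((hs.tendsto_share (hc.pArm_pos a) C 1).mul (h 1))
  have e : 1 / 2 * c + 1 / 2 * c = c := by ring
  rw [e] at h1
  refine h1.congr' ?_
  filter_upwards [hc.eventually_card_pos hs C a] with q hq
  rw [avg_arm_eq hq, Fin.sum_univ_two]

/-- Only one summand of the influence function is active in each arm, so there is no cross term; an
arm probability over its square leaves one inverse power. -/
theorem CausalModel.sigmaSq_eq (hc : CausalModel Q M) (hL2 : MemLp (influence Q) 2 Q)
    (hmean : ∫ z, influence Q z ∂Q = 0) :
    sigmaSq Q = (∫ z, (wt Q z * resid Q z) ^ 2 ∂(armLaw Q false)) / (1 - pTreat Q)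
      + (∫ z, (prog Q z - theta0 Q) ^ 2 ∂(armLaw Q true)) / pTreat Q := by
  have hp := hc.pArm_pos true
  have hp' := hc.pArm_pos false
  rw [sigmaSq, variance_of_integral_eq_zero hL2.aemeasurable hmean,
    ← integral_add_compl (measurableSet_arm true) hL2.integrable_sq]
  have hcompl : {z : FullRecord p | trt z = true}ᶜ = {z | trt z = false} := by
    ext z; simp
  rw [hcompl, integral_armLaw, integral_armLaw,
    setIntegral_congr_fun (g := fun z => (wt Q z * resid Q z) ^ 2 / (1 - pTreat Q) ^ 2)
      (measurableSet_arm false) fun z hz => by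
        simp only [influence_of_control (Q := Q) hz, div_pow],
    setIntegral_congr_fun (g := fun z => (prog Q z - theta0 Q) ^ 2 / pTreat Q ^ 2)
      (measurableSet_arm true) fun z hz => by
        simp only [influence_of_treated (Q := Q) hz, div_pow],
    integral_div, integral_div]
  rw [pArm_true] at hp ⊢
  rw [pArm_false] at hp' ⊢
  field_simp
  ring

/-- The variance estimator is consistent. -/
theorem FeatureRate.tendsto_varianceEstimator (hs : IsSampling P Q D U) (hc : CausalModel Q M)
    (hF : FeatureRate P Q D U C φs) (hG : (controlSecondMoment Q φs).det ≠ 0)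
    (hβ : ∀ᵐ z ∂Q, prog Q z = ∑ j, β j * φs (cov z) j)
    (hw : ∀ k, (fun q => l2 (fold C D U false k q) fun i => w q.1 q.2 i - wt Q (D i q.2))
      =o[probFilter P] fun q => CrossBalancing.rate q.1)
    (hwr : ∀ k, (fun q => l2 (fold C D U false k q) fun i =>
      (w q.1 q.2 i - wt Q (D i q.2)) * resid Q (D i q.2))
      =o[probFilter P] fun q => CrossBalancing.rate q.1)
    (hL2 : MemLp (influence Q) 2 Q) (hmean : ∫ z, influence Q z ∂Q = 0) :
    Tendsto (fun q : ℕ × Ω => varianceEstimator (sample D q.1 q.2)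
        (C.folds (sample D q.1 q.2) (U q.1 q.2))
        (C.features (sample D q.1 q.2) (U q.1 q.2)) (w q.1 q.2)) (probFilter P)
      (𝓝 (sigmaSq Q)) := by
  have hp := hc.pArm_pos true
  have hp' := hc.pArm_pos false
  have h1 := tendsto_avg_arm_of_fold hs hc C false fun k =>
    hF.tendsto_avg_weighted_residual_sq hs hc hG hβ k (hw k) (hwr k)
  have h2 := tendsto_avg_arm_of_fold hs hc C true
    (f := fun (q : ℕ × Ω) (i : Fin q.1) => (fit C D U q i - avg (fold C D U true
      (C.folds (sample D q.1 q.2) (U q.1 q.2) i) q) (fit C D U q)) ^ 2) fun k => by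
    refine (hF.tendsto_avg_centered_fit_sq hs hc hG hβ k).congr fun q => ?_
    refine avg_congr fun i hi => ?_
    have hk : C.folds (sample D q.1 q.2) (U q.1 q.2) i = k := (mem_armFold.1 hi).2
    rw [hk]
  have hpr := hs.tendsto_proportion true
  have hpr' := hpr.const_sub 1
  rw [pArm_true] at hp hpr hpr'
  rw [pArm_false] at hp'
  rw [hc.sigmaSq_eq hL2 hmean]
  refine ((h1.div hpr' hp'.ne').add (h2.div hpr hp.ne')).congr fun q => ?_
  have e : avg (armSet D false q) (fun i => (w q.1 q.2 i * (y0 (D i q.2) - fit C D U q i)) ^ 2)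
      = avg (arm (fun i => (sample D q.1 q.2 i).2.1) false) fun i =>
        (w q.1 q.2 i * ((sample D q.1 q.2 i).2.2 - fit C D U q i)) ^ 2 := by
    refine avg_congr (I := armSet D false q) fun i hi => ?_
    have hi' : trt (D i q.2) = false := mem_armSet.1 hi
    simp [sample, observe, hi']
  simp only [Pi.div_apply]
  rw [e]
  rfl

end Variance

end CrossBalancing

namespace CrossBalancing

/-! ### Linear independence of features and the second-moment matrix. -/

section SecondMoment

set_option linter.unusedSectionVars false

variable {p d : ℕ} {Q : Measure (FullRecord p)} [IsProbabilityMeasure Q] {M : ℝ}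
  {φ : (Fin p → ℝ) → EuclideanSpace ℝ (Fin d)}

theorem det_ne_zero_of_rank_eq {A : Matrix (Fin d) (Fin d) ℝ} (h : A.rank = d) : A.det ≠ 0 := by
  have htop : LinearMap.range A.mulVecLin = ⊤ :=
    Submodule.eq_top_of_finrank_eq (by
      rw [Module.finrank_fin_fun]; exact h)
  have hsurj : Function.Surjective A.mulVec := fun v => by
    obtain ⟨u, hu⟩ := LinearMap.range_eq_top.1 htop v
    exact ⟨u, hu⟩
  exact ((Matrix.isUnit_iff_isUnit_det A).1 (Matrix.mulVec_surjective_iff_isUnit.1 hsurj)).ne_zero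

theorem measurable_coord_of (hφ : Measurable φ) (j : Fin d) : Measurable fun x => φ x j :=
  (by fun_prop : Measurable fun v : EuclideanSpace ℝ (Fin d) => v j).comp hφ

theorem memLp_coord_of (hφ : Measurable φ) (hφ2 : MemLp (fun z => φ (cov z)) 2 Q) (j : Fin d) :
    MemLp (fun z => φ (cov z) j) 2 Q :=
  hφ2.mono ((measurable_coord_of hφ j).comp measurable_cov).aestronglyMeasurable
    (Eventually.of_forall fun z => PiLp.norm_apply_le (φ (cov z)) j)

theorem controlSecondMoment_mulVec (hc : CausalModel Q M) (hφ : Measurable φ)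
    (hφ2 : MemLp (fun z => φ (cov z)) 2 Q) (c : Fin d → ℝ) (i : Fin d) :
    Matrix.mulVec (controlSecondMoment Q φ) c i
      = ∫ z, φ (cov z) i * ∑ j, c j * φ (cov z) j ∂(armLaw Q false) := by
  have hL := fun j => hc.memLp_arm false (memLp_coord_of hφ hφ2 j)
  simp only [Matrix.mulVec, dotProduct, controlSecondMoment, Matrix.of_apply, Finset.mul_sum]
  rw [integral_finsetSum]
  swap
  · exact fun j _ => (hL i).integrable_mul ((hL j).const_mul (c j))
  refine Finset.sum_congr rfl fun j _ => ?_
  rw [controlLaw_eq, ← integral_mul_const]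
  refine integral_congr_ae (Eventually.of_forall fun z => ?_)
  simp only
  ring

/-- Features with a nonsingular second moment are linearly independent. -/
theorem eq_zero_of_sum_ae_eq_zero (hc : CausalModel Q M) (hφ : Measurable φ)
    (hφ2 : MemLp (fun z => φ (cov z)) 2 Q) (hG : (controlSecondMoment Q φ).det ≠ 0)
    {c : Fin d → ℝ} (h : ∀ᵐ z ∂Q, ∑ j, c j * φ (cov z) j = 0) : c = 0 := by
  by_contra hne
  refine hG (Matrix.exists_mulVec_eq_zero_iff.1 ⟨c, hne, ?_⟩)
  funext i
  rw [controlSecondMoment_mulVec hc hφ hφ2]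
  refine integral_eq_zero_of_ae ?_
  filter_upwards [armLaw_absolutelyContinuous false h] with z hz
  have hz' : ∑ j, c j * φ (cov z) j = 0 := hz
  simp [hz']

/-- Features with a singular second moment are linearly dependent. -/
theorem exists_sum_ae_eq_zero (hc : CausalModel Q M) (hφ : Measurable φ)
    (hφ2 : MemLp (fun z => φ (cov z)) 2 Q) (hG : (controlSecondMoment Q φ).det = 0) :
    ∃ c : Fin d → ℝ, c ≠ 0 ∧ ∀ᵐ z ∂Q, ∑ j, c j * φ (cov z) j = 0 := by
  obtain ⟨c, hne, hcz⟩ := Matrix.exists_mulVec_eq_zero_iff.2 hG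
  refine ⟨c, hne, ?_⟩
  have hL := fun j => hc.memLp_arm false (memLp_coord_of hφ hφ2 j)
  have hsum : MemLp (fun z => ∑ j, c j * φ (cov z) j) 2 (armLaw Q false) :=
    memLp_finsetSum _ fun j _ => (hL j).const_mul (c j)
  have hint : ∫ z, (∑ j, c j * φ (cov z) j) ^ 2 ∂(armLaw Q false) = 0 := by
    have e : ∀ z : FullRecord p, (∑ j, c j * φ (cov z) j) ^ 2
        = ∑ i, c i * (φ (cov z) i * ∑ j, c j * φ (cov z) j) := by
      intro z
      rw [sq, Finset.sum_mul]
      exact Finset.sum_congr rfl fun i _ => by ring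
    simp only [e]
    rw [integral_finsetSum]
    swap
    · exact fun i _ => ((hL i).integrable_mul hsum).const_mul (c i)
    refine Finset.sum_eq_zero fun i _ => ?_
    rw [integral_const_mul, ← controlSecondMoment_mulVec hc hφ hφ2, hcz]
    simp
  have hae := (integral_eq_zero_iff_of_nonneg (fun z => sq_nonneg _) hsum.integrable_sq).1 hint
  have hmeas : MeasurableSet {x : Fin p → ℝ | ∑ j, c j * φ x j = 0} :=
    measurableSet_eq_fun (Finset.measurable_fun_sum _ fun j _ =>
      (measurable_coord_of hφ j).const_mul (c j)) measurable_const
  -- The quadratic form of the matrix at c is the control mean of (cᵀφ)², so cᵀφ vanishes on the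
  -- controls; overlap extends this to the whole population.
  have h := ae_cov_of_ae_armLaw hc.unconfounded hc.overlap false hmeas (by
    filter_upwards [hae] with z hz
    exact pow_eq_zero_iff two_ne_zero |>.1 hz)
  exact ae_of_ae_map measurable_cov.aemeasurable h

end SecondMoment

/-! ### Adding an intercept to a procedure. -/

section Intercept

variable {p d : ℕ}

/-- Prepend an intercept to a feature vector. -/
noncomputable def addIntercept (v : EuclideanSpace ℝ (Fin d)) : EuclideanSpace ℝ (Fin (d + 1)) :=
  WithLp.toLp 2 (Fin.cons 1 fun j => v j)

@[simp] theorem addIntercept_zero (v : EuclideanSpace ℝ (Fin d)) : addIntercept v 0 = 1 := rfl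

@[simp] theorem addIntercept_succ (v : EuclideanSpace ℝ (Fin d)) (j : Fin d) :
    addIntercept v j.succ = v j := rfl

theorem measurable_addIntercept : Measurable (addIntercept (d := d)) := by
  refine (WithLp.measurable_toLp 2 _).comp (measurable_pi_iff.2 fun j => ?_)
  refine Fin.cases ?_ (fun i => ?_) j
  · exact measurable_const
  · simp only [Fin.cons_succ]
    fun_prop

theorem norm_addIntercept_sub (u v : EuclideanSpace ℝ (Fin d)) :
    ‖addIntercept u - addIntercept v‖ = ‖u - v‖ := by
  rw [← sq_eq_sq₀ (norm_nonneg _) (norm_nonneg _), EuclideanSpace.real_norm_sq_eq,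
    EuclideanSpace.real_norm_sq_eq, Fin.sum_univ_succ]
  simp

/-- The procedure that also balances an intercept, exactly. -/
noncomputable def Procedure.withIntercept {𝒰 : Type*} [MeasurableSpace 𝒰] (C : Procedure p d 𝒰) :
    Procedure p (d + 1) 𝒰 where
  split := C.split
  measurable_split := C.measurable_split
  balanced_split := C.balanced_split
  learner k :=
    { fit := fun n I z u x => addIntercept ((C.learner k).fit n I z u x)
      fit_congr := fun n I z z' u h => by
        funext x
        rw [(C.learner k).fit_congr n I z z' u h]
      measurable_fit := fun n I => measurable_addIntercept.comp ((C.learner k).measurable_fit n I) }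
  tol n := Fin.cons 0 (C.tol n)
  tol_nonneg n j := by
    refine Fin.cases ?_ (fun i => ?_) j
    · simp
    · simpa using C.tol_nonneg n i
  target := C.target

end Intercept

/-! ### Invariance under the intercept and reduction of the hypotheses. -/

section WithIntercept

set_option linter.unusedSectionVars false

variable {p d : ℕ} {Ω 𝒰 : Type*} [MeasurableSpace Ω] [MeasurableSpace 𝒰]
  {P : Measure Ω} [IsProbabilityMeasure P] {Q : Measure (FullRecord p)} [IsProbabilityMeasure Q]
  {D : ℕ → Ω → FullRecord p} {U : ℕ → Ω → 𝒰} {C : Procedure p d 𝒰}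
  {φs : (Fin p → ℝ) → EuclideanSpace ℝ (Fin d)} {M : ℝ}
  {w : ∀ n : ℕ, Ω → Fin n → ℝ} {lam β : Fin d → ℝ}

theorem spansOne_withIntercept (C : Procedure p d 𝒰) (D : ℕ → Ω → FullRecord p)
    (U : ℕ → Ω → 𝒰) : SpansOne C.withIntercept D U (Fin.cons 1 0) := by
  intro k q x
  rw [Fin.sum_univ_succ]
  simp only [Fin.cons_zero, Fin.cons_succ, Pi.zero_apply, zero_mul, Finset.sum_const_zero,
    add_zero, one_mul]
  rfl

theorem sampleTarget_withIntercept_zero {q : ℕ × Ω}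
    (h : ∀ k, (0 : ℝ) < ((fold C D U true k q).card : ℝ)) (k : Fin 2) :
    sampleTarget C.withIntercept D U k q 0 = 1 := by
  rw [sampleTarget_eq (C := C.withIntercept) h]
  have e : ∀ l, avg (fold C.withIntercept D U true l q) (unitFeat C.withIntercept D U l q 0)
      = 1 := fun l => avg_const (h l) 1
  simp only [e, mul_one]
  exact sum_targetShare (C := C.withIntercept) h k

/-- Balancing the intercept with tolerance 0 is the normalization constraint, because its target is
1 when the treated folds are nonempty. The two programs share feasible set and objective. -/
theorem isWeights_withIntercept {q : ℕ × Ω}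
    (h : ∀ k, (0 : ℝ) < ((fold C D U true k q).card : ℝ)) {v : Fin q.1 → ℝ}
    (hv : C.IsWeights (sample D q.1 q.2) (U q.1 q.2) v) :
    C.withIntercept.IsWeights (sample D q.1 q.2) (U q.1 q.2) v := by
  have hiff : ∀ (k : Fin 2) (v' : Fin q.1 → ℝ),
      Feasible C.withIntercept.target (sample D q.1 q.2)
        (C.withIntercept.folds (sample D q.1 q.2) (U q.1 q.2))
        (C.withIntercept.features (sample D q.1 q.2) (U q.1 q.2)) (C.withIntercept.tol q.1) k v'
      ↔ Feasible C.target (sample D q.1 q.2) (C.folds (sample D q.1 q.2) (U q.1 q.2))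
        (C.features (sample D q.1 q.2) (U q.1 q.2)) (C.tol q.1) k v' := by
    intro k v'
    refine and_congr_left fun hone => ?_
    rw [Fin.forall_fin_succ]
    have h0 : |avg (fold C D U false k q)
          (fun i => v' i * unitFeat C.withIntercept D U k q 0 i)
        - sampleTarget C.withIntercept D U k q 0| ≤ C.withIntercept.tol q.1 0 := by
      have e1 : ∀ i, v' i * unitFeat C.withIntercept D U k q 0 i = v' i := fun i => mul_one _
      have e2 : avg (fold C D U false k q) v' = 1 := hone
      simp only [e1]
      rw [sampleTarget_withIntercept_zero h, e2, sub_self, abs_zero]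
      exact C.withIntercept.tol_nonneg _ _
    exact ⟨fun hj => hj.2, fun hj => ⟨h0, hj⟩⟩
  intro k hk
  obtain ⟨v', hv'⟩ := hk
  obtain ⟨h1, h2⟩ := hv k ⟨v', (hiff k v').1 hv'⟩
  exact ⟨(hiff k v).2 h1, fun u hu => h2 u ((hiff k u).1 hu)⟩

theorem FeatureRate.withIntercept (hF : FeatureRate P Q D U C φs) :
    FeatureRate P Q D U C.withIntercept fun x => addIntercept (φs x) where
  measurable := measurable_addIntercept.comp hF.measurable
  memLp := by
    have h := ((memLp_const (addIntercept (0 : EuclideanSpace ℝ (Fin d)))).norm).add hF.memLp.norm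
    refine h.mono ((measurable_addIntercept.comp
      hF.measurable).comp measurable_cov).aestronglyMeasurable (Eventually.of_forall fun z => ?_)
    have h1 := norm_addIntercept_sub (φs (cov z)) 0
    rw [sub_zero] at h1
    simp only [Pi.add_apply]
    rw [← h1, Real.norm_of_nonneg (add_nonneg (norm_nonneg _) (norm_nonneg _))]
    exact norm_le_insert' _ _
  rate_le k ε hε := by
    filter_upwards [hF.rate_le k ε hε] with q hq
    refine le_trans (le_of_eq (lintegral_congr fun z => ?_)) hq
    rw [← norm_addIntercept_sub (feat C D U k q (cov z))]
    rfl

/-- If the limits of the features do not span the constant `1`, then an intercept can be added to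
the procedure without changing its weights. -/
theorem BalancingModel.withIntercept (h : BalancingModel P Q D U C φs M w lam β)
    (hspan : ∀ a : Fin d → ℝ, ¬ ∀ᵐ z ∂Q, ∑ j, a j * φs (cov z) j = 1) :
    BalancingModel P Q D U C.withIntercept (fun x => addIntercept (φs x)) M w
      (Fin.cons 0 lam) (Fin.cons 0 β) where
  sampling := h.sampling
  causal := h.causal
  rate := h.rate.withIntercept
  det_ne_zero hdet := by
    obtain ⟨c, hne, hcz⟩ := exists_sum_ae_eq_zero h.causal h.rate.withIntercept.measurable
      h.rate.withIntercept.memLp hdet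
    simp only [Fin.sum_univ_succ, addIntercept_zero, addIntercept_succ, mul_one] at hcz
    -- Without the intercept, the dependence contradicts independence of φ*; with it, solving for
    -- the intercept would span the constant by φ*.
    by_cases h0 : c 0 = 0
    · have hz := eq_zero_of_sum_ae_eq_zero h.causal h.rate.measurable h.rate.memLp h.det_ne_zero
        (c := fun j => c j.succ) (by simpa [h0] using hcz)
      refine hne (funext fun j => ?_)
      refine Fin.cases h0 (fun i => ?_) j
      exact congrFun hz i
    · refine hspan (fun j => -(c j.succ) / c 0) ?_
      filter_upwards [hcz] with z hz
      have e : ∑ j, -(c j.succ) / c 0 * φs (cov z) j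
          = -(∑ j, c j.succ * φs (cov z) j) / c 0 := by
        rw [← Finset.sum_neg_distrib, Finset.sum_div]
        exact Finset.sum_congr rfl fun j _ => by ring
      rw [e, div_eq_one_iff_eq h0]
      linarith
  isWeights := by
    filter_upwards [h.isWeights, h.causal.eventually_card_pos h.sampling C true] with q h1 h2
    exact isWeights_withIntercept h2 h1
  tol_isLittleO j := by
    refine Fin.cases ?_ (fun i => ?_) j
    · exact isLittleO_zero _ _
    · exact h.tol_isLittleO i
  wt_eq := by
    filter_upwards [h.wt_eq] with z hz
    rw [hz, Fin.sum_univ_succ]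
    simp
  prog_eq := by
    filter_upwards [h.prog_eq] with z hz
    rw [hz, Fin.sum_univ_succ]
    simp

/-- The expansion of the estimator and the convergence of the weights. -/
theorem BalancingModel.expansion (h : BalancingModel P Q D U C φs M w lam β)
    (hspan : ∀ a : Fin d → ℝ, (∀ᵐ z ∂Q, ∑ j, a j * φs (cov z) j = 1) → SpansOne C D U a) :
    ((fun q => thetaHat (sample D q.1 q.2) (w q.1 q.2)
      - (avg (armSet D false q) (fun i => wt Q (D i q.2) * resid Q (D i q.2))
        + avg (armSet D true q) (fun i => prog Q (D i q.2))))
      =o[probFilter P] fun q => CrossBalancing.rate q.1 ^ 2) ∧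
    (∀ k, (fun q => l2 (fold C D U false k q) fun i => w q.1 q.2 i - wt Q (D i q.2))
      =o[probFilter P] fun q => CrossBalancing.rate q.1) ∧
    ∀ k, (fun q => l2 (fold C D U false k q) fun i =>
      (w q.1 q.2 i - wt Q (D i q.2)) * resid Q (D i q.2))
      =o[probFilter P] fun q => CrossBalancing.rate q.1 := by
  by_cases hex : ∃ a : Fin d → ℝ, ∀ᵐ z ∂Q, ∑ j, a j * φs (cov z) j = 1
  · obtain ⟨a, ha⟩ := hex
    have hs := hspan a ha
    exact ⟨h.isLittleO_thetaHat_sub hs, fun k => h.isLittleO_l2_weight_sub hs k,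
      fun k => h.isLittleO_l2_weight_sub_mul_resid hs k⟩
  -- The conclusions involve the features only through the weights and the split, which the enlarged
  -- procedure shares, so they hold for `C` itself.
  · have h' := h.withIntercept (not_exists.1 hex)
    have hs := spansOne_withIntercept C D U
    exact ⟨h'.isLittleO_thetaHat_sub hs, fun k => h'.isLittleO_l2_weight_sub hs k,
      fun k => h'.isLittleO_l2_weight_sub_mul_resid hs k⟩

theorem featureRate_of_isLittleOInProb (hφ : Measurable φs) (hφ2 : MemLp φs 2 (covLaw Q))
    (hrate : ∀ k, IsLittleOInProb P
      (fun n ω => eLpNorm (fun x => C.features (sample D n ω) (U n ω) k x - φs x) 2 (covLaw Q))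
      (fun n => (n : ℝ) ^ (-(1 / 4) : ℝ))) :
    FeatureRate P Q D U C φs where
  measurable := hφ
  memLp := hφ2.comp_of_map measurable_cov.aemeasurable
  rate_le k ε hε := by
    have h := hrate k (√ε) (Real.sqrt_pos.2 hε)
    have h' : ∀ᶠ q in probFilter P,
        eLpNorm (fun x => feat C D U k q x - φs x) 2 (covLaw Q)
          ≤ ENNReal.ofReal (√ε * CrossBalancing.rate q.1) := by
      rw [eventually_probFilter]
      simp only [not_le]
      exact h
    filter_upwards [h'] with q hq
    have e : ∫⁻ z, ENNReal.ofReal (‖feat C D U k q (cov z) - φs (cov z)‖ ^ 2) ∂Q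
        = eLpNorm (fun x => feat C D U k q x - φs x) 2 (covLaw Q) ^ 2 := by
      rw [← lintegral_norm_sq_eq, covLaw, lintegral_map _ measurable_cov]
      exact (((measurable_feat k q).sub hφ).norm.pow_const 2).ennreal_ofReal
    rw [e]
    refine (pow_le_pow_left' hq 2).trans (le_of_eq ?_)
    rw [← ENNReal.ofReal_pow (mul_nonneg (Real.sqrt_nonneg _) (rate_nonneg _)), mul_pow,
      Real.sq_sqrt hε.le]

theorem memLp_linear (hφ : Measurable φs) (hφ2 : MemLp (fun z => φs (cov z)) 2 Q)
    (c : Fin d → ℝ) : MemLp (fun z => ∑ j, c j * φs (cov z) j) 2 Q :=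
  memLp_finsetSum _ fun j _ => (memLp_coord_of hφ hφ2 j).const_mul (c j)

theorem inner_eq_sum (a x : EuclideanSpace ℝ (Fin d)) : inner ℝ a x = ∑ j, a j * x j := by
  simp [PiLp.inner_apply, mul_comm]

end WithIntercept

end CrossBalancing

/-! ### Assembly of the theorem. -/

open CrossBalancing in
theorem theorem2 {p d : ℕ} {Ω 𝒰 : Type*} [MeasurableSpace Ω] [MeasurableSpace 𝒰]
    (P : Measure Ω) [IsProbabilityMeasure P]
    (Q : Measure (FullRecord p)) [IsProbabilityMeasure Q]
    -- the causal assumptions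
    (hunconf : Unconfounded Q) (hoverlap : Overlap Q) (hY0 : Integrable y0 Q)
    -- i.i.d. subjects, and auxiliary randomness for splitting and learning
    (D : ℕ → Ω → FullRecord p) (hD : ∀ i, HasLaw (D i) Q P) (hDindep : iIndepFun D P)
    (U : ℕ → Ω → 𝒰) (hU : ∀ n, Measurable (U n))
    (hUD : ∀ n, IndepFun (U n) (fun ω (i : Fin n) => D i ω) P)
    -- the procedure and its weights
    (C : Procedure p d 𝒰)
    (w : ∀ n : ℕ, Ω → Fin n → ℝ) (hwmeas : ∀ n i, AEMeasurable (fun ω => w n ω i) P)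
    (hw : ∀ n, ∀ᵐ ω ∂P, C.IsWeights (sample D n ω) (U n ω) (w n ω))
    -- (i) bounded conditional variance
    (M₁ : ℝ) (hvar : CondVarianceBounded Q M₁)
    -- (ii) tolerances of order `o(n^{-1/2})`
    (htol : ∀ j, (fun n => C.tol n j) =o[atTop] fun n : ℕ => (n : ℝ) ^ (-(1 / 2) : ℝ))
    -- (iii) convergence of the learned features
    (φs : (Fin p → ℝ) → EuclideanSpace ℝ (Fin d))
    (hφ : MemLp φs 2 (covLaw Q))
    (hrank : (controlSecondMoment Q φs).rank = d)
    (hrate : ∀ k, IsLittleOInProb P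
      (fun n ω => eLpNorm (fun x => C.features (sample D n ω) (U n ω) k x - φs x) 2 (covLaw Q))
      (fun n => (n : ℝ) ^ (-(1 / 4) : ℝ)))
    -- convention on the intercept: a constant spanned by the limit is spanned by the features
    (hconst : ∀ a : EuclideanSpace ℝ (Fin d), (∀ᵐ x ∂(covLaw Q), inner ℝ a (φs x) = 1) →
      ∀ k n I z u x, inner ℝ a ((C.learner k).fit n I z u x) = 1)
    -- (iv) the weights and the prognostic score are linear in the limiting features
    (lam β : EuclideanSpace ℝ (Fin d))
    (hlam : ∀ᵐ x ∂(covLaw Q), wStar Q x = inner ℝ lam (φs x))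
    (hβ : ∀ᵐ x ∂(covLaw Q), prognostic Q x = inner ℝ β (φs x)) :
    TendstoInDistribution
      (fun (n : ℕ) ω => √(n : ℝ) * (thetaHat (sample D n ω) (w n ω) - theta0 Q)) atTop
      (id : ℝ → ℝ) (fun _ => P) (gaussianReal 0 (sigmaSq Q).toNNReal) ∧
    TendstoInMeasure P
      (fun (n : ℕ) ω => varianceEstimator (sample D n ω) (C.folds (sample D n ω) (U n ω))
        (C.features (sample D n ω) (U n ω)) (w n ω)) atTop (fun _ => sigmaSq Q) ∧
    MemLp (influence Q) 2 Q ∧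
    identifiedMean (obsLaw Q) = theta0 Q ∧
    IsEfficiencyBound identifiedMean (obsLaw Q) (sigmaSq Q) := by
  -- The limit φ* is only almost everywhere measurable, so a Borel version replaces it throughout.
  obtain ⟨φ', hφ'm, hae⟩ : ∃ φ' : (Fin p → ℝ) → EuclideanSpace ℝ (Fin d), Measurable φ' ∧
      φs =ᵐ[covLaw Q] φ' :=
    ⟨hφ.1.mk φs, hφ.1.stronglyMeasurable_mk.measurable, hφ.1.ae_eq_mk⟩
  have haeQ : ∀ᵐ z ∂Q, φs (cov z) = φ' (cov z) := ae_of_ae_map measurable_cov.aemeasurable hae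
  have hs : IsSampling P Q D U := ⟨hD, hDindep, hU, hUD⟩
  have hF : FeatureRate P Q D U C φ' := by
    refine featureRate_of_isLittleOInProb hφ'm (hφ.ae_eq hae) fun k => ?_
    have e : ∀ n ω,
        eLpNorm (fun x => C.features (sample D n ω) (U n ω) k x - φ' x) 2 (covLaw Q)
        = eLpNorm (fun x => C.features (sample D n ω) (U n ω) k x - φs x) 2 (covLaw Q) :=
      fun n ω => eLpNorm_congr_ae (by filter_upwards [hae] with x hx; rw [hx])
    simp only [e]
    exact hrate k
  have hwt : ∀ᵐ z ∂Q, wt Q z = ∑ j, lam j * φ' (cov z) j := by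
    filter_upwards [ae_of_ae_map measurable_cov.aemeasurable hlam, haeQ] with z h1 h2
    rw [← inner_eq_sum, ← h2]
    exact h1
  have hprog : ∀ᵐ z ∂Q, prog Q z = ∑ j, β j * φ' (cov z) j := by
    filter_upwards [ae_of_ae_map measurable_cov.aemeasurable hβ, haeQ] with z h1 h2
    rw [← inner_eq_sum, ← h2]
    exact h1
  -- Square integrability of w* and m₀ is not assumed separately; it comes from their linearity in
  -- φ*.
  have hc : CausalModel Q M₁ := ⟨hunconf, hoverlap, hY0, hvar,
    (memLp_linear hφ'm hF.memLp lam).ae_eq (hwt.mono fun _ h => h.symm),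
    (memLp_linear hφ'm hF.memLp β).ae_eq (hprog.mono fun _ h => h.symm)⟩
  have hG : (controlSecondMoment Q φ').det ≠ 0 := by
    have e : controlSecondMoment Q φ' = controlSecondMoment Q φs := by
      ext i j
      simp only [controlSecondMoment, Matrix.of_apply]
      refine integral_congr_ae ?_
      filter_upwards [armLaw_absolutelyContinuous false haeQ] with z hz
      have hz' : φs (cov z) = φ' (cov z) := hz
      rw [hz']
    rw [e]
    exact det_ne_zero_of_rank_eq hrank
  have h : BalancingModel P Q D U C φ' M₁ w lam β :=
    { sampling := hs
      causal := hc
      rate := hF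
      det_ne_zero := hG
      isWeights := eventually_probFilter_of_ae (Eventually.of_forall hw)
      tol_isLittleO := fun j => by simpa only [rate_sq] using htol j
      wt_eq := hwt
      prog_eq := hprog }
  obtain ⟨h1, h2, h3⟩ := h.expansion fun a ha k q x => by
    have hm : MeasurableSet {x | ∑ j, a j * φ' x j = 1} :=
      measurableSet_eq_fun (Finset.measurable_fun_sum _ fun j _ =>
        (measurable_coord_of hφ'm j).const_mul (a j)) measurable_const
    have hx := hconst (WithLp.toLp 2 a) (by
      have h4 : ∀ᵐ x ∂(covLaw Q), ∑ j, a j * φ' x j = 1 :=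
        (ae_map_iff measurable_cov.aemeasurable hm).2 ha
      filter_upwards [h4, hae] with x hx1 hx2
      rw [inner_eq_sum, hx2]
      exact hx1)
    have h5 := hx k q.1 {i | C.folds (sample D q.1 q.2) (U q.1 q.2) i ≠ k}
      (sample D q.1 q.2) (U q.1 q.2) x
    rw [inner_eq_sum] at h5
    exact h5
  obtain ⟨hL2, hmean, hid, heff⟩ := efficiency_summary hunconf hoverlap hY0 hvar
    hc.memLp_wt hc.memLp_prog
  exact ⟨hc.tendstoInDistribution_of_isLittleO hs C hL2 hmean (aemeasurable_thetaHat hs hwmeas) h1,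
    tendstoInMeasure_iff_probFilter.2
      (hF.tendsto_varianceEstimator hs hc hG hprog h2 h3 hL2 hmean), hL2, hid, heff⟩
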